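/- **Notation.** Let $\Lambda=\varprojlim_n\mathbb Z[[x_1,\dots,x_n]]^{S_n}$ be the (completed) ring of symmetric functions and $\Lambda^{(2)}=\Lambda\,\widehat\otimes\,\Lambda$; superscripts $(1),(2)$ indicate the tensor factor, so $\Lambda^{(2)}\subset\Lambda^{(2)}\otimes\mathbb C:=\mathbb C[[p^{(i)}_k : i=1,2,\ k\ge1]]$, with $p_k$ the power sums, consists of the series with integer coefficients when written in the underlying variables. Put $e_2=\tfrac12(p_1^2-p_2)$ and $h_2=\tfrac12(p_1^2+p_2)$. Let $\mathrm{rk}$ be the homomorphism to power series in $x,y$ with $p^{(1)}_1\mapsto x$, $p^{(2)}_1\mapsto y$, $p^{(i)}_k\mapsto0$ for $k>1$. Say that $f$ satisfies $(*)$ if $\mathrm{rk}(f)=\sum a_{i,j}x^iy^j$ with $a_{2,0}\ne0$, and $a_{i,j}=0$ for all $(i,j)\neq(2,0)$ with $i<2$ or $i+j<3$. Let $\Lambda^{(2)}_*$ be the set of $f\in\Lambda^{(2)}$ satisfying $(*)$. For a series $g$ without constant term, $f\mapsto f\circ_{(1)}g$ is the substitution $p^{(1)}_n\mapsto p^{(1)}_n\circ_{(1)}g$,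 $p^{(2)}_n\mapsto p^{(2)}_n$, where $p^{(1)}_n\circ_{(1)}g$ is obtained from $g$ by $p^{(i)}_k\mapsto p^{(i)}_{nk}$ $(i=1,2)$. The partial Legendre transform $\mathfrak L^{(1)}f$ of a series $f$ satisfying $(*)$ is the unique series $g\in\Lambda^{(2)}\otimes\mathbb C$ satisfying $(*)$ and $$g\circ_{(1)}\frac{\partial f}{\partial p^{(1)}_1}+f=p^{(1)}_1\frac{\partial f}{\partial p^{(1)}_1}.$$ An ungraded $\mathbb S^2$-module $\mathcal W$ is a collection of finite-dimensional complex representations $\mathcal W(m,n)$ of $S_m\times S_n$, $m,n\ge0$. Its characteristic is $$\mathrm{ch}(\mathcal W)=\sum_{m,n\ge0}\frac1{m!\,n!}\sum_{(\sigma,\tau)\in S_m\times S_n}\mathrm{Tr}_{\mathcal W(m,n)}(\sigma,\tau)\,p^{(1)}_{\lambda(\sigma)}p^{(2)}_{\lambda(\tau)},$$ where $\lambda(\sigma)$ is the cycle type of $\sigma$. In the usual way $\mathcal W$ extends to a functor $\mathcal W(A,B)$ of pairs of finite sets and bijections, with $\mathcal W([m],[n])=\mathcal W(m,n)$. An $\mathcal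 A(m,n)$-stable tree is a finite tree with flags (half-edges) coloured $1$ or $2$, both flags of an edge having colour $1$, such that every vertex $v$ carries at least three flags, at least two of them of colour $1$, and whose leaves are numbered: those of colour $1$ by $1,\dots,m$ and those of colour $2$ by $m+1,\dots,m+n$. Let $\mathbb T(m,n)$ be the set of isomorphism classes of such trees, and $$\mathbb T\mathcal W(m,n)=\bigoplus_{T\in\mathbb T(m,n)}\ \bigotimes_{v\in V(T)}\mathcal W(F_1(v),F_2(v)),$$ where $F_i(v)$ is the set of flags of colour $i$ at $v$, and $S_m\times S_n$ acts by renumbering the leaves. **Proposition.** Let $\mathcal W$ be an ungraded $\mathbb S^2$-module such that $\mathcal W(m,n)=0$ if $m<2$ or $m+n<3$. Then every $\mathbb T\mathcal W(m,n)$ is finite-dimensional, the series $$F=e_2^{(1)}-\mathrm{ch}(\mathcal W),\qquad G=h_2^{(1)}+\mathrm{ch}(\mathbb T\mathcal W)$$ are elements of $\Lambda^{(2)}_*$, and $G=\mathfrak L^{(1)}F$; that is, $G$ solves the equation above for $f=F$ and is its only solution satisfying $(*)$. -/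

import Mathlib

universe u

noncomputable section

open Equiv

/-! ## Symmetric functions in two sets of variables

The completed ring `Λ^{(2)} ⊗ ℂ` is the power series ring `ℂ⟦p_k^{(i)}⟧` in the power sums,
`i ∈ {1, 2}`, `k ≥ 1`. The superscripts `(1)`, `(2)` are coded as `0, 1 : Fin 2`. -/

/-- The ring `Λ^{(2)} ⊗ ℂ = ℂ⟦p_1^{(1)}, p_2^{(1)}, …, p_1^{(2)}, p_2^{(2)}, …⟧`. -/
abbrev SymC : Type := MvPowerSeries (Fin 2 × ℕ+) ℂ

/-- The power sum `p_k^{(i + 1)}`. -/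
def psum (i : Fin 2) (k : ℕ+) : SymC := MvPowerSeries.X (i, k)

/-- `p_{λ(σ)}^{(i + 1)}`, the product of the power sums over the cycle lengths of `σ`
(fixed points are cycles of length `1`). -/
def psumOfPerm (i : Fin 2) {n : ℕ} (σ : Perm (Fin n)) : SymC :=
  (σ.partition.parts.map fun k => psum i k.toPNat').prod

/-- The elementary symmetric function `e_2^{(1)}`. -/
def e2 : SymC := (2⁻¹ : ℂ) • (psum 0 1 ^ 2 - psum 0 2)

/-- The complete symmetric function `h_2^{(1)}`. -/
def h2 : SymC := (2⁻¹ : ℂ) • (psum 0 1 ^ 2 + psum 0 2)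

open Classical in
/-- The power sum `∑_j x_{i,j}^k` as a power series in the variables `x_{i,j}`: the variables
`x_{0,j}` belong to the first tensor factor of `Λ ⊗ Λ`, the variables `x_{1,j}` to the second. -/
def powerSumSeries (ik : Fin 2 × ℕ+) : MvPowerSeries (Fin 2 × ℕ) ℂ :=
  fun d => if ∃ j : ℕ, d = Finsupp.single (ik.1, j) (ik.2 : ℕ) then 1 else 0

lemma coeff_powerSumSeries (ik : Fin 2 × ℕ+) (d : Fin 2 × ℕ →₀ ℕ) [Decidable
    (∃ j : ℕ, d = Finsupp.single (ik.1, j) (ik.2 : ℕ))] :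
    MvPowerSeries.coeff d (powerSumSeries ik) =
      if ∃ j : ℕ, d = Finsupp.single (ik.1, j) (ik.2 : ℕ) then 1 else 0 := by
  change powerSumSeries ik d = _
  unfold powerSumSeries
  congr

lemma hasSubst_powerSumSeries : MvPowerSeries.HasSubst powerSumSeries where
  const_coeff ik := by
    classical
    rw [← MvPowerSeries.coeff_zero_eq_constantCoeff_apply, coeff_powerSumSeries, if_neg]
    · exact IsNilpotent.zero
    · rintro ⟨j, hj⟩
      have := DFunLike.congr_fun hj (ik.1, j)
      simp only [Finsupp.coe_zero, Pi.zero_apply, Finsupp.single_eq_same] at this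
      exact ik.2.ne_zero this.symm
  coeff_zero d := by
    classical
    refine Set.Finite.subset ((Set.finite_univ (α := Fin 2)).prod
      (((Finset.range (d.degree + 1)).finite_toSet).preimage
        (f := fun k : ℕ+ => (k : ℕ)) PNat.coe_injective.injOn)) ?_
    rintro ⟨i, k⟩ h
    simp only [Set.mem_ofPred_eq, coeff_powerSumSeries, ne_eq, ite_eq_right_iff, one_ne_zero,
      imp_false, not_not] at h
    obtain ⟨j, rfl⟩ := h
    simp

/-- Membership in `Λ^{(2)} = Λ ⊗ Λ` (completed), as a subset of `Λ^{(2)} ⊗ ℂ`: written as a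
power series in the two sets of variables, `f` has integer coefficients. -/
def MemLambda2 (f : SymC) : Prop :=
  ∀ d, ∃ z : ℤ, MvPowerSeries.coeff d (MvPowerSeries.subst powerSumSeries f) = (z : ℂ)

/-- The substitution `p_1^{(1)} ↦ x`, `p_1^{(2)} ↦ y`, `p_k^{(i)} ↦ 0` for `k > 1`. -/
def rkSubst (ik : Fin 2 × ℕ+) : MvPowerSeries (Fin 2) ℂ :=
  if ik.2 = 1 then MvPowerSeries.X ik.1 else 0

lemma hasSubst_rkSubst : MvPowerSeries.HasSubst rkSubst where
  const_coeff ik := by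
    unfold rkSubst
    split_ifs <;> simp
  coeff_zero d := by
    refine Set.Finite.subset ((Set.finite_univ (α := Fin 2)).prod (Set.finite_singleton 1)) ?_
    rintro ⟨i, k⟩ h
    by_contra hk
    apply h
    have : k ≠ 1 := by simpa using hk
    simp [rkSubst, this]

/-- The rank homomorphism; `x` and `y` are the variables `0` and `1`. -/
def rk (f : SymC) : MvPowerSeries (Fin 2) ℂ := MvPowerSeries.subst rkSubst f

/-- The coefficient of `x^i y^j` in `rk f`. -/
def rkCoeff (i j : ℕ) (f : SymC) : ℂ :=
  MvPowerSeries.coeff (Finsupp.single (0 : Fin 2) i + Finsupp.single (1 : Fin 2) j) (rk f)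

/-- `rk f = ∑ a_{i,j} x^i y^j` with `a_{2,0} ≠ 0`, and all other `a_{i,j}` with `i < 2` or
`i + j < 3` vanish. -/
def RkStar (f : SymC) : Prop :=
  rkCoeff 2 0 f ≠ 0 ∧
    ∀ i j : ℕ, (i, j) ≠ (2, 0) → (i < 2 ∨ i + j < 3) → rkCoeff i j f = 0

/-- Membership in `Λ^{(2)}_*`. -/
def MemLambda2Star (f : SymC) : Prop := MemLambda2 f ∧ RkStar f

/-! ## The plethysm `∘_(1)` and the partial Legendre transform -/

/-- `g ↦ p_n^{(1)} ∘_(1) g`, the substitution `p_k^{(i)} ↦ p_{nk}^{(i)}` for `i = 1, 2`. -/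
def adams (n : ℕ+) (g : SymC) : SymC :=
  MvPowerSeries.subst (fun ik : Fin 2 × ℕ+ => psum ik.1 (n * ik.2)) g

lemma hasSubst_adams (n : ℕ+) :
    MvPowerSeries.HasSubst (fun ik : Fin 2 × ℕ+ => psum ik.1 (n * ik.2)) where
  const_coeff ik := by simp [psum]
  coeff_zero d := by
    classical
    have h1 : Set.InjOn (fun ik : Fin 2 × ℕ+ =>
        (Finsupp.single (ik.1, n * ik.2) 1 : Fin 2 × ℕ+ →₀ ℕ)) Set.univ := by
      rintro ⟨i, k⟩ - ⟨i', k'⟩ - h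
      have := Finsupp.single_left_injective one_ne_zero h
      simpa using this
    refine Set.Finite.subset
      ((Set.finite_singleton d).preimage (h1.mono (Set.subset_univ _))) ?_
    rintro ⟨i, k⟩ h
    simp only [psum, MvPowerSeries.coeff_X, ne_eq, ite_eq_right_iff, one_ne_zero, imp_false,
      not_not, Set.mem_ofPred_eq, Set.mem_preimage, Set.mem_singleton_iff] at h ⊢
    exact h.symm

/-- The values `p_n^{(1)} ↦ p_n^{(1)} ∘_(1) g`, `p_n^{(2)} ↦ p_n^{(2)}`. -/
def plethysmSubst (g : SymC) (ik : Fin 2 × ℕ+) : SymC :=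
  if ik.1 = 0 then adams ik.2 g else psum ik.1 ik.2

/-- The partial plethysm `f ∘_(1) g`, for `g` without constant term. -/
def plethysm (f g : SymC) : SymC := MvPowerSeries.subst (plethysmSubst g) f

/-- `∂ / ∂p_1^{(1)}`. -/
def dP1 (f : SymC) : SymC := MvPowerSeries.pderiv ℂ ((0 : Fin 2), (1 : ℕ+)) f

/-- The equation `g ∘_(1) ∂f/∂p_1^{(1)} + f = p_1^{(1)} ∂f/∂p_1^{(1)}`. -/
def LegendreEq (f g : SymC) : Prop := plethysm g (dP1 f) + f = psum 0 1 * dP1 f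

/-- `g` is the partial Legendre transform of `f`: the unique solution of the defining
equation with `rk g` of the required form. Uniqueness is asked for among all series with complex
coefficients, hence in particular within `Λ^{(2)}_*`. -/
def IsPartialLegendre (f g : SymC) : Prop :=
  RkStar g ∧ LegendreEq f g ∧ ∀ g' : SymC, RkStar g' → LegendreEq f g' → g' = g

/-! ## `S²`-modules and their characteristic -/

/-- An (ungraded) `S²`-module: a complex representation of `S_m × S_n` for all `(m, n)`. -/
structure S2Module where
  carrier : ℕ → ℕ → Type u
  [addCommGroup : ∀ m n, AddCommGroup (carrier m n)]
  [module : ∀ m n, Module ℂ (carrier m n)]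
  rho : ∀ m n, Representation ℂ (Perm (Fin m) × Perm (Fin n)) (carrier m n)

attribute [instance] S2Module.addCommGroup S2Module.module

/-- `ch_{m|n}(V) = (1 / (m! n!)) ∑_{(σ,τ)} Tr_V(σ,τ) p_{λ(σ)}^{(1)} p_{λ(τ)}^{(2)}`. -/
def chMN (m n : ℕ) {V : Type u} [AddCommGroup V] [Module ℂ V]
    (ρ : Representation ℂ (Perm (Fin m) × Perm (Fin n)) V) : SymC :=
  ((m.factorial * n.factorial : ℂ)⁻¹) •
    ∑ g : Perm (Fin m) × Perm (Fin n),
      LinearMap.trace ℂ V (ρ g) • (psumOfPerm 0 g.1 * psumOfPerm 1 g.2)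

namespace S2Module

variable (W : S2Module.{u})

/-- `ch(W) = ∑_{m,n ≥ 0} ch_{m|n}(W(m,n))`. The sum is taken coefficientwise; each monomial
occurs in `ch_{m|n}` for only one pair `(m, n)`. -/
def ch : SymC := fun d =>
  ∑ᶠ mn : ℕ × ℕ, MvPowerSeries.coeff d (chMN mn.1 mn.2 (W.rho mn.1 mn.2))

/-- The value `W(A, B)` on a pair of finite sets: all equivariant maps from pairs of
numberings `[m] ≃ A`, `[n] ≃ B` to `W(m, n)`. Only `m = |A|`, `n = |B|` contribute, and evaluation
at one pair of numberings identifies `W(A, B)` with `W(|A|, |B|)`. -/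
def onSets (A B : Type) :
    Submodule ℂ (∀ m n : ℕ, (Fin m ≃ A) → (Fin n ≃ B) → W.carrier m n) where
  carrier := {φ | ∀ (m n : ℕ) (a : Fin m ≃ A) (b : Fin n ≃ B) (σ : Perm (Fin m))
    (τ : Perm (Fin n)), φ m n (σ.trans a) (τ.trans b) = W.rho m n (σ⁻¹, τ⁻¹) (φ m n a b)}
  add_mem' := by
    intro x y hx hy m n a b σ τ
    simp [hx m n a b σ τ, hy m n a b σ τ]
  zero_mem' := by
    intro m n a b σ τ
    simp
  smul_mem' := by
    intro c x hx m n a b σ τ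
    simp [hx m n a b σ τ]

/-- Functoriality of `W(A, B)` for bijections: transport of structure. -/
def onSetsMap {A A' B B' : Type} (s : A ≃ A') (t : B ≃ B') :
    W.onSets A B →ₗ[ℂ] W.onSets A' B' where
  toFun φ := ⟨fun m n a b => φ.1 m n (a.trans s.symm) (b.trans t.symm), by
    intro m n a b σ τ
    exact φ.2 m n (a.trans s.symm) (b.trans t.symm) σ τ⟩
  map_add' _ _ := rfl
  map_smul' _ _ := rfl

end S2Module

/-! ## Two-coloured stable trees -/

/-- The incidence graph of a graph with set of flags `F`, vertices the classes of `part`, and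
involution `inv`. Its nodes are the vertices and the flags; a vertex is joined to the
flags incident on it, and the two flags of an edge are joined. It is a subdivision of the graph,
so its geometric realisation is the one of the graph. -/
def incidenceGraph {F : Type} (part : Setoid F) (inv : F → F) :
    SimpleGraph (Quotient part ⊕ F) :=
  SimpleGraph.fromRel fun x y =>
    match x, y with
    | Sum.inl v, Sum.inr f => (Quotient.mk part f : Quotient part) = v
    | Sum.inr f, Sum.inr f' => inv f = f'
    | _, _ => False

/-- A two-coloured stable tree with set of flags `F`, before its leaves are numbered. Colour `1`
is coded as `0 : Fin 2` and colour `2` as `1 : Fin 2`. -/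
structure StableTree (F : Type) where
  /-- the partition of the flags into vertices -/
  part : Setoid F
  /-- the involution; fixed points are leaves, two-cycles are edges -/
  inv : F → F
  inv_inv : ∀ f, inv (inv f) = f
  colour : F → Fin 2
  colour_inv : ∀ f, colour (inv f) = colour f
  /-- edges correspond to nodes, so they have colour `1` -/
  edge_colour : ∀ f, inv f ≠ f → colour f = 0
  isTree : (incidenceGraph part inv).IsTree
  three_le : ∀ v : Quotient part, 3 ≤ Nat.card {f : F // Quotient.mk part f = v}
  two_le : ∀ v : Quotient part,
    2 ≤ Nat.card {f : F // Quotient.mk part f = v ∧ colour f = 0}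

namespace StableTree

variable {F F' : Type}

/-- The set of vertices. -/
abbrev Vertex (T : StableTree F) : Type := Quotient T.part

/-- The flags of colour `i + 1` incident on `v`. -/
abbrev FlagsAt (T : StableTree F) (v : T.Vertex) (i : Fin 2) : Type :=
  {f : F // Quotient.mk T.part f = v ∧ T.colour f = i}

/-- The leaves of colour `i + 1`. -/
abbrev Leaves (T : StableTree F) (i : Fin 2) : Type :=
  {f : F // T.inv f = f ∧ T.colour f = i}

/-- A numbering of the leaves: those of colour `1` by `1, …, m`, those of colour `2` by
`m + 1, …, m + n`. -/
abbrev Numbering (T : StableTree F) (m n : ℕ) : Type :=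
  (Fin m ≃ T.Leaves 0) × (Fin n ≃ T.Leaves 1)

/-- Isomorphisms of coloured trees. -/
structure Iso (T : StableTree F) (T' : StableTree F') where
  flags : F ≃ F'
  part_iff : ∀ a b, T.part.r a b ↔ T'.part.r (flags a) (flags b)
  inv_comm : ∀ f, T'.inv (flags f) = flags (T.inv f)
  colour_comm : ∀ f, T'.colour (flags f) = T.colour f

namespace Iso

variable {T : StableTree F} {T' : StableTree F'} (e : Iso T T')

/-- The bijection on vertices. -/
def verts : T.Vertex ≃ T'.Vertex := Quotient.congr e.flags e.part_iff

/-- The bijection on the flags of a given colour at a vertex. -/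
def flagsAt (v : T'.Vertex) (i : Fin 2) : T.FlagsAt (e.verts.symm v) i ≃ T'.FlagsAt v i :=
  e.flags.subtypeEquiv (by
    intro f
    rw [e.colour_comm, Equiv.eq_symm_apply]
    exact Iff.rfl)

/-- The isomorphism is compatible with numberings of the leaves. -/
def Preserves {m n : ℕ} (l : T.Numbering m n) (l' : T'.Numbering m n) : Prop :=
  (∀ i, (l'.1 i : F') = e.flags (l.1 i)) ∧ ∀ j, (l'.2 j : F') = e.flags (l.2 j)

end Iso

/-- `W(T) = ⨂_{v ∈ V(T)} W(F(v))`. -/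
abbrev tensor (W : S2Module.{u}) (T : StableTree F) : Type u :=
  PiTensorProduct ℂ fun v : T.Vertex => W.onSets (T.FlagsAt v 0) (T.FlagsAt v 1)

/-- The map `W(T) → W(T')` induced by an isomorphism `T ≅ T'`. -/
def Iso.tensorMap (W : S2Module.{u}) {T : StableTree F} {T' : StableTree F'} (e : Iso T T') :
    tensor W T →ₗ[ℂ] tensor W T' :=
  (PiTensorProduct.map fun v => W.onSetsMap (e.flagsAt v 0) (e.flagsAt v 1)) ∘ₗ
    (PiTensorProduct.reindex ℂ
      (fun v : T.Vertex => W.onSets (T.FlagsAt v 0) (T.FlagsAt v 1)) e.verts).toLinearMap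

end StableTree

namespace S2Module

variable (W : S2Module.{u})

/-- `TW(m,n) = ⨁ W(T)` over the isomorphism classes of `A(m,n)`-stable trees, that is, stable
trees with numbered leaves. To have it without a choice of representatives, an element is given as
a family of elements of `W(T)`, one for every numbered stable tree on a set of flags `Fin k`,
compatible with all isomorphisms of numbered trees. (There are finitely many
classes and a numbered stable tree has no automorphism but the identity, so restricting a family
to a set of representatives identifies this space with the direct sum.) -/
def treeSpace (m n : ℕ) : Submodule ℂ
    (∀ (k : ℕ) (T : StableTree (Fin k)), T.Numbering m n → StableTree.tensor W T) where
  carrier := {x | ∀ (k k' : ℕ) (T : StableTree (Fin k)) (T' : StableTree (Fin k'))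
    (l : T.Numbering m n) (l' : T'.Numbering m n) (e : StableTree.Iso T T'),
    e.Preserves l l' → x k' T' l' = e.tensorMap W (x k T l)}
  add_mem' := by
    intro x y hx hy k k' T T' l l' e he
    simp [hx k k' T T' l l' e he, hy k k' T T' l l' e he]
  zero_mem' := by
    intro k k' T T' l l' e he
    simp
  smul_mem' := by
    intro c x hx k k' T T' l l' e he
    simp [hx k k' T T' l l' e he]

/-- `S_m × S_n` acts on `TW(m,n)` by renumbering the leaves. -/
def treeRep (m n : ℕ) :
    Representation ℂ (Perm (Fin m) × Perm (Fin n)) (W.treeSpace m n) where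
  toFun g :=
    { toFun := fun x => ⟨fun k T l => x.1 k T (g.1.trans l.1, g.2.trans l.2), by
        intro k k' T T' l l' e he
        exact x.2 k k' T T' _ _ e ⟨fun i => he.1 (g.1 i), fun j => he.2 (g.2 j)⟩⟩
      map_add' := fun _ _ => rfl
      map_smul' := fun _ _ => rfl }
  map_one' := rfl
  map_mul' _ _ := rfl

instance (m n : ℕ) : AddCommGroup (W.treeSpace m n) :=
  Module.addCommMonoidToAddCommGroup ℂ

/-- The `S²`-module `TW`. -/
def trees : S2Module.{u} where
  carrier m n := W.treeSpace m n
  rho m n := W.treeRep m n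

end S2Module

end

/-!
The series in the power sums are compared through class functions. A series `f` assigns to a
permutation `φ` of a finite coloured set the number `val φ col S f`, which is the coefficient of the
monomial of the orbit type of `φ` times the order of the centraliser; these numbers determine `f`
(`eq_of_forall_val_eq`), and for `f = ch W` they are the characters of `W` (`sval_ch`). In this
language products are sums over invariant decompositions, and the partial plethysm `f ∘ g` is a sum
over the invariant partitions of the set into blocks, with a factor of `f` for the permutation of
the blocks and a factor of `g` for each orbit of blocks, at the first return map (`val_plethysm`).

Let `a = ∂ ch W / ∂p_1^{(1)}`, so that the derivative of `F = e_2 - ch W` is `p_1^{(1)} - a`. Its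
compositional inverse `g` satisfies `g = p_1^{(1)} + a ∘ g` (`exists_inverse`). Hence the class
function of `g` is a sum over invariant hierarchies, that is, laminar families of subsets, with one
factor `a` for each orbit of members, evaluated at the children of the member
(`val_fixedPoint`); in other words, `g` counts rooted trees. Similarly `ch W ∘ g` counts trees
with a marked vertex (`val_plethysm_eq_rootSum`), and `e_2 ∘ (g - p_1^{(1)})` counts trees with a
marked edge (`val_plethysm_e2`), where `e_2` contributes the sign by which the edge is counted.

In a finite tree the number of vertices minus the number of edges is one. The equivariant form of
this fact is the Lefschetz fixed point formula for a permutation of the flags (`lefschetz`,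
`sum_centreSign`): the fixed vertices, minus the edges fixed with their orientation, plus the
reversed edges add up to one. Therefore `ch TW = ch W ∘ g - e_2 ∘ (g - p_1^{(1)})` (`ch_trees`).
Two facts make this precise. Firstly, a numbered tree with a centre, which is a vertex or an edge,
is the same as a hierarchy on the set of labels, subject to stability conditions which hold whenever
the weight of the hierarchy is not zero: the members are the sets of labels beyond the flags which
point away from the centre (`labels_injective`, `centre_ext`, `exists_tree_of_isStableHier`,
`isStableHier_of_rootWeight_ne_zero`). Secondly, the trace of an automorphism of a tree on the
tensor product of the spaces attached to the vertices is a product over the orbits of vertices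
(`trace_tensorMap`), and an automorphism of a numbered tree is determined by its effect on the
labels, so that a fixed isomorphism class contributes the trace of one automorphism
(`trace_trees`).

From the formula for `ch TW` one obtains `G = p_1^{(1)} g - F ∘ g`, and the plethysm with the
derivative of `F`, the inverse of `g`, turns this into the equation of the Legendre transform
(`legendreEq_of_inverse`). The solution is unique because the plethysm with a series
`p_1^{(1)} + ⋯` is injective (`IsUnital.injective`).

The coefficients of a characteristic in the underlying variables are dimensions of spaces of
invariants, hence integers (`memLambda2_chMN`). The coefficient of `(p_1^{(1)})^i (p_1^{(2)})^j`
involves the component at `(i, j)` only, and a stable tree has at least two leaves of the first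
colour and at least three leaves in all (`two_le_of_numbering`); this gives the condition on the
rank.
-/

noncomputable section

open Equiv MvPowerSeries

namespace TreeLegendre

/-! ### Orbits of a permutation -/

section Orbits

variable {X Y : Type*}

/-- A chosen representative of the orbit of `x` under `φ`. -/
def rep (φ : Perm X) (x : X) : X := (Quotient.mk (Perm.SameCycle.setoid φ) x).out

lemma rep_sameCycle (φ : Perm X) (x : X) : φ.SameCycle (rep φ x) x :=
  Quotient.exact (s := Perm.SameCycle.setoid φ) (Quotient.out_eq _)

lemma rep_congr {φ : Perm X} {x y : X} (h : φ.SameCycle x y) : rep φ x = rep φ y := by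
  unfold rep
  rw [Quotient.sound (s := Perm.SameCycle.setoid φ) h]

@[simp] lemma rep_rep (φ : Perm X) (x : X) : rep φ (rep φ x) = rep φ x :=
  rep_congr (rep_sameCycle φ x)

/-- The length of the orbit of `x` under `φ`. -/
def len (φ : Perm X) (x : X) : ℕ := Function.minimalPeriod φ x

lemma len_pos [Finite X] (φ : Perm X) (x : X) : 0 < len φ x := by
  apply Function.IsPeriodicPt.minimalPeriod_pos (orderOf_pos φ)
  rw [Function.IsPeriodicPt, Function.IsFixedPt, Perm.iterate_eq_pow, pow_orderOf_eq_one]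
  rfl

lemma pow_apply_eq_iff (φ : Perm X) (x : X) (n : ℕ) : (φ ^ n) x = x ↔ len φ x ∣ n := by
  rw [len, ← Function.isPeriodicPt_iff_minimalPeriod_dvd, Function.IsPeriodicPt,
    Function.IsFixedPt, Perm.iterate_eq_pow]

lemma pow_len_apply (φ : Perm X) (x : X) : (φ ^ len φ x) x = x :=
  (pow_apply_eq_iff φ x _).2 dvd_rfl

lemma len_eq_of_forall {φ : Perm X} {ψ : Perm Y} {x : X} {y : Y}
    (h : ∀ n : ℕ, (φ ^ n) x = x ↔ (ψ ^ n) y = y) : len φ x = len ψ y := by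
  apply Nat.dvd_antisymm
  · rw [← pow_apply_eq_iff, h, pow_apply_eq_iff]
  · rw [← pow_apply_eq_iff, ← h, pow_apply_eq_iff]

@[simp] lemma len_apply (φ : Perm X) (x : X) : len φ (φ x) = len φ x := by
  apply len_eq_of_forall
  intro n
  rw [← Perm.mul_apply, ← pow_succ, pow_succ', Perm.mul_apply, φ.injective.eq_iff]

lemma apply_eq_of_sameCycle {M : Type*} {φ : Perm X} {f : X → M} {S : Finset X}
    (hS : ∀ x, φ x ∈ S ↔ x ∈ S) (hf : ∀ x ∈ S, f (φ x) = f x) [Finite X] {x y : X}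
    (h : φ.SameCycle x y) (hx : x ∈ S) : f y = f x := by
  obtain ⟨n, rfl⟩ := h.exists_nat_pow_eq
  have : (φ ^ n) x ∈ S ∧ f ((φ ^ n) x) = f x := by
    induction n with
    | zero => exact ⟨hx, rfl⟩
    | succ n ih =>
      obtain ⟨h1, h2⟩ := ih ⟨n, rfl⟩
      rw [pow_succ', Perm.mul_apply]
      exact ⟨(hS _).2 h1, (hf _ h1).trans h2⟩
  exact this.2

lemma len_eq_of_sameCycle [Finite X] {φ : Perm X} {x y : X} (h : φ.SameCycle x y) :
    len φ y = len φ x := by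
  obtain ⟨n, rfl⟩ := h.exists_nat_pow_eq
  induction n with
  | zero => rfl
  | succ n ih => rw [pow_succ', Perm.mul_apply, len_apply]; exact ih ⟨n, rfl⟩

/-- The finite set `S` is invariant under `φ`. -/
def PermInv (φ : Perm X) (S : Finset X) : Prop := ∀ x, φ x ∈ S ↔ x ∈ S

lemma PermInv.pow {φ : Perm X} {S : Finset X} (h : PermInv φ S) (n : ℕ) : PermInv (φ ^ n) S := by
  induction n with
  | zero => intro x; rfl
  | succ n ih => intro x; rw [pow_succ', Perm.mul_apply, h, ih]

lemma PermInv.mem_of_sameCycle [Finite X] {φ : Perm X} {S : Finset X} (h : PermInv φ S) {x y : X}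
    (hxy : φ.SameCycle x y) (hx : x ∈ S) : y ∈ S := by
  obtain ⟨n, rfl⟩ := hxy.exists_nat_pow_eq
  exact (h.pow n x).2 hx

lemma permInv_univ [Fintype X] (φ : Perm X) : PermInv φ (Finset.univ : Finset X) :=
  fun x => by simp

lemma permInv_of_forall {φ : Perm X} {S : Finset X} (h : ∀ x ∈ S, φ x ∈ S) : PermInv φ S := by
  intro x
  refine ⟨fun hx => ?_, h x⟩
  have hinj : Set.InjOn φ (S : Set X) := φ.injective.injOn
  have hsurj := Finset.surjOn_of_injOn_of_card_le φ (fun a ha => h a ha) hinj le_rfl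
  obtain ⟨y, hy, hyx⟩ := hsurj hx
  rwa [← φ.injective hyx]

open Classical in
/-- The representatives of the `φ`-orbits contained in `S`. -/
def reps (φ : Perm X) (S : Finset X) : Finset X := S.filter fun x => rep φ x = x

lemma mem_reps {φ : Perm X} {S : Finset X} {x : X} : x ∈ reps φ S ↔ x ∈ S ∧ rep φ x = x := by
  simp [reps]

lemma reps_subset (φ : Perm X) (S : Finset X) : reps φ S ⊆ S := fun _ h => (mem_reps.1 h).1

lemma rep_mem_reps [Finite X] {φ : Perm X} {S : Finset X} (hS : PermInv φ S) {x : X} (hx : x ∈ S) :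
    rep φ x ∈ reps φ S :=
  mem_reps.2 ⟨hS.mem_of_sameCycle (rep_sameCycle φ x).symm hx, rep_rep φ x⟩

lemma eq_of_mem_reps {φ : Perm X} {S : Finset X} {x y : X} (hx : x ∈ reps φ S)
    (hy : y ∈ reps φ S) (h : φ.SameCycle x y) : x = y := by
  rw [← (mem_reps.1 hx).2, ← (mem_reps.1 hy).2, rep_congr h]

/-- A product over orbits may be computed with any set of representatives. -/
@[to_additive]
lemma prod_transversal [Finite X] {M : Type*} [CommMonoid M] {φ : Perm X} {S R : Finset X}
    (hS : PermInv φ S) (hRS : R ⊆ S) (h1 : ∀ x ∈ S, ∃ r ∈ R, φ.SameCycle r x)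
    (h2 : ∀ r ∈ R, ∀ r' ∈ R, φ.SameCycle r r' → r = r') {f : X → M}
    (hf : ∀ x ∈ S, f (φ x) = f x) : ∏ x ∈ R, f x = ∏ x ∈ reps φ S, f x := by
  refine Finset.prod_bij (fun r _ => rep φ r) (fun r hr => rep_mem_reps hS (hRS hr)) ?_ ?_ ?_
  · intro r hr r' hr' h
    exact h2 r hr r' hr'
      ((rep_sameCycle φ r).symm.trans (h ▸ rep_sameCycle φ r'))
  · intro x hx
    obtain ⟨r, hr, hrx⟩ := h1 x (reps_subset _ _ hx)
    exact ⟨r, hr, (rep_congr hrx).trans (mem_reps.1 hx).2⟩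
  · intro r hr
    exact (apply_eq_of_sameCycle hS hf (rep_sameCycle φ r).symm (hRS hr)).symm

section transport

variable {φ : Perm X} {ψ : Perm Y} {S : Finset X} {β : X → Y}

lemma map_pow (hS : PermInv φ S) (hβ : ∀ x ∈ S, β (φ x) = ψ (β x)) (n : ℕ) {x : X}
    (hx : x ∈ S) : β ((φ ^ n) x) = (ψ ^ n) (β x) := by
  induction n with
  | zero => rfl
  | succ n ih =>
    rw [pow_succ', Perm.mul_apply, hβ _ ((hS.pow n x).2 hx), ih, pow_succ', Perm.mul_apply]

lemma len_map (hS : PermInv φ S) (hβ : ∀ x ∈ S, β (φ x) = ψ (β x))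
    (hinj : Set.InjOn β S) {x : X} (hx : x ∈ S) : len ψ (β x) = len φ x := by
  apply len_eq_of_forall
  intro n
  rw [← map_pow hS hβ n hx, hinj.eq_iff ((hS.pow n x).2 hx) hx]

/-- Transport of a product over orbits along an equivariant bijection. -/
@[to_additive]
lemma prod_reps_of_bijOn [Finite X] [Finite Y] {M : Type*} [CommMonoid M] {S' : Finset Y}
    (hS : PermInv φ S) (hS' : PermInv ψ S')
    (hβ : ∀ x ∈ S, β (φ x) = ψ (β x)) (hb : Set.BijOn β S S') {f : X → M} {g : Y → M}
    (hg : ∀ y ∈ S', g (ψ y) = g y) (hfg : ∀ x ∈ S, f x = g (β x)) :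
    ∏ x ∈ reps φ S, f x = ∏ y ∈ reps ψ S', g y := by
  classical
  rw [← prod_transversal (R := (reps φ S).image β) hS' ?_ ?_ ?_ hg, Finset.prod_image]
  · exact Finset.prod_congr rfl fun x hx => hfg x (reps_subset _ _ hx)
  · exact hb.injOn.mono (by simpa using reps_subset φ S)
  · intro y hy
    obtain ⟨x, hx, rfl⟩ := Finset.mem_image.1 hy
    exact hb.mapsTo (reps_subset _ _ hx)
  · intro y hy
    obtain ⟨x, hx, rfl⟩ := hb.surjOn hy
    refine ⟨β (rep φ x), Finset.mem_image_of_mem _ (rep_mem_reps hS hx), ?_⟩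
    obtain ⟨n, hn⟩ := (rep_sameCycle φ x).symm.exists_nat_pow_eq
    rw [← hn, map_pow hS hβ n hx]
    exact (Perm.sameCycle_pow_right.2 (Perm.SameCycle.refl _ _)).symm
  · simp only [Finset.mem_image]
    rintro _ ⟨x, hx, rfl⟩ _ ⟨x', hx', rfl⟩ h
    obtain ⟨n, hn⟩ := h.exists_nat_pow_eq
    have hxS := reps_subset _ _ hx
    rw [← map_pow hS hβ n hxS] at hn
    have := hb.injOn ((hS.pow n x).2 hxS) (reps_subset _ _ hx') hn
    rw [eq_of_mem_reps hx hx' ⟨n, by simpa using this⟩]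

end transport

section fibration

variable {φ : Perm X} {σ : Perm Y} {S : Finset X} {T : Finset Y} {p : X → Y}

lemma permInv_fibre [DecidableEq Y] (hS : PermInv φ S) (hp : ∀ x ∈ S, p (φ x) = σ (p x)) (y : Y) :
    PermInv (φ ^ len σ y) (S.filter fun x => p x = y) := by
  apply permInv_of_forall
  simp only [Finset.mem_filter]
  rintro x ⟨hx, rfl⟩
  exact ⟨(hS.pow _ x).2 hx, by rw [map_pow hS hp _ hx, pow_len_apply]⟩

lemma len_eq_mul (hS : PermInv φ S) (hp : ∀ x ∈ S, p (φ x) = σ (p x)) {x : X} (hx : x ∈ S) :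
    len φ x = len σ (p x) * len (φ ^ len σ (p x)) x := by
  apply Nat.dvd_antisymm
  · rw [← pow_apply_eq_iff, pow_mul, pow_len_apply]
  · have h1 : len σ (p x) ∣ len φ x := by
      rw [← pow_apply_eq_iff, ← map_pow hS hp _ hx, pow_len_apply]
    obtain ⟨k, hk⟩ := h1
    rw [hk]
    apply mul_dvd_mul_left
    rw [← pow_apply_eq_iff, ← pow_mul, ← hk, pow_len_apply]

lemma sameCycle_pow_of_fibre [Finite X] (hS : PermInv φ S) (hp : ∀ x ∈ S, p (φ x) = σ (p x))
    {x x' : X} (hx : x ∈ S) (h : p x = p x') (hc : φ.SameCycle x x') :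
    (φ ^ len σ (p x)).SameCycle x x' := by
  obtain ⟨n, rfl⟩ := hc.exists_nat_pow_eq
  rw [map_pow hS hp n hx] at h
  obtain ⟨k, hk⟩ := (pow_apply_eq_iff σ _ n).1 h.symm
  exact ⟨k, by rw [hk, pow_mul]; simp⟩

/-- The orbits in the total space of an equivariant map `p` correspond to an orbit in the base
and an orbit of the return map `φ ^ len y` in the fibre over its representative `y`. -/
@[to_additive]
lemma prod_reps_fibration [DecidableEq Y] [Finite X] [Finite Y] {M : Type*} [CommMonoid M]
    (hS : PermInv φ S) (hT : PermInv σ T) (hp : ∀ x ∈ S, p (φ x) = σ (p x))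
    (hpT : ∀ x ∈ S, p x ∈ T) {f : X → M} (hf : ∀ x ∈ S, f (φ x) = f x) :
    ∏ x ∈ reps φ S, f x =
      ∏ y ∈ reps σ T, ∏ x ∈ reps (φ ^ len σ y) (S.filter fun x => p x = y), f x := by
  classical
  rw [← prod_transversal (R := (reps σ T).biUnion fun y =>
    reps (φ ^ len σ y) (S.filter fun x => p x = y)) hS ?_ ?_ ?_ hf, Finset.prod_biUnion]
  · intro y _ y' _ hne
    rw [Function.onFun, Finset.disjoint_left]
    intro x hx hx'
    have h1 := reps_subset _ _ hx
    have h2 := reps_subset _ _ hx'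
    simp only [Finset.mem_filter] at h1 h2
    exact hne (h1.2.symm.trans h2.2)
  · intro x hx
    obtain ⟨y, _, hx⟩ := Finset.mem_biUnion.1 hx
    exact (Finset.mem_filter.1 (reps_subset _ _ hx)).1
  · intro x hx
    obtain ⟨n, hn⟩ := (rep_sameCycle σ (p x)).symm.exists_nat_pow_eq
    have hx' := (hS.pow n x).2 hx
    have hmem : (φ ^ n) x ∈ S.filter fun z => p z = rep σ (p x) := by
      simp [hx', map_pow hS hp n hx, hn]
    refine ⟨rep (φ ^ len σ (rep σ (p x))) ((φ ^ n) x), ?_, ?_⟩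
    · exact Finset.mem_biUnion.2 ⟨_, rep_mem_reps hT (hpT x hx),
        rep_mem_reps (permInv_fibre hS hp _) hmem⟩
    · exact (rep_sameCycle _ _).of_pow.trans
        (Perm.sameCycle_pow_left.2 (Perm.SameCycle.refl _ _))
  · intro r hr r' hr' h
    obtain ⟨y, hy, hr⟩ := Finset.mem_biUnion.1 hr
    obtain ⟨y', hy', hr'⟩ := Finset.mem_biUnion.1 hr'
    have h1 := Finset.mem_filter.1 (reps_subset _ _ hr)
    have h2 := Finset.mem_filter.1 (reps_subset _ _ hr')
    have hyy : y = y' := by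
      apply eq_of_mem_reps hy hy'
      obtain ⟨n, hn⟩ := h.exists_nat_pow_eq
      rw [← h1.2, ← h2.2, ← hn, map_pow hS hp n h1.1]
      exact Perm.sameCycle_pow_right.2 (Perm.SameCycle.refl _ _)
    subst hyy
    apply eq_of_mem_reps hr hr'
    have := sameCycle_pow_of_fibre hS hp h1.1 (h1.2.trans h2.2.symm) h
    rwa [h1.2] at this

end fibration

end Orbits

/-! ### Coefficients of symmetric functions as class functions -/

/-- The order of the centraliser of a permutation whose orbits have colours and lengths `s`. -/
def zfac (s : Fin 2 × ℕ+ →₀ ℕ) : ℂ := s.prod fun a k => ((a.2 : ℕ) : ℂ) ^ k * (k.factorial : ℂ)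

/-- The value at the type `s` of the class function with characteristic `f`. -/
def sval (s : Fin 2 × ℕ+ →₀ ℕ) (f : SymC) : ℂ := zfac s * coeff s f

/-- The derivation `k ∂ / ∂p_k^{(i)}`, which on class functions is the evaluation at
permutations with one additional orbit of colour `i` and length `k`. -/
def orbitDeriv (a : Fin 2 × ℕ+) (f : SymC) : SymC := ((a.2 : ℕ) : ℂ) • pderiv ℂ a f

lemma zfac_ne_zero (s : Fin 2 × ℕ+ →₀ ℕ) : zfac s ≠ 0 := by
  rw [zfac, Finsupp.prod, Finset.prod_ne_zero_iff]
  intro a _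
  exact mul_ne_zero (pow_ne_zero _ (by exact_mod_cast a.2.ne_zero))
    (by exact_mod_cast Nat.factorial_ne_zero _)

lemma zfac_add_single (s : Fin 2 × ℕ+ →₀ ℕ) (a : Fin 2 × ℕ+) :
    zfac (s + Finsupp.single a 1) = zfac s * ((a.2 : ℕ) * (s a + 1)) := by
  classical
  have key : ∀ s' : Fin 2 × ℕ+ →₀ ℕ, s'.support ⊆ insert a s.support →
      zfac s' = ∏ b ∈ insert a s.support, (((b.2 : ℕ) : ℂ) ^ s' b * ((s' b).factorial : ℂ)) := by
    intro s' hs'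
    exact Finsupp.prod_of_support_subset _ hs' _ (by simp)
  rw [key s (Finset.subset_insert _ _), key (s + Finsupp.single a 1)]
  · rw [← Finset.mul_prod_erase _ _ (Finset.mem_insert_self a _),
      ← Finset.mul_prod_erase _ _ (Finset.mem_insert_self a _)]
    have : ∀ b ∈ (insert a s.support).erase a,
        (s + Finsupp.single a 1 : Fin 2 × ℕ+ →₀ ℕ) b = s b := by
      intro b hb
      have : a ≠ b := (Finset.ne_of_mem_erase hb).symm
      simp [this]
    rw [Finset.prod_congr rfl fun b hb => by rw [this b hb]]
    simp only [Finsupp.add_apply, Finsupp.single_eq_same, pow_succ, Nat.factorial_succ]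
    push_cast
    ring
  · refine Finsupp.support_add.trans ?_
    intro b hb
    rcases Finset.mem_union.1 hb with h | h
    · exact Finset.mem_insert_of_mem h
    · have := Finsupp.support_single_subset h
      simp at this
      simp [this]

lemma sval_add_single (s : Fin 2 × ℕ+ →₀ ℕ) (a : Fin 2 × ℕ+) (f : SymC) :
    sval (s + Finsupp.single a 1) f = sval s (orbitDeriv a f) := by
  simp only [sval, orbitDeriv, zfac_add_single, map_smul, coeff_pderiv, smul_eq_mul]
  ring

lemma sval_zero_left (f : SymC) : sval 0 f = constantCoeff f := by
  simp [sval, zfac]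

lemma sval_add (s : Fin 2 × ℕ+ →₀ ℕ) (f g : SymC) : sval s (f + g) = sval s f + sval s g := by
  simp [sval, mul_add]

lemma sval_sub (s : Fin 2 × ℕ+ →₀ ℕ) (f g : SymC) : sval s (f - g) = sval s f - sval s g := by
  simp [sval, mul_sub]

lemma sval_sum {ι : Type*} (s : Fin 2 × ℕ+ →₀ ℕ) (t : Finset ι) (f : ι → SymC) :
    sval s (∑ i ∈ t, f i) = ∑ i ∈ t, sval s (f i) := by
  simp [sval, Finset.mul_sum]

/-! ### Adams operations -/

/-- Multiplication of all the orbit lengths by `n`. -/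
def scaleIdx (n : ℕ+) (a : Fin 2 × ℕ+) : Fin 2 × ℕ+ := (a.1, n * a.2)

lemma scaleIdx_injective (n : ℕ+) : Function.Injective (scaleIdx n) := by
  rintro ⟨i, k⟩ ⟨j, l⟩ h
  simpa [scaleIdx] using h

lemma adams_one_prod (n : ℕ+) (e : Fin 2 × ℕ+ →₀ ℕ) :
    (e.prod fun s m => (psum s.1 (n * s.2)) ^ m) =
      monomial (e.mapDomain (scaleIdx n)) (1 : ℂ) := by
  rw [monomial_one_eq, Finsupp.prod_mapDomain_index_inj (scaleIdx_injective n)]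
  rfl

lemma coeff_mapDomain_adams (n : ℕ+) (f : SymC) (e : Fin 2 × ℕ+ →₀ ℕ) :
    coeff (e.mapDomain (scaleIdx n)) (adams n f) = coeff e f := by
  classical
  rw [adams, coeff_subst (hasSubst_adams n), finsum_eq_single _ e]
  · rw [adams_one_prod, coeff_monomial_same, smul_eq_mul, mul_one]
  · intro e' he'
    rw [adams_one_prod, coeff_monomial_ne, smul_zero]
    intro h
    exact he' (Finsupp.mapDomain_injective (scaleIdx_injective n) h).symm

lemma coeff_adams_of_not_dvd (n : ℕ+) (f : SymC) (d : Fin 2 × ℕ+ →₀ ℕ) {a : Fin 2 × ℕ+}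
    (ha : d a ≠ 0) (hn : ¬ n ∣ a.2) : coeff d (adams n f) = 0 := by
  classical
  rw [adams, coeff_subst (hasSubst_adams n), finsum_eq_zero_of_forall_eq_zero]
  intro e
  rw [adams_one_prod, coeff_monomial_ne, smul_zero]
  rintro rfl
  apply ha
  rw [Finsupp.mapDomain_of_notMem_range]
  rintro ⟨b, rfl⟩
  exact hn (Dvd.intro _ rfl)

lemma exists_mapDomain_scaleIdx (n : ℕ+) (d : Fin 2 × ℕ+ →₀ ℕ) (h : ∀ a, d a ≠ 0 → n ∣ a.2) :
    ∃ e : Fin 2 × ℕ+ →₀ ℕ, e.mapDomain (scaleIdx n) = d := by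
  refine ⟨d.comapDomain (scaleIdx n) (scaleIdx_injective n).injOn, ?_⟩
  apply Finsupp.mapDomain_comapDomain _ (scaleIdx_injective n)
  rintro ⟨i, k⟩ hk
  obtain ⟨l, rfl⟩ := h _ (by simpa using hk)
  exact ⟨(i, l), rfl⟩

lemma pderiv_adams_of_not_dvd (n : ℕ+) (f : SymC) {a : Fin 2 × ℕ+} (hn : ¬ n ∣ a.2) :
    pderiv ℂ a (adams n f) = 0 := by
  ext d
  rw [coeff_pderiv, coeff_adams_of_not_dvd n f _ (a := a) (by simp) hn]
  simp

lemma pderiv_adams (n : ℕ+) (f : SymC) (a : Fin 2 × ℕ+) :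
    pderiv ℂ (scaleIdx n a) (adams n f) = adams n (pderiv ℂ a f) := by
  ext d
  rw [coeff_pderiv]
  by_cases h : ∀ a, d a ≠ 0 → n ∣ a.2
  · obtain ⟨e, rfl⟩ := exists_mapDomain_scaleIdx n d h
    rw [coeff_mapDomain_adams, coeff_pderiv, ← Finsupp.mapDomain_single,
      ← Finsupp.mapDomain_add, coeff_mapDomain_adams,
      Finsupp.mapDomain_apply (scaleIdx_injective n)]
  · push Not at h
    obtain ⟨b, hb, hn⟩ := h
    rw [coeff_adams_of_not_dvd n _ _ hb hn, coeff_adams_of_not_dvd n _ _ (a := b) _ hn, zero_mul]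
    rw [Finsupp.add_apply]
    omega

/-- Division of the length by `n`. -/
def divIdx (n : ℕ+) (a : Fin 2 × ℕ+) : Fin 2 × ℕ+ := (a.1, ((a.2 : ℕ) / (n : ℕ)).toPNat')

lemma divIdx_scaleIdx (n : ℕ+) (a : Fin 2 × ℕ+) : divIdx n (scaleIdx n a) = a := by
  apply Prod.ext
  · rfl
  · apply PNat.eq
    simp [divIdx, scaleIdx]

lemma orbitDeriv_adams (n : ℕ+) (f : SymC) (a : Fin 2 × ℕ+) :
    orbitDeriv a (adams n f) =
      if (n : ℕ) ∣ a.2 then ((n : ℕ) : ℂ) • adams n (orbitDeriv (divIdx n a) f) else 0 := by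
  split_ifs with h
  · obtain ⟨i, k⟩ := a
    obtain ⟨l, rfl⟩ := PNat.dvd_iff.2 h
    have : ((i, n * l) : Fin 2 × ℕ+) = scaleIdx n (i, l) := rfl
    rw [this, divIdx_scaleIdx, orbitDeriv, pderiv_adams, orbitDeriv]
    unfold adams
    rw [subst_smul (hasSubst_adams n), smul_smul]
    simp [scaleIdx]
  · rw [orbitDeriv, pderiv_adams_of_not_dvd n f (fun h' => h (PNat.dvd_iff.1 h')), smul_zero]

/-! ### Values of products over orbits -/

/-- The length of an orbit, as a positive number. -/
def plen {X : Type*} (φ : Perm X) (x : X) : ℕ+ := (len φ x).toPNat'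

lemma coe_plen {X : Type*} [Finite X] (φ : Perm X) (x : X) : (plen φ x : ℕ) = len φ x := by
  simp [plen, len_pos φ x]

lemma orbitDeriv_mul (a : Fin 2 × ℕ+) (f g : SymC) :
    orbitDeriv a (f * g) = orbitDeriv a f * g + f * orbitDeriv a g := by
  rw [orbitDeriv, Derivation.leibniz, smul_add, smul_eq_mul, smul_eq_mul, ← mul_smul_comm,
    ← mul_smul_comm, add_comm, mul_comm g]
  rfl

lemma orbitDeriv_prod {ι : Type*} [DecidableEq ι] (a : Fin 2 × ℕ+) (s : Finset ι) (f : ι → SymC) :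
    orbitDeriv a (∏ i ∈ s, f i) = ∑ i ∈ s, ∏ j ∈ s, Function.update f i (orbitDeriv a (f i)) j := by
  induction s using Finset.induction_on with
  | empty => simp [orbitDeriv]
  | insert i s hi ih =>
    rw [Finset.prod_insert hi, orbitDeriv_mul, ih, Finset.sum_insert hi, Finset.prod_insert hi,
      Function.update_self, Finset.mul_sum]
    congr 1
    · congr 1
      refine Finset.prod_congr rfl fun j hj => ?_
      rw [Function.update_of_ne (ne_of_mem_of_not_mem hj hi)]
    · refine Finset.sum_congr rfl fun j hj => ?_
      rw [Finset.prod_insert hi, Function.update_of_ne (ne_of_mem_of_not_mem hj hi).symm]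

/-- The part of the type `t` mapped to the orbit of `y` by `ρ`, with lengths divided by that of
the orbit. -/
def fibreType {Y : Type*} [DecidableEq Y] {N : ℕ} (σ : Perm Y)
    (t : Fin N → Fin 2 × ℕ+) (ρ : Fin N → Y) (y : Y) :
    Fin 2 × ℕ+ →₀ ℕ :=
  ∑ o ∈ Finset.univ.filter (fun o => rep σ (ρ o) = y), Finsupp.single (divIdx (plen σ y) (t o)) 1

lemma fibreType_cons {Y : Type*} [DecidableEq Y] {N : ℕ} (σ : Perm Y)
    (t : Fin (N + 1) → Fin 2 × ℕ+) (z : Y) (ρ : Fin N → Y)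
    (y : Y) : fibreType σ t (Fin.cons z ρ) y =
      (if rep σ z = y then Finsupp.single (divIdx (plen σ y) (t 0)) 1 else 0) +
        fibreType σ (fun o => t o.succ) ρ y := by
  rw [fibreType, fibreType, Finset.sum_filter, Fin.sum_univ_succ, Finset.sum_filter]
  simp

section

variable {Y : Type*} [Fintype Y] [DecidableEq Y]

lemma card_orbit (σ : Perm Y) (y : Y) :
    (Finset.univ.filter fun z => rep σ z = rep σ y).card = len σ y := by
  have : (Finset.univ.filter fun z => rep σ z = rep σ y) =
      (Finset.range (len σ y)).image fun n => (σ ^ n) y := by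
    ext z
    simp only [Finset.mem_filter, Finset.mem_univ, true_and, Finset.mem_image, Finset.mem_range]
    constructor
    · intro h
      have hs : σ.SameCycle y z := (rep_sameCycle σ y).symm.trans (h ▸ rep_sameCycle σ z)
      obtain ⟨n, rfl⟩ := hs.exists_nat_pow_eq
      refine ⟨n % len σ y, Nat.mod_lt _ (len_pos σ y), ?_⟩
      rw [len, ← Perm.iterate_eq_pow, ← Perm.iterate_eq_pow]
      exact Function.iterate_mod_minimalPeriod_eq
    · rintro ⟨n, _, rfl⟩
      exact rep_congr (Perm.sameCycle_pow_left.2 (Perm.SameCycle.refl _ _))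
  rw [this, Finset.card_image_of_injOn, Finset.card_range]
  intro i hi j hj h
  have := Function.iterate_injOn_Iio_minimalPeriod (f := σ) (x := y)
    (by simpa [len] using hi : i ∈ Set.Iio _) (by simpa [len] using hj : j ∈ Set.Iio _)
  apply this
  simpa [Perm.iterate_eq_pow] using h

/-- The additional orbit of length `a.2` lies in one of the factors `u z`, for `z` in an orbit of
`σ` whose length divides `a.2`, and it is an orbit of length `a.2 / len σ z` of the first return
map. The `len σ z` points of the orbit of `z` account for the factor in `orbitDeriv_adams`. -/
lemma orbitDeriv_prod_adams (σ : Perm Y) (a : Fin 2 × ℕ+) (u : Y → SymC) :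
    orbitDeriv a (∏ y ∈ reps σ Finset.univ, adams (plen σ y) (u y)) =
      ∑ z ∈ Finset.univ.filter fun z => len σ z ∣ a.2, ∏ y ∈ reps σ Finset.univ, adams (plen σ y)
        (Function.update u (rep σ z) (orbitDeriv (divIdx (plen σ z) a) (u (rep σ z))) y) := by
  rw [orbitDeriv_prod]
  have h1 : ∀ z, rep σ z ∈ reps σ (Finset.univ : Finset Y) := fun z =>
    rep_mem_reps (permInv_univ σ) (Finset.mem_univ z)
  refine Eq.trans ?_ (Finset.sum_fiberwise_of_maps_to (g := rep σ) (t := reps σ Finset.univ)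
    (fun z _ => h1 z) _)
  refine Finset.sum_congr rfl fun i hi => ?_
  have hi2 := (mem_reps.1 hi).2
  have hlen : ∀ z, rep σ z = i → len σ z = len σ i := fun z hz =>
    hz ▸ len_eq_of_sameCycle (rep_sameCycle σ z)
  have h2 : ∀ z ∈ (Finset.univ.filter fun z => len σ z ∣ a.2).filter (fun z => rep σ z = i),
      (∏ y ∈ reps σ Finset.univ, adams (plen σ y)
        (Function.update u (rep σ z) (orbitDeriv (divIdx (plen σ z) a) (u (rep σ z))) y)) =
      ∏ y ∈ reps σ Finset.univ, adams (plen σ y)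
        (Function.update u i (orbitDeriv (divIdx (plen σ i) a) (u i)) y) := by
    intro z hz
    have hz := (Finset.mem_filter.1 hz).2
    have : plen σ z = plen σ i := by rw [plen, hlen z hz, plen]
    rw [hz, this]
  rw [Finset.sum_congr rfl h2, Finset.sum_const]
  rw [← Finset.mul_prod_erase _ _ hi, ← Finset.mul_prod_erase _ _ hi, Function.update_self,
    Function.update_self, orbitDeriv_adams, coe_plen]
  have h3 : ∀ j ∈ (reps σ (Finset.univ : Finset Y)).erase i,
      Function.update (fun y => adams (plen σ y) (u y)) i
        (orbitDeriv a (adams (plen σ i) (u i))) j =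
      adams (plen σ j) (Function.update u i (orbitDeriv (divIdx (plen σ i) a) (u i)) j) := by
    intro j hj
    rw [Function.update_of_ne (Finset.ne_of_mem_erase hj),
      Function.update_of_ne (Finset.ne_of_mem_erase hj)]
  rw [← coe_plen, ← orbitDeriv_adams, Finset.prod_congr rfl h3, orbitDeriv_adams, coe_plen]
  split_ifs with h
  · have h4 : (Finset.univ.filter fun z => len σ z ∣ a.2).filter (fun z => rep σ z = i) =
        Finset.univ.filter fun z => rep σ z = rep σ i := by
      ext z
      simp only [Finset.mem_filter, Finset.mem_univ, true_and, hi2]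
      exact ⟨fun h => h.2, fun hz => ⟨hlen z hz ▸ h, hz⟩⟩
    rw [h4, card_orbit, smul_mul_assoc, Nat.cast_smul_eq_nsmul]
  · have h4 : (Finset.univ.filter fun z => len σ z ∣ a.2).filter (fun z => rep σ z = i) = ∅ := by
      ext z
      simp only [Finset.mem_filter, Finset.mem_univ, true_and, Finset.notMem_empty, iff_false]
      rintro ⟨h', hz⟩
      exact h (hlen z hz ▸ h')
    rw [h4, zero_mul, Finset.card_empty, zero_smul]

/-- The class function of a product over the orbits of `σ`: the orbits of the argument, with types
`t o`, are distributed over the points of `Y`; the product lives on families indexed by `Y` on which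
the permutation acts over `σ`. -/
lemma sval_prod_adams (σ : Perm Y) {N : ℕ} (t : Fin N → Fin 2 × ℕ+) (u : Y → SymC) :
    sval (∑ o, Finsupp.single (t o) 1) (∏ y ∈ reps σ Finset.univ, adams (plen σ y) (u y)) =
      ∑ ρ ∈ Finset.univ.filter (fun ρ : Fin N → Y => ∀ o, len σ (ρ o) ∣ (t o).2),
        ∏ y ∈ reps σ Finset.univ, sval (fibreType σ t ρ y) (u y) := by
  induction N generalizing u with
  | zero =>
    rw [Finset.univ_eq_empty (α := Fin 0), Finset.sum_empty, sval_zero_left, map_prod]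
    have : (Finset.univ.filter (fun ρ : Fin 0 → Y => ∀ o, len σ (ρ o) ∣ (t o).2)) =
      {Fin.elim0} := by
      ext ρ
      simp [Subsingleton.elim ρ Fin.elim0, Subsingleton.elim default (Fin.elim0 : Fin 0 → Y)]
    rw [this, Finset.sum_singleton]
    refine Finset.prod_congr rfl fun y _ => ?_
    rw [fibreType, Finset.univ_eq_empty (α := Fin 0), Finset.filter_empty, Finset.sum_empty,
      sval_zero_left]
    have := coeff_mapDomain_adams (plen σ y) (u y) 0
    rwa [Finsupp.mapDomain_zero, coeff_zero_eq_constantCoeff] at this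
  | succ N ih =>
    -- The first orbit is taken off by the derivation `orbitDeriv (t 0)`; the point `z` of
    -- `orbitDeriv_prod_adams` becomes the value `ρ 0`.
    rw [Fin.sum_univ_succ, add_comm, sval_add_single, orbitDeriv_prod_adams, sval_sum]
    rw [Finset.sum_congr rfl fun z _ => ih (fun o => t o.succ) _]
    rw [← Finset.sum_product']
    refine Finset.sum_bij' (fun p _ => (Fin.cons p.1 p.2 : Fin (N + 1) → Y))
      (fun ρ _ => (ρ 0, fun o => ρ o.succ)) ?_ ?_ ?_ ?_ ?_
    · rintro ⟨z, ρ⟩ h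
      simp only [Finset.mem_product, Finset.mem_filter, Finset.mem_univ, true_and] at h ⊢
      intro o
      refine Fin.cases ?_ (fun i => ?_) o
      · simpa using h.1
      · simpa using h.2 i
    · intro ρ h
      simp only [Finset.mem_product, Finset.mem_filter, Finset.mem_univ, true_and] at h ⊢
      exact ⟨h 0, fun o => h o.succ⟩
    · rintro ⟨z, ρ⟩ _
      simp
    · intro ρ _
      exact Fin.cons_self_tail ρ
    · rintro ⟨z, ρ⟩ _
      refine Finset.prod_congr rfl fun y _ => ?_
      rw [fibreType_cons]
      dsimp only
      by_cases hz : rep σ z = y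
      · subst hz
        have hl : plen σ z = plen σ (rep σ z) := by
          rw [plen, plen, len_eq_of_sameCycle (rep_sameCycle σ z)]
        rw [Function.update_self, if_pos rfl, ← hl, add_comm (Finsupp.single _ _), sval_add_single]
      · rw [Function.update_of_ne (Ne.symm hz), if_neg hz, zero_add]

end

/-! ### Values on invariant sets and products over orbits -/

section

variable {X : Type*}

/-- The multiset of colours and lengths of the `φ`-orbits in `S`. -/
def orbitType (φ : Perm X) (col : X → Fin 2) (S : Finset X) : Fin 2 × ℕ+ →₀ ℕ :=
  ∑ x ∈ reps φ S, Finsupp.single (col x, plen φ x) 1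

/-- The value on the coloured set `S` with permutation `φ` of the class function with
characteristic `f`. -/
def val (φ : Perm X) (col : X → Fin 2) (S : Finset X) (f : SymC) : ℂ :=
  sval (orbitType φ col S) f

/-- The families of disjoint sets with union `b`, indexed by `Y` and equivariant for `σ` on `Y` and
`φ`. They are the fibres of the equivariant maps from `b` to `Y`. -/
structure IsFam {Y : Type*} (σ : Perm Y) (φ : Perm X) (b : Finset X) (A : Y → Finset X) :
    Prop where
  equivariant : ∀ y x, φ x ∈ A (σ y) ↔ x ∈ A y
  subset : ∀ y, A y ⊆ b
  cover : ∀ x ∈ b, ∃ y, x ∈ A y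
  unique : ∀ {x y z}, x ∈ A y → x ∈ A z → y = z

lemma IsFam.pow {Y : Type*} {σ : Perm Y} {φ : Perm X} {b : Finset X} {A : Y → Finset X}
    (hA : IsFam σ φ b A) (n : ℕ) (y : Y) (x : X) : (φ ^ n) x ∈ A ((σ ^ n) y) ↔ x ∈ A y := by
  induction n with
  | zero => rfl
  | succ n ih => rw [pow_succ', pow_succ', Perm.mul_apply, Perm.mul_apply, hA.equivariant, ih]

lemma IsFam.permInv {Y : Type*} {σ : Perm Y} {φ : Perm X} {b : Finset X} {A : Y → Finset X}
    (hA : IsFam σ φ b A) {n : ℕ} {y : Y} (h : (σ ^ n) y = y) : PermInv (φ ^ n) (A y) := by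
  intro x
  conv_lhs => rw [← h]
  exact hA.pow n y x

lemma zpow_apply_eq_iff (φ : Perm X) (x : X) (n : ℤ) : (φ ^ n) x = x ↔ (len φ x : ℤ) ∣ n := by
  obtain ⟨m, rfl | rfl⟩ := n.eq_nat_or_neg
  · rw [zpow_natCast, pow_apply_eq_iff, Int.natCast_dvd_natCast]
  · rw [Int.dvd_neg, Int.natCast_dvd_natCast, ← pow_apply_eq_iff, zpow_neg, zpow_natCast,
      Perm.inv_eq_iff_eq]
    exact eq_comm

variable [Fintype X] {Y : Type*} [Fintype Y] [DecidableEq Y]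

open Classical in
/-- The finite set of families as in `IsFam`. -/
def fam (σ : Perm Y) (φ : Perm X) (b : Finset X) : Finset (Y → Finset X) :=
  Finset.univ.filter fun A => IsFam σ φ b A

lemma mem_fam {σ : Perm Y} {φ : Perm X} {b : Finset X} {A : Y → Finset X} :
    A ∈ fam σ φ b ↔ IsFam σ φ b A := by
  simp [fam]

variable [DecidableEq X]

/-- The family of orbits mapped to the orbit of `y` has the same type as the fibre `A y` with its
return map. -/
lemma orbitType_fam {σ : Perm Y} {φ : Perm X} {b : Finset X} {col : X → Fin 2}
    (hcol : ∀ x, col (φ x) = col x) {A : Y → Finset X}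
    (hb : PermInv φ b) (hA : IsFam σ φ b A) {N : ℕ} (e : Fin N ≃ reps φ b) {ρ : Fin N → Y}
    (hρ : ∀ o, (e o : X) ∈ A (ρ o)) {y : Y} (hy : y ∈ reps σ (Finset.univ : Finset Y)) :
    fibreType σ (fun o => (col (e o), plen φ (e o : X))) ρ y =
      orbitType (φ ^ len σ y) col (A y) := by
  classical
  have hy' := (mem_reps.1 hy).2
  let p : X → Y := fun x => if h : ∃ z, x ∈ A z then h.choose else y
  have hpA : ∀ {x z}, x ∈ A z → p x = z := by
    intro x z hx
    have h : ∃ z, x ∈ A z := ⟨z, hx⟩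
    simp only [p, dif_pos h]
    exact hA.unique h.choose_spec hx
  have hpb : ∀ x ∈ b, x ∈ A (p x) := by
    intro x hx
    obtain ⟨z, hz⟩ := hA.cover x hx
    rwa [hpA hz]
  have hpφ : ∀ x ∈ b, p (φ x) = σ (p x) := fun x hx =>
    hpA ((hA.equivariant _ _).2 (hpb x hx))
  set S := b.filter fun x => rep σ (p x) = y with hSdef
  have hSb : ∀ x ∈ S, x ∈ b := fun x hx => (Finset.mem_filter.1 hx).1
  have hS : PermInv φ S := by
    apply permInv_of_forall
    intro x hx
    rw [hSdef, Finset.mem_filter] at hx ⊢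
    refine ⟨(hb x).2 hx.1, ?_⟩
    rw [hpφ x hx.1, ← hx.2]
    exact rep_congr (Perm.sameCycle_apply_left.2 (Perm.SameCycle.refl _ _))
  have hT : PermInv σ (Finset.univ.filter fun z => rep σ z = y) := by
    intro z
    simp only [Finset.mem_filter, Finset.mem_univ, true_and]
    rw [rep_congr (Perm.sameCycle_apply_left.2 (Perm.SameCycle.refl σ z))]
  have hrT : reps σ (Finset.univ.filter fun z => rep σ z = y) = {y} := by
    ext z
    simp only [mem_reps, Finset.mem_filter, Finset.mem_univ, true_and, Finset.mem_singleton]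
    exact ⟨fun h => h.2.symm.trans h.1, fun h => by subst h; exact ⟨hy', hy'⟩⟩
  have hfib : (S.filter fun x => p x = y) = A y := by
    ext x
    simp only [hSdef, Finset.mem_filter]
    exact ⟨fun h => h.2 ▸ hpb x h.1.1,
      fun h => ⟨⟨hA.subset y h, by rw [hpA h, hy']⟩, hpA h⟩⟩
  have key := sum_reps_fibration (f := fun x =>
    (Finsupp.single (divIdx (plen σ y) (col x, plen φ x)) 1 : Fin 2 × ℕ+ →₀ ℕ)) hS hT
    (fun x hx => hpφ x (hSb x hx))
    (fun x hx => by simpa using (Finset.mem_filter.1 hx).2)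
    (fun x _ => by simp only [hcol, plen, len_apply])
  rw [hrT, Finset.sum_singleton, hfib] at key
  have h1 : orbitType (φ ^ len σ y) col (A y) = ∑ x ∈ reps (φ ^ len σ y) (A y),
      (Finsupp.single (divIdx (plen σ y) (col x, plen φ x)) 1 : Fin 2 × ℕ+ →₀ ℕ) := by
    refine Finset.sum_congr rfl fun x hx => ?_
    have hx := reps_subset _ _ hx
    have := len_eq_mul hb hpφ (hA.subset y hx)
    rw [hpA hx] at this
    congr 2
    apply PNat.eq
    rw [coe_plen]
    simp only [coe_plen, this, Nat.mul_div_cancel_left _ (len_pos σ y)]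
    simp [len_pos]
  rw [h1, ← key, fibreType, Finset.sum_filter]
  have h2 : reps φ S = (reps φ b).filter fun x => rep σ (p x) = y := by
    ext x
    simp only [mem_reps, hSdef, Finset.mem_filter]
    tauto
  rw [h2, Finset.sum_filter, ← Finset.sum_coe_sort (reps φ b), ← e.sum_comp]
  refine Finset.sum_congr rfl fun o _ => ?_
  rw [hpA (hρ o)]

/-- The value of a product of Adams operations over the orbits of a permutation `σ` is a sum over
equivariant maps to the set permuted by `σ`. -/
theorem val_prod_adams (σ : Perm Y) (φ : Perm X) {b : Finset X} {col : X → Fin 2}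
    (hcol : ∀ x, col (φ x) = col x) (hb : PermInv φ b) (u : Y → SymC) :
    val φ col b (∏ y ∈ reps σ Finset.univ, adams (plen σ y) (u y)) =
      ∑ A ∈ fam σ φ b, ∏ y ∈ reps σ Finset.univ, val (φ ^ len σ y) col (A y) (u y) := by
  classical
  let e : Fin (reps φ b).card ≃ reps φ b := (reps φ b).equivFin.symm
  have heb : ∀ o, (e o : X) ∈ b := fun o => reps_subset _ _ (e o).2
  have htype : orbitType φ col b =
      ∑ o, Finsupp.single (col (e o), plen φ (e o : X)) 1 := by
    rw [orbitType, ← Finset.sum_coe_sort, ← e.sum_comp]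
  rw [val, htype, sval_prod_adams]
  symm
  refine Finset.sum_bij (fun A hA o => ((mem_fam.1 hA).cover _ (heb o)).choose) ?_ ?_ ?_ ?_
  · intro A hA
    simp only [Finset.mem_filter, Finset.mem_univ, true_and]
    intro o
    have hA' := mem_fam.1 hA
    have ho := (hA'.cover _ (heb o)).choose_spec
    rw [coe_plen, ← pow_apply_eq_iff]
    refine hA'.unique ?_ ho
    have := (hA'.pow (len φ (e o : X)) _ _).2 ho
    rwa [pow_len_apply] at this
  · intro A hA A' hA' h
    have key : ∀ {A A' : Y → Finset X} (hA : IsFam σ φ b A) (hA' : IsFam σ φ b A'),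
        (∀ o, (hA.cover _ (heb o)).choose = (hA'.cover _ (heb o)).choose) →
        ∀ y x, x ∈ A y → x ∈ A' y := by
      intro A A' hA hA' h y x hx
      have hxb := hA.subset _ hx
      obtain ⟨n, hn⟩ := (rep_sameCycle φ x).exists_nat_pow_eq
      obtain ⟨o, ho⟩ := e.surjective ⟨rep φ x, rep_mem_reps hb hxb⟩
      have ho' : (e o : X) = rep φ x := by rw [ho]
      have h1 := (hA.pow n _ _).2 (hA.cover _ (heb o)).choose_spec
      have h2 := (hA'.pow n _ _).2 (hA'.cover _ (heb o)).choose_spec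
      have hn' : (φ ^ n) (e o : X) = x := by rw [ho', hn]
      rw [hn'] at h1 h2
      rw [hA.unique hx h1, h o]
      exact h2
    have h' := congr_fun h
    funext y
    ext x
    exact ⟨key (mem_fam.1 hA) (mem_fam.1 hA') h' y x,
      key (mem_fam.1 hA') (mem_fam.1 hA) (fun o => (h' o).symm) y x⟩
  · intro ρ hρ
    simp only [Finset.mem_filter, Finset.mem_univ, true_and] at hρ
    let A : Y → Finset X := fun y =>
      Finset.univ.filter fun x => ∃ (n : ℤ) (o : _), (φ ^ n) (e o : X) = x ∧ (σ ^ n) (ρ o) = y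
    have hmem : ∀ {x y}, x ∈ A y ↔
        ∃ (n : ℤ) (o : _), (φ ^ n) (e o : X) = x ∧ (σ ^ n) (ρ o) = y := by
      intro x y; simp [A]
    have hA : IsFam σ φ b A := by
      refine ⟨?_, ?_, ?_, ?_⟩
      · intro y x
        rw [hmem, hmem]
        constructor
        · rintro ⟨n, o, h1, h2⟩
          refine ⟨-1 + n, o, ?_, ?_⟩
          · rw [zpow_add, Perm.mul_apply, h1]; simp
          · rw [zpow_add, Perm.mul_apply, h2]; simp
        · rintro ⟨n, o, rfl, rfl⟩
          exact ⟨1 + n, o, by rw [zpow_add]; rfl, by rw [zpow_add]; rfl⟩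
      · intro y x hx
        obtain ⟨n, o, rfl, -⟩ := hmem.1 hx
        exact hb.mem_of_sameCycle ⟨n, rfl⟩ (heb o)
      · intro x hx
        obtain ⟨n, hn⟩ := rep_sameCycle φ x
        obtain ⟨o, ho⟩ := e.surjective ⟨rep φ x, rep_mem_reps hb hx⟩
        exact ⟨_, hmem.2 ⟨n, o, by rw [ho]; exact hn, rfl⟩⟩
      · intro x y z hy hz
        obtain ⟨n, o, rfl, rfl⟩ := hmem.1 hy
        obtain ⟨m, o', h, rfl⟩ := hmem.1 hz
        have hoo : o' = o := by
          apply e.injective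
          apply Subtype.ext
          apply eq_of_mem_reps (e o').2 (e o).2
          have h3 : φ.SameCycle (e o' : X) ((φ ^ n) (e o : X)) := ⟨m, h⟩
          exact Perm.sameCycle_zpow_right.1 h3
        subst hoo
        have h1 : (φ ^ (-m + n)) (e o' : X) = e o' := by
          rw [zpow_add, Perm.mul_apply, ← h, ← Perm.mul_apply, ← zpow_add]; simp
        have h2 : (σ ^ (-m + n)) (ρ o') = ρ o' := by
          rw [zpow_apply_eq_iff] at h1 ⊢
          refine dvd_trans ?_ h1
          have := hρ o'
          rw [coe_plen] at this
          exact_mod_cast this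
        rw [zpow_add, Perm.mul_apply, zpow_neg, Perm.inv_eq_iff_eq] at h2
        exact h2
    refine ⟨A, mem_fam.2 hA, ?_⟩
    funext o
    exact hA.unique ((mem_fam.1 (mem_fam.2 hA)).cover _ (heb o)).choose_spec
      (hmem.2 ⟨0, o, rfl, rfl⟩)
  · intro A hA
    refine Finset.prod_congr rfl fun y hy => ?_
    rw [val, ← orbitType_fam hcol hb (mem_fam.1 hA) e
      (fun o => ((mem_fam.1 hA).cover _ (heb o)).choose_spec) hy]

end

/-! ### Orbit types -/

section orbitType

variable {X Y : Type*}

lemma orbitType_of_bijOn [Finite X] [Finite Y] {φ : Perm X} {ψ : Perm Y} {S : Finset X}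
    {S' : Finset Y} {β : X → Y} {col : X → Fin 2} {col' : Y → Fin 2}
    (hS : PermInv φ S) (hS' : PermInv ψ S') (hβ : ∀ x ∈ S, β (φ x) = ψ (β x))
    (hb : Set.BijOn β S S') (hcol : ∀ y ∈ S', col' (ψ y) = col' y)
    (hcc : ∀ x ∈ S, col x = col' (β x)) : orbitType φ col S = orbitType ψ col' S' := by
  refine sum_reps_of_bijOn hS hS' hβ hb ?_ ?_
  · intro y hy
    rw [hcol y hy, plen, len_apply, plen]
  · intro x hx
    rw [hcc x hx, plen, plen, len_map hS hβ hb.injOn hx]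

lemma orbitType_empty (φ : Perm X) (col : X → Fin 2) : orbitType φ col ∅ = 0 := by
  simp [orbitType, reps]

lemma orbitType_union [Finite X] [DecidableEq X] {φ : Perm X} {col : X → Fin 2} {S T : Finset X}
    (h : Disjoint S T) : orbitType φ col (S ∪ T) = orbitType φ col S + orbitType φ col T := by
  have hu : reps φ (S ∪ T) = reps φ S ∪ reps φ T := by
    ext x
    simp only [mem_reps, Finset.mem_union]
    tauto
  rw [orbitType, orbitType, orbitType, hu, Finset.sum_union]
  exact h.mono (reps_subset _ _) (reps_subset _ _)

lemma orbitType_of_sameCycle [Finite X] {φ : Perm X} {col : X → Fin 2} {S : Finset X}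
    {x : X} (hS : PermInv φ S) (hcol : ∀ y ∈ S, col (φ y) = col y) (hx : x ∈ S)
    (h : ∀ y ∈ S, φ.SameCycle x y) :
    orbitType φ col S = Finsupp.single (col x, plen φ x) 1 := by
  rw [orbitType, ← sum_transversal (R := {x}) hS (by simpa using hx)
    (fun y hy => ⟨x, by simp, h y hy⟩)
    (by simp), Finset.sum_singleton]
  intro y hy
  rw [hcol y hy, plen, len_apply, plen]

lemma orbitType_singleton [Finite X] {φ : Perm X} {col : X → Fin 2} {x : X} (h : φ x = x) :
    orbitType φ col {x} = Finsupp.single (col x, 1) 1 := by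
  have hS : PermInv φ {x} := permInv_of_forall (by simp [h])
  rw [orbitType_of_sameCycle hS (by simp [h]) (Finset.mem_singleton_self x)]
  · congr 2
    apply PNat.eq
    rw [coe_plen, PNat.one_coe, len, Function.minimalPeriod_eq_one_iff_isFixedPt]
    exact h
  · intro y hy
    rw [Finset.mem_singleton.1 hy]

lemma eq_singleton_of_orbitType [Finite X] {φ : Perm X} {col : X → Fin 2} {S : Finset X}
    (hS : PermInv φ S) {i : Fin 2} (h : orbitType φ col S = Finsupp.single (i, 1) 1) :
    ∃ x, S = {x} ∧ col x = i := by
  classical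
  have hcard : (reps φ S).card = 1 := by
    have h1 := congrArg Finsupp.degree h
    rw [orbitType, map_sum] at h1
    simpa using h1
  obtain ⟨r, hr⟩ := Finset.card_eq_one.1 hcard
  have hrS : r ∈ reps φ S := by rw [hr]; simp
  rw [orbitType, hr, Finset.sum_singleton] at h
  have h2 := Finsupp.single_left_injective one_ne_zero h
  rw [Prod.mk.injEq] at h2
  have hfix : φ r = r := by
    have : len φ r = 1 := by rw [← coe_plen, h2.2]; rfl
    rw [len, Function.minimalPeriod_eq_one_iff_isFixedPt] at this
    exact this
  refine ⟨r, ?_, h2.1⟩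
  ext x
  rw [Finset.mem_singleton]
  constructor
  · intro hx
    have h3 := rep_mem_reps hS hx
    rw [hr, Finset.mem_singleton] at h3
    exact ((h3 ▸ rep_sameCycle φ x).eq_of_left hfix).symm
  · rintro rfl
    exact reps_subset _ _ hrS

end orbitType

/-- The colouring of `Fin m ⊕ Fin n` whose two summands have colour `0` and `1`. -/
def sumCol (m n : ℕ) : Fin m ⊕ Fin n → Fin 2 := Sum.elim (fun _ => 0) (fun _ => 1)

lemma sumCol_sumCongr {m n : ℕ} (σ : Perm (Fin m)) (τ : Perm (Fin n)) (x : Fin m ⊕ Fin n) :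
    sumCol m n (Perm.sumCongr σ τ x) = sumCol m n x := by
  rcases x with x | x <;> rfl

/-- Every type is the orbit type of a permutation: a disjoint union of rotations of `ZMod k`. -/
lemma exists_orbitType_eq (d : Fin 2 × ℕ+ →₀ ℕ) :
    ∃ (Y : Type) (_ : Fintype Y) (_ : DecidableEq Y) (σ : Perm Y) (col : Y → Fin 2),
      (∀ y, col (σ y) = col y) ∧ orbitType σ col Finset.univ = d := by
  classical
  induction d using Finsupp.induction_linear with
  | zero =>
    refine ⟨Empty, inferInstance, inferInstance, 1, fun _ => 0, fun _ => rfl, ?_⟩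
    rw [Finset.univ_eq_empty, orbitType_empty]
  | add f g hf hg =>
    obtain ⟨Y, _, _, σ, c, hc, rfl⟩ := hf
    obtain ⟨Z, _, _, τ, c', hc', rfl⟩ := hg
    refine ⟨Y ⊕ Z, inferInstance, inferInstance, Perm.sumCongr σ τ, Sum.elim c c', ?_, ?_⟩
    · rintro (y | y)
      · exact hc y
      · exact hc' y
    · have hu : (Finset.univ : Finset (Y ⊕ Z)) =
          Finset.univ.map Function.Embedding.inl ∪ Finset.univ.map Function.Embedding.inr := by
        ext (x | x) <;> simp
      rw [hu, orbitType_union]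
      · congr 1
        · symm
          refine orbitType_of_bijOn (β := Sum.inl) (permInv_univ σ) ?_ (fun x _ => rfl) ?_ ?_
            (fun x _ => rfl)
          · rintro (x | x) <;> simp
          · refine ⟨fun x _ => by simp, Sum.inl_injective.injOn, ?_⟩
            rintro (x | x) hx
            · exact ⟨x, by simp⟩
            · simp at hx
          · rintro (x | x) hx
            · exact hc x
            · simp at hx
        · symm
          refine orbitType_of_bijOn (β := Sum.inr) (permInv_univ τ) ?_ (fun x _ => rfl) ?_ ?_
            (fun x _ => rfl)
          · rintro (x | x) <;> simp
          · refine ⟨fun x _ => by simp, Sum.inr_injective.injOn, ?_⟩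
            rintro (x | x) hx
            · simp at hx
            · exact ⟨x, by simp⟩
          · rintro (x | x) hx
            · simp at hx
            · exact hc' x
      · rw [Finset.disjoint_left]
        rintro (x | x) <;> simp
  | single a n =>
    obtain ⟨i, k⟩ := a
    induction n with
    | zero =>
      refine ⟨Empty, inferInstance, inferInstance, 1, fun _ => 0, fun _ => rfl, ?_⟩
      rw [Finset.univ_eq_empty, orbitType_empty, Finsupp.single_zero]
    | succ n ih =>
      obtain ⟨Y, _, _, σ, c, hc, h⟩ := ih
      -- One more orbit of length `k`: the rotation of `ZMod k`.
      have : NeZero (k : ℕ) := ⟨k.ne_zero⟩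
      let τ : Perm (ZMod k) := Equiv.addRight 1
      have hτ : ∀ (m : ℕ) (z : ZMod k), (τ ^ m) z = z + m := by
        intro m z
        induction m with
        | zero => simp
        | succ m ih =>
          rw [pow_succ', Perm.mul_apply, ih]
          simp [τ, add_assoc]
      refine ⟨Y ⊕ ZMod k, inferInstance, inferInstance, Perm.sumCongr σ τ,
        Sum.elim c (fun _ => i), ?_, ?_⟩
      · rintro (y | y)
        · exact hc y
        · rfl
      · have hu : (Finset.univ : Finset (Y ⊕ ZMod k)) =
            Finset.univ.map Function.Embedding.inl ∪ Finset.univ.map Function.Embedding.inr := by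
          ext (x | x) <;> simp
        rw [hu, orbitType_union, Finsupp.single_add, ← h]
        · congr 1
          · symm
            refine orbitType_of_bijOn (β := Sum.inl) (permInv_univ σ) ?_ (fun x _ => rfl) ?_ ?_
              (fun x _ => rfl)
            · rintro (x | x) <;> simp
            · refine ⟨fun x _ => by simp, Sum.inl_injective.injOn, ?_⟩
              rintro (x | x) hx
              · exact ⟨x, by simp⟩
              · simp at hx
            · rintro (x | x) hx
              · exact hc x
              · simp at hx
          · have hpow : ∀ m : ℕ, ((Perm.sumCongr σ τ) ^ m) (Sum.inr 0) = Sum.inr (m : ZMod k) := by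
              intro m
              induction m with
              | zero => simp
              | succ m ih => rw [pow_succ', Perm.mul_apply, ih]; simp [τ]
            rw [orbitType_of_sameCycle (x := Sum.inr 0)]
            · congr 2
              apply PNat.eq
              rw [coe_plen]
              apply Nat.dvd_antisymm
              · rw [← pow_apply_eq_iff, hpow]
                simp
              · have := pow_len_apply (Perm.sumCongr σ τ) (Sum.inr 0)
                rw [hpow, Sum.inr.injEq] at this
                exact (ZMod.natCast_eq_zero_iff _ _).1 this
            · rintro (x | x) <;> simp
            · rintro (x | x) hx
              · simp at hx
              · rfl
            · simp
            · rintro (x | x) hx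
              · simp at hx
              · exact ⟨x.val, by rw [zpow_natCast, hpow]; simp⟩
        · rw [Finset.disjoint_left]
          rintro (x | x) <;> simp

/-- Every type is the orbit type of a pair of permutations of `Fin m` and `Fin n`. -/
lemma exists_sum_orbitType_eq (d : Fin 2 × ℕ+ →₀ ℕ) :
    ∃ (m n : ℕ) (σ : Perm (Fin m)) (τ : Perm (Fin n)),
      orbitType (Perm.sumCongr σ τ) (sumCol m n) Finset.univ = d := by
  classical
  obtain ⟨Y, _, _, σ, c, hc, rfl⟩ := exists_orbitType_eq d
  let e0 := Fintype.equivFin {y // c y = 0}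
  let e1 := Fintype.equivFin {y // c y = 1}
  have h2 : ∀ i : Fin 2, i ≠ 0 → i = 1 := by decide
  let σ0 : Perm {y // c y = 0} := σ.subtypePerm (fun y => by simp [hc])
  let σ1 : Perm {y // c y = 1} := σ.subtypePerm (fun y => by simp [hc])
  refine ⟨_, _, e0.permCongr σ0, e1.permCongr σ1, ?_⟩
  let β : Fin (Fintype.card {y // c y = 0}) ⊕ Fin (Fintype.card {y // c y = 1}) → Y :=
    Sum.elim (fun x => (e0.symm x : Y)) (fun x => (e1.symm x : Y))
  refine orbitType_of_bijOn (β := β) (permInv_univ _) (permInv_univ _) ?_ ?_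
    (fun y _ => hc y) ?_
  · rintro (x | x) _ <;> simp [β, σ0, σ1]
  · refine ⟨fun x _ => by simp, ?_, ?_⟩
    · rintro (x | x) _ (y | y) _ h
      · simp only [β, Sum.elim_inl] at h
        rw [e0.symm.injective (Subtype.ext h)]
      · have hx := (e0.symm x).2
        have hy := (e1.symm y).2
        simp only [β, Sum.elim_inl, Sum.elim_inr] at h
        rw [h, hy] at hx
        exact absurd hx (by decide)
      · have hx := (e1.symm x).2
        have hy := (e0.symm y).2
        simp only [β, Sum.elim_inl, Sum.elim_inr] at h
        rw [h, hy] at hx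
        exact absurd hx (by decide)
      · simp only [β, Sum.elim_inr] at h
        rw [e1.symm.injective (Subtype.ext h)]
    · intro y _
      by_cases hy : c y = 0
      · exact ⟨Sum.inl (e0 ⟨y, hy⟩), by simp, by simp [β]⟩
      · exact ⟨Sum.inr (e1 ⟨y, h2 _ hy⟩), by simp, by simp [β]⟩
  · rintro (x | x) _
    · exact (e0.symm x).2.symm
    · exact (e1.symm x).2.symm

/-- A series is determined by the values of the class function. -/
theorem eq_of_forall_val_eq {f g : SymC}
    (h : ∀ (m n : ℕ) (σ : Perm (Fin m)) (τ : Perm (Fin n)),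
      val (Perm.sumCongr σ τ) (sumCol m n) Finset.univ f =
        val (Perm.sumCongr σ τ) (sumCol m n) Finset.univ g) : f = g := by
  ext d
  obtain ⟨m, n, σ, τ, rfl⟩ := exists_sum_orbitType_eq d
  exact mul_left_cancel₀ (zfac_ne_zero _) (h m n σ τ)

/-! ### Plethysm and set partitions -/

section

variable {X : Type*}

lemma val_empty (φ : Perm X) (col : X → Fin 2) (f : SymC) :
    val φ col ∅ f = constantCoeff f := by
  rw [val, orbitType_empty, sval_zero_left]

lemma sval_monomial [DecidableEq (Fin 2 × ℕ+ →₀ ℕ)] (s d : Fin 2 × ℕ+ →₀ ℕ) :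
    sval s (monomial d (1 : ℂ)) = if s = d then zfac d else 0 := by
  rw [sval, coeff_monomial]
  split_ifs with h
  · rw [h, mul_one]
  · rw [mul_zero]

open Classical in
lemma val_psum_one [Finite X] {φ : Perm X} {col : X → Fin 2} {S : Finset X}
    (hS : PermInv φ S) (i : Fin 2) :
    val φ col S (psum i 1) = if ∃ x, S = {x} ∧ col x = i then 1 else 0 := by
  rw [val, psum, MvPowerSeries.X, sval_monomial]
  have hz : zfac (Finsupp.single (i, 1) 1) = 1 := by simp [zfac]
  rw [hz]
  congr 1
  rw [eq_iff_iff]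
  refine ⟨eq_singleton_of_orbitType hS, ?_⟩
  rintro ⟨x, rfl, rfl⟩
  apply orbitType_singleton
  simpa using (hS x).2 (by simp)

/-- The action of a permutation on subsets. -/
def permB (φ : Perm X) : Perm (Finset X) := φ.finsetCongr

@[simp] lemma permB_apply (φ : Perm X) (S : Finset X) : permB φ S = S.map φ.toEmbedding := rfl

lemma mem_permB {φ : Perm X} {S : Finset X} {x : X} : φ x ∈ permB φ S ↔ x ∈ S := by
  simp

lemma mem_permB_iff {φ : Perm X} {S : Finset X} {x : X} : x ∈ permB φ S ↔ φ.symm x ∈ S := by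
  rw [← mem_permB (φ := φ) (x := φ.symm x), Equiv.apply_symm_apply]

lemma permB_pow (φ : Perm X) (n : ℕ) : permB φ ^ n = permB (φ ^ n) := by
  induction n with
  | zero => ext S x; simp [mem_permB_iff, -permB_apply]; rfl
  | succ n ih =>
    ext S x
    rw [pow_succ', Perm.mul_apply, ih, mem_permB_iff, mem_permB_iff, mem_permB_iff, pow_succ']
    rfl

lemma permB_eq_self_iff {φ : Perm X} {S : Finset X} : permB φ S = S ↔ PermInv φ S := by
  constructor
  · intro h x
    conv_lhs => rw [← h]
    exact mem_permB
  · intro h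
    ext x
    rw [mem_permB_iff, ← h, Equiv.apply_symm_apply]

lemma permInv_pow_len (φ : Perm X) (S : Finset X) : PermInv (φ ^ len (permB φ) S) S := by
  rw [← permB_eq_self_iff, ← permB_pow, pow_len_apply]

open Classical in
/-- The colour of a block: a block with one element has the colour of its element, all the others
have colour `0`. -/
def colB (col : X → Fin 2) (B : Finset X) : Fin 2 :=
  if h : ∃ x, B = {x} then col h.choose else 0

@[simp] lemma colB_singleton (col : X → Fin 2) (x : X) : colB col {x} = col x := by
  have h : ∃ y, ({x} : Finset X) = {y} := ⟨x, rfl⟩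
  rw [colB, dif_pos h]
  exact congrArg col (Finset.singleton_injective h.choose_spec).symm

lemma colB_of_not {col : X → Fin 2} {B : Finset X} (h : ¬ ∃ x, B = {x}) : colB col B = 0 :=
  dif_neg h

lemma colB_permB {col : X → Fin 2} {φ : Perm X} (hcol : ∀ x, col (φ x) = col x) (B : Finset X) :
    colB col (permB φ B) = colB col B := by
  by_cases h : ∃ x, B = {x}
  · obtain ⟨x, rfl⟩ := h
    simp [hcol]
  · rw [colB_of_not h, colB_of_not]
    rintro ⟨x, hx⟩
    exact h ⟨φ.symm x, (permB φ).injective (by rw [hx]; simp)⟩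

lemma orbitType_permB [Finite X] {col : X → Fin 2} {φ χ : Perm X} (hcol : ∀ x, col (φ x) = col x)
    (hc : Commute φ χ) {S : Finset X} (hS : PermInv χ S) (hχ : ∀ x, col (χ x) = col x) :
    orbitType χ col (permB φ S) = orbitType χ col S := by
  symm
  refine orbitType_of_bijOn (β := φ) hS ?_ ?_ ?_ (fun y _ => hχ y) (fun x _ => (hcol x).symm)
  · intro x
    rw [mem_permB_iff, mem_permB_iff, ← hS (φ.symm x)]
    have : φ.symm (χ x) = χ (φ.symm x) := by
      rw [Equiv.symm_apply_eq, ← Perm.mul_apply, hc.eq, Perm.mul_apply, Equiv.apply_symm_apply]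
    rw [this]
  · intro x _
    rw [← Perm.mul_apply, hc.eq, Perm.mul_apply]
  · refine ⟨fun x hx => ?_, φ.injective.injOn, fun y hy => ?_⟩
    · exact mem_permB.2 hx
    · exact ⟨φ.symm y, mem_permB_iff.1 hy, by simp⟩

/-- `P` is a partition of the set `b` into nonempty blocks. -/
structure IsPart (P : Finset (Finset X)) (b : Finset X) : Prop where
  nonempty : ∀ B ∈ P, B.Nonempty
  subset : ∀ B ∈ P, B ⊆ b
  cover : ∀ x ∈ b, ∃ B ∈ P, x ∈ B
  unique : ∀ B ∈ P, ∀ C ∈ P, ∀ x, x ∈ B → x ∈ C → B = C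

lemma col_pow {col : X → Fin 2} {φ : Perm X} (hcol : ∀ x, col (φ x) = col x) (n : ℕ) (x : X) :
    col ((φ ^ n) x) = col x := by
  induction n with
  | zero => rfl
  | succ n ih => rw [pow_succ', Perm.mul_apply, hcol, ih]

variable [Fintype X]

open Classical in
/-- The partitions of `b` invariant under `φ`. -/
def parts (φ : Perm X) (b : Finset X) : Finset (Finset (Finset X)) :=
  Finset.univ.filter fun P => IsPart P b ∧ PermInv (permB φ) P

lemma mem_parts {φ : Perm X} {b : Finset X} {P : Finset (Finset X)} :
    P ∈ parts φ b ↔ IsPart P b ∧ PermInv (permB φ) P := by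
  simp [parts]

/-- The series substituted for `p_1^{(i+1)}` in the partial plethysm with `g`. -/
def plethysmGen (g : SymC) (i : Fin 2) : SymC := if i = 0 then g else psum i 1

lemma adams_psum (n : ℕ+) (i : Fin 2) (k : ℕ+) : adams n (psum i k) = psum i (n * k) := by
  rw [adams, psum, subst_X (hasSubst_adams n)]

lemma plethysmSubst_eq (g : SymC) (i : Fin 2) (k : ℕ+) :
    plethysmSubst g (i, k) = adams k (plethysmGen g i) := by
  unfold plethysmSubst plethysmGen
  split_ifs
  · rfl
  · rw [adams_psum, mul_one]

lemma constantCoeff_adams (n : ℕ+) (g : SymC) : constantCoeff (adams n g) = constantCoeff g := by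
  have := coeff_mapDomain_adams n g 0
  rwa [Finsupp.mapDomain_zero, coeff_zero_eq_constantCoeff] at this

lemma hasSubst_plethysmSubst {g : SymC} (hg : constantCoeff g = 0) :
    HasSubst (plethysmSubst g) where
  const_coeff := by
    rintro ⟨i, k⟩
    rw [plethysmSubst_eq, constantCoeff_adams, plethysmGen]
    split_ifs <;> simp [hg, psum]
  coeff_zero d := by
    classical
    by_cases hd : d = 0
    · refine Set.Finite.subset Set.finite_empty ?_
      rintro ⟨i, k⟩ h
      apply h
      rw [hd, coeff_zero_eq_constantCoeff, plethysmSubst_eq, constantCoeff_adams, plethysmGen]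
      split_ifs <;> simp [hg, psum]
    · obtain ⟨a, ha⟩ := Finsupp.ne_iff.1 hd
      refine Set.Finite.subset ((Set.finite_univ (α := Fin 2)).prod
        (((Finset.range ((a.2 : ℕ) + 1)).finite_toSet).preimage
          (f := fun k : ℕ+ => (k : ℕ)) PNat.coe_injective.injOn)) ?_
      rintro ⟨i, k⟩ h
      simp only [Set.mem_prod, Set.mem_univ, true_and, Set.mem_preimage, Finset.coe_range,
        Set.mem_Iio]
      by_contra hk
      apply h
      rw [plethysmSubst_eq, coeff_adams_of_not_dvd k _ d (a := a) (by simpa using ha)]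
      intro hdvd
      have := Nat.le_of_dvd a.2.pos (PNat.dvd_iff.1 hdvd)
      omega

lemma monomial_orbitType {Y : Type*} [Fintype Y] (σ : Perm Y) (c : Y → Fin 2) :
    (monomial (orbitType σ c Finset.univ) (1 : ℂ) : SymC) =
      ∏ y ∈ reps σ Finset.univ, psum (c y) (plen σ y) := by
  rw [orbitType]
  induction reps σ Finset.univ using Finset.cons_induction with
  | empty => simp
  | cons a s ha ih =>
    rw [Finset.sum_cons, Finset.prod_cons, ← ih, psum, MvPowerSeries.X,
      monomial_mul_monomial, mul_one]

lemma val_plethysmGen_permB {φ : Perm X} {col : X → Fin 2} (hcol : ∀ x, col (φ x) = col x)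
    (g : SymC) (B : Finset X) :
    val (φ ^ len (permB φ) (permB φ B)) col (permB φ B)
      (plethysmGen g (colB col (permB φ B))) =
    val (φ ^ len (permB φ) B) col B (plethysmGen g (colB col B)) := by
  rw [len_apply, colB_permB hcol, val, orbitType_permB hcol ((Commute.refl φ).pow_right _)
    (permInv_pow_len φ B) (col_pow hcol _), val]

variable [DecidableEq X]

section comp

variable {φ : Perm X} {col : X → Fin 2} (hcol : ∀ x, col (φ x) = col x) {g : SymC}
  (hg : constantCoeff g = 0) (hg1 : coeff (Finsupp.single (1, 1) 1) g = 0)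

include hg hg1 in
/-- The series substituted for `p_1^{(i)}` vanishes on the empty set and, since `g` has no term
`p_1^{(2)}`, on sets whose colour as a block is not `i`. -/
lemma val_plethysmGen_eq_zero {n : ℕ} {S : Finset X} (hS : PermInv (φ ^ n) S) {i : Fin 2}
    (h : ¬ (S.Nonempty ∧ colB col S = i)) : val (φ ^ n) col S (plethysmGen g i) = 0 := by
  by_cases hne : S.Nonempty
  · have hi : colB col S ≠ i := fun h' => h ⟨hne, h'⟩
    by_cases h0 : i = 0
    · subst h0
      obtain ⟨x, rfl⟩ : ∃ x, S = {x} := by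
        by_contra hx
        exact hi (colB_of_not hx)
      rw [colB_singleton] at hi
      have h1 : col x = 1 := by
        generalize col x = j at hi
        revert j; decide
      have hx : (φ ^ n) x = x := by simpa using (hS x).2 (by simp)
      rw [val, orbitType_singleton hx, h1, plethysmGen, if_pos rfl, sval, hg1, mul_zero]
    · rw [plethysmGen, if_neg h0, val_psum_one hS, if_neg]
      rintro ⟨x, rfl, rfl⟩
      simp at hi
  · rw [Finset.not_nonempty_iff_eq_empty.1 hne, val_empty, plethysmGen]
    split_ifs <;> simp [hg, psum]

open Classical in
include hcol hg hg1 in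
/-- The formula for the class function of a plethysm, for a product of power sums. -/
lemma val_plethysm_prod {Y : Type} [Fintype Y] [DecidableEq Y] (σ : Perm Y) {c : Y → Fin 2}
    (hc : ∀ y, c (σ y) = c y) {b : Finset X} (hb : PermInv φ b) :
    val φ col b (∏ y ∈ reps σ Finset.univ, adams (plen σ y) (plethysmGen g (c y))) =
      ∑ P ∈ parts φ b,
        val (permB φ) (colB col) P (∏ y ∈ reps σ Finset.univ, adams (plen σ y) (psum (c y) 1)) *
        ∏ B ∈ reps (permB φ) P,
          val (φ ^ len (permB φ) B) col B (plethysmGen g (colB col B)) := by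
  have hcY : ∀ n y, c y = c ((σ ^ n) y) := fun n y => (col_pow hc n y).symm
  rw [val_prod_adams σ φ hcol hb]
  -- The factor of the partition is a sum over families of sets of blocks; only the families
  -- of one-element sets contribute, since `psum (c y) 1` is supported on one point.
  have hR : ∀ P ∈ parts φ b,
      val (permB φ) (colB col) P (∏ y ∈ reps σ Finset.univ, adams (plen σ y) (psum (c y) 1)) *
        (∏ B ∈ reps (permB φ) P,
          val (φ ^ len (permB φ) B) col B (plethysmGen g (colB col B))) =
      ∑ A' ∈ (fam σ (permB φ) P).filter fun A' => ∀ y,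
          ∃ B, A' y = {B} ∧ colB col B = c y,
        ∏ B ∈ reps (permB φ) P,
          val (φ ^ len (permB φ) B) col B (plethysmGen g (colB col B)) := by
    intro P hP
    rw [val_prod_adams σ (permB φ) (colB_permB hcol) (mem_parts.1 hP).2, Finset.sum_mul,
      Finset.sum_filter]
    refine Finset.sum_congr rfl fun A' hA' => ?_
    rw [Finset.prod_congr rfl fun y _ => val_psum_one
      ((mem_fam.1 hA').permInv (pow_len_apply σ y)) (c y)]
    split_ifs with h
    · refine (congrArg (· * _) (Finset.prod_eq_one fun y _ => if_pos (h y))).trans (one_mul _)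
    · push Not at h
      obtain ⟨y, hy⟩ := h
      rw [Finset.prod_eq_zero (i := rep σ y) (rep_mem_reps (permInv_univ σ) (Finset.mem_univ y)),
        zero_mul]
      rw [if_neg]
      rintro ⟨B, hB, hBc⟩
      obtain ⟨n, hn⟩ := (rep_sameCycle σ y).exists_nat_pow_eq
      refine hy (((permB φ) ^ n) B) ?_ ?_
      · ext C
        have h1 := (mem_fam.1 hA').pow n (rep σ y) (((permB φ) ^ n).symm C)
        rw [Equiv.apply_symm_apply, hn, hB, Finset.mem_singleton] at h1
        rw [h1, Finset.mem_singleton, Equiv.symm_apply_eq]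
      · rw [col_pow (colB_permB hcol), hBc, hcY n, hn]
  rw [Finset.sum_congr rfl hR]
  -- Only families of nonempty blocks of the right colours contribute.
  have hL : (∑ A ∈ fam σ φ b, ∏ y ∈ reps σ Finset.univ,
        val (φ ^ len σ y) col (A y) (plethysmGen g (c y))) =
      ∑ A ∈ (fam σ φ b).filter fun A => ∀ y, (A y).Nonempty ∧ colB col (A y) = c y,
        ∏ y ∈ reps σ Finset.univ, val (φ ^ len σ y) col (A y) (plethysmGen g (c y)) := by
    symm
    apply Finset.sum_subset (Finset.filter_subset _ _)
    intro A hA hA'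
    have hF := mem_fam.1 hA
    rw [Finset.mem_filter, not_and] at hA'
    have h := hA' hA
    push Not at h
    obtain ⟨y, hy⟩ := h
    apply Finset.prod_eq_zero (rep_mem_reps (permInv_univ σ) (Finset.mem_univ y))
    apply val_plethysmGen_eq_zero hg hg1 (hF.permInv (pow_len_apply σ _))
    rintro ⟨h1, h2⟩
    obtain ⟨n, hn⟩ := (rep_sameCycle σ y).exists_nat_pow_eq
    have hAy : A y = (permB φ ^ n) (A (rep σ y)) := by
      rw [permB_pow]
      ext x
      have h := hF.pow n (rep σ y) ((φ ^ n).symm x)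
      rw [Equiv.apply_symm_apply, hn] at h
      rw [mem_permB_iff]
      exact h
    refine hy ?_ ?_
    · rw [hAy, permB_pow]
      simpa using h1
    · rw [hAy, col_pow (colB_permB hcol), h2, hcY n, hn]
  -- A family of blocks indexed by `Y`, equivariant and with disjoint members, is an invariant
  -- partition together with an equivariant numbering of its blocks by `Y`.
  rw [hL, Finset.sum_sigma']
  refine Finset.sum_bij' (fun A _ => ⟨Finset.univ.image A, fun y => {A y}⟩)
    (fun p _ y => (p.2 y).biUnion id) ?_ ?_ ?_ ?_ ?_
  · intro A hA
    obtain ⟨hA, hgood⟩ := Finset.mem_filter.1 hA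
    have hF := mem_fam.1 hA
    have hequiv : ∀ y, A (σ y) = permB φ (A y) := by
      intro y
      ext x
      have h := hF.equivariant y (φ.symm x)
      rw [Equiv.apply_symm_apply] at h
      rw [mem_permB_iff]
      exact h
    have hinj : ∀ y z, A y = A z → y = z := by
      intro y z h
      obtain ⟨x, hx⟩ := (hgood y).1
      exact hF.unique hx (h ▸ hx)
    simp only [Finset.mem_sigma, mem_parts, Finset.mem_filter, mem_fam]
    refine ⟨⟨⟨?_, ?_, ?_, ?_⟩, ?_⟩, ⟨?_, ?_, ?_, ?_⟩, ?_⟩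
    · intro B hB
      obtain ⟨y, _, rfl⟩ := Finset.mem_image.1 hB
      exact (hgood y).1
    · intro B hB
      obtain ⟨y, _, rfl⟩ := Finset.mem_image.1 hB
      exact hF.subset y
    · intro x hx
      obtain ⟨y, hy⟩ := hF.cover x hx
      exact ⟨A y, Finset.mem_image_of_mem _ (Finset.mem_univ _), hy⟩
    · intro B hB C hC x hx hx'
      obtain ⟨y, _, rfl⟩ := Finset.mem_image.1 hB
      obtain ⟨z, _, rfl⟩ := Finset.mem_image.1 hC
      rw [hF.unique hx hx']
    · apply permInv_of_forall
      intro B hB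
      obtain ⟨y, _, rfl⟩ := Finset.mem_image.1 hB
      rw [← hequiv]
      exact Finset.mem_image_of_mem _ (Finset.mem_univ _)
    · intro y B
      rw [Finset.mem_singleton, Finset.mem_singleton, hequiv, (permB φ).injective.eq_iff]
    · intro y
      simp
    · intro B hB
      obtain ⟨y, _, rfl⟩ := Finset.mem_image.1 hB
      exact ⟨y, Finset.mem_singleton_self _⟩
    · intro B y z hy hz
      rw [Finset.mem_singleton] at hy hz
      exact hinj y z (hy.symm.trans hz)
    · exact fun y => ⟨A y, rfl, (hgood y).2⟩
  · rintro ⟨P, A'⟩ hp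
    simp only [Finset.mem_sigma, mem_parts, Finset.mem_filter, mem_fam] at hp
    obtain ⟨⟨hP, hPinv⟩, hF, hgood⟩ := hp
    choose B hB hBc using hgood
    have hBP : ∀ y, B y ∈ P := fun y => hF.subset y (by rw [hB]; simp)
    have hA : ∀ y, (A' y).biUnion id = B y := by
      intro y
      rw [hB y, Finset.singleton_biUnion, id]
    simp only [Finset.mem_filter, mem_fam, hA]
    refine ⟨⟨?_, ?_, ?_, ?_⟩, ?_⟩
    · intro y x
      have h1 := (hF.equivariant y (B y)).2 (by rw [hB]; simp)
      rw [hB, Finset.mem_singleton] at h1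
      rw [← h1, mem_permB]
    · exact fun y => hP.subset _ (hBP y)
    · intro x hx
      obtain ⟨C, hC, hxC⟩ := hP.cover x hx
      obtain ⟨y, hy⟩ := hF.cover C hC
      rw [hB, Finset.mem_singleton] at hy
      exact ⟨y, hy ▸ hxC⟩
    · intro x y z hy hz
      have := hP.unique _ (hBP y) _ (hBP z) x hy hz
      exact hF.unique (x := B y) (by rw [hB]; simp) (by rw [hB, this]; simp)
    · exact fun y => ⟨hP.nonempty _ (hBP y), hBc y⟩
  · intro A _
    funext y
    simp
  · rintro ⟨P, A'⟩ hp
    simp only [Finset.mem_sigma, mem_parts, Finset.mem_filter, mem_fam] at hp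
    obtain ⟨⟨hP, hPinv⟩, hF, hgood⟩ := hp
    choose B hB hBc using hgood
    have hBP : ∀ y, B y ∈ P := fun y => hF.subset y (by rw [hB]; simp)
    have hA : (fun y => (A' y).biUnion id) = B := by
      funext y
      rw [hB y, Finset.singleton_biUnion, id]
    apply Sigma.ext
    · dsimp only
      rw [hA]
      ext C
      constructor
      · intro hC
        obtain ⟨y, _, rfl⟩ := Finset.mem_image.1 hC
        exact hBP y
      · intro hC
        obtain ⟨y, hy⟩ := hF.cover C hC
        rw [hB, Finset.mem_singleton] at hy
        exact Finset.mem_image.2 ⟨y, Finset.mem_univ _, hy.symm⟩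
    · apply heq_of_eq
      funext y
      dsimp only
      rw [hB y, Finset.singleton_biUnion, id]
  · intro A hA
    obtain ⟨hA, hgood⟩ := Finset.mem_filter.1 hA
    have hF := mem_fam.1 hA
    have hequiv : ∀ y, A (σ y) = permB φ (A y) := by
      intro y
      ext x
      have h := hF.equivariant y (φ.symm x)
      rw [Equiv.apply_symm_apply] at h
      rw [mem_permB_iff]
      exact h
    have hinj : ∀ y z, A y = A z → y = z := by
      intro y z h
      obtain ⟨x, hx⟩ := (hgood y).1
      exact hF.unique hx (h ▸ hx)
    dsimp only
    refine prod_reps_of_bijOn (β := A) (permInv_univ σ) ?_ (fun y _ => hequiv y) ?_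
      (fun B _ => val_plethysmGen_permB hcol g B) ?_
    · apply permInv_of_forall
      intro B hB
      obtain ⟨y, _, rfl⟩ := Finset.mem_image.1 hB
      rw [← hequiv]
      exact Finset.mem_image_of_mem _ (Finset.mem_univ _)
    · refine ⟨fun y _ => by simp, fun y _ z _ h => hinj y z h, fun B hB => ?_⟩
      obtain ⟨y, _, rfl⟩ := Finset.mem_image.1 hB
      exact ⟨y, by simp, rfl⟩
    · intro y _
      have hl : len (permB φ) (A y) = len σ y :=
        len_map (permInv_univ σ) (fun y _ => hequiv y) (fun y _ z _ h => hinj y z h)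
          (Finset.mem_univ y)
      rw [hl, (hgood y).2]

open Classical in
include hcol hg hg1 in
/-- The class function of a partial plethysm: a sum over the invariant partitions into blocks. -/
theorem val_plethysm {b : Finset X} (hb : PermInv φ b) (f : SymC) :
    val φ col b (plethysm f g) =
      ∑ P ∈ parts φ b, val (permB φ) (colB col) P f *
        ∏ B ∈ reps (permB φ) P,
          val (φ ^ len (permB φ) B) col B (plethysmGen g (colB col B)) := by
  set K : Finset (Finset X) → ℂ := fun P => ∏ B ∈ reps (permB φ) P,
    val (φ ^ len (permB φ) B) col B (plethysmGen g (colB col B)) with hK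
  have hmon : ∀ d : Fin 2 × ℕ+ →₀ ℕ,
      sval (orbitType φ col b) (d.prod fun s e => plethysmSubst g s ^ e)
      = ∑ P ∈ parts φ b, sval (orbitType (permB φ) (colB col) P) (monomial d 1) * K P := by
    intro d
    obtain ⟨Y, _, _, σ, c, hc, rfl⟩ := exists_orbitType_eq d
    have h1 := val_plethysm_prod hcol hg hg1 σ (c := c) hc hb
    have h2 : (∏ y ∈ reps σ Finset.univ, adams (plen σ y) (psum (c y) 1)) =
        (monomial (orbitType σ c Finset.univ) (1 : ℂ) : SymC) := by
      rw [monomial_orbitType]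
      exact Finset.prod_congr rfl fun y _ => by rw [adams_psum, mul_one]
    have h3 : (∏ y ∈ reps σ Finset.univ, adams (plen σ y) (plethysmGen g (c y))) =
        (orbitType σ c Finset.univ).prod fun s e => plethysmSubst g s ^ e := by
      have h4 := subst_monomial (hasSubst_plethysmSubst hg) (orbitType σ c Finset.univ) (1 : ℂ)
      rw [show algebraMap ℂ SymC (1 : ℂ) = 1 from map_one _, one_mul] at h4
      rw [← h4, monomial_orbitType, ← substAlgHom_apply (hasSubst_plethysmSubst hg), map_prod]
      refine Finset.prod_congr rfl fun y _ => ?_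
      rw [substAlgHom_apply, psum, subst_X (hasSubst_plethysmSubst hg), plethysmSubst_eq]
    rw [h2, h3] at h1
    exact h1
  have hfin : ∀ d, d ∉ (parts φ b).image (fun P => orbitType (permB φ) (colB col) P) →
      ∑ P ∈ parts φ b, sval (orbitType (permB φ) (colB col) P) (monomial d 1) * K P = 0 := by
    intro d hd
    refine Finset.sum_eq_zero fun P hP => ?_
    rw [sval_monomial, if_neg, zero_mul]
    rintro rfl
    exact hd (Finset.mem_image_of_mem _ hP)
  rw [val, plethysm, sval, coeff_subst (hasSubst_plethysmSubst hg), finsum_eq_sum_of_support_subset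
    (s := (parts φ b).image fun P => orbitType (permB φ) (colB col) P)]
  · rw [Finset.mul_sum]
    have h1 : ∀ d, zfac (orbitType φ col b) * (coeff d f • coeff (orbitType φ col b)
        (d.prod fun s e => plethysmSubst g s ^ e)) = ∑ P ∈ parts φ b,
          coeff d f * (sval (orbitType (permB φ) (colB col) P) (monomial d 1) * K P) := by
      intro d
      rw [← Finset.mul_sum, ← hmon d, sval, smul_eq_mul]
      ring
    rw [Finset.sum_congr rfl fun d _ => h1 d, Finset.sum_comm]
    refine Finset.sum_congr rfl fun P hP => ?_
    rw [Finset.sum_eq_single (orbitType (permB φ) (colB col) P)]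
    · rw [sval_monomial, if_pos rfl, val, sval]
      ring
    · intro d _ hd
      rw [sval_monomial, if_neg (Ne.symm hd)]
      ring
    · intro h
      exact absurd (Finset.mem_image_of_mem _ hP) h
  · intro d hd
    by_contra hd'
    apply hd
    have h1 := hmon d
    rw [hfin d hd', sval] at h1
    have h2 := (mul_eq_zero.1 h1).resolve_left (zfac_ne_zero _)
    dsimp only
    rw [h2, smul_zero]

end comp

end

/-! ### Inversion of the partial plethysm -/

/-- The total degree of a monomial, where `p_k^{(i)}` has degree `k`. -/
def wt (d : Fin 2 × ℕ+ →₀ ℕ) : ℕ := d.sum fun a e => (a.2 : ℕ) * e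

lemma wt_add (d e : Fin 2 × ℕ+ →₀ ℕ) : wt (d + e) = wt d + wt e :=
  Finsupp.sum_add_index' (fun _ => mul_zero _) fun _ _ _ => mul_add _ _ _

lemma wt_orbitType {X : Type*} [Finite X] {φ : Perm X} {col : X → Fin 2} {S : Finset X}
    (hS : PermInv φ S) : wt (orbitType φ col S) = S.card := by
  classical
  cases nonempty_fintype X
  have h1 : wt (orbitType φ col S) = ∑ x ∈ reps φ S, len φ x := by
    rw [orbitType]
    induction reps φ S using Finset.cons_induction with
    | empty => rfl
    | cons a s ha ih =>
      rw [Finset.sum_cons, Finset.sum_cons, wt_add, ih]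
      simp [wt, coe_plen]
  rw [h1, Finset.card_eq_sum_card_fiberwise (f := rep φ) (t := reps φ S)
    fun x hx => rep_mem_reps hS hx]
  refine Finset.sum_congr rfl fun x hx => ?_
  rw [← card_orbit φ x]
  congr 1
  ext z
  rw [(mem_reps.1 hx).2]
  simp only [Finset.mem_filter, Finset.mem_univ, true_and]
  refine ⟨fun h => ⟨?_, h⟩, fun h => h.2⟩
  exact hS.mem_of_sameCycle (rep_sameCycle φ z) (h ▸ (mem_reps.1 hx).1)

section

variable {X : Type*}

/-- The partition into points. -/
def pointPart [DecidableEq X] (b : Finset X) : Finset (Finset X) := b.image singleton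

lemma mem_pointPart [DecidableEq X] {b B : Finset X} : B ∈ pointPart b ↔ ∃ x ∈ b, {x} = B := by
  simp [pointPart]

lemma bijOn_pointPart [DecidableEq X] (b : Finset X) :
    Set.BijOn (singleton : X → Finset X) b (pointPart b) := by
  refine ⟨fun x hx => ?_, Finset.singleton_injective.injOn, fun B hB => ?_⟩
  · exact mem_pointPart.2 ⟨x, hx, rfl⟩
  · obtain ⟨x, hx, rfl⟩ := mem_pointPart.1 hB
    exact ⟨x, hx, rfl⟩

lemma isPart_pointPart [DecidableEq X] (b : Finset X) : IsPart (pointPart b) b where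
  nonempty B hB := by
    obtain ⟨x, _, rfl⟩ := mem_pointPart.1 hB
    simp
  subset B hB := by
    obtain ⟨x, hx, rfl⟩ := mem_pointPart.1 hB
    simpa using hx
  cover x hx := ⟨{x}, mem_pointPart.2 ⟨x, hx, rfl⟩, by simp⟩
  unique B hB C hC x hx hx' := by
    obtain ⟨y, _, rfl⟩ := mem_pointPart.1 hB
    obtain ⟨z, _, rfl⟩ := mem_pointPart.1 hC
    rw [Finset.mem_singleton] at hx hx'
    rw [← hx, ← hx']

lemma permInv_pointPart [DecidableEq X] {φ : Perm X} {b : Finset X} (hb : PermInv φ b) :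
    PermInv (permB φ) (pointPart b) := by
  apply permInv_of_forall
  intro B hB
  obtain ⟨x, hx, rfl⟩ := mem_pointPart.1 hB
  exact mem_pointPart.2 ⟨φ x, (hb x).2 hx, by simp⟩

lemma IsPart.card_lt [DecidableEq X] {P : Finset (Finset X)} {b : Finset X} (hP : IsPart P b)
    (h : P ≠ pointPart b) : P.card < b.card := by
  have hb : P.biUnion id = b := by
    ext x
    simp only [Finset.mem_biUnion, id]
    exact ⟨fun ⟨B, hB, hx⟩ => hP.subset B hB hx, hP.cover x⟩
  have hcard : b.card = ∑ B ∈ P, B.card := by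
    rw [← hb]
    refine Finset.card_biUnion fun B hB C hC hBC => ?_
    rw [Function.onFun, Finset.disjoint_left]
    exact fun x hx hx' => hBC (hP.unique B hB C hC x hx hx')
  by_contra hlt
  have h1 : ∀ B ∈ P, 1 ≤ B.card := fun B hB => (hP.nonempty B hB).card_pos
  have h2 : ∑ B ∈ P, 1 = ∑ B ∈ P, B.card := by
    apply le_antisymm (Finset.sum_le_sum h1)
    rw [Finset.sum_const, smul_eq_mul, mul_one]
    omega
  have h3 := (Finset.sum_eq_sum_iff_of_le h1).1 h2
  apply h
  ext B
  rw [mem_pointPart]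
  constructor
  · intro hB
    obtain ⟨x, rfl⟩ := Finset.card_eq_one.1 (h3 B hB).symm
    exact ⟨x, hP.subset _ hB (by simp), rfl⟩
  · rintro ⟨x, hx, rfl⟩
    obtain ⟨C, hC, hxC⟩ := hP.cover x hx
    obtain ⟨y, rfl⟩ := Finset.card_eq_one.1 (h3 C hC).symm
    rw [Finset.mem_singleton] at hxC
    rwa [hxC]

variable [Fintype X] [DecidableEq X]

open Classical in
/-- Substitution into a series of the form `p_1^{(1)} + ⋯` is unitriangular: the partition into
points contributes the value itself. -/
lemma val_plethysm_of_coeff_eq_one {φ : Perm X} {col : X → Fin 2} (hcol : ∀ x, col (φ x) = col x)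
    {g : SymC} (hg : constantCoeff g = 0) (hg1 : coeff (Finsupp.single (1, 1) 1) g = 0)
    (hg0 : coeff (Finsupp.single (0, 1) 1) g = 1)
    {b : Finset X} (hb : PermInv φ b) (f : SymC) :
    val φ col b (plethysm f g) = val φ col b f +
      ∑ P ∈ (parts φ b).filter fun P => P.card < b.card, val (permB φ) (colB col) P f *
        ∏ B ∈ reps (permB φ) P,
          val (φ ^ len (permB φ) B) col B (plethysmGen g (colB col B)) := by
  rw [val_plethysm hcol hg hg1 hb]
  have hmem : pointPart b ∈ parts φ b := mem_parts.2 ⟨isPart_pointPart b, permInv_pointPart hb⟩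
  have hf : (parts φ b).filter (fun P => P.card < b.card) = (parts φ b).erase (pointPart b) := by
    ext P
    rw [Finset.mem_filter, Finset.mem_erase, and_comm]
    refine and_congr_left fun hP => ⟨?_, (mem_parts.1 hP).1.card_lt⟩
    rintro h rfl
    rw [pointPart, Finset.card_image_of_injective _ Finset.singleton_injective] at h
    exact lt_irrefl _ h
  rw [hf, ← Finset.add_sum_erase _ _ hmem]
  congr 1
  have h1 : orbitType φ col b = orbitType (permB φ) (colB col) (pointPart b) :=
    orbitType_of_bijOn hb (permInv_pointPart hb) (fun x _ => by simp) (bijOn_pointPart b)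
      (fun B _ => colB_permB hcol B) fun x _ => by simp
  rw [val, ← h1, Finset.prod_eq_one, mul_one, val]
  intro B hB
  obtain ⟨x, hx, rfl⟩ := mem_pointPart.1 (reps_subset _ _ hB)
  have hfix := permInv_pow_len φ {x}
  rw [colB_singleton, plethysmGen]
  split_ifs with h
  · rw [val, orbitType_singleton (by simpa using (hfix x).2 (by simp)), h, sval, hg0]
    simp [zfac]
  · rw [val_psum_one hfix, if_pos ⟨x, rfl, rfl⟩]

end

/-- The series `p_1^{(1)} + ⋯` into which partial plethysm is an invertible operation. -/
structure IsUnital (g : SymC) : Prop where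
  const : constantCoeff g = 0
  coeff_zero : coeff (Finsupp.single (0, 1) 1) g = 1
  coeff_one : coeff (Finsupp.single (1, 1) 1) g = 0

lemma plethysm_sub (f f' : SymC) {g : SymC} (hg : constantCoeff g = 0) :
    plethysm (f - f') g = plethysm f g - plethysm f' g := by
  simp only [plethysm, ← substAlgHom_apply (hasSubst_plethysmSubst hg), map_sub]

lemma plethysm_mul (f f' : SymC) {g : SymC} (hg : constantCoeff g = 0) :
    plethysm (f * f') g = plethysm f g * plethysm f' g := by
  simp only [plethysm, ← substAlgHom_apply (hasSubst_plethysmSubst hg), map_mul]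

lemma plethysm_smul (c : ℂ) (f : SymC) {g : SymC} (hg : constantCoeff g = 0) :
    plethysm (c • f) g = c • plethysm f g := by
  simp only [plethysm, ← substAlgHom_apply (hasSubst_plethysmSubst hg), map_smul]

lemma plethysm_psum (i : Fin 2) (k : ℕ+) {g : SymC} (hg : constantCoeff g = 0) :
    plethysm (psum i k) g = adams k (plethysmGen g i) := by
  rw [plethysm, psum, subst_X (hasSubst_plethysmSubst hg), plethysmSubst_eq]

lemma adams_one (g : SymC) : adams 1 g = g := by
  have h : (fun ik : Fin 2 × ℕ+ => psum ik.1 (1 * ik.2)) = MvPowerSeries.X := by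
    funext ik
    rw [one_mul, psum]
  rw [adams, h, ← map_algebraMap_eq_subst_X]
  simp

lemma plethysm_psum_zero_one {g : SymC} (hg : constantCoeff g = 0) :
    plethysm (psum 0 1) g = g := by
  rw [plethysm_psum 0 1 hg, adams_one, plethysmGen, if_pos rfl]

lemma plethysm_psum_zero_right (f : SymC) : plethysm f (psum 0 1) = f := by
  have h : plethysmSubst (psum 0 1) = MvPowerSeries.X := by
    funext ⟨i, k⟩
    rw [plethysmSubst_eq, plethysmGen]
    split_ifs with h
    · rw [adams_psum, mul_one, psum, h]
    · rw [adams_psum, mul_one, psum]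
  rw [plethysm, h, ← map_algebraMap_eq_subst_X]
  simp

lemma adams_adams (m n : ℕ+) (g : SymC) : adams m (adams n g) = adams (m * n) g := by
  rw [adams, adams, subst_comp_subst_apply (hasSubst_adams n) (hasSubst_adams m), adams]
  congr 1
  funext ik
  rw [psum, subst_X (hasSubst_adams m), mul_comm n, mul_comm m n, mul_comm n m]
  congr 1
  rw [mul_comm ik.2 n, mul_assoc]

lemma plethysm_adams (n : ℕ+) (f : SymC) {g : SymC} (hg : constantCoeff g = 0) :
    plethysm (adams n f) g = adams n (plethysm f g) := by
  rw [plethysm, adams, subst_comp_subst_apply (hasSubst_adams n) (hasSubst_plethysmSubst hg),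
    adams, plethysm, subst_comp_subst_apply (hasSubst_plethysmSubst hg) (hasSubst_adams n)]
  congr 1
  funext ⟨i, k⟩
  rw [psum, subst_X (hasSubst_plethysmSubst hg), plethysmSubst_eq, plethysmSubst_eq, ← adams_adams]
  rfl

lemma plethysm_assoc (f : SymC) {g h : SymC} (hg : constantCoeff g = 0) (hh : constantCoeff h = 0) :
    plethysm (plethysm f g) h = plethysm f (plethysm g h) := by
  rw [plethysm, plethysm, subst_comp_subst_apply (hasSubst_plethysmSubst hg)
    (hasSubst_plethysmSubst hh), plethysm]
  congr 1
  funext ⟨i, k⟩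
  rw [plethysmSubst_eq, plethysmSubst_eq]
  change plethysm _ h = _
  rw [plethysm_adams _ _ hh, plethysmGen, plethysmGen]
  split_ifs
  · rfl
  · rw [plethysm_psum _ _ hh, adams_one, plethysmGen, if_neg ‹_›]

/-- The partition into points is the only one with as many blocks as points, and it contributes
the value of `f`; the other partitions contribute values of `f` in lower degree. -/
lemma IsUnital.eq_zero {g : SymC} (hg : IsUnital g) {f : SymC} (h : plethysm f g = 0) : f = 0 := by
  classical
  have key : ∀ (N : ℕ) (d : Fin 2 × ℕ+ →₀ ℕ), wt d < N → sval d f = 0 := by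
    intro N
    induction N with
    | zero => exact fun d hd => absurd hd (Nat.not_lt_zero _)
    | succ N ih =>
      intro d hd
      obtain ⟨Y, _, _, σ, c, hc, rfl⟩ := exists_orbitType_eq d
      rw [wt_orbitType (permInv_univ σ)] at hd
      have h1 := val_plethysm_of_coeff_eq_one hc hg.const hg.coeff_one hg.coeff_zero
        (permInv_univ σ) f
      rw [h, Finset.sum_eq_zero, add_zero, val, sval, map_zero, mul_zero] at h1
      · exact h1.symm
      · intro P hP
        rw [Finset.mem_filter] at hP
        rw [val, ih, zero_mul]
        rw [wt_orbitType (mem_parts.1 hP.1).2]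
        omega
  ext d
  have := key _ d (Nat.lt_succ_self _)
  rw [sval] at this
  simpa using (mul_eq_zero.1 this).resolve_left (zfac_ne_zero d)

lemma IsUnital.injective {g : SymC} (hg : IsUnital g) {f f' : SymC}
    (h : plethysm f g = plethysm f' g) : f = f' := by
  apply sub_eq_zero.1
  apply hg.eq_zero
  rw [plethysm_sub _ _ hg.const, h, sub_self]

lemma coeff_plethysm (d : Fin 2 × ℕ+ →₀ ℕ) (f : SymC) {g : SymC} (hg : constantCoeff g = 0) :
    coeff d (plethysm f g) = ∑ᶠ e, coeff e f * coeff d (plethysm (monomial e 1) g) := by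
  rw [plethysm, coeff_subst (hasSubst_plethysmSubst hg)]
  refine finsum_congr fun e => ?_
  rw [plethysm, subst_monomial (hasSubst_plethysmSubst hg),
    show algebraMap ℂ SymC (1 : ℂ) = 1 from map_one _, one_mul, smul_eq_mul]

lemma IsUnital.coeff_plethysm_monomial {g : SymC} (hg : IsUnital g) {d e : Fin 2 × ℕ+ →₀ ℕ}
    (h : wt d ≤ wt e) :
    coeff d (plethysm (monomial e (1 : ℂ)) g) = if d = e then 1 else 0 := by
  have : sval d (plethysm (monomial e (1 : ℂ)) g) = sval d (monomial e 1) := by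
    obtain ⟨Y, _, _, σ, c, hc, rfl⟩ := exists_orbitType_eq d
    rw [wt_orbitType (permInv_univ σ)] at h
    have h1 := val_plethysm_of_coeff_eq_one hc hg.const hg.coeff_one hg.coeff_zero
      (permInv_univ σ) (monomial e (1 : ℂ))
    rw [Finset.sum_eq_zero, add_zero] at h1
    · exact h1
    · intro P hP
      rw [Finset.mem_filter] at hP
      rw [val, sval_monomial, if_neg, zero_mul]
      rintro rfl
      rw [wt_orbitType (mem_parts.1 hP.1).2] at h
      omega
  rw [sval, sval, coeff_monomial] at this
  exact mul_left_cancel₀ (zfac_ne_zero d) this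

/-- The coefficients of the solution `g` of `g ∘ f = t`, by recursion on the degree. -/
def solveCoeff (f t : SymC) (d : Fin 2 × ℕ+ →₀ ℕ) : ℂ :=
  coeff d t - ∑ᶠ e, if _h : wt e < wt d then
    solveCoeff f t e * coeff d (plethysm (monomial e 1) f) else 0
termination_by wt d

/-- The plethysm with `g` is unitriangular with respect to the degree, hence surjective. -/
lemma IsUnital.exists_plethysm_eq {g : SymC} (hg : IsUnital g) (t : SymC) :
    ∃ f, plethysm f g = t := by
  classical
  let f : SymC := fun d => solveCoeff g t d
  have hf : ∀ d, coeff d f = solveCoeff g t d := fun d => rfl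
  refine ⟨f, ?_⟩
  ext d
  rw [coeff_plethysm d f hg.const]
  have hfin :
      (Function.support fun e => coeff e f * coeff d (plethysm (monomial e 1) g)).Finite := by
    have := coeff_subst_finite (hasSubst_plethysmSubst hg.const) f d
    refine this.subset ?_
    intro e he
    rw [Function.mem_support] at he ⊢
    rwa [plethysm, subst_monomial (hasSubst_plethysmSubst hg.const),
      show algebraMap ℂ SymC (1 : ℂ) = 1 from map_one _, one_mul] at he
  -- The term at `e = d` has coefficient one, and the others are known by recursion or vanish.
  have hsplit : ∀ e, coeff e f * coeff d (plethysm (monomial e 1) g) =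
      (if e = d then coeff d f else 0) + if h : wt e < wt d then
        solveCoeff g t e * coeff d (plethysm (monomial e 1) g) else 0 := by
    intro e
    by_cases h : wt e < wt d
    · rw [if_neg (by rintro rfl; exact lt_irrefl _ h), dif_pos h, zero_add, hf]
    · rw [dif_neg h, add_zero, hg.coeff_plethysm_monomial (not_lt.1 h)]
      by_cases hde : d = e
      · rw [if_pos hde, if_pos hde.symm, mul_one, hde]
      · rw [if_neg hde, if_neg (Ne.symm hde), mul_zero]
  rw [finsum_congr hsplit, finsum_add_distrib, finsum_eq_single _ d fun e he => if_neg he,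
    if_pos rfl, hf, solveCoeff]
  · ring
  · refine (Set.finite_singleton d).subset fun e he => ?_
    by_contra hne
    exact he (if_neg hne)
  · refine hfin.subset fun e he => ?_
    rw [Function.mem_support] at he ⊢
    by_cases h : wt e < wt d
    · rwa [dif_pos h] at he
    · exact absurd (dif_neg h) he

lemma isUnital_psum_sub {a : SymC} (ha : constantCoeff a = 0)
    (ha0 : coeff (Finsupp.single (0, 1) 1) a = 0) (ha1 : coeff (Finsupp.single (1, 1) 1) a = 0) :
    IsUnital (psum 0 1 - a) := by
  classical
  refine ⟨?_, ?_, ?_⟩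
  · rw [map_sub, ha, psum, constantCoeff_X, sub_zero]
  · rw [map_sub, ha0, psum, coeff_X, if_pos rfl, sub_zero]
  · rw [map_sub, ha1, psum, coeff_X, if_neg, sub_zero]
    intro h
    have := Finsupp.single_left_injective one_ne_zero h
    simp at this

/-- A series `p_1^{(1)} - a` has a compositional inverse `g`, which is the fixed point of
`g ↦ p_1^{(1)} + a ∘ g`. -/
lemma exists_inverse {a : SymC} (ha : constantCoeff a = 0)
    (ha0 : coeff (Finsupp.single (0, 1) 1) a = 0) (ha1 : coeff (Finsupp.single (1, 1) 1) a = 0) :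
    ∃ g, IsUnital g ∧ plethysm g (psum 0 1 - a) = psum 0 1 ∧
      plethysm (psum 0 1 - a) g = psum 0 1 ∧ g = psum 0 1 + plethysm a g := by
  classical
  have hF := isUnital_psum_sub ha ha0 ha1
  obtain ⟨g, hg⟩ := hF.exists_plethysm_eq (psum 0 1)
  have hgu : IsUnital g := by
    -- The terms of degree at most one of `g` are read off from the permutations of a point and of
    -- the empty set, for which the partition into points is the only one.
    have hone : ∀ (i : Fin 2), coeff (Finsupp.single (i, 1) 1) g =
        if i = 0 then 1 else 0 := by
      intro i
      have h1 := val_plethysm_of_coeff_eq_one (X := Unit) (φ := 1) (col := fun _ => i)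
        (fun _ => rfl) hF.const hF.coeff_one hF.coeff_zero (permInv_univ _) g
      have h2 : orbitType (1 : Perm Unit) (fun _ => i) Finset.univ = Finsupp.single (i, 1) 1 :=
        orbitType_singleton (x := ()) rfl
      have hc : constantCoeff g = 0 := by
        have h1 := val_plethysm_of_coeff_eq_one (X := Empty) (φ := 1) (col := fun _ => i)
          (fun _ => rfl) hF.const hF.coeff_one hF.coeff_zero (permInv_univ _) g
        rw [hg, Finset.univ_eq_empty, val_empty, val_empty, Finset.sum_eq_zero, add_zero, psum,
          constantCoeff_X] at h1
        · exact h1.symm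
        · intro P hP
          simp at hP
      rw [Finset.sum_eq_zero, add_zero, hg] at h1
      · rw [val, val, h2, sval, sval] at h1
        rw [← mul_left_cancel₀ (zfac_ne_zero _) h1, psum, coeff_X]
        congr 1
        rw [(Finsupp.single_left_injective one_ne_zero).eq_iff]
        simp
      · intro P hP
        rw [Finset.mem_filter] at hP
        have : P = ∅ := by simpa using hP.2
        rw [this, val_empty, hc, zero_mul]
    refine ⟨?_, hone 0, by simpa using hone 1⟩
    have h1 := val_plethysm_of_coeff_eq_one (X := Empty) (φ := 1) (col := fun _ => 0)
      (fun _ => rfl) hF.const hF.coeff_one hF.coeff_zero (permInv_univ _) g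
    rw [hg, Finset.univ_eq_empty, val_empty, val_empty, Finset.sum_eq_zero, add_zero, psum,
      constantCoeff_X] at h1
    · exact h1.symm
    · intro P hP
      simp at hP
  -- A left inverse is a right inverse, since the plethysm with `psum 0 1 - a` is injective.
  have h2 : plethysm (psum 0 1 - a) g = psum 0 1 := by
    apply hF.injective
    rw [plethysm_assoc _ hgu.const hF.const, hg, plethysm_psum_zero_right,
      plethysm_psum_zero_one hF.const]
  refine ⟨g, hgu, hg, h2, ?_⟩
  rw [plethysm_sub _ _ hgu.const, plethysm_psum_zero_one hgu.const] at h2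
  rw [← h2]
  ring

/-- The defining equation of the Legendre transform of `e_2 - c`, from a formula for the
transform in terms of the compositional inverse `g` of its derivative. -/
lemma legendreEq_of_inverse {F G g : SymC} (hF : IsUnital (dP1 F)) (hg : IsUnital g)
    (hinv : plethysm g (dP1 F) = psum 0 1) (hG : G = psum 0 1 * g - plethysm F g) :
    LegendreEq F G := by
  rw [LegendreEq, hG, plethysm_sub _ _ hF.const, plethysm_mul _ _ hF.const, hinv,
    plethysm_psum_zero_one hF.const, plethysm_assoc _ hg.const hF.const, hinv,
    plethysm_psum_zero_right]
  ring

lemma legendreEq_unique {F G G' : SymC} (hF : IsUnital (dP1 F)) (h : LegendreEq F G)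
    (h' : LegendreEq F G') : G' = G := by
  apply hF.injective
  rw [LegendreEq] at h h'
  exact add_right_cancel (h'.trans h.symm)

lemma dP1_e2 : dP1 e2 = psum 0 1 := by
  have h2 : pderiv ℂ ((0 : Fin 2), (1 : ℕ+)) (psum 0 2) = 0 := pderiv_X_of_ne (by simp)
  have h1 : pderiv ℂ ((0 : Fin 2), (1 : ℕ+)) (psum 0 1) = 1 := pderiv_X_self
  rw [dP1, e2, Derivation.map_smul, map_sub, pow_two, Derivation.leibniz, h1, h2, sub_zero,
    smul_eq_mul, mul_one, ← two_smul ℂ (psum 0 1), smul_smul]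
  norm_num

lemma plethysm_e2 {g : SymC} (hg : constantCoeff g = 0) :
    plethysm e2 g = (2⁻¹ : ℂ) • (g ^ 2 - adams 2 g) := by
  rw [e2, plethysm_smul _ _ hg, plethysm_sub _ _ hg, pow_two, plethysm_mul _ _ hg,
    plethysm_psum_zero_one hg, plethysm_psum _ _ hg, plethysmGen, if_pos rfl, pow_two]

/-! ### Characteristics as class functions -/

section

variable {n : ℕ}

lemma len_eq_card_support_cycleOf {X : Type*} [Fintype X] [DecidableEq X]
    (σ : Perm X) {x : X} (hx : σ x ≠ x) :
    (σ.cycleOf x).support.card = len σ x := by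
  have h := σ.isCycleOn_support_cycleOf x
  have hm : x ∈ (σ.cycleOf x).support := by
    rw [Perm.mem_support_cycleOf_iff]
    exact ⟨Perm.SameCycle.refl _ _, Perm.mem_support.2 hx⟩
  apply Nat.dvd_antisymm
  · rw [← h.pow_apply_eq hm, pow_len_apply]
  · rw [← pow_apply_eq_iff, h.pow_apply_eq hm]

/-- The cycle type in the sense of Mathlib agrees with the orbits of the permutation, fixed points
included. -/
lemma psumOfPerm_eq_prod (i : Fin 2) (σ : Perm (Fin n)) :
    psumOfPerm i σ = ∏ x ∈ reps σ Finset.univ, psum i (plen σ x) := by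
  rw [psumOfPerm, Perm.parts_partition, Multiset.map_add, Multiset.prod_add,
    Multiset.map_replicate, Multiset.prod_replicate, Perm.cycleType_def, Multiset.map_map,
    ← Finset.prod_filter_mul_prod_filter_not (reps σ Finset.univ) (fun x => σ x ≠ x)]
  congr 1
  -- The orbits with more than one point correspond to the cycle factors.
  · change ∏ c ∈ σ.cycleFactorsFinset, psum i (c.support.card.toPNat') = _
    symm
    refine Finset.prod_bij (fun x _ => σ.cycleOf x) ?_ ?_ ?_ ?_
    · intro x hx
      rw [Perm.cycleOf_mem_cycleFactorsFinset_iff, Perm.mem_support]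
      exact (Finset.mem_filter.1 hx).2
    · intro x hx y hy hxy
      rw [Finset.mem_filter] at hx hy
      apply eq_of_mem_reps hx.1 hy.1
      have : y ∈ (σ.cycleOf x).support := by
        rw [hxy, Perm.mem_support_cycleOf_iff]
        exact ⟨Perm.SameCycle.refl _ _, Perm.mem_support.2 hy.2⟩
      exact (Perm.mem_support_cycleOf_iff.1 this).1
    · intro c hc
      obtain ⟨x, hx⟩ := (Perm.mem_cycleFactorsFinset_iff.1 hc).1.nonempty_support
      have hcx := Perm.cycle_is_cycleOf hx hc
      have hσ : σ x ≠ x := Perm.mem_support.1 (Perm.mem_cycleFactorsFinset_support_le hc hx)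
      have hs := rep_sameCycle σ x
      refine ⟨rep σ x, ?_, ?_⟩
      · rw [Finset.mem_filter]
        refine ⟨rep_mem_reps (permInv_univ σ) (Finset.mem_univ x), ?_⟩
        intro h
        apply hσ
        exact hs.apply_eq_self_iff.1 h
      · rw [hcx]
        exact hs.cycleOf_eq
    · intro x hx
      rw [len_eq_card_support_cycleOf σ (Finset.mem_filter.1 hx).2]
      rfl
  · have h1 : ∀ x ∈ (reps σ Finset.univ).filter (fun x => ¬ σ x ≠ x), psum i (plen σ x) =
        psum i (1 : ℕ).toPNat' := by
      intro x hx
      rw [Finset.mem_filter, not_not] at hx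
      have : len σ x = 1 := Nat.dvd_one.1 ((pow_apply_eq_iff σ x 1).1 (by rw [pow_one]; exact hx.2))
      rw [plen, this]
    rw [Finset.prod_congr rfl h1, Finset.prod_const]
    congr 1
    rw [← Finset.card_compl]
    congr 1
    ext x
    simp only [Finset.mem_compl, Perm.mem_support, not_not, Finset.mem_filter, mem_reps,
      Finset.mem_univ, true_and]
    refine ⟨fun h => ⟨?_, h⟩, fun h => h.2⟩
    exact ((rep_sameCycle σ x).symm.eq_of_left h).symm

end

@[simp] lemma sumCol_inl {m n : ℕ} (x : Fin m) : sumCol m n (Sum.inl x) = 0 := rfl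

@[simp] lemma sumCol_inr {m n : ℕ} (x : Fin n) : sumCol m n (Sum.inr x) = 1 := rfl

lemma prod_reps_sumCongr {M : Type*} [CommMonoid M] {m n : ℕ} (σ : Perm (Fin m)) (τ : Perm (Fin n))
    (f : Fin 2 → ℕ+ → M) :
    ∏ x ∈ reps (Perm.sumCongr σ τ) Finset.univ, f (sumCol m n x) (plen (Perm.sumCongr σ τ) x) =
      (∏ x ∈ reps σ Finset.univ, f 0 (plen σ x)) * ∏ x ∈ reps τ Finset.univ, f 1 (plen τ x) := by
  classical
  have hinl : ∀ x, plen (Perm.sumCongr σ τ) (Sum.inl x) = plen σ x := by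
    intro x
    rw [plen, len_map (φ := σ) (β := Sum.inl) (permInv_univ _) (fun x _ => by simp)
      Sum.inl_injective.injOn (Finset.mem_univ x), plen]
  have hinr : ∀ x, plen (Perm.sumCongr σ τ) (Sum.inr x) = plen τ x := by
    intro x
    rw [plen, len_map (φ := τ) (β := Sum.inr) (permInv_univ _) (fun x _ => by simp)
      Sum.inr_injective.injOn (Finset.mem_univ x), plen]
  have hinv : ∀ x, f (sumCol m n (Perm.sumCongr σ τ x)) (plen (Perm.sumCongr σ τ)
      (Perm.sumCongr σ τ x)) = f (sumCol m n x) (plen (Perm.sumCongr σ τ) x) := by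
    intro x
    rw [sumCol_sumCongr, plen, len_apply, plen]
  have h0 := prod_reps_of_bijOn (φ := σ) (ψ := Perm.sumCongr σ τ) (S := Finset.univ)
    (S' := Finset.univ.filter fun x => sumCol m n x = 0) (β := Sum.inl)
    (f := fun x => f 0 (plen σ x))
    (g := fun x => f (sumCol m n x) (plen (Perm.sumCongr σ τ) x))
    (permInv_univ _) (fun x => by rw [Finset.mem_filter, Finset.mem_filter, sumCol_sumCongr]; simp)
    (fun x _ => by simp)
    ⟨fun x _ => by simp, Sum.inl_injective.injOn, fun x hx => by
      cases x <;> simp at hx ⊢⟩ (fun x _ => hinv x)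
    (fun x _ => by rw [hinl]; rfl)
  have h1 := prod_reps_of_bijOn (φ := τ) (ψ := Perm.sumCongr σ τ) (S := Finset.univ)
    (S' := Finset.univ.filter fun x => ¬ sumCol m n x = 0) (β := Sum.inr)
    (f := fun x => f 1 (plen τ x))
    (g := fun x => f (sumCol m n x) (plen (Perm.sumCongr σ τ) x))
    (permInv_univ _) (fun x => by rw [Finset.mem_filter, Finset.mem_filter, sumCol_sumCongr]; simp)
    (fun x _ => by simp)
    ⟨fun x _ => by simp, Sum.inr_injective.injOn, fun x hx => by
      cases x <;> simp at hx ⊢⟩ (fun x _ => hinv x)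
    (fun x _ => by rw [hinr]; rfl)
  rw [h0, h1, ← Finset.prod_filter_mul_prod_filter_not _ (fun x => sumCol m n x = 0)]
  congr 1 <;> refine Finset.prod_congr ?_ fun _ _ => rfl <;> · ext x; simp [reps]; tauto

/-- The type of a pair of permutations. -/
def typeOf {m n : ℕ} (σ : Perm (Fin m)) (τ : Perm (Fin n)) : Fin 2 × ℕ+ →₀ ℕ :=
  orbitType (Perm.sumCongr σ τ) (sumCol m n) Finset.univ

lemma psumOfPerm_mul_psumOfPerm {m n : ℕ} (σ : Perm (Fin m)) (τ : Perm (Fin n)) :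
    psumOfPerm 0 σ * psumOfPerm 1 τ = monomial (typeOf σ τ) (1 : ℂ) := by
  rw [typeOf, monomial_orbitType, prod_reps_sumCongr σ τ fun i k => psum i k, psumOfPerm_eq_prod,
    psumOfPerm_eq_prod]

/-- The degree in the variables of a colour. -/
def cwt (i : Fin 2) (d : Fin 2 × ℕ+ →₀ ℕ) : ℕ :=
  d.sum fun a e => if a.1 = i then (a.2 : ℕ) * e else 0

lemma cwt_add (i : Fin 2) (d e : Fin 2 × ℕ+ →₀ ℕ) : cwt i (d + e) = cwt i d + cwt i e := by
  apply Finsupp.sum_add_index'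
  · intro a
    simp
  · intro a x y
    split_ifs <;> ring

lemma wt_eq_sum (d : Fin 2 × ℕ+ →₀ ℕ) : wt d = cwt 0 d + cwt 1 d := by
  rw [wt, cwt, cwt, ← Finsupp.sum_add]
  refine Finsupp.sum_congr fun a _ => ?_
  obtain ⟨i, k⟩ := a
  fin_cases i <;> simp

lemma cwt_orbitType {X : Type*} [Fintype X] {φ : Perm X} {col : X → Fin 2}
    (hcol : ∀ x, col (φ x) = col x) {S : Finset X} (hS : PermInv φ S) (i : Fin 2) :
    cwt i (orbitType φ col S) = (S.filter fun x => col x = i).card := by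
  classical
  have hS' : PermInv φ (S.filter fun x => col x = i) := fun x => by simp [hcol, hS x]
  rw [← wt_orbitType (col := col) hS', orbitType, orbitType]
  have h : ∀ R : Finset X, cwt i (∑ x ∈ R, Finsupp.single (col x, plen φ x) 1) =
      wt (∑ x ∈ R.filter (fun x => col x = i), Finsupp.single (col x, plen φ x) 1) := by
    intro R
    induction R using Finset.cons_induction with
    | empty => rfl
    | cons a s ha ih =>
      rw [Finset.sum_cons, cwt_add, ih, Finset.filter_cons]
      split_ifs with h
      · rw [Finset.sum_cons, wt_add]
        congr 1
        simp [cwt, wt, h]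
      · simp [cwt, h]
  rw [h]
  congr 2
  ext x
  simp [reps]
  tauto

lemma cwt_typeOf {m n : ℕ} (σ : Perm (Fin m)) (τ : Perm (Fin n)) :
    cwt 0 (typeOf σ τ) = m ∧ cwt 1 (typeOf σ τ) = n := by
  rw [typeOf, cwt_orbitType (sumCol_sumCongr σ τ) (permInv_univ _),
    cwt_orbitType (sumCol_sumCongr σ τ) (permInv_univ _)]
  have h0 : (Finset.univ.filter fun x => sumCol m n x = 0) =
      (Finset.univ : Finset (Fin m)).map ⟨Sum.inl, Sum.inl_injective⟩ := by
    ext x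
    cases x <;> simp
  have h1 : (Finset.univ.filter fun x => sumCol m n x = 1) =
      (Finset.univ : Finset (Fin n)).map ⟨Sum.inr, Sum.inr_injective⟩ := by
    ext x
    cases x <;> simp
  rw [h0, h1]
  simp

open Classical in
/-- The number of conjugations of one pair of permutations into another. -/
lemma sval_typeOf_monomial {m n : ℕ} (σ σ' : Perm (Fin m)) (τ τ' : Perm (Fin n)) :
    sval (typeOf σ τ) (monomial (typeOf σ' τ') (1 : ℂ)) =
      ((Finset.univ.filter fun h : Perm (Fin m) × Perm (Fin n) =>
        h.1 * σ' = σ * h.1 ∧ h.2 * τ' = τ * h.2).card : ℂ) := by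
  have h1 := val_prod_adams (Perm.sumCongr σ' τ') (Perm.sumCongr σ τ) (sumCol_sumCongr σ τ)
    (permInv_univ _) (fun y => psum (sumCol m n y) 1)
  have h2 : (∏ y ∈ reps (Perm.sumCongr σ' τ') Finset.univ,
      adams (plen (Perm.sumCongr σ' τ') y) (psum (sumCol m n y) 1)) =
      monomial (typeOf σ' τ') (1 : ℂ) := by
    rw [typeOf, monomial_orbitType]
    exact Finset.prod_congr rfl fun y _ => by rw [adams_psum, mul_one]
  rw [h2] at h1
  rw [typeOf, ← val, h1]
  have h3 : ∀ A ∈ fam (Perm.sumCongr σ' τ') (Perm.sumCongr σ τ) Finset.univ,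
      (∏ y ∈ reps (Perm.sumCongr σ' τ') Finset.univ,
        val (Perm.sumCongr σ τ ^ len (Perm.sumCongr σ' τ') y) (sumCol m n) (A y)
          (psum (sumCol m n y) 1)) =
      if ∀ y, ∃ x, A y = {x} ∧ sumCol m n x = sumCol m n y then 1 else 0 := by
    intro A hA
    have hF := mem_fam.1 hA
    rw [Finset.prod_congr rfl fun y _ => val_psum_one (hF.permInv (pow_len_apply _ y)) _]
    split_ifs with h
    · exact Finset.prod_eq_one fun y _ => if_pos (h y)
    · push Not at h
      obtain ⟨y, hy⟩ := h
      apply Finset.prod_eq_zero (i := rep (Perm.sumCongr σ' τ') y)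
        (rep_mem_reps (permInv_univ _) (Finset.mem_univ y))
      rw [if_neg]
      rintro ⟨x, hx, hxc⟩
      obtain ⟨k, hk⟩ := (rep_sameCycle (Perm.sumCongr σ' τ') y).exists_nat_pow_eq
      refine hy ((Perm.sumCongr σ τ ^ k) x) ?_ ?_
      · ext z
        have h1 := hF.pow k (rep (Perm.sumCongr σ' τ') y) (((Perm.sumCongr σ τ) ^ k).symm z)
        rw [Equiv.apply_symm_apply, hk, hx, Finset.mem_singleton] at h1
        rw [h1, Finset.mem_singleton, Equiv.symm_apply_eq]
      · rw [col_pow (sumCol_sumCongr σ τ), hxc, ← col_pow (sumCol_sumCongr σ' τ') k, hk]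
  rw [Finset.sum_congr rfl h3, ← Finset.sum_filter, Finset.sum_const, nsmul_eq_mul, mul_one]
  congr 1
  symm
  refine Finset.card_bij (fun h _ => fun y => {Perm.sumCongr h.1 h.2 y}) ?_ ?_ ?_
  · intro h hh
    obtain ⟨hh1, hh2⟩ := (Finset.mem_filter.1 hh).2
    have hc : ∀ y, Perm.sumCongr h.1 h.2 (Perm.sumCongr σ' τ' y) =
        Perm.sumCongr σ τ (Perm.sumCongr h.1 h.2 y) := by
      rintro (y | y)
      · simpa using DFunLike.congr_fun hh1 y
      · simpa using DFunLike.congr_fun hh2 y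
    rw [Finset.mem_filter, mem_fam]
    refine ⟨⟨?_, ?_, ?_, ?_⟩, ?_⟩
    · intro y x
      rw [Finset.mem_singleton, Finset.mem_singleton, hc, (Perm.sumCongr σ τ).injective.eq_iff]
    · intro y
      simp
    · intro x _
      exact ⟨(Perm.sumCongr h.1 h.2).symm x, by rw [Equiv.apply_symm_apply]; simp⟩
    · intro x y z hy hz
      rw [Finset.mem_singleton] at hy hz
      exact (Perm.sumCongr h.1 h.2).injective (hy.symm.trans hz)
    · exact fun y => ⟨_, rfl, sumCol_sumCongr _ _ _⟩
  · intro h _ h' _ heq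
    have h1 : ∀ y, Perm.sumCongr h.1 h.2 y = Perm.sumCongr h'.1 h'.2 y := fun y =>
      Finset.singleton_injective (congrFun heq y)
    refine Prod.ext (Equiv.ext fun y => ?_) (Equiv.ext fun y => ?_)
    · simpa using h1 (Sum.inl y)
    · simpa using h1 (Sum.inr y)
  · intro A hA
    rw [Finset.mem_filter, mem_fam] at hA
    obtain ⟨hF, hA⟩ := hA
    choose B hB hBc using hA
    have hinj : Function.Injective B := fun y z hyz =>
      hF.unique (x := B y) (by rw [hB]; simp) (by rw [hB, hyz]; simp)
    let e : Perm (Fin m ⊕ Fin n) := Equiv.ofBijective B (Finite.injective_iff_bijective.1 hinj)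
    have he : Set.MapsTo e (Set.range Sum.inl) (Set.range Sum.inl) := by
      rintro _ ⟨y, rfl⟩
      have := hBc (Sum.inl y)
      change B (Sum.inl y) ∈ _
      rcases hb : B (Sum.inl y) with z | z
      · exact ⟨z, rfl⟩
      · rw [hb] at this
        simp at this
    obtain ⟨⟨h1, h2⟩, hh⟩ := Perm.mem_sumCongrHom_range_of_perm_mapsTo_inl he
    have hB' : ∀ y, B y = Perm.sumCongr h1 h2 y := fun y => (DFunLike.congr_fun hh y).symm
    have hequiv : ∀ y, B (Perm.sumCongr σ' τ' y) = Perm.sumCongr σ τ (B y) := by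
      intro y
      have := (hF.equivariant y (B y)).2 (by rw [hB]; simp)
      rw [hB, Finset.mem_singleton] at this
      exact this.symm
    refine ⟨(h1, h2), ?_, ?_⟩
    · rw [Finset.mem_filter]
      refine ⟨Finset.mem_univ _, Equiv.ext fun y => ?_, Equiv.ext fun y => ?_⟩
      · simpa [hB'] using hequiv (Sum.inl y)
      · simpa [hB'] using hequiv (Sum.inr y)
    · funext y
      rw [hB, hB']

lemma coeff_chMN (d : Fin 2 × ℕ+ →₀ ℕ) (m n : ℕ) {V : Type u} [AddCommGroup V] [Module ℂ V]
    (ρ : Representation ℂ (Perm (Fin m) × Perm (Fin n)) V) :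
    coeff d (chMN m n ρ) = ((m.factorial * n.factorial : ℂ)⁻¹) *
      ∑ g : Perm (Fin m) × Perm (Fin n), LinearMap.trace ℂ V (ρ g) *
        coeff d (monomial (typeOf g.1 g.2) (1 : ℂ)) := by
  rw [chMN]
  simp only [map_smul, map_sum, smul_eq_mul, psumOfPerm_mul_psumOfPerm]

lemma coeff_chMN_eq_zero {d : Fin 2 × ℕ+ →₀ ℕ} {m n : ℕ} {V : Type u} [AddCommGroup V]
    [Module ℂ V] (ρ : Representation ℂ (Perm (Fin m) × Perm (Fin n)) V)
    (h : ¬ (cwt 0 d = m ∧ cwt 1 d = n)) : coeff d (chMN m n ρ) = 0 := by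
  classical
  rw [coeff_chMN, Finset.sum_eq_zero, mul_zero]
  intro g _
  rw [coeff_monomial, if_neg, mul_zero]
  rintro rfl
  exact h (cwt_typeOf _ _)

lemma coeff_ch (W : S2Module.{u}) (d : Fin 2 × ℕ+ →₀ ℕ) :
    coeff d W.ch = coeff d (chMN (cwt 0 d) (cwt 1 d) (W.rho (cwt 0 d) (cwt 1 d))) := by
  change (∑ᶠ mn : ℕ × ℕ, coeff d (chMN mn.1 mn.2 (W.rho mn.1 mn.2))) = _
  rw [finsum_eq_single _ (cwt 0 d, cwt 1 d)]
  rintro ⟨m, n⟩ h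
  apply coeff_chMN_eq_zero
  rintro ⟨rfl, rfl⟩
  exact h rfl

lemma coeff_ch_eq_zero (W : S2Module.{u}) {d : Fin 2 × ℕ+ →₀ ℕ}
    (h : Subsingleton (W.carrier (cwt 0 d) (cwt 1 d))) : coeff d W.ch = 0 := by
  rw [coeff_ch, coeff_chMN, Finset.sum_eq_zero, mul_zero]
  intro g _
  rw [Subsingleton.elim (W.rho _ _ g) 0, map_zero, zero_mul]

/-- The characteristic of a representation has the character as its class function. -/
theorem sval_ch (W : S2Module.{u}) {m n : ℕ} (σ : Perm (Fin m)) (τ : Perm (Fin n)) :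
    sval (typeOf σ τ) W.ch = LinearMap.trace ℂ _ (W.rho m n (σ, τ)) := by
  classical
  have hc : coeff (typeOf σ τ) W.ch = coeff (typeOf σ τ) (chMN m n (W.rho m n)) := by
    rw [coeff_ch, (cwt_typeOf σ τ).1, (cwt_typeOf σ τ).2]
  rw [sval, hc, coeff_chMN]
  have h1 : ∀ g : Perm (Fin m) × Perm (Fin n),
      zfac (typeOf σ τ) * (LinearMap.trace ℂ _ (W.rho m n g) *
        coeff (typeOf σ τ) (monomial (typeOf g.1 g.2) (1 : ℂ))) =
      ∑ h : Perm (Fin m) × Perm (Fin n), if h * g = (σ, τ) * h then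
        LinearMap.trace ℂ _ (W.rho m n (σ, τ)) else 0 := by
    intro g
    have h2 := sval_typeOf_monomial σ g.1 τ g.2
    rw [sval] at h2
    rw [mul_left_comm, h2, ← Finset.sum_filter, Finset.sum_congr rfl (g := fun _ =>
      LinearMap.trace ℂ _ (W.rho m n g)), Finset.sum_const, nsmul_eq_mul, mul_comm]
    · congr 2
      congr 1
      ext h
      simp [Prod.ext_iff]
    · intro h hh
      have h3 := (Finset.mem_filter.1 hh).2
      have h4 : (σ, τ) = h * g * h⁻¹ := by rw [h3, mul_inv_cancel_right]
      rw [h4, map_mul (W.rho m n), map_mul (W.rho m n), LinearMap.trace_mul_cycle,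
        ← map_mul (W.rho m n), ← map_mul (W.rho m n), inv_mul_cancel, one_mul]
  rw [mul_left_comm, Finset.mul_sum, Finset.sum_congr rfl fun g _ => h1 g, Finset.sum_comm]
  have h5 : ∀ h : Perm (Fin m) × Perm (Fin n), (∑ g : Perm (Fin m) × Perm (Fin n),
      if h * g = (σ, τ) * h then LinearMap.trace ℂ _ (W.rho m n (σ, τ)) else 0) =
      LinearMap.trace ℂ _ (W.rho m n (σ, τ)) := by
    intro h
    rw [Finset.sum_eq_single (h⁻¹ * ((σ, τ) * h))]
    · rw [if_pos (by group)]
    · intro g _ hg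
      rw [if_neg]
      intro h'
      apply hg
      rw [← h', inv_mul_cancel_left]
    · intro h'
      exact absurd (Finset.mem_univ _) h'
  rw [Finset.sum_congr rfl fun h _ => h5 h, Finset.sum_const, Finset.card_univ, Fintype.card_prod,
    Fintype.card_perm, Fintype.card_perm, Fintype.card_fin, Fintype.card_fin, nsmul_eq_mul,
    ← mul_assoc]
  push_cast
  rw [inv_mul_cancel₀, one_mul]
  exact mul_ne_zero (Nat.cast_ne_zero.2 m.factorial_ne_zero)
    (Nat.cast_ne_zero.2 n.factorial_ne_zero)

/-- The class function of `ch W` at a permutation `φ` of a coloured set `S` is the character of `W`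
at the pair of permutations by which `φ` acts on numberings `a` and `b` of the two colour classes
of `S`. -/
theorem val_ch (W : S2Module.{u}) {X : Type*} [Finite X] {φ : Perm X} {col : X → Fin 2}
    (hcol : ∀ x, col (φ x) = col x) {S : Finset X} (hS : PermInv φ S) {m n : ℕ}
    (a : Fin m → X) (b : Fin n → X) (ha : Function.Injective a) (hb : Function.Injective b)
    (haS : ∀ x, x ∈ S ∧ col x = 0 ↔ ∃ i, a i = x) (hbS : ∀ x, x ∈ S ∧ col x = 1 ↔ ∃ i, b i = x)
    {σ : Perm (Fin m)} {τ : Perm (Fin n)} (hσ : ∀ i, φ (a i) = a (σ i))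
    (hτ : ∀ i, φ (b i) = b (τ i)) :
    val φ col S W.ch = LinearMap.trace ℂ _ (W.rho m n (σ, τ)) := by
  rw [← sval_ch, val]
  congr 1
  symm
  have ha' := fun i => (haS (a i)).2 ⟨i, rfl⟩
  have hb' := fun i => (hbS (b i)).2 ⟨i, rfl⟩
  refine orbitType_of_bijOn (β := Sum.elim a b) (permInv_univ _) hS ?_ ⟨?_, ?_, ?_⟩
    (fun x _ => hcol x) ?_
  · rintro (i | i) _
    · simp [hσ]
    · simp [hτ]
  · rintro (i | i) _
    · exact (ha' i).1
    · exact (hb' i).1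
  · rintro (i | i) _ (j | j) _ h
    · exact congrArg _ (ha h)
    · have h1 := (ha' i).2
      have h2 := (hb' j).2
      rw [show a i = b j from h] at h1
      rw [h1] at h2
      exact absurd h2 (by decide)
    · have h1 := (ha' j).2
      have h2 := (hb' i).2
      rw [show b i = a j from h] at h2
      rw [h1] at h2
      exact absurd h2 (by decide)
    · exact congrArg _ (hb h)
  · intro x hx
    have : col x = 0 ∨ col x = 1 := by
      generalize col x = j
      revert j; decide
    rcases this with h | h
    · obtain ⟨i, hi⟩ := (haS x).1 ⟨hx, h⟩
      exact ⟨Sum.inl i, by simp, hi⟩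
    · obtain ⟨i, hi⟩ := (hbS x).1 ⟨hx, h⟩
      exact ⟨Sum.inr i, by simp, hi⟩
  · rintro (i | i) _
    · exact (ha' i).2.symm
    · exact (hb' i).2.symm

/-- The derivative by `p_1^{(1)}` corresponds to an additional fixed point of colour `0`. -/
lemma val_dP1 {X : Type*} [Finite X] [DecidableEq X] {φ : Perm X} {col : X → Fin 2}
    {S : Finset X} {x : X} (hx : x ∉ S) (hφ : φ x = x) (hc : col x = 0) (f : SymC) :
    val φ col S (dP1 f) = val φ col (insert x S) f := by
  have h : orbitType φ col (insert x S) = orbitType φ col S + Finsupp.single (0, 1) 1 := by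
    rw [Finset.insert_eq, orbitType_union (Finset.disjoint_singleton_left.2 hx),
      orbitType_singleton hφ, hc, add_comm]
  rw [val, val, h, sval_add_single, orbitDeriv, dP1]
  simp

/-! ### Hierarchies -/

section sections

variable {Y Z : Type*}

lemma pow_apply_eq_of_len {σ : Perm Y} {θ : Perm Z} {r : Y} {z : Z} (hz : (θ ^ len σ r) z = z)
    {k l : ℕ} (h : (σ ^ k) r = (σ ^ l) r) : (θ ^ k) z = (θ ^ l) z := by
  wlog hkl : k ≤ l generalizing k l
  · exact (this h.symm (le_of_not_ge hkl)).symm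
  obtain ⟨j, rfl⟩ := Nat.exists_eq_add_of_le hkl
  rw [pow_add, Perm.mul_apply, (σ ^ k).injective.eq_iff, eq_comm, pow_apply_eq_iff] at h
  have hj : (θ ^ j) z = z := (pow_apply_eq_iff θ z j).2
    (((pow_apply_eq_iff θ z _).1 hz).trans h)
  rw [pow_add, Perm.mul_apply, hj]

variable [Fintype Y] [Fintype Z]

open Classical in
/-- An equivariant section is determined by its values at representatives of the orbits, which
are fixed by the first return map. -/
lemma prod_reps_sum_fixed [DecidableEq Y] [DecidableEq Z] {M : Type*} [CommSemiring M]
    {σ : Perm Y} {T : Finset Y} (hT : PermInv σ T)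
    (θ : Perm Z) {C : Y → Finset Z} (hC : ∀ y ∈ T, ∀ z, θ z ∈ C (σ y) ↔ z ∈ C y) (z₀ : Z)
    (w : Y → Z → M) :
    ∏ y ∈ reps σ T, ∑ z ∈ (C y).filter (fun z => (θ ^ len σ y) z = z), w y z =
      ∑ s ∈ Finset.univ.filter (fun s : Y → Z =>
        (∀ y ∈ T, s y ∈ C y ∧ s (σ y) = θ (s y)) ∧ ∀ y, y ∉ T → s y = z₀),
        ∏ y ∈ reps σ T, w y (s y) := by
  rw [Finset.prod_sum]
  symm
  have hmem : ∀ n, ∀ y ∈ T, ∀ z ∈ C y, (θ ^ n) z ∈ C ((σ ^ n) y) := by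
    intro n y hy z hz
    induction n with
    | zero => exact hz
    | succ n ih =>
      rw [pow_succ', pow_succ', Perm.mul_apply, Perm.mul_apply]
      exact (hC _ ((hT.pow n y).2 hy) _).2 ih
  have hpow : ∀ s : Y → Z, (∀ y ∈ T, s y ∈ C y ∧ s (σ y) = θ (s y)) → ∀ n, ∀ y ∈ T,
      s ((σ ^ n) y) = (θ ^ n) (s y) := by
    intro s hs n y hy
    induction n with
    | zero => rfl
    | succ n ih =>
      rw [pow_succ', pow_succ', Perm.mul_apply, Perm.mul_apply, ← ih]
      exact (hs _ ((hT.pow n y).2 hy)).2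
  refine Finset.sum_bij (fun s _ => fun y _ => s y) ?_ ?_ ?_ ?_
  · intro s hs
    obtain ⟨hs, -⟩ := (Finset.mem_filter.1 hs).2
    rw [Finset.mem_pi]
    intro y hy
    have hyT := reps_subset _ _ hy
    rw [Finset.mem_filter]
    refine ⟨(hs y hyT).1, ?_⟩
    rw [← hpow s hs _ y hyT, pow_len_apply]
  · intro s hs s' hs' h
    obtain ⟨hs, hs0⟩ := (Finset.mem_filter.1 hs).2
    obtain ⟨hs', hs0'⟩ := (Finset.mem_filter.1 hs').2
    funext y
    by_cases hy : y ∈ T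
    · obtain ⟨k, hk⟩ := (rep_sameCycle σ y).exists_nat_pow_eq
      have hr := rep_mem_reps hT hy
      rw [← hk, hpow s hs k _ (reps_subset _ _ hr), hpow s' hs' k _ (reps_subset _ _ hr)]
      exact congrArg _ (congrFun (congrFun h _) hr)
    · rw [hs0 y hy, hs0' y hy]
  · intro p hp
    rw [Finset.mem_pi] at hp
    choose k hk using fun y => (rep_sameCycle σ y).exists_nat_pow_eq
    let s : Y → Z := fun y =>
      if hy : y ∈ T then (θ ^ k y) (p (rep σ y) (rep_mem_reps hT hy)) else z₀
    have hs : ∀ y (hy : y ∈ T), s y = (θ ^ k y) (p (rep σ y) (rep_mem_reps hT hy)) :=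
      fun y hy => dif_pos hy
    refine ⟨s, ?_, ?_⟩
    · rw [Finset.mem_filter]
      refine ⟨Finset.mem_univ _, fun y hy => ⟨?_, ?_⟩, fun y hy => dif_neg hy⟩
      · rw [hs y hy]
        have hr := rep_mem_reps hT hy
        have := hmem (k y) _ (reps_subset _ _ hr) _ (Finset.mem_filter.1 (hp _ hr)).1
        rwa [hk] at this
      · rw [hs y hy, hs _ ((hT y).2 hy), ← Perm.mul_apply, ← pow_succ']
        have hrep : rep σ (σ y) = rep σ y :=
          rep_congr (Perm.sameCycle_apply_left.2 (Perm.SameCycle.refl σ y))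
        have hkk := hk (σ y)
        have hr := rep_mem_reps hT hy
        have hpe : ∀ r (hr : r ∈ reps σ T) (hr' : rep σ y ∈ reps σ T), r = rep σ y →
            p r hr = p (rep σ y) hr' := by
          rintro r hr hr' rfl
          rfl
        rw [hpe _ _ hr hrep]
        apply pow_apply_eq_of_len (Finset.mem_filter.1 (hp _ hr)).2
        rw [hrep] at hkk
        rw [hkk, pow_succ', Perm.mul_apply, hk]
    · funext y hy
      have hyT := reps_subset _ _ hy
      have hrep := (mem_reps.1 hy).2
      have hpe : ∀ r (hr : r ∈ reps σ T), r = y → p r hr = p y hy := by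
        rintro r hr rfl
        rfl
      rw [hs y hyT, hpe _ _ hrep]
      have h0 := pow_apply_eq_of_len (k := k y) (l := 0) (Finset.mem_filter.1 (hp y hy)).2
        (by rw [pow_zero, Perm.one_apply]; conv_lhs => rw [← hrep]
            rw [hrep]; have := hk y; rwa [hrep] at this)
      rw [h0]
      rfl
  · intro s _
    exact (Finset.prod_attach (reps σ T) fun y => w y (s y)).symm

end sections

section

variable {X : Type*}

/-- A hierarchy on `b`, given by its members with at least two elements: a laminar family of
subsets of `b`, which contains `b`. -/
structure IsHier (H : Finset (Finset X)) (b : Finset X) : Prop where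
  two_le : ∀ S ∈ H, 2 ≤ S.card
  subset : ∀ S ∈ H, S ⊆ b
  top : 2 ≤ b.card → b ∈ H
  laminar : ∀ S ∈ H, ∀ T ∈ H, S ⊆ T ∨ T ⊆ S ∨ Disjoint S T

lemma permB_subset_permB {φ : Perm X} {S T : Finset X} : permB φ S ⊆ permB φ T ↔ S ⊆ T := by
  simp

lemma permB_ssubset_permB {φ : Perm X} {S T : Finset X} : permB φ S ⊂ permB φ T ↔ S ⊂ T := by
  simp

lemma card_permB (φ : Perm X) (S : Finset X) : (permB φ S).card = S.card := by
  simp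

lemma permB_disjoint {φ : Perm X} {S T : Finset X} :
    Disjoint (permB φ S) (permB φ T) ↔ Disjoint S T := by
  simp

lemma isHier_permB_iff {φ : Perm X} {H : Finset (Finset X)} {b : Finset X} :
    IsHier (permB (permB φ) H) (permB φ b) ↔ IsHier H b := by
  constructor
  · intro h
    refine ⟨fun S hS => ?_, fun S hS => ?_, fun hb => ?_, fun S hS T hT => ?_⟩
    · rw [← card_permB φ]
      exact h.two_le _ (mem_permB.2 hS)
    · exact permB_subset_permB.1 (h.subset _ (mem_permB.2 hS))
    · exact mem_permB.1 (h.top (by rwa [card_permB]))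
    · have := h.laminar _ (mem_permB.2 hS) _ (mem_permB.2 hT)
      rwa [permB_subset_permB, permB_subset_permB, permB_disjoint] at this
  · intro h
    refine ⟨fun S hS => ?_, fun S hS => ?_, fun hb => ?_, fun S hS T hT => ?_⟩
    · obtain ⟨S, rfl⟩ := (permB φ).surjective S
      rw [card_permB]
      exact h.two_le S (mem_permB.1 hS)
    · obtain ⟨S, rfl⟩ := (permB φ).surjective S
      exact permB_subset_permB.2 (h.subset S (mem_permB.1 hS))
    · exact mem_permB.2 (h.top (by rwa [card_permB] at hb))
    · obtain ⟨S, rfl⟩ := (permB φ).surjective S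
      obtain ⟨T, rfl⟩ := (permB φ).surjective T
      rw [permB_subset_permB, permB_subset_permB, permB_disjoint]
      exact h.laminar S (mem_permB.1 hS) T (mem_permB.1 hT)

lemma IsHier.filter_subset {H : Finset (Finset X)} {b B : Finset X} [DecidableEq X]
    (h : IsHier H b) (hB : 2 ≤ B.card → B ∈ H) : IsHier (H.filter (· ⊆ B)) B where
  two_le S hS := h.two_le S (Finset.mem_filter.1 hS).1
  subset _ hS := (Finset.mem_filter.1 hS).2
  top hb := Finset.mem_filter.2 ⟨hB hb, subset_rfl⟩
  laminar _ hS _ hT := h.laminar _ (Finset.mem_filter.1 hS).1 _ (Finset.mem_filter.1 hT).1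

lemma IsPart.ssubset {P : Finset (Finset X)} {b : Finset X} (hP : IsPart P b) (hPb : b ∉ P)
    {B : Finset X} (hB : B ∈ P) : B ⊂ b :=
  Finset.ssubset_iff_subset_ne.2 ⟨hP.subset B hB, fun h => hPb (h ▸ hB)⟩

lemma IsPart.eq_of_subset {P : Finset (Finset X)} {b : Finset X} (hP : IsPart P b)
    {B C S : Finset X} (hB : B ∈ P) (hC : C ∈ P) (hS : S.Nonempty)
    (hSB : S ⊆ B) (hSC : S ⊆ C) : B = C := by
  obtain ⟨x, hx⟩ := hS
  exact hP.unique B hB C hC x (hSB hx) (hSC hx)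

section glue

variable [DecidableEq X] {P : Finset (Finset X)} {b : Finset X} (hP : IsPart P b) (hPb : b ∉ P)
  {s : Finset X → Finset (Finset X)} (hs : ∀ B ∈ P, IsHier (s B) B)

include hP hPb hs in
/-- Hierarchies on the blocks of a partition, together with the whole set, form a hierarchy. -/
lemma isHier_glue (hb : 2 ≤ b.card) : IsHier (insert b (P.biUnion s)) b where
  two_le S hS := by
    rcases Finset.mem_insert.1 hS with rfl | hS
    · exact hb
    · obtain ⟨B, hB, hS⟩ := Finset.mem_biUnion.1 hS
      exact (hs B hB).two_le S hS
  subset S hS := by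
    rcases Finset.mem_insert.1 hS with rfl | hS
    · exact subset_rfl
    · obtain ⟨B, hB, hS⟩ := Finset.mem_biUnion.1 hS
      exact ((hs B hB).subset S hS).trans (hP.subset B hB)
  top _ := Finset.mem_insert_self _ _
  laminar S hS T hT := by
    have hsub : ∀ S ∈ P.biUnion s, S ⊆ b := by
      intro S hS
      obtain ⟨B, hB, hS⟩ := Finset.mem_biUnion.1 hS
      exact ((hs B hB).subset S hS).trans (hP.subset B hB)
    rw [Finset.mem_insert] at hS hT
    rcases hS with rfl | hS
    · right; left
      rcases hT with rfl | hT
      · exact subset_rfl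
      · exact hsub T hT
    · rcases hT with rfl | hT
      · exact Or.inl (hsub S hS)
      · obtain ⟨B, hB, hS⟩ := Finset.mem_biUnion.1 hS
        obtain ⟨C, hC, hT⟩ := Finset.mem_biUnion.1 hT
        by_cases hBC : B = C
        · subst hBC
          exact (hs B hB).laminar S hS T hT
        · right; right
          rw [Finset.disjoint_left]
          intro x hx hx'
          exact hBC (hP.unique B hB C hC x ((hs B hB).subset S hS hx) ((hs C hC).subset T hT hx'))

include hP hPb hs in
lemma filter_glue {B : Finset X} (hB : B ∈ P) :
    (insert b (P.biUnion s)).filter (· ⊆ B) = s B := by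
  ext S
  rw [Finset.mem_filter, Finset.mem_insert, Finset.mem_biUnion]
  constructor
  · rintro ⟨rfl | ⟨C, hC, hS⟩, hSB⟩
    · exact absurd hSB (hP.ssubset hPb hB).2
    · have hne : S.Nonempty := Finset.card_pos.1 (by have := (hs C hC).two_le S hS; omega)
      rwa [hP.eq_of_subset hB hC hne hSB ((hs C hC).subset S hS)]
  · exact fun hS => ⟨Or.inr ⟨B, hB, hS⟩, (hs B hB).subset S hS⟩

end glue

variable [Fintype X]

open Classical in
/-- The children of `S` in a hierarchy: the maximal sets strictly below `S`, among the members
of the hierarchy and the points. -/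
def children (H : Finset (Finset X)) (S : Finset X) : Finset (Finset X) :=
  Finset.univ.filter fun T => T ⊂ S ∧ (T ∈ H ∨ T.card = 1) ∧ ∀ U ∈ H, T ⊆ U → U ⊂ S → U = T

lemma mem_children {H : Finset (Finset X)} {S T : Finset X} : T ∈ children H S ↔
    T ⊂ S ∧ (T ∈ H ∨ T.card = 1) ∧ ∀ U ∈ H, T ⊆ U → U ⊂ S → U = T := by
  simp [children]

lemma children_congr {H H' : Finset (Finset X)} {S : Finset X} (h : ∀ U, U ⊂ S → (U ∈ H ↔ U ∈ H')) :
    children H S = children H' S := by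
  ext T
  rw [mem_children, mem_children]
  refine and_congr_right fun hT => and_congr (or_congr_left (h T hT)) ?_
  refine ⟨fun h1 U hU hTU hUS => h1 U ((h U hUS).2 hU) hTU hUS,
    fun h1 U hU hTU hUS => h1 U ((h U hUS).1 hU) hTU hUS⟩

lemma exists_mem_children {H : Finset (Finset X)} {S T : Finset X} (hTS : T ⊂ S)
    (hT : T ∈ H ∨ T.card = 1) : ∃ U ∈ children H S, T ⊆ U := by
  classical
  obtain ⟨U, hU, hmax⟩ := Finset.exists_max_image
    (Finset.univ.filter fun U => T ⊆ U ∧ U ⊂ S ∧ (U ∈ H ∨ U.card = 1)) Finset.card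
    ⟨T, by simp [hTS, hT]⟩
  simp only [Finset.mem_filter, Finset.mem_univ, true_and, and_imp] at hU hmax
  refine ⟨U, mem_children.2 ⟨hU.2.1, hU.2.2, fun V hV hUV hVS => ?_⟩, hU.1⟩
  exact (Finset.eq_of_subset_of_card_le hUV
    (hmax V (hU.1.trans hUV) hVS (Or.inl hV))).symm

lemma IsHier.isPart_children {H : Finset (Finset X)} {b S : Finset X} (hH : IsHier H b)
    (hS : 2 ≤ S.card) : IsPart (children H S) S where
  nonempty B hB := by
    rcases (mem_children.1 hB).2.1 with h | h
    · exact Finset.card_pos.1 (by have := hH.two_le B h; omega)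
    · exact Finset.card_pos.1 (by omega)
  subset B hB := (mem_children.1 hB).1.subset
  cover x hx := by
    have hxS : ({x} : Finset X) ⊂ S := by
      refine Finset.ssubset_iff_subset_ne.2 ⟨by simpa using hx, ?_⟩
      rintro rfl
      simp at hS
    obtain ⟨U, hU, hxU⟩ := exists_mem_children (H := H) hxS (Or.inr (by simp))
    exact ⟨U, hU, hxU (by simp)⟩
  unique B hB C hC x hx hx' := by
    obtain ⟨hBS, hB1, hB2⟩ := mem_children.1 hB
    obtain ⟨hCS, hC1, hC2⟩ := mem_children.1 hC
    rcases hB1 with hB1 | hB1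
    · rcases hC1 with hC1 | hC1
      · rcases hH.laminar B hB1 C hC1 with h | h | h
        · exact (hB2 C hC1 h hCS).symm
        · exact hC2 B hB1 h hBS
        · exact absurd hx' (Finset.disjoint_left.1 h hx)
      · obtain ⟨y, rfl⟩ := Finset.card_eq_one.1 hC1
        rw [Finset.mem_singleton] at hx'
        subst hx'
        exact hC2 B hB1 (by simpa using hx) hBS
    · obtain ⟨y, rfl⟩ := Finset.card_eq_one.1 hB1
      rw [Finset.mem_singleton] at hx
      subst hx
      rcases hC1 with hC1 | hC1
      · exact (hB2 C hC1 (by simpa using hx') hCS).symm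
      · obtain ⟨z, rfl⟩ := Finset.card_eq_one.1 hC1
        rw [Finset.mem_singleton] at hx'
        rw [hx']

open Classical in
/-- The hierarchies on `b` invariant under `φ`. -/
def hiers (φ : Perm X) (b : Finset X) : Finset (Finset (Finset X)) :=
  Finset.univ.filter fun H => IsHier H b ∧ PermInv (permB φ) H

lemma mem_hiers {φ : Perm X} {b : Finset X} {H : Finset (Finset X)} :
    H ∈ hiers φ b ↔ IsHier H b ∧ PermInv (permB φ) H := by
  simp [hiers]

/-- The weight of a family of members of a hierarchy: the product over the orbits of members of the
values of `a` on the sets of children. -/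
def hierWeight (a : SymC) (φ : Perm X) (col : X → Fin 2) (H R : Finset (Finset X)) : ℂ :=
  ∏ S ∈ reps (permB φ) R, val (permB φ ^ len (permB φ) S) (colB col) (children H S) a

/-- The sum of the weights of the invariant hierarchies. -/
def hierSum (a : SymC) (φ : Perm X) (col : X → Fin 2) (b : Finset X) : ℂ :=
  ∑ H ∈ hiers φ b, hierWeight a φ col H H

lemma children_permB {φ : Perm X} {H : Finset (Finset X)} (S : Finset X) :
    children (permB (permB φ) H) (permB φ S) = permB (permB φ) (children H S) := by
  ext T
  obtain ⟨T, rfl⟩ := (permB φ).surjective T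
  rw [mem_permB, mem_children, mem_children, permB_ssubset_permB, mem_permB, card_permB]
  refine and_congr_right fun _ => and_congr_right fun _ => ?_
  constructor
  · intro h U hU hTU hUS
    exact (permB φ).injective (h _ (mem_permB.2 hU) (permB_subset_permB.2 hTU)
      (permB_ssubset_permB.2 hUS))
  · intro h U hU hTU hUS
    obtain ⟨U, rfl⟩ := (permB φ).surjective U
    rw [h U (mem_permB.1 hU) (permB_subset_permB.1 hTU) (permB_ssubset_permB.1 hUS)]

lemma permInv_children {φ : Perm X} {H : Finset (Finset X)} (hH : PermInv (permB φ) H)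
    {S : Finset X} (hS : PermInv φ S) : PermInv (permB φ) (children H S) := by
  rw [← permB_eq_self_iff] at hH hS ⊢
  rw [← children_permB, hH, hS]

/-- The factors of the weight of an invariant hierarchy are invariant. -/
lemma val_children_permB {φ : Perm X} {col : X → Fin 2} (hcol : ∀ x, col (φ x) = col x)
    {H : Finset (Finset X)} (hH : PermInv (permB φ) H) (a : SymC) (S : Finset X) :
    val (permB φ ^ len (permB φ) (permB φ S)) (colB col) (children H (permB φ S)) a =
      val (permB φ ^ len (permB φ) S) (colB col) (children H S) a := by
  have h1 : children H (permB φ S) = permB (permB φ) (children H S) := by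
    conv_lhs => rw [← permB_eq_self_iff.2 hH]
    exact children_permB S
  rw [len_apply, h1, val, orbitType_permB (colB_permB hcol) ((Commute.refl _).pow_right _) ?_
    (col_pow (colB_permB hcol) _), val]
  rw [permB_pow]
  apply permInv_children _ (permInv_pow_len φ S)
  rw [← permB_pow]
  exact hH.pow _

section glue

variable [DecidableEq X] {P : Finset (Finset X)} {b : Finset X} (hP : IsPart P b) (hPb : b ∉ P)
  {s : Finset X → Finset (Finset X)} (hs : ∀ B ∈ P, IsHier (s B) B)

include hP hPb hs in
lemma children_glue (hb : 2 ≤ b.card) : children (insert b (P.biUnion s)) b = P := by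
  have hH := isHier_glue hP hPb hs hb
  have hsub : ∀ B ∈ P, B ∈ children (insert b (P.biUnion s)) b := by
    intro B hB
    rw [mem_children]
    refine ⟨hP.ssubset hPb hB, ?_, ?_⟩
    · by_cases h1 : B.card = 1
      · exact Or.inr h1
      · left
        have := (hP.nonempty B hB).card_pos
        exact Finset.mem_insert_of_mem (Finset.mem_biUnion.2 ⟨B, hB, (hs B hB).top (by omega)⟩)
    · intro U hU hBU hUb
      rcases Finset.mem_insert.1 hU with rfl | hU
      · exact absurd rfl hUb.ne
      · obtain ⟨C, hC, hU⟩ := Finset.mem_biUnion.1 hU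
        have hUC := (hs C hC).subset U hU
        have := hP.eq_of_subset hB hC (hP.nonempty B hB) subset_rfl (hBU.trans hUC)
        subst this
        exact hUC.antisymm hBU
  refine Finset.Subset.antisymm (fun B hB => ?_) hsub
  obtain ⟨x, hx⟩ := (hH.isPart_children hb).nonempty B hB
  obtain ⟨C, hC, hxC⟩ := hP.cover x ((hH.isPart_children hb).subset B hB hx)
  rw [(hH.isPart_children hb).unique B hB C (hsub C hC) x hx hxC]
  exact hC

lemma IsHier.eq_glue {H : Finset (Finset X)} (hH : IsHier H b) (hb : 2 ≤ b.card) :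
    insert b ((children H b).biUnion fun B => H.filter (· ⊆ B)) = H := by
  ext S
  rw [Finset.mem_insert, Finset.mem_biUnion]
  constructor
  · rintro (rfl | ⟨B, _, hS⟩)
    · exact hH.top hb
    · exact (Finset.mem_filter.1 hS).1
  · intro hS
    by_cases hSb : S = b
    · exact Or.inl hSb
    · right
      obtain ⟨B, hB, hSB⟩ := exists_mem_children (H := H)
        (Finset.ssubset_iff_subset_ne.2 ⟨hH.subset S hS, hSb⟩) (Or.inl hS)
      exact ⟨B, hB, Finset.mem_filter.2 ⟨hS, hSB⟩⟩

open Classical in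
/-- A hierarchy on `b` in which the children of `b` are the blocks of `P` is a family of hierarchies
on the blocks. An invariant family is determined by its members at representatives of the orbits of
blocks, which are invariant under the first return maps. -/
lemma sum_hiers_children {φ : Perm X} {b : Finset X} (hφ : PermInv φ b) (hb : 2 ≤ b.card)
    {P : Finset (Finset X)} (hP : P ∈ parts φ b) (hPb : b ∉ P) (a : SymC) {col : X → Fin 2}
    (hcol : ∀ x, col (φ x) = col x) :
    ∑ H ∈ (hiers φ b).filter (fun H => children H b = P), hierWeight a φ col H (H.erase b) =
      ∏ B ∈ reps (permB φ) P, hierSum a (φ ^ len (permB φ) B) col B := by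
  obtain ⟨hP, hPφ⟩ := mem_parts.1 hP
  have hfix : permB φ b = b := permB_eq_self_iff.2 hφ
  have h1 : ∀ B ∈ reps (permB φ) P, hierSum a (φ ^ len (permB φ) B) col B =
      ∑ H ∈ (Finset.univ.filter fun H => IsHier H B).filter
        (fun H => (permB (permB φ) ^ len (permB φ) B) H = H),
        hierWeight a (φ ^ len (permB φ) B) col H H := by
    intro B _
    rw [hierSum]
    refine Finset.sum_congr ?_ fun _ _ => rfl
    ext H
    rw [mem_hiers, Finset.mem_filter, Finset.mem_filter, permB_pow, permB_pow, permB_eq_self_iff]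
    simp
  rw [Finset.prod_congr rfl h1, prod_reps_sum_fixed hPφ (permB (permB φ))
    (C := fun B => Finset.univ.filter fun H => IsHier H B) (fun B _ H => by
      simp only [Finset.mem_filter, Finset.mem_univ, true_and, isHier_permB_iff]) ∅]
  have hfilter : ∀ H B, (permB (permB φ) H).filter (· ⊆ permB φ B) =
      permB (permB φ) (H.filter (· ⊆ B)) := by
    intro H B
    ext S
    obtain ⟨S, rfl⟩ := (permB φ).surjective S
    rw [Finset.mem_filter, mem_permB, mem_permB, permB_subset_permB, Finset.mem_filter]
  refine Finset.sum_bij' (fun H _ => fun B => if B ∈ P then H.filter (· ⊆ B) else ∅)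
    (fun s _ => insert b (P.biUnion s)) ?_ ?_ ?_ ?_ ?_
  · intro H hH
    have hHm : H ∈ hiers φ b := (Finset.mem_filter.1 hH).1
    obtain rfl : children H b = P := (Finset.mem_filter.1 hH).2
    obtain ⟨hH, hHφ⟩ := mem_hiers.1 hHm
    rw [Finset.mem_filter]
    refine ⟨Finset.mem_univ _, fun B hB => ⟨?_, ?_⟩, fun B hB => by beta_reduce; rw [if_neg hB]⟩
    · beta_reduce
      rw [if_pos hB, Finset.mem_filter]
      refine ⟨Finset.mem_univ _, hH.filter_subset fun h2 => ?_⟩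
      rcases (mem_children.1 hB).2.1 with h | h
      · exact h
      · omega
    · beta_reduce
      rw [if_pos hB, if_pos ((hPφ B).2 hB), ← hfilter, permB_eq_self_iff.2 hHφ]
  · intro s hs
    obtain ⟨hs, -⟩ := (Finset.mem_filter.1 hs).2
    have hs' : ∀ B ∈ P, IsHier (s B) B := fun B hB => (Finset.mem_filter.1 (hs B hB).1).2
    rw [Finset.mem_filter, mem_hiers]
    refine ⟨⟨isHier_glue hP hPb hs' hb, ?_⟩, children_glue hP hPb hs' hb⟩
    apply permInv_of_forall
    intro S hS
    rcases Finset.mem_insert.1 hS with rfl | hS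
    · rw [hfix]
      exact Finset.mem_insert_self _ _
    · obtain ⟨B, hB, hS⟩ := Finset.mem_biUnion.1 hS
      refine Finset.mem_insert_of_mem (Finset.mem_biUnion.2 ⟨permB φ B, (hPφ B).2 hB, ?_⟩)
      rw [(hs B hB).2]
      exact mem_permB.2 hS
  · intro H hH
    have hHm : H ∈ hiers φ b := (Finset.mem_filter.1 hH).1
    obtain rfl : children H b = P := (Finset.mem_filter.1 hH).2
    obtain ⟨hH, hHφ⟩ := mem_hiers.1 hHm
    refine Eq.trans ?_ (hH.eq_glue hb)
    congr 1
    exact Finset.biUnion_congr rfl fun B hB => if_pos hB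
  · intro s hs
    obtain ⟨hs, hs0⟩ := (Finset.mem_filter.1 hs).2
    have hs' : ∀ B ∈ P, IsHier (s B) B := fun B hB => (Finset.mem_filter.1 (hs B hB).1).2
    funext B
    split_ifs with hB
    · exact filter_glue hP hPb hs' hB
    · exact (hs0 B hB).symm
  · intro H hH₀
    have hHm : H ∈ hiers φ b := (Finset.mem_filter.1 hH₀).1
    obtain rfl : children H b = P := (Finset.mem_filter.1 hH₀).2
    obtain ⟨hH, hHφ⟩ := mem_hiers.1 hHm
    set P := children H b with hPdef
    have hblock : ∀ S ∈ H.erase b, ∃ B ∈ P, S ⊆ B := by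
      intro S hS
      obtain ⟨hSb, hS⟩ := Finset.mem_erase.1 hS
      exact exists_mem_children
        (Finset.ssubset_iff_subset_ne.2 ⟨hH.subset S hS, hSb⟩) (Or.inl hS)
    let p : Finset X → Finset X := fun S => if h : S ∈ H.erase b then (hblock S h).choose else ∅
    have hp : ∀ S ∈ H.erase b, p S ∈ P ∧ S ⊆ p S := by
      intro S hS
      have := (hblock S hS).choose_spec
      simp only [p, dif_pos hS]
      exact this
    have hne : ∀ S ∈ H, S.Nonempty := fun S hS =>
      Finset.card_pos.1 (by have := hH.two_le S hS; omega)
    have hpu : ∀ S ∈ H.erase b, ∀ B ∈ P, S ⊆ B → p S = B := fun S hS B hB hSB =>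
      hP.eq_of_subset (hp S hS).1 hB (hne S (Finset.mem_of_mem_erase hS)) (hp S hS).2 hSB
    have hinv : PermInv (permB φ) (H.erase b) := by
      intro S
      rw [Finset.mem_erase, Finset.mem_erase, hHφ S]
      refine and_congr_left fun _ => not_congr ?_
      conv_lhs => rw [← hfix]
      exact (permB φ).injective.eq_iff
    rw [hierWeight, prod_reps_fibration (p := p) (σ := permB φ) hinv hPφ]
    · refine Finset.prod_congr rfl fun B hB => ?_
      have hBP := reps_subset _ _ hB
      beta_reduce
      rw [if_pos hBP, hierWeight, ← permB_pow]
      have hset : (H.erase b).filter (fun S => p S = B) = H.filter (· ⊆ B) := by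
        ext S
        rw [Finset.mem_filter, Finset.mem_filter]
        constructor
        · rintro ⟨hS, rfl⟩
          exact ⟨Finset.mem_of_mem_erase hS, (hp S hS).2⟩
        · rintro ⟨hS, hSB⟩
          have hSe : S ∈ H.erase b := by
            refine Finset.mem_erase.2 ⟨?_, hS⟩
            rintro rfl
            exact (hP.ssubset hPb hBP).2 hSB
          exact ⟨hSe, hpu S hSe B hBP hSB⟩
      rw [hset]
      refine Finset.prod_congr rfl fun S hS => ?_
      have hSf := reps_subset _ _ hS
      rw [← hset, Finset.mem_filter] at hSf
      have hch : children (H.filter (· ⊆ B)) S = children H S := by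
        refine children_congr fun U hU => ?_
        rw [Finset.mem_filter, and_iff_left]
        exact hU.subset.trans (hSf.2 ▸ (hp S hSf.1).2)
      have hl := len_eq_mul (p := p) (σ := permB φ) hinv (fun S hS => ?_) hSf.1
      · rw [hch, hl, hSf.2, pow_mul]
      · exact hpu _ ((hinv S).2 hS) _ ((hPφ _).2 (hp S hS).1) (permB_subset_permB.2 (hp S hS).2)
    · intro S hS
      exact hpu _ ((hinv S).2 hS) _ ((hPφ _).2 (hp S hS).1) (permB_subset_permB.2 (hp S hS).2)
    · exact fun S hS => (hp S hS).1
    · exact fun S _ => val_children_permB hcol hHφ a S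

/-- The sum over the invariant hierarchies on `b` with an arbitrary series at the root. -/
def rootSum (a f : SymC) (φ : Perm X) (col : X → Fin 2) (b : Finset X) : ℂ :=
  ∑ H ∈ hiers φ b, val (permB φ) (colB col) (children H b) f * hierWeight a φ col H (H.erase b)

open Classical in
/-- The sum over hierarchies, organised by the partition into the children of the root. -/
lemma rootSum_eq {φ : Perm X} {b : Finset X} (hφ : PermInv φ b) (hb : 2 ≤ b.card) (a : SymC)
    {col : X → Fin 2} (hcol : ∀ x, col (φ x) = col x) (f : SymC) :
    rootSum a f φ col b = ∑ P ∈ (parts φ b).filter (fun P => b ∉ P),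
      val (permB φ) (colB col) P f *
        ∏ B ∈ reps (permB φ) P, hierSum a (φ ^ len (permB φ) B) col B := by
  rw [rootSum, ← Finset.sum_fiberwise_of_maps_to (t := (parts φ b).filter (fun P => b ∉ P))
    (g := fun H => children H b)]
  · refine Finset.sum_congr rfl fun P hP => ?_
    obtain ⟨hP, hPb⟩ := Finset.mem_filter.1 hP
    rw [← sum_hiers_children hφ hb hP hPb a hcol, Finset.mul_sum]
    refine Finset.sum_congr rfl fun H hH => ?_
    rw [(Finset.mem_filter.1 hH).2]
  · intro H hH
    obtain ⟨hH, hHφ⟩ := mem_hiers.1 hH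
    rw [Finset.mem_filter, mem_parts]
    exact ⟨⟨hH.isPart_children hb, permInv_children hHφ hφ⟩,
      fun h => absurd rfl (mem_children.1 h).1.ne⟩

/-- The root is an orbit of its own, so that its factor can be separated from the weight. -/
lemma hierSum_eq_rootSum {φ : Perm X} {b : Finset X} (hφ : PermInv φ b) (hb : 2 ≤ b.card)
    (a : SymC) (col : X → Fin 2) :
    hierSum a φ col b = rootSum a a φ col b := by
  have hfix : permB φ b = b := permB_eq_self_iff.2 hφ
  have hl : len (permB φ) b = 1 :=
    Nat.dvd_one.1 ((pow_apply_eq_iff (permB φ) b 1).1 (by rw [pow_one]; exact hfix))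
  refine Finset.sum_congr rfl fun H hH => ?_
  obtain ⟨hH, hHφ⟩ := mem_hiers.1 hH
  have hinv : PermInv (permB φ) (H.erase b) := by
    intro S
    rw [Finset.mem_erase, Finset.mem_erase, hHφ S]
    refine and_congr_left fun _ => not_congr ?_
    conv_lhs => rw [← hfix]
    exact (permB φ).injective.eq_iff
  have hrep : rep (permB φ) b = b :=
    ((rep_sameCycle (permB φ) b).symm.eq_of_left hfix).symm
  have h1 : reps (permB φ) H = insert b (reps (permB φ) (H.erase b)) := by
    ext S
    rw [Finset.mem_insert, mem_reps, mem_reps, Finset.mem_erase]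
    by_cases hS : S = b
    · subst hS
      simp [hrep, hH.top hb]
    · simp [hS]
  rw [hierWeight, h1, Finset.prod_insert, hl, pow_one, hierWeight]
  intro h
  exact (Finset.mem_erase.1 (reps_subset _ _ h)).1 rfl

lemma hierSum_of_card_lt_two (a : SymC) (φ : Perm X) (col : X → Fin 2) {b : Finset X}
    (hb : b.card < 2) : hierSum a φ col b = 1 := by
  have h : hiers φ b = {∅} := by
    ext H
    rw [mem_hiers, Finset.mem_singleton]
    constructor
    · rintro ⟨hH, -⟩
      refine Finset.eq_empty_of_forall_notMem fun S hS => ?_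
      have := Finset.card_le_card (hH.subset S hS)
      have := hH.two_le S hS
      omega
    · rintro rfl
      exact ⟨⟨by simp, by simp, fun h => by omega, by simp⟩, fun S => by simp⟩
  rw [hierSum, h, Finset.sum_singleton, hierWeight]
  rfl

/-- A series without terms of degree one vanishes on a set with one element. -/
lemma val_eq_zero_of_card_eq_one {Y : Type*} [Finite Y] {f : SymC}
    (hf : ∀ i, coeff (Finsupp.single (i, 1) 1) f = 0) {φ : Perm Y} {col : Y → Fin 2} {S : Finset Y}
    (hS : PermInv φ S) (h1 : S.card = 1) : val φ col S f = 0 := by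
  obtain ⟨x, rfl⟩ := Finset.card_eq_one.1 h1
  rw [val, orbitType_singleton (by simpa using (hS x).2 (by simp)), sval, hf, mul_zero]

open Classical in
/-- For a series without terms of degree one, the partition with a single block does not
contribute, so that every partition which does is the one into the children of a root. -/
lemma sum_parts_filter {f : SymC} (hf : ∀ i, coeff (Finsupp.single (i, 1) 1) f = 0) {φ : Perm X}
    {col : X → Fin 2} {b : Finset X} (c : Finset (Finset X) → ℂ) :
    ∑ P ∈ parts φ b, val (permB φ) (colB col) P f * c P =
      ∑ P ∈ (parts φ b).filter (fun P => b ∉ P), val (permB φ) (colB col) P f * c P := by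
  symm
  apply Finset.sum_subset (Finset.filter_subset _ _)
  intro P hP hP'
  rw [Finset.mem_filter, not_and, not_not] at hP'
  have hPb := hP' hP
  obtain ⟨hP, hPφ⟩ := mem_parts.1 hP
  have : P = {b} := by
    refine Finset.Subset.antisymm (fun B hB => ?_) (by simpa using hPb)
    rw [Finset.mem_singleton]
    exact hP.eq_of_subset hB hPb (hP.nonempty B hB) subset_rfl (hP.subset B hB)
  rw [val_eq_zero_of_card_eq_one hf hPφ (by rw [this, Finset.card_singleton]), zero_mul]

/-- The class function of the fixed point `g` of `g ↦ p_1^{(1)} + a ∘ g` counts hierarchies. -/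
theorem val_fixedPoint {a g : SymC} (ha : ∀ i, coeff (Finsupp.single (i, 1) 1) a = 0)
    (hgu : IsUnital g) (hg : g = psum 0 1 + plethysm a g) {col : X → Fin 2} (N : ℕ) :
    ∀ (φ : Perm X) (_ : ∀ x, col (φ x) = col x) (b : Finset X) (_ : PermInv φ b)
      (_ : b.Nonempty) (_ : b.card ≤ N),
      val φ col b (plethysmGen g (colB col b)) = hierSum a φ col b := by
  classical
  induction N with
  | zero =>
    intro φ _ b _ hne hN
    have := hne.card_pos
    omega
  | succ N ih =>
    intro φ hcol b hb hne hN
    by_cases h2 : 2 ≤ b.card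
    · have hns : ¬ ∃ x, b = {x} := by
        rintro ⟨x, rfl⟩
        simp at h2
      rw [colB_of_not hns, plethysmGen, if_pos rfl, hierSum_eq_rootSum hb h2 a col,
        rootSum_eq hb h2 a hcol]
      conv_lhs => rw [hg]
      rw [val, sval_add, ← val, ← val, val_psum_one hb, if_neg (fun ⟨x, hx, _⟩ => hns ⟨x, hx⟩),
        zero_add, val_plethysm hcol hgu.const hgu.coeff_one hb, sum_parts_filter ha]
      refine Finset.sum_congr rfl fun P hP => ?_
      obtain ⟨hP, hPb⟩ := Finset.mem_filter.1 hP
      obtain ⟨hP, hPφ⟩ := mem_parts.1 hP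
      congr 1
      refine Finset.prod_congr rfl fun B hB => ?_
      have hB := reps_subset _ _ hB
      have := Finset.card_lt_card (hP.ssubset hPb hB)
      exact ih _ (col_pow hcol _) B (permInv_pow_len φ B) (hP.nonempty B hB) (by omega)
    · rw [hierSum_of_card_lt_two a φ col (not_le.1 h2)]
      have := hne.card_pos
      obtain ⟨x, rfl⟩ := Finset.card_eq_one.1 (by omega : b.card = 1)
      rw [colB_singleton, plethysmGen]
      split_ifs with h
      · rw [val, orbitType_singleton (by simpa using (hb x).2 (by simp)), h, sval, hgu.coeff_zero]
        simp [zfac]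
      · rw [val_psum_one hb, if_pos ⟨x, rfl, rfl⟩]

/-- The class function of `f ∘ g` as a sum over hierarchies, with `f` at the root. -/
theorem val_plethysm_eq_rootSum {a g f : SymC} (ha : ∀ i, coeff (Finsupp.single (i, 1) 1) a = 0)
    (hf : ∀ i, coeff (Finsupp.single (i, 1) 1) f = 0)
    (hgu : IsUnital g) (hg : g = psum 0 1 + plethysm a g) {φ : Perm X} {col : X → Fin 2}
    (hcol : ∀ x, col (φ x) = col x) {b : Finset X} (hb : PermInv φ b) (h2 : 2 ≤ b.card) :
    val φ col b (plethysm f g) = rootSum a f φ col b := by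
  classical
  rw [val_plethysm hcol hgu.const hgu.coeff_one hb, sum_parts_filter hf, rootSum_eq hb h2 a hcol]
  refine Finset.sum_congr rfl fun P hP => ?_
  obtain ⟨hP, hPb⟩ := Finset.mem_filter.1 hP
  obtain ⟨hP, hPφ⟩ := mem_parts.1 hP
  congr 1
  exact Finset.prod_congr rfl fun B hB => val_fixedPoint ha hgu hg _ _ (col_pow hcol _) B
    (permInv_pow_len φ B) (hP.nonempty B (reps_subset _ _ hB)) le_rfl

open Classical in
/-- The class function of `e_2 ∘ (g - p_1^{(1)})` as a sum over the hierarchies with no point among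
the children of the root. -/
theorem val_plethysm_e2 {a g : SymC} (ha : ∀ i, coeff (Finsupp.single (i, 1) 1) a = 0)
    (hgu : IsUnital g) (hg : g = psum 0 1 + plethysm a g) {φ : Perm X} {col : X → Fin 2}
    (hcol : ∀ x, col (φ x) = col x) {b : Finset X} (hb : PermInv φ b) (h2 : 2 ≤ b.card) :
    val φ col b (plethysm e2 (g - psum 0 1)) =
      ∑ H ∈ (hiers φ b).filter (fun H => ∀ B ∈ children H b, 2 ≤ B.card),
        val (permB φ) (colB col) (children H b) e2 * hierWeight a φ col H (H.erase b) := by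
  have he2 : ∀ i, coeff (Finsupp.single (i, 1) 1) e2 = 0 := by
    intro i
    have h1 : (Finsupp.single (i, 1) 1 : Fin 2 × ℕ+ →₀ ℕ) ≠ Finsupp.single (0, 2) 1 := by
      intro h
      have := Finsupp.single_left_injective one_ne_zero h
      simp at this
    have h2 : (Finsupp.single (i, 1) 1 : Fin 2 × ℕ+ →₀ ℕ) ≠ Finsupp.single (0, 1) 2 := by
      intro h
      have := congrArg Finsupp.degree h
      simp at this
    rw [e2, psum, psum, X_pow_eq, MvPowerSeries.X, map_smul, map_sub, coeff_monomial,
      coeff_monomial, if_neg h1, if_neg h2, sub_zero, smul_zero]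
  have hz : constantCoeff (g - psum 0 1) = 0 := by
    rw [map_sub, hgu.const, psum, constantCoeff_X, sub_zero]
  have hz1 : coeff (Finsupp.single (1, 1) 1) (g - psum 0 1) = 0 := by
    rw [map_sub, hgu.coeff_one, psum, coeff_X, if_neg, sub_zero]
    intro h
    have := Finsupp.single_left_injective one_ne_zero h
    simp at this
  have hz0 : coeff (Finsupp.single (0, 1) 1) (g - psum 0 1) = 0 := by
    rw [map_sub, hgu.coeff_zero, psum, coeff_X, if_pos rfl, sub_self]
  have hW : ∀ P ∈ (parts φ b).filter (fun P => b ∉ P), val (permB φ) (colB col) P e2 *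
      ∏ B ∈ reps (permB φ) P, val (φ ^ len (permB φ) B) col B
        (plethysmGen (g - psum 0 1) (colB col B)) =
      if ∀ B ∈ P, 2 ≤ B.card then val (permB φ) (colB col) P e2 *
        ∏ B ∈ reps (permB φ) P, hierSum a (φ ^ len (permB φ) B) col B else 0 := by
    intro P hP
    obtain ⟨hP, hPb⟩ := Finset.mem_filter.1 hP
    obtain ⟨hP, hPφ⟩ := mem_parts.1 hP
    split_ifs with h
    · congr 1
      refine Finset.prod_congr rfl fun B hB => ?_
      have hB := reps_subset _ _ hB
      have hns : ¬ ∃ x, B = {x} := by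
        rintro ⟨x, rfl⟩
        simpa using h _ hB
      rw [← val_fixedPoint ha hgu hg _ _ (col_pow hcol _) B (permInv_pow_len φ B)
        (hP.nonempty B hB) le_rfl, colB_of_not hns, plethysmGen, if_pos rfl, plethysmGen,
        if_pos rfl, val, sval_sub, ← val, ← val, val_psum_one (permInv_pow_len φ B),
        if_neg (fun ⟨x, hx, _⟩ => hns ⟨x, hx⟩), sub_zero]
    · push Not at h
      obtain ⟨B, hB, hB2⟩ := h
      have := (hP.nonempty B hB).card_pos
      obtain ⟨x, rfl⟩ := Finset.card_eq_one.1 (by omega : B.card = 1)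
      by_cases hx : col x = 0
      · rw [Finset.prod_eq_zero (rep_mem_reps hPφ hB), mul_zero]
        obtain ⟨k, hk⟩ := (rep_sameCycle (permB φ) {x}).symm.exists_nat_pow_eq
        have h1 : rep (permB φ) {x} = {(φ ^ k) x} := by
          rw [← hk, permB_pow]
          simp
        rw [h1, colB_singleton, col_pow hcol, hx, plethysmGen, if_pos rfl, val,
          orbitType_singleton
            (by simpa using (permInv_pow_len φ {(φ ^ k) x} ((φ ^ k) x)).2 (by simp)),
          col_pow hcol, hx, sval, hz0, mul_zero]
      · have hv : val (permB φ) (colB col) P e2 = 0 := by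
          have hcw : cwt 1 (orbitType (permB φ) (colB col) P) ≠ 0 := by
            rw [cwt_orbitType (colB_permB hcol) hPφ]
            refine (Finset.card_pos.2 ⟨{x}, ?_⟩).ne'
            rw [Finset.mem_filter, colB_singleton]
            refine ⟨hB, ?_⟩
            generalize col x = j at hx ⊢
            revert j; decide
          rw [val, sval, e2, psum, psum, X_pow_eq, MvPowerSeries.X, map_smul, map_sub,
            coeff_monomial, coeff_monomial, if_neg, if_neg, sub_zero, smul_zero, mul_zero]
          · intro h
            rw [h] at hcw
            simp [cwt] at hcw
          · intro h
            rw [h] at hcw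
            simp [cwt] at hcw
        rw [hv, zero_mul]
  rw [val_plethysm hcol hz hz1 hb, sum_parts_filter he2, Finset.sum_congr rfl hW,
    ← Finset.sum_filter]
  symm
  rw [← Finset.sum_fiberwise_of_maps_to (t := ((parts φ b).filter
      (fun P => b ∉ P)).filter fun P => ∀ B ∈ P, 2 ≤ B.card)
    (g := fun H => children H b)]
  · refine Finset.sum_congr rfl fun P hP => ?_
    obtain ⟨hP, hP2⟩ := Finset.mem_filter.1 hP
    obtain ⟨hP, hPb⟩ := Finset.mem_filter.1 hP
    rw [← sum_hiers_children hb h2 hP hPb a hcol, Finset.mul_sum]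
    refine Finset.sum_congr ?_ fun H hH => ?_
    · ext H
      simp only [Finset.mem_filter]
      constructor
      · rintro ⟨⟨h1, -⟩, h3⟩
        exact ⟨h1, h3⟩
      · rintro ⟨h1, rfl⟩
        exact ⟨⟨h1, hP2⟩, rfl⟩
    · rw [(Finset.mem_filter.1 hH).2]
  · intro H hH
    obtain ⟨hH, hH2⟩ := Finset.mem_filter.1 hH
    obtain ⟨hH, hHφ⟩ := mem_hiers.1 hH
    rw [Finset.mem_filter, Finset.mem_filter, mem_parts]
    exact ⟨⟨⟨hH.isPart_children h2, permInv_children hHφ hb⟩,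
      fun h => absurd rfl (mem_children.1 h).1.ne⟩, hH2⟩

end glue

end

/-! ### Sides of flags in a tree -/

section graph

variable {N : Type*} {G : SimpleGraph N}

/-- For neighbours `a`, `b` in a tree, the nodes on the side of `b`. -/
def graphSide (G : SimpleGraph N) (a b : N) : Set N :=
  {x | ∃ p : G.Walk x a, p.IsPath ∧ b ∈ p.support}

lemma mem_graphSide_iff (hG : G.IsTree) {a b : N} (h : G.Adj a b) (x : N) :
    x ∈ graphSide G a b ↔ x ∉ graphSide G b a := by
  constructor
  · rintro ⟨p, hp, hb⟩ ⟨q, hq, ha⟩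
    exact hG.isAcyclic.ne_mem_support_of_support_of_adj_of_isPath hp hq h hb ha
  · intro hx
    obtain ⟨p, hp, -⟩ := hG.existsUnique_path x a
    obtain ⟨q, hq, -⟩ := hG.existsUnique_path x b
    refine ⟨p, hp, hG.isAcyclic.mem_support_of_ne_mem_support_of_adj_of_isPath hp hq h ?_⟩
    exact fun ha => hx ⟨q, hq, ha⟩

lemma exists_mem_graphSide (hG : G.IsTree) {a x : N} (h : x ≠ a) :
    ∃ b, G.Adj a b ∧ x ∈ graphSide G a b := by
  obtain ⟨p, hp, -⟩ := hG.existsUnique_path x a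
  exact ⟨p.penultimate, (p.adj_penultimate (SimpleGraph.Walk.not_nil_of_ne h)).symm, p, hp,
    p.getVert_mem_support _⟩

lemma eq_of_mem_graphSide (hG : G.IsTree) {a b b' x : N} (h : G.Adj a b) (h' : G.Adj a b')
    (hb : x ∈ graphSide G a b) (hb' : x ∈ graphSide G a b') : b = b' := by
  obtain ⟨p, hp, hb⟩ := hb
  obtain ⟨q, hq, hb'⟩ := hb'
  rw [(hG.existsUnique_path x a).unique hq hp] at hb'
  rw [hG.isAcyclic.eq_penultimate_of_adj_end hp h hb,
    hG.isAcyclic.eq_penultimate_of_adj_end hp h' hb']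

lemma not_mem_graphSide_self {a b : N} (h : G.Adj a b) : a ∉ graphSide G a b := by
  rintro ⟨p, hp, hb⟩
  rw [SimpleGraph.Walk.isPath_iff_nil] at hp
  rw [SimpleGraph.Walk.nil_iff_support_eq.1 hp, List.mem_singleton] at hb
  exact h.ne hb.symm

lemma of_reachable {K : N → Prop} (hK : ∀ x y, G.Adj x y → K x → K y) {x y : N}
    (h : G.Reachable x y) (hx : K x) : K y := by
  obtain ⟨p⟩ := h
  induction p with
  | nil => exact hx
  | cons h p ih => exact ih (hK _ _ h hx)

end graph

/-- The sides of the flags in a finite tree: `side f` is the set of the vertices which are reached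
from the vertex of `f` through `f`. The tree is given by its flags, the vertex of each of them,
and the involution which exchanges the flags of an edge. -/
structure FlagSides {F V : Type*} (vert : F → V) (inv : F → F) (side : F → Set V) : Prop where
  inv_inv : ∀ f, inv (inv f) = f
  leaf : ∀ f, inv f = f → side f = ∅
  compl : ∀ f, inv f ≠ f → ∀ w, w ∈ side (inv f) ↔ w ∉ side f
  vert_not_mem : ∀ f, vert f ∉ side f
  exists_flag : ∀ u w, u ≠ w → ∃ f, vert f = u ∧ w ∈ side f
  unique : ∀ f f' w, vert f = vert f' → w ∈ side f → w ∈ side f' → f = f'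

section incidence

variable {F : Type} {part : Setoid F} {inv : F → F}

lemma incidenceGraph_adj_inl_inr {v : Quotient part} {f : F} :
    (incidenceGraph part inv).Adj (Sum.inl v) (Sum.inr f) ↔ Quotient.mk part f = v := by
  rw [incidenceGraph, SimpleGraph.fromRel_adj]
  simp

lemma incidenceGraph_not_adj_inl_inl {v w : Quotient part} :
    ¬ (incidenceGraph part inv).Adj (Sum.inl v) (Sum.inl w) := by
  rw [incidenceGraph, SimpleGraph.fromRel_adj]
  simp

lemma incidenceGraph_adj_inr_inr (hinv : ∀ f, inv (inv f) = f) {f f' : F} :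
    (incidenceGraph part inv).Adj (Sum.inr f) (Sum.inr f') ↔ inv f ≠ f ∧ f' = inv f := by
  rw [incidenceGraph, SimpleGraph.fromRel_adj]
  simp only [ne_eq, Sum.inr.injEq]
  constructor
  · rintro ⟨h, rfl | rfl⟩
    · exact ⟨fun h' => h h'.symm, rfl⟩
    · rw [hinv]
      exact ⟨fun h' => h h'.symm, rfl⟩
  · rintro ⟨h, rfl⟩
    exact ⟨fun h' => h h'.symm, Or.inl rfl⟩

/-- The vertices beyond a flag. -/
def flagSide (part : Setoid F) (inv : F → F) (f : F) : Set (Quotient part) :=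
  {w | Sum.inl w ∈ graphSide (incidenceGraph part inv) (Sum.inl (Quotient.mk part f)) (Sum.inr f)}

/-- The vertices beyond a flag are those beyond its edge; beyond a leaf there are none. -/
lemma mem_flagSide_iff (hG : (incidenceGraph part inv).IsTree) (hinv : ∀ f, inv (inv f) = f)
    {f : F} {w : Quotient part} : w ∈ flagSide part inv f ↔
      inv f ≠ f ∧
        Sum.inl w ∈ graphSide (incidenceGraph part inv) (Sum.inr f) (Sum.inr (inv f)) := by
  have h1 : (incidenceGraph part inv).Adj (Sum.inl (Quotient.mk part f)) (Sum.inr f) :=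
    incidenceGraph_adj_inl_inr.2 rfl
  rw [flagSide, Set.mem_ofPred_eq, mem_graphSide_iff hG h1]
  constructor
  · intro h
    obtain ⟨b, hb, hwb⟩ := exists_mem_graphSide hG (a := Sum.inr f) (x := Sum.inl w) (by simp)
    rcases b with v | f'
    · obtain rfl := incidenceGraph_adj_inl_inr.1 hb.symm
      exact absurd hwb h
    · obtain ⟨h2, rfl⟩ := (incidenceGraph_adj_inr_inr hinv).1 hb
      exact ⟨h2, hwb⟩
  · rintro ⟨h2, h3⟩ h4
    have := eq_of_mem_graphSide hG h1.symm ((incidenceGraph_adj_inr_inr hinv).2 ⟨h2, rfl⟩) h4 h3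
    simp at this

lemma flagSides_of_isTree (hG : (incidenceGraph part inv).IsTree) (hinv : ∀ f, inv (inv f) = f) :
    FlagSides (Quotient.mk part) inv (flagSide part inv) where
  inv_inv := hinv
  leaf f hf := by
    ext w
    rw [mem_flagSide_iff hG hinv]
    simp [hf]
  compl f hf w := by
    have h1 : (incidenceGraph part inv).Adj (Sum.inr f) (Sum.inr (inv f)) :=
      (incidenceGraph_adj_inr_inr hinv).2 ⟨hf, rfl⟩
    rw [mem_flagSide_iff hG hinv, mem_flagSide_iff hG hinv, hinv,
      mem_graphSide_iff hG h1.symm, and_iff_right (Ne.symm hf), and_iff_right hf]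
  vert_not_mem f := not_mem_graphSide_self (incidenceGraph_adj_inl_inr.2 rfl)
  exists_flag u w h := by
    obtain ⟨b, hb, hwb⟩ := exists_mem_graphSide hG (a := Sum.inl u) (x := Sum.inl w)
      (fun h' => h (Sum.inl_injective h').symm)
    rcases b with v | f
    · exact absurd hb incidenceGraph_not_adj_inl_inl
    · obtain rfl := incidenceGraph_adj_inl_inr.1 hb
      exact ⟨f, rfl, hwb⟩
  unique f f' w h hw hw' := by
    have h' : Sum.inl w ∈ graphSide (incidenceGraph part inv) (Sum.inl (Quotient.mk part f))
        (Sum.inr f') := by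
      rw [h]
      exact hw'
    exact Sum.inr_injective (eq_of_mem_graphSide hG (incidenceGraph_adj_inl_inr.2 rfl)
      (incidenceGraph_adj_inl_inr.2 h.symm) hw h')

end incidence

namespace FlagSides

variable {F V : Type*} {vert : F → V} {inv : F → F} {side : F → Set V}
  (hs : FlagSides vert inv side)

include hs

lemma inv_ne {f : F} {w : V} (h : w ∈ side f) : inv f ≠ f := by
  intro h'
  rw [hs.leaf f h'] at h
  exact h

lemma vert_inv_mem {f : F} (h : inv f ≠ f) : vert (inv f) ∈ side f := by
  by_contra h'
  exact hs.vert_not_mem (inv f) ((hs.compl f h _).2 h')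

lemma side_subset {f h : F} (hf : inv f ≠ f) (hv : vert h = vert (inv f)) (hne : h ≠ inv f) :
    side h ⊆ side f := by
  intro w hw
  by_contra hw'
  exact hne (hs.unique h (inv f) w hv hw ((hs.compl f hf w).2 hw'))

/-- The flags at two vertices in the direction of each other. -/
lemma exists_facing {u w : V} (h : u ≠ w) :
    ∃ x y, vert x = u ∧ vert y = w ∧ vert y ∈ side x ∧ vert x ∈ side y := by
  obtain ⟨x, hx, hwx⟩ := hs.exists_flag u w h
  obtain ⟨y, hy, huy⟩ := hs.exists_flag w u h.symm
  exact ⟨x, y, hx, hy, hy ▸ hwx, hx ▸ huy⟩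

variable [Finite V]

lemma side_ncard_lt {f h : F} (hf : inv f ≠ f) (hv : vert h = vert (inv f)) (hne : h ≠ inv f) :
    (side h).ncard < (side f).ncard := by
  refine Set.ncard_lt_ncard ⟨hs.side_subset hf hv hne, fun hsub => ?_⟩ (Set.toFinite _)
  have := hsub (hs.vert_inv_mem hf)
  rw [← hv] at this
  exact hs.vert_not_mem h this

/-- The ends of an edge other than that of `f` are on the same side of `f`. -/
lemma vert_inv_mem_of_vert_mem {f h : F} (hh : vert h ∈ side f) :
    h = inv f ∨ vert (inv h) ∈ side f := by
  induction hn : (side f).ncard using Nat.strong_induction_on generalizing f with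
  | _ n ih =>
    have hf := hs.inv_ne hh
    by_cases h1 : vert h = vert (inv f)
    · by_cases h2 : h = inv f
      · exact Or.inl h2
      · right
        by_cases h3 : inv h = h
        · rwa [h3]
        · exact hs.side_subset hf h1 h2 (hs.vert_inv_mem h3)
    · obtain ⟨f2, hf2, hhf2⟩ := hs.exists_flag _ _ (Ne.symm h1)
      have hne : f2 ≠ inv f := by
        rintro rfl
        exact (hs.compl f hf _).1 hhf2 hh
      have hlt := hs.side_ncard_lt hf hf2 hne
      rw [hn] at hlt
      right
      rcases ih _ hlt hhf2 rfl with h2 | h2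
      · rw [h2, hs.inv_inv, hf2]
        exact hs.vert_inv_mem hf
      · exact hs.side_subset hf hf2 hne h2

/-- If `x` points from `u` to `w` and `y` points from `w` to `u`, then every vertex is beyond one
of them. -/
lemma mem_side_of_not_mem {x y : F} (hx : vert y ∈ side x) (hy : vert x ∈ side y) {z : V}
    (hz : z ∉ side x) : z ∈ side y := by
  induction hn : (side x).ncard using Nat.strong_induction_on generalizing x with
  | _ n ih =>
    have hxn := hs.inv_ne hx
    by_cases h1 : vert (inv x) = vert y
    · have : vert x ∈ side (inv x) := (hs.compl x hxn _).2 (hs.vert_not_mem x)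
      rw [hs.unique y (inv x) _ h1.symm hy this]
      exact (hs.compl x hxn _).2 hz
    · obtain ⟨x2, hx2, hyx2⟩ := hs.exists_flag _ _ h1
      have hne : x2 ≠ inv x := by
        rintro rfl
        exact (hs.compl x hxn _).1 hyx2 hx
      have hlt := hs.side_ncard_lt hxn hx2 hne
      rw [hn] at hlt
      refine ih _ hlt hyx2 ?_ ?_ rfl
      · rw [hx2]
        rcases hs.vert_inv_mem_of_vert_mem hy with h | h
        · rw [h, hs.inv_inv] at h1
          exact absurd rfl h1
        · exact h
      · exact fun h => hz (hs.side_subset hxn hx2 hne h)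

lemma subset_of_flagSides {side' : F → Set V} (hs' : FlagSides vert inv side') (f : F) :
    side f ⊆ side' f := by
  induction hn : (side f).ncard using Nat.strong_induction_on generalizing f with
  | _ n ih =>
    intro w hw
    have hf := hs.inv_ne hw
    by_cases h1 : w = vert (inv f)
    · rw [h1]
      exact hs'.vert_inv_mem hf
    · obtain ⟨f2, hf2, hwf2⟩ := hs.exists_flag _ _ (Ne.symm h1)
      have hne : f2 ≠ inv f := by
        rintro rfl
        exact (hs.compl f hf _).1 hwf2 hw
      have hlt := hs.side_ncard_lt hf hf2 hne
      rw [hn] at hlt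
      exact hs'.side_subset hf hf2 hne (ih _ hlt f2 rfl hwf2)

/-- The sides are determined by the tree. -/
lemma eq_of_flagSides {side' : F → Set V} (hs' : FlagSides vert inv side') : side = side' :=
  funext fun f => Set.Subset.antisymm (hs.subset_of_flagSides hs' f) (hs'.subset_of_flagSides hs f)

end FlagSides

/-- The sides of the flags show that the incidence graph is a tree. -/
lemma FlagSides.isTree {F : Type} {part : Setoid F} {inv : F → F} {side : F → Set (Quotient part)}
    (hs : FlagSides (Quotient.mk part) inv side) [Finite (Quotient part)]
    (hne : Nonempty (Quotient part)) : (incidenceGraph part inv).IsTree := by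
  -- Walking through `f` and on to the next flag in the direction of `w` makes the side smaller.
  have hreach : ∀ n : ℕ, ∀ f w, (side f).ncard = n → w ∈ side f →
      (incidenceGraph part inv).Reachable (Sum.inr f) (Sum.inl w) := by
    intro n
    induction n using Nat.strong_induction_on with
    | _ n ih =>
      intro f w hn hw
      have hf := hs.inv_ne hw
      have h1 : (incidenceGraph part inv).Reachable (Sum.inr f)
          (Sum.inl (Quotient.mk part (inv f))) :=
        ((incidenceGraph_adj_inr_inr hs.inv_inv).2 ⟨hf, rfl⟩).reachable.trans
          (incidenceGraph_adj_inl_inr.2 rfl).symm.reachable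
      by_cases h2 : w = Quotient.mk part (inv f)
      · rwa [h2]
      · obtain ⟨f2, hf2, hwf2⟩ := hs.exists_flag _ _ (Ne.symm h2)
        have hne : f2 ≠ inv f := by
          rintro rfl
          exact (hs.compl f hf _).1 hwf2 hw
        have hlt := hs.side_ncard_lt hf hf2 hne
        rw [hn] at hlt
        exact (h1.trans (incidenceGraph_adj_inl_inr.2 hf2).reachable).trans
          (ih _ hlt f2 w rfl hwf2)
  constructor
  · have hvv : ∀ v w : Quotient part,
        (incidenceGraph part inv).Reachable (Sum.inl v) (Sum.inl w) := by
      intro v w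
      by_cases h : v = w
      · rw [h]
      · obtain ⟨f, hf, hw⟩ := hs.exists_flag _ _ h
        exact (incidenceGraph_adj_inl_inr.2 hf).reachable.trans (hreach _ f w rfl hw)
    have hroot : ∀ x : Quotient part ⊕ F, ∃ v : Quotient part,
        (incidenceGraph part inv).Reachable x (Sum.inl v) := by
      rintro (v | f)
      · exact ⟨v, SimpleGraph.Reachable.refl _⟩
      · exact ⟨_, (incidenceGraph_adj_inl_inr.2 rfl).symm.reachable⟩
    have : Nonempty (Quotient part ⊕ F) := hne.map Sum.inl
    refine SimpleGraph.Connected.mk fun x y => ?_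
    obtain ⟨v, hv⟩ := hroot x
    obtain ⟨w, hw⟩ := hroot y
    exact (hv.trans (hvv v w)).trans hw.symm
  · rw [SimpleGraph.isAcyclic_iff_forall_adj_isBridge]
    -- The edge from the vertex of `f` to `f` is a bridge: the set `K` of the nodes beyond it is
    -- closed under the adjacency of the other edges.
    have hA : ∀ f, (incidenceGraph part inv).IsBridge
        s(Sum.inl (Quotient.mk part f), Sum.inr f) := by
      intro f
      rw [SimpleGraph.isBridge_iff]
      intro h
      let K : Quotient part ⊕ F → Prop :=
        Sum.elim (fun w => w ∈ side f) fun h => h = f ∨ Quotient.mk part h ∈ side f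
      have : K (Sum.inl (Quotient.mk part f)) :=
        of_reachable (K := K) ?_ h.symm (Or.inl rfl : K (Sum.inr f))
      · exact hs.vert_not_mem f this
      · rintro (v | h) (w | h') hadj hx
        · exact absurd (SimpleGraph.deleteEdges_adj.1 hadj).1 incidenceGraph_not_adj_inl_inl
        · obtain rfl := incidenceGraph_adj_inl_inr.1 (SimpleGraph.deleteEdges_adj.1 hadj).1
          exact Or.inr hx
        · obtain ⟨h1, h2⟩ := SimpleGraph.deleteEdges_adj.1 hadj
          obtain rfl := incidenceGraph_adj_inl_inr.1 h1.symm
          rcases hx with rfl | hx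
          · exact absurd (by simp [Sym2.eq_swap]) h2
          · exact hx
        · obtain ⟨h1, h2⟩ := (incidenceGraph_adj_inr_inr hs.inv_inv).1
            (SimpleGraph.deleteEdges_adj.1 hadj).1
          subst h2
          rcases hx with rfl | hx
          · exact Or.inr (hs.vert_inv_mem h1)
          · rcases hs.vert_inv_mem_of_vert_mem hx with h3 | h3
            · rw [h3, hs.inv_inv]
              exact Or.inl rfl
            · exact Or.inr h3
    -- The edge between the two flags of an edge of the tree is a bridge for the same reason.
    have hB : ∀ f, inv f ≠ f → (incidenceGraph part inv).IsBridge
        s(Sum.inr f, Sum.inr (inv f)) := by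
      intro f hf
      rw [SimpleGraph.isBridge_iff]
      intro h
      let K : Quotient part ⊕ F → Prop :=
        Sum.elim (fun w => w ∈ side f) fun h => Quotient.mk part h ∈ side f
      have : K (Sum.inr f) :=
        of_reachable (K := K) ?_ h.symm (hs.vert_inv_mem hf : K (Sum.inr (inv f)))
      · exact hs.vert_not_mem f this
      · rintro (v | h) (w | h') hadj hx
        · exact absurd (SimpleGraph.deleteEdges_adj.1 hadj).1 incidenceGraph_not_adj_inl_inl
        · obtain rfl := incidenceGraph_adj_inl_inr.1 (SimpleGraph.deleteEdges_adj.1 hadj).1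
          exact hx
        · obtain rfl := incidenceGraph_adj_inl_inr.1 (SimpleGraph.deleteEdges_adj.1 hadj).1.symm
          exact hx
        · obtain ⟨h1, h2⟩ := SimpleGraph.deleteEdges_adj.1 hadj
          obtain ⟨h3, rfl⟩ := (incidenceGraph_adj_inr_inr hs.inv_inv).1 h1
          rcases hs.vert_inv_mem_of_vert_mem hx with rfl | h4
          · rw [hs.inv_inv] at h2
            exact absurd (by simp [Sym2.eq_swap]) h2
          · exact h4
    rintro (v | f) (w | f') hadj
    · exact absurd hadj incidenceGraph_not_adj_inl_inl
    · obtain rfl := incidenceGraph_adj_inl_inr.1 hadj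
      exact hA f'
    · obtain rfl := incidenceGraph_adj_inl_inr.1 hadj.symm
      rw [Sym2.eq_swap]
      exact hA f
    · obtain ⟨h1, rfl⟩ := (incidenceGraph_adj_inr_inr hs.inv_inv).1 hadj
      exact hB f h1

namespace FlagSides

variable {F V : Type*} [Fintype F] [DecidableEq F] {vert : F → V} {inv : F → F}
  {side : F → Set V} (hs : FlagSides vert inv side)

open Classical in
include hs in
lemma sum_inv (p : F → ℤ) :
    ∑ f ∈ Finset.univ.filter (fun f => inv f ≠ f), p (inv f) =
      ∑ f ∈ Finset.univ.filter (fun f => inv f ≠ f), p f := by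
  have h : ∀ f ∈ Finset.univ.filter (fun f => inv f ≠ f),
      inv f ∈ Finset.univ.filter (fun f => inv f ≠ f) := by
    intro f hf
    rw [Finset.mem_filter] at hf ⊢
    rw [hs.inv_inv]
    exact ⟨Finset.mem_univ _, hf.2.symm⟩
  exact Finset.sum_bij' (fun f _ => inv f) (fun f _ => inv f) h h (fun f _ => hs.inv_inv f)
    (fun f _ => hs.inv_inv f) (fun f _ => rfl)

variable [Fintype V] [DecidableEq V]

open Classical in
include hs in
/-- A moved vertex has exactly one flag in the direction of its image. -/
lemma card_moved (e : V → V) :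
    ((Finset.univ.filter fun f => inv f ≠ f).filter fun f => e (vert f) ∈ side f).card =
      (Finset.univ.filter fun v => e v ≠ v).card := by
  refine Finset.card_bij (fun f _ => vert f) ?_ ?_ ?_
  · intro f hf
    rw [Finset.mem_filter] at hf ⊢
    exact ⟨Finset.mem_univ _, fun h => hs.vert_not_mem f (h ▸ hf.2)⟩
  · intro f hf f' hf' h
    rw [Finset.mem_filter] at hf hf'
    exact hs.unique f f' _ h hf.2 (h ▸ hf'.2)
  · intro v hv
    rw [Finset.mem_filter] at hv
    obtain ⟨f, rfl, hf⟩ := hs.exists_flag _ _ hv.2.symm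
    exact ⟨f, by simp [hf, hs.inv_ne hf], rfl⟩

open Classical in
include hs in
/-- The Lefschetz fixed point formula for an automorphism of a tree: the number of fixed vertices,
minus the number of edges with both flags fixed, plus the number of edges with exchanged flags,
equals `1`. Both sides are compared by counting the flags `f` such that the image of the vertex
of `f` is beyond `f`. -/
theorem lefschetz (eF : Perm F) (eV : Perm V) (hvert : ∀ f, vert (eF f) = eV (vert f))
    (hinv : ∀ f, inv (eF f) = eF (inv f)) (v₀ : V) :
    2 * ((Finset.univ.filter fun v => eV v = v).card : ℤ) =
      2 + (Finset.univ.filter fun f => inv f ≠ f ∧ eF f = f).card -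
        (Finset.univ.filter fun f => inv f ≠ f ∧ eF f = inv f).card := by
  have hcount : ∀ e : V → V, ∑ f ∈ Finset.univ.filter (fun f => inv f ≠ f),
      ((if e (vert f) ∈ side f then 1 else 0) +
        (if e (vert (inv f)) ∈ side (inv f) then 1 else 0) : ℤ) =
      2 * (Finset.univ.filter fun v => e v ≠ v).card := by
    intro e
    rw [Finset.sum_add_distrib, hs.sum_inv fun f => if e (vert f) ∈ side f then (1 : ℤ) else 0,
      ← two_mul, Finset.sum_boole, hs.card_moved e]
  have h1 := hcount fun _ => v₀
  have h2 := hcount eV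
  have h3 : ∀ f ∈ Finset.univ.filter (fun f => inv f ≠ f),
      ((if v₀ ∈ side f then 1 else 0) + (if v₀ ∈ side (inv f) then 1 else 0) : ℤ) = 1 := by
    intro f hf
    simp only [hs.compl f (Finset.mem_filter.1 hf).2]
    by_cases h : v₀ ∈ side f <;> simp [h]
  have h4 : ∀ f ∈ Finset.univ.filter (fun f => inv f ≠ f),
      ((if eV (vert f) ∈ side f then 1 else 0) +
        (if eV (vert (inv f)) ∈ side (inv f) then 1 else 0) : ℤ) =
      1 - (if eF f = f then 1 else 0) + (if eF f = inv f then 1 else 0) := by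
    intro f hf
    have hf := (Finset.mem_filter.1 hf).2
    simp only [hs.compl f hf, ← hvert, ← hinv]
    by_cases h5 : eF f = f
    · rw [h5, if_neg (hs.vert_not_mem f), if_neg (not_not.2 (hs.vert_inv_mem hf)), if_pos rfl,
        if_neg (Ne.symm hf)]
      norm_num
    · by_cases h6 : eF f = inv f
      · rw [h6, hs.inv_inv, if_pos (hs.vert_inv_mem hf), if_pos (hs.vert_not_mem f), if_neg hf,
          if_pos rfl]
        norm_num
      · rw [if_neg h5, if_neg h6]
        have h7 : vert (eF f) ∈ side f ↔ vert (inv (eF f)) ∈ side f := by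
          constructor
          · intro h
            exact (hs.vert_inv_mem_of_vert_mem h).resolve_left h6
          · intro h
            have h8 := (hs.vert_inv_mem_of_vert_mem h).resolve_left fun h' =>
              h5 (by rw [← hs.inv_inv (eF f), h', hs.inv_inv])
            rwa [hs.inv_inv] at h8
        rw [h7]
        by_cases h : vert (inv (eF f)) ∈ side f <;> simp [h]
  rw [Finset.sum_congr rfl h3, Finset.sum_const, nsmul_eq_mul, mul_one] at h1
  rw [Finset.sum_congr rfl h4, Finset.sum_add_distrib, Finset.sum_sub_distrib, Finset.sum_const,
    nsmul_eq_mul, mul_one, h1, Finset.sum_boole, Finset.sum_boole, Finset.filter_filter,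
    Finset.filter_filter] at h2
  have h5 : (Finset.univ.filter fun v => v₀ ≠ v).card + 1 = Fintype.card V := by
    rw [Finset.filter_ne, Finset.card_erase_add_one (Finset.mem_univ _), Finset.card_univ]
  have h6 : (Finset.univ.filter fun v => eV v = v).card +
      (Finset.univ.filter fun v => eV v ≠ v).card = Fintype.card V := by
    rw [Finset.card_filter_add_card_filter_not, Finset.card_univ]
  push_cast [← h6] at h5 h2 ⊢
  zify at h5
  linarith

end FlagSides

/-! ### Sets of leaves beyond a flag -/

/-- A finite tree with leaves labelled by `L`, such that every vertex carries at least three flags;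
`loc l` is the leaf with label `l`. -/
structure LeafTree {F V L : Type*} (vert : F → V) (inv : F → F) (side : F → Set V) (loc : L → F) :
    Prop extends FlagSides vert inv side where
  loc_injective : Function.Injective loc
  loc_iff : ∀ f, inv f = f ↔ ∃ l, loc l = f
  three : ∀ v f g, ∃ h, vert h = v ∧ h ≠ f ∧ h ≠ g

section

variable {F V L : Type*} [Fintype L]

open Classical in
/-- The labels of the leaves which are reached through the flag `f` from its vertex; a leaf is
reached through itself. -/
def leafSet (vert : F → V) (side : F → Set V) (loc : L → F) (f : F) : Finset L :=
  Finset.univ.filter fun l => loc l = f ∨ vert (loc l) ∈ side f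

lemma mem_leafSet {vert : F → V} {side : F → Set V} {loc : L → F} {f : F} {l : L} :
    l ∈ leafSet vert side loc f ↔ loc l = f ∨ vert (loc l) ∈ side f := by
  simp [leafSet]

end

namespace LeafTree

variable {F V L : Type*} {vert : F → V} {inv : F → F} {side : F → Set V} {loc : L → F}
  (ht : LeafTree vert inv side loc)

include ht

lemma inv_loc (l : L) : inv (loc l) = loc l := (ht.loc_iff _).2 ⟨l, rfl⟩

variable [Fintype L]

local notation "S" => leafSet vert side loc

lemma leafSet_loc (l : L) : S (loc l) = {l} := by
  ext k
  rw [mem_leafSet, ht.leaf _ (ht.inv_loc l), Finset.mem_singleton, ht.loc_injective.eq_iff]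
  simp

lemma exists_mem_leafSet (u : V) (l : L) : ∃ f, vert f = u ∧ l ∈ S f := by
  by_cases h : u = vert (loc l)
  · exact ⟨loc l, h.symm, mem_leafSet.2 (Or.inl rfl)⟩
  · obtain ⟨f, hf, hl⟩ := ht.exists_flag _ _ h
    exact ⟨f, hf, mem_leafSet.2 (Or.inr hl)⟩

lemma eq_of_mem_leafSet {f f' : F} {l : L} (hv : vert f = vert f') (hl : l ∈ S f) (hl' : l ∈ S f') :
    f = f' := by
  rw [mem_leafSet] at hl hl'
  rcases hl with rfl | hl
  · rcases hl' with rfl | hl'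
    · rfl
    · rw [hv] at hl'
      exact absurd hl' (ht.vert_not_mem _)
  · rcases hl' with rfl | hl'
    · rw [← hv] at hl
      exact absurd hl (ht.vert_not_mem _)
    · exact ht.unique f f' _ hv hl hl'

lemma disjoint_leafSet {f f' : F} (hv : vert f = vert f') (hne : f ≠ f') :
    Disjoint (S f) (S f') :=
  Finset.disjoint_left.2 fun _ hl hl' => hne (ht.eq_of_mem_leafSet hv hl hl')

lemma mem_leafSet_inv {f : F} (hf : inv f ≠ f) (l : L) : l ∈ S (inv f) ↔ l ∉ S f := by
  have h1 : loc l ≠ f := by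
    rintro rfl
    exact hf (ht.inv_loc l)
  have h2 : loc l ≠ inv f := by
    intro h
    apply hf
    rw [← h, ← ht.inv_loc l, h, ht.inv_inv]
  rw [mem_leafSet, mem_leafSet, or_iff_right h1, or_iff_right h2, ht.compl f hf]

lemma leafSet_subset {f h : F} (hf : inv f ≠ f) (hv : vert h = vert (inv f)) (hne : h ≠ inv f) :
    S h ⊆ S f := by
  intro l hl
  rw [mem_leafSet] at hl ⊢
  right
  rcases hl with rfl | hl
  · rw [hv]
    exact ht.vert_inv_mem hf
  · exact ht.side_subset hf hv hne hl

variable [Finite V]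

lemma leafSet_nonempty (f : F) : (S f).Nonempty := by
  induction hn : (side f).ncard using Nat.strong_induction_on generalizing f with
  | _ n ih =>
    by_cases hf : inv f = f
    · obtain ⟨l, rfl⟩ := (ht.loc_iff f).1 hf
      rw [ht.leafSet_loc]
      exact Finset.singleton_nonempty l
    · obtain ⟨h, hv, hne, -⟩ := ht.three (vert (inv f)) (inv f) (inv f)
      have hlt := ht.side_ncard_lt hf hv hne
      rw [hn] at hlt
      exact (ih _ hlt h rfl).mono (ht.leafSet_subset hf hv hne)

lemma leafSet_ne_univ (f : F) : S f ≠ Finset.univ := by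
  obtain ⟨h, hv, hne, -⟩ := ht.three (vert f) f f
  obtain ⟨l, hl⟩ := ht.leafSet_nonempty h
  intro hu
  exact hne (ht.eq_of_mem_leafSet hv hl (hu ▸ Finset.mem_univ l))

lemma two_le_card_leafSet {f : F} (hf : inv f ≠ f) : 2 ≤ (S f).card := by
  obtain ⟨h, hv, hne, -⟩ := ht.three (vert (inv f)) (inv f) (inv f)
  obtain ⟨g, hv', hne', hgh⟩ := ht.three (vert (inv f)) (inv f) h
  obtain ⟨l, hl⟩ := ht.leafSet_nonempty h
  obtain ⟨k, hk⟩ := ht.leafSet_nonempty g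
  apply Finset.one_lt_card.2
  refine ⟨l, ht.leafSet_subset hf hv hne hl, k, ht.leafSet_subset hf hv' hne' hk, ?_⟩
  rintro rfl
  exact hgh (ht.eq_of_mem_leafSet (hv'.trans hv.symm) hk hl)

lemma card_leafSet_eq_one_iff {f : F} : (S f).card = 1 ↔ inv f = f := by
  constructor
  · intro h
    by_contra hf
    have := ht.two_le_card_leafSet hf
    omega
  · intro h
    obtain ⟨l, rfl⟩ := (ht.loc_iff f).1 h
    rw [ht.leafSet_loc, Finset.card_singleton]

lemma mem_leafSet_of_not_mem {x y : F} (hx : vert y ∈ side x) (hy : vert x ∈ side y) {l : L}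
    (hl : l ∉ S x) : l ∈ S y := by
  rw [mem_leafSet, not_or] at hl
  exact mem_leafSet.2 (Or.inr (ht.mem_side_of_not_mem hx hy hl.2))

lemma leafSet_subset_of_ne {x y f : F} (hx : vert y ∈ side x) (hy : vert x ∈ side y)
    (hf : vert f = vert x) (hne : f ≠ x) : S f ⊆ S y := fun _ hl =>
  ht.mem_leafSet_of_not_mem hx hy fun hl' => hne (ht.eq_of_mem_leafSet hf hl hl')

lemma not_leafSet_subset_of_ne {f g : F} (hv : vert f = vert g) (hne : f ≠ g) : ¬ S f ⊆ S g := by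
  intro h
  obtain ⟨l, hl⟩ := ht.leafSet_nonempty f
  exact hne (ht.eq_of_mem_leafSet hv hl (h hl))

/-- A flag is determined by its set of leaves. -/
lemma leafSet_injective : Function.Injective S := by
  intro f h hfh
  by_contra hne
  by_cases hv : vert f = vert h
  · exact ht.not_leafSet_subset_of_ne hv hne hfh.subset
  · obtain ⟨x, y, hx, hy, hyx, hxy⟩ := ht.exists_facing hv
    have key : ∀ {x y f h : F}, vert x = vert f → vert y = vert h → vert y ∈ side x →
        vert x ∈ side y → S f = S h → f ≠ x → False := by
      intro x y f h hx hy hyx hxy hfh hfx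
      have h1 := ht.leafSet_subset_of_ne hyx hxy hx.symm hfx
      have h2 : h = y := by
        by_contra hne
        refine ht.not_leafSet_subset_of_ne hy.symm hne ?_
        rwa [← hfh]
      obtain ⟨g, hg, hgf, hgx⟩ := ht.three (vert f) f x
      have h3 := ht.leafSet_subset_of_ne hyx hxy (hg.trans hx.symm) hgx
      rw [← h2, ← hfh] at h3
      exact ht.not_leafSet_subset_of_ne hg hgf h3
    by_cases hfx : f = x
    · by_cases hhy : h = y
      · subst hfx hhy
        have : S f = Finset.univ := by
          ext l
          simp only [Finset.mem_univ, iff_true]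
          by_contra hl
          exact hl (hfh ▸ ht.mem_leafSet_of_not_mem hyx hxy hl)
        exact ht.leafSet_ne_univ f this
      · exact key hy hx hxy hyx hfh.symm hhy
    · exact key hx hy hyx hxy hfh hfx

/-- Incidence of flags at the same vertex in terms of the sets of leaves. -/
lemma vert_eq_iff {f f' : F} (hne : f ≠ f') : vert f = vert f' ↔
    Disjoint (S f) (S f') ∧ (∃ l, l ∉ S f ∧ l ∉ S f') ∧
      ∀ h, S f ⊆ S h → Disjoint (S h) (S f') → S h = S f ∨ ∀ l, l ∉ S f' → l ∈ S h := by
  constructor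
  · intro hv
    refine ⟨ht.disjoint_leafSet hv hne, ?_, ?_⟩
    · obtain ⟨g, hg, hgf, hgf'⟩ := ht.three (vert f) f f'
      obtain ⟨l, hl⟩ := ht.leafSet_nonempty g
      exact ⟨l, fun h => hgf (ht.eq_of_mem_leafSet hg hl h),
        fun h => hgf' (ht.eq_of_mem_leafSet (hg.trans hv) hl h)⟩
    · intro h hsub hdisj
      by_cases hh : vert f = vert h
      · left
        by_cases hfh : f = h
        · rw [hfh]
        · exact absurd hsub (ht.not_leafSet_subset_of_ne hh hfh)
      · obtain ⟨x, y, hx, hy, hyx, hxy⟩ := ht.exists_facing hh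
        obtain ⟨k, hk⟩ := ht.leafSet_nonempty f'
        by_cases hfx : f = x
        · left
          have h1 : h ≠ y := by
            rintro rfl
            have := ht.leafSet_subset_of_ne hyx hxy (hv.symm.trans hx.symm)
              (fun h => hne (hfx.trans h.symm))
            exact Finset.disjoint_left.1 hdisj (this hk) hk
          have h2 := ht.leafSet_subset_of_ne hxy hyx hy.symm h1
          rw [← hfx] at h2
          exact h2.antisymm hsub
        · right
          have h1 := ht.leafSet_subset_of_ne hyx hxy hx.symm hfx
          obtain ⟨l, hl⟩ := ht.leafSet_nonempty f
          have h2 : h = y := ht.eq_of_mem_leafSet hy.symm (hsub hl) (h1 hl)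
          have h3 : f' = x := by
            by_contra h3
            have := ht.leafSet_subset_of_ne hyx hxy (hv.symm.trans hx.symm) h3
            exact Finset.disjoint_left.1 hdisj (h2 ▸ this hk) hk
          intro l hl
          rw [h2]
          exact ht.mem_leafSet_of_not_mem hyx hxy (h3 ▸ hl)
  · rintro ⟨hdisj, ⟨k, hk, hk'⟩, hmax⟩
    by_contra hv
    obtain ⟨x, y, hx, hy, hyx, hxy⟩ := ht.exists_facing hv
    obtain ⟨l, hl⟩ := ht.leafSet_nonempty f
    obtain ⟨l', hl'⟩ := ht.leafSet_nonempty f'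
    by_cases hfx : f = x
    · by_cases hfy : f' = y
      · subst hfx hfy
        exact hk' (ht.mem_leafSet_of_not_mem hyx hxy hk)
      · have := ht.leafSet_subset_of_ne hxy hyx hy.symm hfy
        rw [← hfx] at this
        exact Finset.disjoint_left.1 hdisj (this hl') hl'
    · have h1 := ht.leafSet_subset_of_ne hyx hxy hx.symm hfx
      by_cases hfy : f' = y
      · rw [← hfy] at h1
        exact Finset.disjoint_left.1 hdisj hl (h1 hl)
      · rcases hmax y h1 (ht.disjoint_leafSet hy (Ne.symm hfy)) with h2 | h2
        · obtain ⟨g, hg, hgf, hgx⟩ := ht.three (vert f) f x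
          have h3 := ht.leafSet_subset_of_ne hyx hxy (hg.trans hx.symm) hgx
          rw [h2] at h3
          exact ht.not_leafSet_subset_of_ne hg hgf h3
        · obtain ⟨g, hg, hgf, hgy⟩ := ht.three (vert f') f' y
          obtain ⟨j, hj⟩ := ht.leafSet_nonempty g
          exact hgy (ht.eq_of_mem_leafSet (hg.trans hy.symm) hj
            (h2 j fun h => hgf (ht.eq_of_mem_leafSet hg hj h)))

end LeafTree

section iso

variable {F V F' V' L : Type*} [Fintype L] [Finite V] [Finite V']
  {vert : F → V} {inv : F → F} {side : F → Set V} {loc : L → F} (ht : LeafTree vert inv side loc)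
  {vert' : F' → V'} {inv' : F' → F'} {side' : F' → Set V'} {loc' : L → F'}
  (ht' : LeafTree vert' inv' side' loc')

include ht ht'

/-- Two trees with the same sets of leaves are isomorphic. -/
lemma exists_iso_of_range_eq
    (h : Set.range (leafSet vert side loc) = Set.range (leafSet vert' side' loc')) :
    ∃ e : F ≃ F', (∀ f, leafSet vert' side' loc' (e f) = leafSet vert side loc f) ∧
      (∀ f g, vert f = vert g ↔ vert' (e f) = vert' (e g)) ∧ (∀ f, inv' (e f) = e (inv f)) ∧
      ∀ l, e (loc l) = loc' l := by
  let e : F ≃ F' := (Equiv.ofInjective _ ht.leafSet_injective).trans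
    ((Equiv.setCongr h).trans (Equiv.ofInjective _ ht'.leafSet_injective).symm)
  have he : ∀ f, leafSet vert' side' loc' (e f) = leafSet vert side loc f := by
    intro f
    have h1 : Equiv.ofInjective _ ht'.leafSet_injective (e f) =
        Equiv.setCongr h (Equiv.ofInjective _ ht.leafSet_injective f) := by
      simp [e]
    exact congrArg Subtype.val h1
  have hloc : ∀ l, e (loc l) = loc' l := by
    intro l
    apply ht'.leafSet_injective
    rw [he, ht.leafSet_loc, ht'.leafSet_loc]
  refine ⟨e, he, ?_, ?_, hloc⟩
  · intro f g
    by_cases hfg : f = g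
    · simp [hfg]
    · rw [ht.vert_eq_iff hfg, ht'.vert_eq_iff (e.injective.ne hfg), he, he]
      refine and_congr_right fun _ => and_congr_right fun _ => ?_
      rw [e.surjective.forall]
      simp only [he]
  · intro f
    by_cases hf : inv f = f
    · obtain ⟨l, rfl⟩ := (ht.loc_iff f).1 hf
      rw [hf, hloc, ht'.inv_loc]
    · have hf' : inv' (e f) ≠ e f := by
        intro h1
        have h2 := ht'.card_leafSet_eq_one_iff.2 h1
        rw [he] at h2
        exact hf (ht.card_leafSet_eq_one_iff.1 h2)
      apply ht'.leafSet_injective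
      ext l
      rw [ht'.mem_leafSet_inv hf', he, he, ht.mem_leafSet_inv hf]

end iso

/-! ### The hierarchy of a tree with a centre -/

section

variable {F V L : Type*}

/-- A centre of a tree is a vertex or an edge, as the set of its ends. -/
def IsCentre (vert : F → V) (inv : F → F) (C : Set V) : Prop :=
  (∃ v, C = {v}) ∨ ∃ f, inv f ≠ f ∧ C = {vert f, vert (inv f)}

lemma IsCentre.nonempty {C : Set V} {vert : F → V} {inv : F → F} (hC : IsCentre vert inv C) :
    C.Nonempty := by
  rcases hC with ⟨v, rfl⟩ | ⟨f, -, rfl⟩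
  · exact Set.singleton_nonempty v
  · exact Set.insert_nonempty _ _

/-- The flag `f` points away from the centre `C`. -/
def Away (side : F → Set V) (C : Set V) (f : F) : Prop := ∃ c ∈ C, c ∉ side f

open Classical in
/-- The flags of edges which point away from `C`. -/
def awayFlags [Fintype F] (inv : F → F) (side : F → Set V) (C : Set V) : Finset F :=
  Finset.univ.filter fun f => inv f ≠ f ∧ Away side C f

lemma mem_awayFlags [Fintype F] {inv : F → F} {side : F → Set V} {C : Set V} {f : F} :
    f ∈ awayFlags inv side C ↔ inv f ≠ f ∧ Away side C f := by
  simp [awayFlags]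

open Classical in
/-- The hierarchy of the sets of leaves beyond the flags which point away from the centre. -/
def centreHier [Fintype F] [Fintype L] (vert : F → V) (inv : F → F) (side : F → Set V) (loc : L → F)
    (C : Set V) : Finset (Finset L) :=
  insert Finset.univ ((awayFlags inv side C).image (leafSet vert side loc))

lemma mem_centreHier [Fintype F] [Fintype L] {vert : F → V} {inv : F → F} {side : F → Set V}
    {loc : L → F} {C : Set V} {A : Finset L} : A ∈ centreHier vert inv side loc C ↔
      A = Finset.univ ∨ ∃ f, (inv f ≠ f ∧ Away side C f) ∧ leafSet vert side loc f = A := by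
  simp [centreHier, mem_awayFlags]

end

/-- A criterion for a partition to be the one into the children. -/
lemma children_eq_of_isPart {X : Type*} [Fintype X] {H P : Finset (Finset X)} {S : Finset X}
    (hP : IsPart P S) (hmem : ∀ B ∈ P, B ⊂ S ∧ (B ∈ H ∨ B.card = 1))
    (hne : ∀ U ∈ H, U.Nonempty) (hcov : ∀ U ∈ H, U ⊂ S → ∃ B ∈ P, U ⊆ B) : children H S = P := by
  ext T
  rw [mem_children]
  constructor
  · rintro ⟨hTS, hT, hmax⟩
    obtain ⟨B, hB, hTB⟩ : ∃ B ∈ P, T ⊆ B := by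
      rcases hT with hT | hT
      · exact hcov T hT hTS
      · obtain ⟨x, rfl⟩ := Finset.card_eq_one.1 hT
        obtain ⟨B, hB, hx⟩ := hP.cover x (hTS.subset (by simp))
        exact ⟨B, hB, by simpa using hx⟩
    have hTne : T.Nonempty := by
      rcases hT with hT | hT
      · exact hne T hT
      · exact Finset.card_pos.1 (by omega)
    rcases (hmem B hB).2 with h | h
    · rw [← hmax B h hTB (hmem B hB).1]
      exact hB
    · rwa [Finset.eq_of_subset_of_card_le hTB (by rw [h]; exact hTne.card_pos)]
  · intro hT
    refine ⟨(hmem T hT).1, (hmem T hT).2, fun U hU hTU hUS => ?_⟩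
    obtain ⟨B, hB, hUB⟩ := hcov U hU hUS
    have := hP.eq_of_subset hT hB (hP.nonempty T hT) subset_rfl (hTU.trans hUB)
    subst this
    exact hUB.antisymm hTU

namespace LeafTree

variable {F V L : Type*} {vert : F → V} {inv : F → F} {side : F → Set V} {loc : L → F}
  (ht : LeafTree vert inv side loc)

include ht

lemma vert_ne_vert_inv {f : F} (hf : inv f ≠ f) : vert f ≠ vert (inv f) := fun h =>
  ht.vert_not_mem f (h ▸ ht.vert_inv_mem hf)

lemma away_or_away_inv {C : Set V} (hne : C.Nonempty) {f : F} (hf : inv f ≠ f) :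
    Away side C f ∨ Away side C (inv f) := by
  obtain ⟨c, hc⟩ := hne
  by_cases h : c ∈ side f
  · exact Or.inr ⟨c, hc, fun h' => (ht.compl f hf c).1 h' h⟩
  · exact Or.inl ⟨c, hc, h⟩

lemma away_of_vert_eq {C : Set V} {f h : F} (hf : inv f ≠ f) (ha : Away side C f)
    (hv : vert h = vert (inv f)) (hne : h ≠ inv f) : Away side C h := by
  obtain ⟨c, hc, hcf⟩ := ha
  exact ⟨c, hc, fun hch => hcf (ht.side_subset hf hv hne hch)⟩

variable [Finite V]

lemma centre_cases {C : Set V} (hC : IsCentre vert inv C) {f : F} (hf : inv f ≠ f) :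
    C ⊆ side f ∨ C ⊆ side (inv f) ∨ C = {vert f, vert (inv f)} := by
  rcases hC with ⟨v, rfl⟩ | ⟨g, hg, rfl⟩
  · by_cases h : v ∈ side f
    · left
      simpa using h
    · right; left
      simpa using (ht.compl f hf v).2 h
  · by_cases h1 : g = f
    · right; right
      rw [h1]
    · by_cases h2 : g = inv f
      · right; right
        rw [h2, ht.inv_inv, Set.pair_comm]
      · by_cases h : vert g ∈ side f
        · left
          rintro w (rfl | rfl)
          · exact h
          · exact (ht.vert_inv_mem_of_vert_mem h).resolve_left h2
        · right; left
          rintro w (rfl | rfl)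
          · exact (ht.compl f hf _).2 h
          · refine (ht.vert_inv_mem_of_vert_mem ((ht.compl f hf _).2 h)).resolve_left ?_
            rwa [ht.inv_inv]

lemma eq_pair_of_away {C : Set V} (hC : IsCentre vert inv C) {f : F} (hf : inv f ≠ f)
    (h : Away side C f) (h' : Away side C (inv f)) : C = {vert f, vert (inv f)} := by
  obtain ⟨c, hc, hcf⟩ := h
  obtain ⟨c', hc', hcf'⟩ := h'
  rcases ht.centre_cases hC hf with h1 | h1 | h1
  · exact absurd (h1 hc) hcf
  · exact absurd (h1 hc') hcf'
  · exact h1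

/-- A vertex has at most one flag towards the centre. -/
lemma injOn_vert_inv {C : Set V} (hC : IsCentre vert inv C) :
    Set.InjOn (fun f => vert (inv f)) {f | inv f ≠ f ∧ Away side C f} := by
  rintro f ⟨hf, haf⟩ g ⟨hg, hag⟩ (hv : vert (inv f) = vert (inv g))
  by_contra hne
  have hne' : inv f ≠ inv g := fun h => hne (by rw [← ht.inv_inv f, h, ht.inv_inv])
  have h1 : side (inv f) ⊆ side g := ht.side_subset hg hv hne'
  have h2 : side (inv g) ⊆ side f := ht.side_subset hf hv.symm (Ne.symm hne')
  have h3 : C = {vert f, vert (inv f)} := by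
    rcases ht.centre_cases hC hf with h | h | h
    · obtain ⟨c, hc, hcf⟩ := haf
      exact absurd (h hc) hcf
    · obtain ⟨c, hc, hcg⟩ := hag
      exact absurd (h1 (h hc)) hcg
    · exact h
  have h4 : C = {vert g, vert (inv g)} := by
    rcases ht.centre_cases hC hg with h | h | h
    · obtain ⟨c, hc, hcf⟩ := hag
      exact absurd (h hc) hcf
    · obtain ⟨c, hc, hcg⟩ := haf
      exact absurd (h2 (h hc)) hcg
    · exact h
  have h5 : vert f ∈ side (inv f) := (ht.compl f hf _).2 (ht.vert_not_mem f)
  have h6 : vert f ∈ ({vert g, vert (inv g)} : Set V) := by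
    rw [← h4, h3]
    simp
  rcases h6 with h6 | h6
  · rw [h6] at h5
    exact ht.vert_not_mem g (h1 h5)
  · rw [← hv] at h6
    exact ht.vert_ne_vert_inv hf h6

/-- Each vertex other than the centre `v` has exactly one flag towards `v`. -/
lemma bijOn_vert_inv_vertex (v : V) :
    Set.BijOn (fun f => vert (inv f)) {f | inv f ≠ f ∧ Away side {v} f} {u | u ≠ v} := by
  refine ⟨?_, ht.injOn_vert_inv (Or.inl ⟨v, rfl⟩), ?_⟩
  · rintro f ⟨hf, c, hc, hcf⟩ (h : vert (inv f) = v)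
    rw [Set.mem_singleton_iff] at hc
    rw [hc, ← h] at hcf
    exact hcf (ht.vert_inv_mem hf)
  · intro u hu
    obtain ⟨y, hy, hvy⟩ := ht.exists_flag u v hu
    have hyn := ht.inv_ne hvy
    refine ⟨inv y, ⟨?_, v, rfl, fun h => (ht.compl y hyn v).1 h hvy⟩, ?_⟩
    · rw [ht.inv_inv]
      exact hyn.symm
    · change vert (inv (inv y)) = u
      rw [ht.inv_inv, hy]

/-- Each vertex has exactly one flag towards a central edge; for the two ends of the edge it is the
flag of the edge itself. -/
lemma bijOn_vert_inv_edge {g : F} (hg : inv g ≠ g) :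
    Set.BijOn (fun f => vert (inv f)) {f | inv f ≠ f ∧ Away side {vert g, vert (inv g)} f}
      Set.univ := by
  refine ⟨fun _ _ => Set.mem_univ _, ht.injOn_vert_inv (Or.inr ⟨g, hg, rfl⟩), ?_⟩
  intro u _
  by_cases h : u = vert g
  · refine ⟨inv g, ⟨?_, vert (inv g), by simp, ht.vert_not_mem _⟩, ?_⟩
    · rw [ht.inv_inv]
      exact hg.symm
    · change vert (inv (inv g)) = u
      rw [ht.inv_inv, h]
  · obtain ⟨y, hy, hvy⟩ := ht.exists_flag u _ h
    have hyn := ht.inv_ne hvy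
    refine ⟨inv y, ⟨?_, vert g, by simp, fun h => (ht.compl y hyn _).1 h hvy⟩, ?_⟩
    · rw [ht.inv_inv]
      exact hyn.symm
    · change vert (inv (inv y)) = u
      rw [ht.inv_inv, hy]

/-- A centre is determined by the flags pointing away from it. -/
lemma centre_ext {C C' : Set V} (hC : IsCentre vert inv C) (hC' : IsCentre vert inv C')
    (h : ∀ f, inv f ≠ f → (Away side C f ↔ Away side C' f)) : C = C' := by
  have hva : ∀ {v : V} {f : F}, Away side {v} f ↔ v ∉ side f := by
    intro v f
    simp [Away]
  have key : ∀ {v : V} {g : F}, inv g ≠ g →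
      (∀ f, inv f ≠ f → (Away side {v} f ↔ Away side {vert g, vert (inv g)} f)) → False := by
    intro v g hg h
    have h1 := hva.1 ((h g hg).2 ⟨vert g, by simp, ht.vert_not_mem g⟩)
    have hg' : inv (inv g) ≠ inv g := by
      rw [ht.inv_inv]
      exact hg.symm
    have h2 := hva.1 ((h (inv g) hg').2 ⟨vert (inv g), by simp, ht.vert_not_mem _⟩)
    exact h2 ((ht.compl g hg v).2 h1)
  rcases hC with ⟨v, rfl⟩ | ⟨g, hg, rfl⟩
  · rcases hC' with ⟨w, rfl⟩ | ⟨g, hg, rfl⟩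
    · by_contra hne
      obtain ⟨x, y, rfl, rfl, hx, hy⟩ := ht.exists_facing (fun h => hne (by rw [h]) : v ≠ w)
      exact hva.1 ((h x (ht.inv_ne hx)).1 (hva.2 (ht.vert_not_mem x))) hx
    · exact (key hg h).elim
  · rcases hC' with ⟨w, rfl⟩ | ⟨g', hg', rfl⟩
    · exact (key hg fun f hf => (h f hf).symm).elim
    · have hgg : inv (inv g) ≠ inv g := by
        rw [ht.inv_inv]
        exact hg.symm
      exact (ht.eq_pair_of_away (Or.inr ⟨g', hg', rfl⟩) hg
        ((h g hg).1 ⟨vert g, by simp, ht.vert_not_mem g⟩)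
        ((h _ hgg).1 ⟨vert (inv g), by simp, ht.vert_not_mem _⟩)).symm

variable [Fintype L]

local notation "S" => leafSet vert side loc

/-- The flags which point away from a centre do not face each other, except for the two flags of
a central edge, whose sets of leaves are complementary. -/
lemma leafSet_laminar {C : Set V} (hC : IsCentre vert inv C) {f h : F} (hf : inv f ≠ f)
    (hh : inv h ≠ h) (haf : Away side C f) (hah : Away side C h) :
    S f ⊆ S h ∨ S h ⊆ S f ∨ Disjoint (S f) (S h) := by
  by_cases hv : vert f = vert h
  · by_cases hfh : f = h
    · left
      rw [hfh]
    · exact Or.inr (Or.inr (ht.disjoint_leafSet hv hfh))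
  · obtain ⟨x, y, hx, hy, hyx, hxy⟩ := ht.exists_facing hv
    by_cases hfx : f = x
    · by_cases hhy : h = y
      · subst hfx hhy
        right; right
        -- The flags `f` and `h` face each other. As both point away from the centre, this has to be
        -- the edge of `f` and also that of `h`.
        have h1 : C = {vert f, vert (inv f)} := by
          rcases ht.centre_cases hC hf with h | h | h
          · obtain ⟨c, hc, hcf⟩ := haf
            exact absurd (h hc) hcf
          · obtain ⟨c, hc, hch⟩ := hah
            refine absurd (ht.mem_side_of_not_mem hyx hxy ?_) hch
            exact (ht.compl f hf c).1 (h hc)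
          · exact h
        have h2 : C = {vert h, vert (inv h)} := by
          rcases ht.centre_cases hC hh with h | h | h
          · obtain ⟨c, hc, hcf⟩ := hah
            exact absurd (h hc) hcf
          · obtain ⟨c, hc, hch⟩ := haf
            refine absurd (ht.mem_side_of_not_mem hxy hyx ?_) hch
            exact (ht.compl _ hh c).1 (h hc)
          · exact h
        have h3 : vert h ∈ ({vert f, vert (inv f)} : Set V) := by
          rw [← h1, h2]
          simp
        have h4 : vert h = vert (inv f) := h3.resolve_left (Ne.symm hv)
        have h5 : h = inv f := by
          by_contra hne
          exact ht.vert_not_mem f (ht.side_subset hf h4 hne hxy)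
        rw [h5, Finset.disjoint_left]
        exact fun l hl hl' => (ht.mem_leafSet_inv hf l).1 hl' hl
      · right; left
        rw [hfx]
        exact ht.leafSet_subset_of_ne hxy hyx hy.symm hhy
    · have h1 := ht.leafSet_subset_of_ne hyx hxy hx.symm hfx
      by_cases hhy : h = y
      · left
        rwa [hhy]
      · right; right
        exact (ht.disjoint_leafSet hy.symm hhy).symm.mono_left h1

lemma leafSet_ssubset_univ (f : F) : S f ⊂ Finset.univ :=
  Finset.ssubset_univ_iff.2 (ht.leafSet_ne_univ f)

variable [Fintype F]

lemma isHier_centreHier {C : Set V} (hC : IsCentre vert inv C) (h2 : 2 ≤ Fintype.card L) :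
    IsHier (centreHier vert inv side loc C) Finset.univ where
  two_le A hA := by
    rcases mem_centreHier.1 hA with rfl | ⟨f, ⟨hf, -⟩, rfl⟩
    · rwa [Finset.card_univ]
    · exact ht.two_le_card_leafSet hf
  subset A _ := Finset.subset_univ A
  top _ := mem_centreHier.2 (Or.inl rfl)
  laminar A hA B hB := by
    rcases mem_centreHier.1 hA with rfl | ⟨f, ⟨hf, haf⟩, rfl⟩
    · exact Or.inr (Or.inl (Finset.subset_univ _))
    · rcases mem_centreHier.1 hB with rfl | ⟨h, ⟨hh, hah⟩, rfl⟩
      · exact Or.inl (Finset.subset_univ _)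
      · exact ht.leafSet_laminar hC hf hh haf hah

lemma centreHier_nonempty [Nonempty L] {C : Set V} : ∀ A ∈ centreHier vert inv side loc C,
    A.Nonempty := by
  intro A hA
  rcases mem_centreHier.1 hA with rfl | ⟨f, -, rfl⟩
  · exact Finset.univ_nonempty
  · exact ht.leafSet_nonempty f

lemma mem_centreHier_or_card {C : Set V} {f : F} (h : Away side C f) :
    S f ∈ centreHier vert inv side loc C ∨ (S f).card = 1 := by
  by_cases hf : inv f = f
  · exact Or.inr (ht.card_leafSet_eq_one_iff.2 hf)
  · exact Or.inl (mem_centreHier.2 (Or.inr ⟨f, ⟨hf, h⟩, rfl⟩))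

open Classical in
/-- If the centre is a vertex, then it is the root of the hierarchy. -/
lemma children_centreHier_vertex [Nonempty L] (v : V) :
    children (centreHier vert inv side loc {v}) Finset.univ =
      (Finset.univ.filter fun f => vert f = v).image S := by
  apply children_eq_of_isPart
  · refine ⟨?_, fun _ _ => Finset.subset_univ _, ?_, ?_⟩
    · intro B hB
      obtain ⟨f, -, rfl⟩ := Finset.mem_image.1 hB
      exact ht.leafSet_nonempty f
    · intro l _
      obtain ⟨f, hf, hl⟩ := ht.exists_mem_leafSet v l
      exact ⟨S f, Finset.mem_image_of_mem _ (by simpa using hf), hl⟩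
    · intro B hB D hD l hl hl'
      obtain ⟨f, hf, rfl⟩ := Finset.mem_image.1 hB
      obtain ⟨g, hg, rfl⟩ := Finset.mem_image.1 hD
      rw [ht.eq_of_mem_leafSet ((Finset.mem_filter.1 hf).2.trans (Finset.mem_filter.1 hg).2.symm)
        hl hl']
  · intro B hB
    obtain ⟨f, hf, rfl⟩ := Finset.mem_image.1 hB
    refine ⟨ht.leafSet_ssubset_univ f, ht.mem_centreHier_or_card ⟨v, rfl, ?_⟩⟩
    rw [← (Finset.mem_filter.1 hf).2]
    exact ht.vert_not_mem f
  · exact ht.centreHier_nonempty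
  · intro U hU hUu
    rcases mem_centreHier.1 hU with rfl | ⟨h, ⟨hh, c, hc, hch⟩, rfl⟩
    · exact absurd rfl hUu.ne
    · rw [Set.mem_singleton_iff] at hc
      subst hc
      by_cases hv : c = vert h
      · exact ⟨_, Finset.mem_image_of_mem _ (by simp [hv]), subset_rfl⟩
      · obtain ⟨x, y, hx, hy, hyx, hxy⟩ := ht.exists_facing hv
        refine ⟨S x, Finset.mem_image_of_mem _ (by simpa using hx), ?_⟩
        refine ht.leafSet_subset_of_ne hxy hyx hy.symm ?_
        rintro rfl
        exact hch (hx ▸ hxy)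

open Classical in
/-- If the centre is an edge, then the root of the hierarchy has the two sides of the edge as
children. -/
lemma children_centreHier_edge [Nonempty L] {g : F} (hg : inv g ≠ g) :
    children (centreHier vert inv side loc {vert g, vert (inv g)}) Finset.univ =
      {S g, S (inv g)} := by
  apply children_eq_of_isPart
  · refine ⟨?_, fun _ _ => Finset.subset_univ _, ?_, ?_⟩
    · intro B hB
      simp only [Finset.mem_insert, Finset.mem_singleton] at hB
      rcases hB with rfl | rfl
      · exact ht.leafSet_nonempty _
      · exact ht.leafSet_nonempty _
    · intro l _
      by_cases hl : l ∈ S g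
      · exact ⟨S g, by simp, hl⟩
      · exact ⟨S (inv g), by simp, (ht.mem_leafSet_inv hg l).2 hl⟩
    · intro B hB D hD l hl hl'
      simp only [Finset.mem_insert, Finset.mem_singleton] at hB hD
      rcases hB with rfl | rfl <;> rcases hD with rfl | rfl
      · rfl
      · exact absurd hl ((ht.mem_leafSet_inv hg l).1 hl')
      · exact absurd hl' ((ht.mem_leafSet_inv hg l).1 hl)
      · rfl
  · intro B hB
    simp only [Finset.mem_insert, Finset.mem_singleton] at hB
    rcases hB with rfl | rfl
    · exact ⟨ht.leafSet_ssubset_univ _,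
        ht.mem_centreHier_or_card ⟨vert g, by simp, ht.vert_not_mem _⟩⟩
    · exact ⟨ht.leafSet_ssubset_univ _,
        ht.mem_centreHier_or_card ⟨vert (inv g), by simp, ht.vert_not_mem _⟩⟩
  · exact ht.centreHier_nonempty
  · intro U hU hUu
    rcases mem_centreHier.1 hU with rfl | ⟨h, ⟨hh, hah⟩, rfl⟩
    · exact absurd rfl hUu.ne
    · have key : ∀ g : F, inv g ≠ g → h ≠ inv g → vert (inv g) ∉ side h → vert h ∈ side g →
          S h ⊆ S g := by
        intro g hg hne hgh hhg
        by_cases hv : vert (inv g) = vert h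
        · exact ht.leafSet_subset hg hv.symm hne
        · obtain ⟨x, y, hx, hy, hyx, hxy⟩ := ht.exists_facing hv
          refine (ht.leafSet_subset_of_ne hxy hyx hy.symm ?_).trans (ht.leafSet_subset hg hx ?_)
          · rintro rfl
            exact hgh (hx ▸ hxy)
          · rintro rfl
            exact (ht.compl g hg _).1 (hy ▸ hyx) hhg
      by_cases hhg : h = g
      · exact ⟨S g, by simp, by rw [hhg]⟩
      by_cases hhg' : h = inv g
      · exact ⟨S (inv g), by simp, by rw [hhg']⟩
      -- both ends of `g` lie on the same side of `h`, since `g` is not the edge of `h`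
      have h1 : vert g ∈ side h → vert (inv g) ∈ side h := fun hv =>
        (ht.vert_inv_mem_of_vert_mem hv).resolve_left fun e => hhg' (by rw [e, ht.inv_inv])
      have h2 : vert (inv g) ∈ side h → vert g ∈ side h := fun hv => by
        have := (ht.vert_inv_mem_of_vert_mem hv).resolve_left fun e =>
          hhg (by rw [← ht.inv_inv h, ← e, ht.inv_inv])
        rwa [ht.inv_inv] at this
      have hends : vert g ∉ side h ∧ vert (inv g) ∉ side h := by
        obtain ⟨c, (rfl | rfl), hch⟩ := hah
        · exact ⟨hch, fun h' => hch (h2 h')⟩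
        · exact ⟨fun h' => hch (h1 h'), hch⟩
      by_cases hs : vert h ∈ side g
      · exact ⟨S g, by simp, key g hg hhg' hends.2 hs⟩
      · refine ⟨S (inv g), by simp, key (inv g) ?_ ?_ ?_ ((ht.compl g hg _).2 hs)⟩
        · rw [ht.inv_inv]
          exact hg.symm
        · rwa [ht.inv_inv]
        · rw [ht.inv_inv]
          exact hends.1

open Classical in
/-- The member of a flag `f` stands for the vertex at the other end of its edge, and its children
are given by the other flags at this vertex. -/
lemma children_centreHier_leafSet [Nonempty L] {C : Set V} {f : F} (hf : inv f ≠ f)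
    (ha : Away side C f) :
    children (centreHier vert inv side loc C) (S f) =
      (Finset.univ.filter fun h => vert h = vert (inv f) ∧ h ≠ inv f).image S := by
  apply children_eq_of_isPart
  · refine ⟨?_, ?_, ?_, ?_⟩
    · intro B hB
      obtain ⟨h, -, rfl⟩ := Finset.mem_image.1 hB
      exact ht.leafSet_nonempty h
    · intro B hB
      obtain ⟨h, hh, rfl⟩ := Finset.mem_image.1 hB
      have hh := (Finset.mem_filter.1 hh).2
      exact ht.leafSet_subset hf hh.1 hh.2
    · intro l hl
      obtain ⟨h, hh, hlh⟩ := ht.exists_mem_leafSet (vert (inv f)) l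
      refine ⟨S h, Finset.mem_image_of_mem _ ?_, hlh⟩
      rw [Finset.mem_filter]
      refine ⟨Finset.mem_univ _, hh, ?_⟩
      rintro rfl
      exact (ht.mem_leafSet_inv hf l).1 hlh hl
    · intro B hB D hD l hl hl'
      obtain ⟨h, hh, rfl⟩ := Finset.mem_image.1 hB
      obtain ⟨g, hg, rfl⟩ := Finset.mem_image.1 hD
      rw [ht.eq_of_mem_leafSet ((Finset.mem_filter.1 hh).2.1.trans
        (Finset.mem_filter.1 hg).2.1.symm) hl hl']
  · intro B hB
    obtain ⟨h, hh, rfl⟩ := Finset.mem_image.1 hB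
    have hh := (Finset.mem_filter.1 hh).2
    refine ⟨Finset.ssubset_iff_subset_ne.2 ⟨ht.leafSet_subset hf hh.1 hh.2, fun h' => ?_⟩,
      ht.mem_centreHier_or_card (ht.away_of_vert_eq hf ha hh.1 hh.2)⟩
    have h1 : h = f := ht.leafSet_injective h'
    rw [h1] at hh
    exact ht.vert_ne_vert_inv hf hh.1
  · exact ht.centreHier_nonempty
  · intro U hU hUf
    rcases mem_centreHier.1 hU with rfl | ⟨h, ⟨hh, hah⟩, rfl⟩
    · exact absurd (Finset.univ_subset_iff.1 hUf.subset) (ht.leafSet_ne_univ f)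
    · obtain ⟨l, hl⟩ := ht.leafSet_nonempty h
      have hlf := hUf.subset hl
      have hli : l ∉ S (inv f) := fun h' => (ht.mem_leafSet_inv hf l).1 h' hlf
      by_cases hv : vert (inv f) = vert h
      · refine ⟨S h, Finset.mem_image_of_mem _ ?_, subset_rfl⟩
        rw [Finset.mem_filter]
        refine ⟨Finset.mem_univ _, hv.symm, ?_⟩
        rintro rfl
        exact hli hl
      · obtain ⟨x, y, hx, hy, hyx, hxy⟩ := ht.exists_facing hv
        by_cases hxi : x = inv f
        · subst hxi
          exfalso
          by_cases hhy : h = y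
          · subst hhy
            refine hUf.2 fun k hk => ?_
            exact ht.mem_leafSet_of_not_mem hyx hxy fun h' => (ht.mem_leafSet_inv hf k).1 h' hk
          · exact hli (ht.leafSet_subset_of_ne hxy hyx hy.symm hhy hl)
        · by_cases hhy : h = y
          · subst hhy
            exfalso
            obtain ⟨k, hk⟩ := ht.leafSet_nonempty (inv f)
            have h1 := ht.leafSet_subset_of_ne hyx hxy hx.symm (Ne.symm hxi) hk
            exact (ht.mem_leafSet_inv hf k).1 hk (hUf.subset h1)
          · refine ⟨S x, Finset.mem_image_of_mem _ ?_, ht.leafSet_subset_of_ne hxy hyx hy.symm hhy⟩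
            rw [Finset.mem_filter]
            exact ⟨Finset.mem_univ _, hx, hxi⟩

/-- The sets of leaves are those in the hierarchy of a centre, their complements and the points. -/
lemma range_leafSet_eq {C : Set V} (hC : IsCentre vert inv C) [DecidableEq L] :
    Set.range S = {A | A.card = 1 ∨ (A ∈ centreHier vert inv side loc C ∧ A ≠ Finset.univ) ∨
      (Aᶜ ∈ centreHier vert inv side loc C ∧ Aᶜ ≠ Finset.univ)} := by
  have hcompl : ∀ f, inv f ≠ f → (S f)ᶜ = S (inv f) := by
    intro f hf
    ext l
    rw [Finset.mem_compl, ht.mem_leafSet_inv hf]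
  ext A
  rw [Set.mem_ofPred_eq]
  constructor
  · rintro ⟨f, rfl⟩
    by_cases hf : inv f = f
    · exact Or.inl (ht.card_leafSet_eq_one_iff.2 hf)
    · right
      rw [hcompl f hf]
      have hf' : inv (inv f) ≠ inv f := by
        rw [ht.inv_inv]
        exact Ne.symm hf
      rcases ht.away_or_away_inv hC.nonempty hf with h | h
      · exact Or.inl ⟨mem_centreHier.2 (Or.inr ⟨f, ⟨hf, h⟩, rfl⟩), ht.leafSet_ne_univ f⟩
      · exact Or.inr ⟨mem_centreHier.2 (Or.inr ⟨_, ⟨hf', h⟩, rfl⟩), ht.leafSet_ne_univ _⟩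
  · rintro (h | ⟨h, hne⟩ | ⟨h, hne⟩)
    · obtain ⟨l, rfl⟩ := Finset.card_eq_one.1 h
      exact ⟨loc l, ht.leafSet_loc l⟩
    · rcases mem_centreHier.1 h with h | ⟨f, -, rfl⟩
      · exact absurd h hne
      · exact ⟨f, rfl⟩
    · rcases mem_centreHier.1 h with h | ⟨f, ⟨hf, -⟩, hA⟩
      · exact absurd h hne
      · exact ⟨inv f, by rw [← hcompl f hf, hA, compl_compl]⟩

end LeafTree

/-! ### The tree of a hierarchy -/

section

variable {L : Type*} [Fintype L] [DecidableEq L]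

/-- The hierarchies on all of `L` which belong to a stable tree with a centre. If the root has only
two children, then it stands for an edge and not for a vertex. -/
structure IsStableHier (H : Finset (Finset L)) (col : L → Fin 2) : Prop
    extends IsHier H Finset.univ where
  three_le : 3 ≤ Fintype.card L
  card_compl : ∀ A ∈ H, Aᶜ.card ≠ 1
  colour : ∀ S ∈ H, S ≠ Finset.univ → ∃ B ∈ children H S, colB col B = 0
  root : (∃ A ∈ H, Aᶜ ∈ H) ∨
    ∃ B ∈ children H Finset.univ, ∃ D ∈ children H Finset.univ, B ≠ D ∧ colB col B = 0 ∧
      colB col D = 0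

/-- The sets of leaves of the flags of the tree of a hierarchy. -/
def IsFlagSet (H : Finset (Finset L)) (A : Finset L) : Prop :=
  A.card = 1 ∨ (A ∈ H ∧ A ≠ Finset.univ) ∨ (Aᶜ ∈ H ∧ Aᶜ ≠ Finset.univ)

/-- The vertex of a flag: the vertices are members of the hierarchy, and a member `S` carries the
flags to its children and the flag towards the root, whose set of leaves is `Sᶜ`. -/
def hierVert (H : Finset (Finset L)) (A : Finset L) : Finset L :=
  open Classical in
  if Aᶜ ∈ H then Aᶜ else if h : ∃ S ∈ H, A ∈ children H S then h.choose else ∅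

lemma hierVert_of_compl {H : Finset (Finset L)} {A : Finset L} (h : Aᶜ ∈ H) :
    hierVert H A = Aᶜ := if_pos h

lemma isFlagSet_of_mem_children {H : Finset (Finset L)} {S B : Finset L}
    (hB : B ∈ children H S) : IsFlagSet H B := by
  obtain ⟨h1, h2, -⟩ := mem_children.1 hB
  rcases h2 with h2 | h2
  · exact Or.inr (Or.inl ⟨h2, fun h => h1.2 (h ▸ Finset.subset_univ _)⟩)
  · exact Or.inl h2

/-- The vertex `S` is beyond the flag `A`. -/
def Beyond (H : Finset (Finset L)) (A S : Finset L) : Prop :=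
  (A ∈ H ∧ S ⊆ A) ∨ (Aᶜ ∈ H ∧ ¬ S ⊆ Aᶜ)

namespace IsStableHier

variable {H : Finset (Finset L)} {col : L → Fin 2} (hH : IsStableHier H col)

include hH

lemma nonempty {S : Finset L} (hS : S ∈ H) : S.Nonempty :=
  Finset.card_pos.1 (by have := hH.two_le S hS; omega)

lemma univ_mem : Finset.univ ∈ H := hH.top (by
  have := hH.three_le
  rw [Finset.card_univ]
  omega)

lemma ne_univ_of_compl {A : Finset L} (h : Aᶜ ∈ H) : A ≠ Finset.univ := by
  rintro rfl
  simpa using hH.nonempty h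

lemma not_mem_of_card {A : Finset L} (h : A.card = 1) : A ∉ H := fun hA => by
  have := hH.two_le A hA
  omega

lemma compl_not_mem_of_card {A : Finset L} (h : A.card = 1) : Aᶜ ∉ H := fun hA =>
  hH.card_compl _ hA (by rwa [compl_compl])

lemma flag_nonempty {A : Finset L} (hA : IsFlagSet H A) : A.Nonempty := by
  rcases hA with h | h | h
  · exact Finset.card_pos.1 (by omega)
  · exact hH.nonempty h.1
  · rw [Finset.nonempty_iff_ne_empty]
    rintro rfl
    simp at h

lemma flag_ne_univ {A : Finset L} (hA : IsFlagSet H A) : A ≠ Finset.univ := by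
  rcases hA with h | h | h
  · rintro rfl
    rw [Finset.card_univ] at h
    have := hH.three_le
    omega
  · exact h.2
  · exact hH.ne_univ_of_compl h.1

/-- If two complementary sets belong to the hierarchy, then they are the children of the root. -/
lemma subset_or_subset_compl {B S : Finset L} (hB : B ∈ H) (hB' : Bᶜ ∈ H) (hS : S ∈ H)
    (hSu : S ≠ Finset.univ) : S ⊆ B ∨ S ⊆ Bᶜ := by
  rcases hH.laminar S hS B hB with h | h | h
  · exact Or.inl h
  · rcases hH.laminar S hS _ hB' with h' | h' | h'
    · exact Or.inr h'
    · refine absurd (Finset.univ_subset_iff.1 ?_) hSu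
      rw [← Finset.union_compl B]
      exact Finset.union_subset h h'
    · exact Or.inl (disjoint_compl_right_iff.1 h')
  · exact Or.inr (by rwa [← le_compl_iff_disjoint_right] at h)

lemma parent_unique {A S T : Finset L} (hS : S ∈ H) (hT : T ∈ H) (hA : A ∈ children H S)
    (hA' : A ∈ children H T) : S = T := by
  obtain ⟨h1, h2, h3⟩ := mem_children.1 hA
  obtain ⟨h1', -, h3'⟩ := mem_children.1 hA'
  have hne := (hH.isPart_children (hH.two_le S hS)).nonempty A hA
  rcases hH.laminar S hS T hT with h | h | h
  · by_contra hST
    exact h1.ne (h3' S hS h1.subset (Finset.ssubset_iff_subset_ne.2 ⟨h, hST⟩)).symm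
  · by_contra hST
    exact h1'.ne (h3 T hT h1'.subset (Finset.ssubset_iff_subset_ne.2 ⟨h, Ne.symm hST⟩)).symm
  · obtain ⟨x, hx⟩ := hne
    exact absurd (h1'.subset hx) (Finset.disjoint_left.1 h (h1.subset hx))

lemma exists_parent {A : Finset L} (hA : A ∈ H ∨ A.card = 1) (hu : A ≠ Finset.univ) :
    ∃ S ∈ H, A ∈ children H S := by
  obtain ⟨S, hS, hmin⟩ := Finset.exists_min_image (H.filter fun U => A ⊂ U) Finset.card
    ⟨Finset.univ, by simpa [hH.univ_mem, Finset.ssubset_univ_iff] using hu⟩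
  rw [Finset.mem_filter] at hS
  refine ⟨S, hS.1, mem_children.2 ⟨hS.2, hA, fun U hU hAU hUS => ?_⟩⟩
  by_contra hne
  have := hmin U (Finset.mem_filter.2 ⟨hU, Finset.ssubset_iff_subset_ne.2 ⟨hAU, Ne.symm hne⟩⟩)
  have := Finset.card_lt_card hUS
  omega

lemma hierVert_spec {A : Finset L} (hA : IsFlagSet H A) (h : Aᶜ ∉ H) :
    hierVert H A ∈ H ∧ A ∈ children H (hierVert H A) := by
  have h1 : ∃ S ∈ H, A ∈ children H S := by
    apply hH.exists_parent _ (hH.flag_ne_univ hA)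
    rcases hA with h' | h' | h'
    · exact Or.inr h'
    · exact Or.inl h'.1
    · exact absurd h'.1 h
  rw [hierVert, if_neg h, dif_pos h1]
  exact h1.choose_spec

lemma hierVert_eq {A S : Finset L} (h : Aᶜ ∉ H) (hS : S ∈ H) (hA : A ∈ children H S) :
    hierVert H A = S := by
  have h1 : ∃ S ∈ H, A ∈ children H S := ⟨S, hS, hA⟩
  rw [hierVert, if_neg h, dif_pos h1]
  exact hH.parent_unique h1.choose_spec.1 hS h1.choose_spec.2 hA

lemma hierVert_mem {A : Finset L} (hA : IsFlagSet H A) : hierVert H A ∈ H := by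
  by_cases h : Aᶜ ∈ H
  · rwa [hierVert_of_compl h]
  · exact (hH.hierVert_spec hA h).1

/-- The root is no vertex if it has two complementary children. -/
lemma hierVert_ne_univ {A B : Finset L} (hA : IsFlagSet H A) (hB : B ∈ H) (hB' : Bᶜ ∈ H) :
    hierVert H A ≠ Finset.univ := by
  intro hv
  by_cases h : Aᶜ ∈ H
  · rw [hierVert_of_compl h] at hv
    exact (hH.flag_nonempty hA).ne_empty (by simpa using hv)
  · obtain ⟨h1, h2⟩ := hH.hierVert_spec hA h
    rw [hv] at h2
    obtain ⟨h3, h4, h5⟩ := mem_children.1 h2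
    obtain ⟨x, hx⟩ := hH.flag_nonempty hA
    have key : ∀ B : Finset L, B ∈ H → Bᶜ ∈ H → A ⊆ B → False := by
      intro B hB hB' hAB
      have := h5 B hB hAB (Finset.ssubset_univ_iff.2 (hH.ne_univ_of_compl hB'))
      exact h (this ▸ hB')
    rcases h4 with h4 | h4
    · rcases hH.subset_or_subset_compl hB hB' h4 (hH.flag_ne_univ hA) with h6 | h6
      · exact key B hB hB' h6
      · exact key _ hB' (by rwa [compl_compl]) h6
    · obtain ⟨y, rfl⟩ := Finset.card_eq_one.1 h4
      by_cases hy : y ∈ B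
      · exact key B hB hB' (by simpa using hy)
      · exact key _ hB' (by rwa [compl_compl]) (by simpa using hy)

lemma hierVert_subset_iff {A B : Finset L} (hA : IsFlagSet H A) (hB : B ∈ H) (hB' : Bᶜ ∈ H) :
    hierVert H A ⊆ B ↔ ¬ hierVert H A ⊆ Bᶜ := by
  constructor
  · intro h h'
    obtain ⟨x, hx⟩ := hH.nonempty (hH.hierVert_mem hA)
    exact (Finset.mem_compl.1 (h' hx)) (h hx)
  · exact (hH.subset_or_subset_compl hB hB' (hH.hierVert_mem hA)
      (hH.hierVert_ne_univ hA hB hB')).resolve_right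

lemma beyond_iff_of_mem {A B : Finset L} (hA : IsFlagSet H A) (hB : B ∈ H) :
    Beyond H B (hierVert H A) ↔ hierVert H A ⊆ B := by
  refine ⟨?_, fun h => Or.inl ⟨hB, h⟩⟩
  rintro (⟨-, h⟩ | ⟨h, h'⟩)
  · exact h
  · exact (hH.hierVert_subset_iff hA hB h).2 h'

lemma not_beyond_self {A : Finset L} (hA : IsFlagSet H A) : ¬ Beyond H A (hierVert H A) := by
  by_cases h : Aᶜ ∈ H
  · rw [hierVert_of_compl h]
    rintro (⟨-, h'⟩ | ⟨-, h'⟩)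
    · obtain ⟨x, hx⟩ := hH.nonempty h
      exact (Finset.mem_compl.1 hx) (h' hx)
    · exact h' subset_rfl
  · have h1 := (mem_children.1 (hH.hierVert_spec hA h).2).1
    rintro (⟨-, h'⟩ | ⟨h', -⟩)
    · exact h1.2 h'
    · exact h h'

lemma beyond_compl {A B : Finset L} (hA : A ∈ H ∨ Aᶜ ∈ H) (hB : IsFlagSet H B) :
    Beyond H Aᶜ (hierVert H B) ↔ ¬ Beyond H A (hierVert H B) := by
  rw [Beyond, Beyond, compl_compl]
  by_cases h1 : A ∈ H
  · by_cases h2 : Aᶜ ∈ H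
    · have := hH.hierVert_subset_iff hB h1 h2
      tauto
    · tauto
  · tauto

/-- The children of a vertex are flags at it. -/
lemma hierVert_child {A B : Finset L} (hA : IsFlagSet H A) (hB : B ∈ children H (hierVert H A)) :
    hierVert H B = hierVert H A := by
  refine hH.hierVert_eq (fun h => ?_) (hH.hierVert_mem hA) hB
  obtain ⟨h1, h2 | h2, -⟩ := mem_children.1 hB
  · have h3 := (hH.hierVert_subset_iff hA h2 h).2 fun h' => ?_
    · exact h1.2 h3
    · obtain ⟨x, hx⟩ := hH.nonempty h2
      exact (Finset.mem_compl.1 (h' (h1.subset hx))) hx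
  · exact hH.compl_not_mem_of_card h2 h

lemma compl_ne_of_child {A B : Finset L} (hB : B ∈ children H A) : B ≠ Aᶜ := by
  rintro rfl
  obtain ⟨x, hx⟩ := hH.flag_nonempty (isFlagSet_of_mem_children hB)
  exact (Finset.mem_compl.1 hx) ((mem_children.1 hB).1.subset hx)

/-- At most one flag at a vertex has a given vertex beyond it. -/
lemma beyond_unique {A A' B : Finset L} (hA : IsFlagSet H A) (hA' : IsFlagSet H A')
    (hB : IsFlagSet H B) (hv : hierVert H A = hierVert H A') (h : Beyond H A (hierVert H B))
    (h' : Beyond H A' (hierVert H B)) : A = A' := by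
  by_cases h1 : Aᶜ ∈ H
  · by_cases h2 : A'ᶜ ∈ H
    · rw [hierVert_of_compl h1, hierVert_of_compl h2] at hv
      exact compl_injective hv
    · exfalso
      rw [hierVert_of_compl h1] at hv
      have h3 := (mem_children.1 (hH.hierVert_spec hA' h2).2).1
      rw [← hv] at h3
      obtain ⟨-, h4⟩ := h'.resolve_right fun h => h2 h.1
      rcases h with h | h
      · exact (hH.hierVert_subset_iff hB h.1 h1).1 h.2 (h4.trans h3.subset)
      · exact h.2 (h4.trans h3.subset)
  · obtain ⟨-, h5⟩ := h.resolve_right fun h => h1 h.1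
    by_cases h2 : A'ᶜ ∈ H
    · exfalso
      rw [hierVert_of_compl h2] at hv
      have h3 := (mem_children.1 (hH.hierVert_spec hA h1).2).1
      rw [hv] at h3
      rcases h' with h | h
      · exact (hH.hierVert_subset_iff hB h.1 h2).1 h.2 (h5.trans h3.subset)
      · exact h.2 (h5.trans h3.subset)
    · obtain ⟨-, h4⟩ := h'.resolve_right fun h => h2 h.1
      have h3 := (hH.hierVert_spec hA h1)
      have h3' := (hH.hierVert_spec hA' h2).2
      rw [← hv] at h3'
      obtain ⟨x, hx⟩ := hH.nonempty (hH.hierVert_mem hB)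
      exact (hH.isPart_children (hH.two_le _ h3.1)).unique A h3.2 A' h3' x (h5 hx) (h4 hx)

/-- Every other vertex is beyond one of the flags at a vertex: beyond a flag to a child, if it is a
subset, and beyond the flag towards the root otherwise. -/
lemma exists_beyond {A B : Finset L} (hA : IsFlagSet H A) (hB : IsFlagSet H B)
    (hne : hierVert H A ≠ hierVert H B) :
    ∃ D, IsFlagSet H D ∧ hierVert H D = hierVert H A ∧ Beyond H D (hierVert H B) := by
  by_cases h : hierVert H B ⊆ hierVert H A
  · obtain ⟨D, hD, hBD⟩ := exists_mem_children (H := H)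
      (Finset.ssubset_iff_subset_ne.2 ⟨h, hne.symm⟩) (Or.inl (hH.hierVert_mem hB))
    refine ⟨D, isFlagSet_of_mem_children hD, hH.hierVert_child hA hD, Or.inl ⟨?_, hBD⟩⟩
    refine (mem_children.1 hD).2.1.resolve_right fun h1 => ?_
    have := hH.two_le _ (hH.hierVert_mem hB)
    have := Finset.card_le_card hBD
    omega
  · have h1 : (hierVert H A)ᶜᶜ ∈ H := by
      rw [compl_compl]
      exact hH.hierVert_mem hA
    refine ⟨(hierVert H A)ᶜ, Or.inr (Or.inr ⟨h1, ?_⟩), ?_, Or.inr ⟨h1, ?_⟩⟩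
    · rw [compl_compl]
      intro h2
      exact h (h2 ▸ Finset.subset_univ _)
    · rw [hierVert_of_compl h1, compl_compl]
    · rwa [compl_compl]

/-- Every vertex carries three flags, two of which have colour `0`. -/
lemma exists_three {A : Finset L} (hA : IsFlagSet H A) : ∃ B D E, IsFlagSet H B ∧ IsFlagSet H D ∧
    IsFlagSet H E ∧ hierVert H B = hierVert H A ∧ hierVert H D = hierVert H A ∧
    hierVert H E = hierVert H A ∧ B ≠ D ∧ B ≠ E ∧ D ≠ E ∧ colB col B = 0 ∧ colB col D = 0 := by
  have hS := hH.hierVert_mem hA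
  have hP := hH.isPart_children (hH.two_le _ hS)
  by_cases hu : hierVert H A = Finset.univ
  · obtain ⟨B, hB, D, hD, hBD, hcB, hcD⟩ : ∃ B ∈ children H (hierVert H A),
        ∃ D ∈ children H (hierVert H A), B ≠ D ∧ colB col B = 0 ∧ colB col D = 0 := by
      rw [hu]
      refine hH.root.resolve_left ?_
      rintro ⟨B, hB, hB'⟩
      exact hH.hierVert_ne_univ hA hB hB' hu
    -- Two children of the root do not exhaust the labels: otherwise they would be complementary,
    -- and the root would stand for an edge.
    obtain ⟨x, hx⟩ : ∃ x, x ∉ B ∪ D := by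
      by_contra! hall
      have hcompl : D = Bᶜ := by
        ext x
        rw [Finset.mem_compl]
        constructor
        · exact fun hxD hxB => hBD (hP.unique B hB D hD x hxB hxD)
        · exact fun hxB => (Finset.mem_union.1 (hall x)).resolve_left hxB
      subst hcompl
      have hBf := isFlagSet_of_mem_children hB
      rcases (mem_children.1 hB).2.1 with h1 | h1
      · rcases (mem_children.1 hD).2.1 with h2 | h2
        · exact hH.hierVert_ne_univ hA h1 h2 hu
        · exact hH.card_compl B h1 h2
      · rcases (mem_children.1 hD).2.1 with h2 | h2
        · exact hH.compl_not_mem_of_card h1 h2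
        · have := Finset.card_add_card_compl B
          have := hH.three_le
          omega
    obtain ⟨E, hE, hxE⟩ := hP.cover x (hu ▸ Finset.mem_univ x)
    rw [Finset.mem_union, not_or] at hx
    exact ⟨B, D, E, isFlagSet_of_mem_children hB, isFlagSet_of_mem_children hD,
      isFlagSet_of_mem_children hE, hH.hierVert_child hA hB, hH.hierVert_child hA hD,
      hH.hierVert_child hA hE, hBD, fun h => hx.1 (h ▸ hxE), fun h => hx.2 (h ▸ hxE), hcB, hcD⟩
  · obtain ⟨B, hB, hcB⟩ := hH.colour _ hS hu
    obtain ⟨x, hxS, hxB⟩ := Finset.exists_of_ssubset (mem_children.1 hB).1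
    obtain ⟨E, hE, hxE⟩ := hP.cover x hxS
    have h1 : (hierVert H A)ᶜᶜ ∈ H := by rwa [compl_compl]
    have h2 : IsFlagSet H (hierVert H A)ᶜ := Or.inr (Or.inr ⟨h1, by rwa [compl_compl]⟩)
    refine ⟨B, (hierVert H A)ᶜ, E, isFlagSet_of_mem_children hB, h2,
      isFlagSet_of_mem_children hE, hH.hierVert_child hA hB, ?_, hH.hierVert_child hA hE,
      hH.compl_ne_of_child hB, fun h => hxB (h ▸ hxE), (hH.compl_ne_of_child hE).symm, hcB,
      colB_of_not ?_⟩
    · rw [hierVert_of_compl h1, compl_compl]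
    · rintro ⟨x, hx⟩
      exact hH.card_compl _ hS (by rw [hx, Finset.card_singleton])

/-- The leaves beyond a flag are the elements of its set. -/
lemma mem_iff_beyond {A : Finset L} (hA : IsFlagSet H A) (l : L) :
    l ∈ A ↔ A = {l} ∨ Beyond H A (hierVert H {l}) := by
  have hl : ({l} : Finset L)ᶜ ∉ H := hH.compl_not_mem_of_card (by simp)
  have hlf : IsFlagSet H {l} := Or.inl (by simp)
  obtain ⟨hp, hc⟩ := hH.hierVert_spec hlf hl
  have hlp : l ∈ hierVert H {l} := by simpa using (mem_children.1 hc).1.subset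
  have key : ∀ U ∈ H, l ∈ U → hierVert H {l} ⊆ U := by
    intro U hU hlU
    rcases hH.laminar _ hp U hU with h | h | h
    · exact h
    · rcases h.eq_or_ssubset with h | h
      · rw [h]
      · have := (mem_children.1 hc).2.2 U hU (by simpa using hlU) h
        exact absurd hU (hH.not_mem_of_card (by simp [this]))
    · exact absurd hlU (Finset.disjoint_left.1 h hlp)
  constructor
  · intro h
    rcases hA with h1 | h1 | h1
    · left
      obtain ⟨x, rfl⟩ := Finset.card_eq_one.1 h1
      rw [Finset.mem_singleton.1 h]
    · exact Or.inr (Or.inl ⟨h1.1, key A h1.1 h⟩)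
    · exact Or.inr (Or.inr ⟨h1.1, fun h2 => Finset.mem_compl.1 (h2 hlp) h⟩)
  · rintro (rfl | ⟨-, h⟩ | ⟨h, h'⟩)
    · simp
    · exact h hlp
    · by_contra hlA
      exact h' (key _ h (Finset.mem_compl.2 hlA))

end IsStableHier

end

section tree

variable {F L : Type} [Fintype L] [DecidableEq L] {H : Finset (Finset L)}

/-- The partition of the flags of the tree of a hierarchy into vertices; the flags are indexed
by `F`. -/
def hierSetoid (H : Finset (Finset L)) (A : F → Finset L) : Setoid F :=
  Setoid.ker fun f => hierVert H (A f)

open Classical in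
/-- The involution on the flags of the tree of a hierarchy. -/
def hierInv (A : F → Finset L) (f : F) : F := if h : ∃ g, A g = (A f)ᶜ then h.choose else f

/-- The vertices beyond a flag of the tree of a hierarchy. -/
def hierSide (H : Finset (Finset L)) (A : F → Finset L) (f : F) :
    Set (Quotient (hierSetoid H A)) :=
  {v | ∃ g, Quotient.mk _ g = v ∧ Beyond H (A f) (hierVert H (A g))}

lemma mk_hierSetoid_eq {A : F → Finset L} {f g : F} :
    Quotient.mk (hierSetoid H A) f = Quotient.mk (hierSetoid H A) g ↔
      hierVert H (A f) = hierVert H (A g) := Quotient.eq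

lemma mk_mem_hierSide {A : F → Finset L} {f g : F} :
    Quotient.mk (hierSetoid H A) g ∈ hierSide H A f ↔ Beyond H (A f) (hierVert H (A g)) := by
  constructor
  · rintro ⟨h, hv, hb⟩
    rwa [← mk_hierSetoid_eq.1 hv]
  · exact fun h => ⟨g, rfl, h⟩

lemma away_hierSide_vertex {A : F → Finset L} {f g : F} :
    Away (hierSide H A) {Quotient.mk _ f} g ↔ ¬ Beyond H (A g) (hierVert H (A f)) := by
  rw [Away, ← mk_mem_hierSide]
  simp

lemma away_hierSide_edge {A : F → Finset L} {f f' g : F} :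
    Away (hierSide H A) {Quotient.mk _ f, Quotient.mk _ f'} g ↔
      ¬ Beyond H (A g) (hierVert H (A f)) ∨ ¬ Beyond H (A g) (hierVert H (A f')) := by
  rw [Away, ← mk_mem_hierSide, ← mk_mem_hierSide]
  simp

lemma apply_hierInv {A : F → Finset L} {f : F} (h : ∃ g, A g = (A f)ᶜ) :
    A (hierInv A f) = (A f)ᶜ := by
  rw [hierInv, dif_pos h]
  exact h.choose_spec

/-- The sets `A f` are those of the flags of the tree of a stable hierarchy. -/
structure IsHierFlags (H : Finset (Finset L)) (col : L → Fin 2) (A : F → Finset L) : Prop where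
  stable : IsStableHier H col
  injective : Function.Injective A
  range : ∀ B, (∃ f, A f = B) ↔ IsFlagSet H B

/-- The flags of edges are those whose complements are also sets of flags. -/
lemma IsStableHier.isFlagSet_compl_iff {col : L → Fin 2} (hH : IsStableHier H col) {B : Finset L}
    (hB : IsFlagSet H B) :
    IsFlagSet H Bᶜ ↔ B ∈ H ∨ Bᶜ ∈ H := by
  constructor
  · rintro (h | h | h)
    · exfalso
      rcases hB with h1 | h1 | h1
      · have := Finset.card_add_card_compl B
        have := hH.three_le
        omega
      · exact hH.card_compl B h1.1 h
      · exact hH.not_mem_of_card h h1.1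
    · exact Or.inr h.1
    · exact Or.inl (by simpa using h.1)
  · rintro (h | h)
    · exact Or.inr (Or.inr (by rw [compl_compl]; exact ⟨h, hH.flag_ne_univ hB⟩))
    · refine Or.inr (Or.inl ⟨h, fun h' => ?_⟩)
      exact (hH.flag_nonempty hB).ne_empty (by simpa using h')

namespace IsHierFlags

variable {col : L → Fin 2} {A : F → Finset L} (hA : IsHierFlags H col A)

include hA

lemma isFlagSet (f : F) : IsFlagSet H (A f) := (hA.range _).1 ⟨f, rfl⟩

lemma exists_compl_iff (f : F) : (∃ g, A g = (A f)ᶜ) ↔ A f ∈ H ∨ (A f)ᶜ ∈ H :=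
  (hA.range _).trans (hA.stable.isFlagSet_compl_iff (hA.isFlagSet f))

lemma hierInv_ne_iff (f : F) : hierInv A f ≠ f ↔ A f ∈ H ∨ (A f)ᶜ ∈ H := by
  rw [← hA.exists_compl_iff]
  constructor
  · intro h
    by_contra h'
    exact h (dif_neg h')
  · intro h h'
    have := apply_hierInv h
    rw [h'] at this
    obtain ⟨x, hx⟩ := hA.stable.flag_nonempty (hA.isFlagSet f)
    exact Finset.mem_compl.1 (this ▸ hx) hx

lemma flagSides :
    FlagSides (Quotient.mk (hierSetoid H A)) (hierInv A) (hierSide H A) where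
  inv_inv f := by
    by_cases h : ∃ g, A g = (A f)ᶜ
    · have h1 := apply_hierInv h
      apply hA.injective
      rw [apply_hierInv (A := A) ⟨f, by rw [h1, compl_compl]⟩, h1, compl_compl]
    · have h1 : hierInv A f = f := dif_neg h
      rw [h1, h1]
  leaf f hf := by
    ext v
    obtain ⟨g, rfl⟩ := Quotient.exists_rep v
    have := fun h => (hA.hierInv_ne_iff f).2 h hf
    rw [mk_mem_hierSide]
    simp only [Set.mem_empty_iff_false, iff_false]
    rintro (h | h)
    · exact this (Or.inl h.1)
    · exact this (Or.inr h.1)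
  compl f hf w := by
    obtain ⟨g, rfl⟩ := Quotient.exists_rep w
    have h1 := (hA.hierInv_ne_iff f).1 hf
    rw [mk_mem_hierSide, mk_mem_hierSide, apply_hierInv ((hA.exists_compl_iff f).2 h1)]
    exact hA.stable.beyond_compl h1 (hA.isFlagSet g)
  vert_not_mem f := by
    rw [mk_mem_hierSide]
    exact hA.stable.not_beyond_self (hA.isFlagSet f)
  exists_flag u w hne := by
    obtain ⟨f, rfl⟩ := Quotient.exists_rep u
    obtain ⟨g, rfl⟩ := Quotient.exists_rep w
    obtain ⟨D, hD, hv, hb⟩ := hA.stable.exists_beyond (hA.isFlagSet f)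
      (hA.isFlagSet g) (fun h => hne (mk_hierSetoid_eq.2 h))
    obtain ⟨k, rfl⟩ := (hA.range D).2 hD
    exact ⟨k, mk_hierSetoid_eq.2 hv, mk_mem_hierSide.2 hb⟩
  unique f f' w hv h h' := by
    obtain ⟨g, rfl⟩ := Quotient.exists_rep w
    exact hA.injective (hA.stable.beyond_unique (hA.isFlagSet f) (hA.isFlagSet f')
      (hA.isFlagSet g) (mk_hierSetoid_eq.1 hv) (mk_mem_hierSide.1 h)
      (mk_mem_hierSide.1 h'))

lemma exists_leaf (l : L) : ∃ f, A f = {l} := (hA.range _).2 (Or.inl (by simp))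

lemma hierInv_leaf {f : F} {l : L} (hf : A f = {l}) : hierInv A f = f := by
  by_contra h
  rcases (hA.hierInv_ne_iff f).1 h with h | h
  · exact hA.stable.not_mem_of_card (by simp) (hf ▸ h)
  · exact hA.stable.compl_not_mem_of_card (by simp) (hf ▸ h)

lemma exists_leaf_of_hierInv {f : F} (hf : hierInv A f = f) : ∃ l, A f = {l} := by
  have h := (hA.hierInv_ne_iff f).not_right.1 hf
  rcases hA.isFlagSet f with h1 | h1 | h1
  · exact Finset.card_eq_one.1 h1
  · exact absurd (Or.inl h1.1) h
  · exact absurd (Or.inr h1.1) h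

lemma colour_of_hierInv_ne {f : F} (hf : hierInv A f ≠ f) : colB col (A f) = 0 := by
  refine colB_of_not ?_
  rintro ⟨l, hl⟩
  exact hf (hA.hierInv_leaf hl)

/-- Three flags at the vertex of a given flag. -/
lemma exists_three (f : F) : ∃ b d e, hierVert H (A b) = hierVert H (A f) ∧
    hierVert H (A d) = hierVert H (A f) ∧ hierVert H (A e) = hierVert H (A f) ∧ b ≠ d ∧ b ≠ e ∧
    d ≠ e ∧ colB col (A b) = 0 ∧ colB col (A d) = 0 := by
  obtain ⟨B, D, E, hB, hD, hE, hvB, hvD, hvE, hBD, hBE, hDE, hcB, hcD⟩ :=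
    hA.stable.exists_three (hA.isFlagSet f)
  obtain ⟨b, rfl⟩ := (hA.range _).2 hB
  obtain ⟨d, rfl⟩ := (hA.range _).2 hD
  obtain ⟨e, rfl⟩ := (hA.range _).2 hE
  exact ⟨b, d, e, hvB, hvD, hvE, fun h => hBD (h ▸ rfl), fun h => hBE (h ▸ rfl),
    fun h => hDE (h ▸ rfl), hcB, hcD⟩

/-- The tree of a stable hierarchy. -/
def tree [Finite F] : StableTree F where
  part := hierSetoid H A
  inv := hierInv A
  inv_inv := hA.flagSides.inv_inv
  colour f := colB col (A f)
  colour_inv f := by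
    by_cases h : hierInv A f = f
    · rw [h]
    · rw [hA.colour_of_hierInv_ne h, hA.colour_of_hierInv_ne]
      rw [hA.flagSides.inv_inv]
      exact Ne.symm h
  edge_colour f hf := hA.colour_of_hierInv_ne hf
  isTree := by
    refine hA.flagSides.isTree ?_
    have : 0 < Fintype.card L := by
      have := hA.stable.three_le
      omega
    obtain ⟨l⟩ := Fintype.card_pos_iff.1 this
    obtain ⟨f, -⟩ := hA.exists_leaf l
    exact ⟨Quotient.mk _ f⟩
  three_le v := by
    obtain ⟨f, rfl⟩ := Quotient.exists_rep v
    obtain ⟨b, d, e, hvb, hvd, hve, hbd, hbe, hde, -⟩ := hA.exists_three f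
    change 3 ≤ Nat.card ({g | Quotient.mk (hierSetoid H A) g = Quotient.mk _ f} : Set F)
    rw [Nat.card_coe_set_eq]
    refine (Set.ncard_eq_three.2 ⟨b, d, e, hbd, hbe, hde, rfl⟩).symm.le.trans
      (Set.ncard_le_ncard ?_ (Set.toFinite _))
    rintro x (rfl | rfl | rfl)
    · exact mk_hierSetoid_eq.2 hvb
    · exact mk_hierSetoid_eq.2 hvd
    · exact mk_hierSetoid_eq.2 hve
  two_le v := by
    obtain ⟨f, rfl⟩ := Quotient.exists_rep v
    obtain ⟨b, d, e, hvb, hvd, hve, hbd, hbe, hde, hcb, hcd⟩ := hA.exists_three f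
    change 2 ≤ Nat.card ({g | Quotient.mk (hierSetoid H A) g = Quotient.mk _ f ∧
      colB col (A g) = 0} : Set F)
    rw [Nat.card_coe_set_eq]
    refine (Set.ncard_pair hbd).symm.le.trans (Set.ncard_le_ncard ?_ (Set.toFinite _))
    rintro x (rfl | rfl)
    · exact ⟨mk_hierSetoid_eq.2 hvb, hcb⟩
    · exact ⟨mk_hierSetoid_eq.2 hvd, hcd⟩

end IsHierFlags

end tree

/-! ### Numbered stable trees -/

section numbering

variable {F : Type} {T : StableTree F} {m n : ℕ}

/-- The leaf with a given label. -/
def leafOf (l : T.Numbering m n) : Fin m ⊕ Fin n → F := Sum.elim (fun i => l.1 i) fun j => l.2 j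

lemma colour_leafOf (l : T.Numbering m n) (x : Fin m ⊕ Fin n) :
    T.colour (leafOf l x) = sumCol m n x := by
  rcases x with i | j
  · exact (l.1 i).2.2
  · exact (l.2 j).2.2

lemma leafOf_sumCongr (l : T.Numbering m n) (σ : Perm (Fin m)) (τ : Perm (Fin n))
    (x : Fin m ⊕ Fin n) :
    leafOf (T := T) (σ.trans l.1, τ.trans l.2) x = leafOf l (Perm.sumCongr σ τ x) := by
  rcases x with i | j <;> rfl

lemma flagSides_of_stableTree (T : StableTree F) :
    FlagSides (Quotient.mk T.part) T.inv (flagSide T.part T.inv) :=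
  flagSides_of_isTree T.isTree T.inv_inv

lemma leafTree (l : T.Numbering m n) :
    LeafTree (Quotient.mk T.part) T.inv (flagSide T.part T.inv) (leafOf l) where
  toFlagSides := flagSides_of_stableTree T
  loc_injective := by
    have h : ∀ (i : Fin m) (j : Fin n), (l.1 i : F) ≠ l.2 j := by
      intro i j h
      have h1 := (l.1 i).2.2
      rw [h, (l.2 j).2.2] at h1
      exact one_ne_zero h1
    rintro (i | j) (i' | j') hij
    · exact congrArg Sum.inl (l.1.injective (Subtype.ext hij))
    · exact absurd hij (h i j')
    · exact absurd hij.symm (h i' j)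
    · exact congrArg Sum.inr (l.2.injective (Subtype.ext hij))
  loc_iff f := by
    constructor
    · intro hf
      have h2 : ∀ i : Fin 2, i = 0 ∨ i = 1 := by decide
      rcases h2 (T.colour f) with hc | hc
      · exact ⟨Sum.inl (l.1.symm ⟨f, hf, hc⟩), by simp [leafOf]⟩
      · exact ⟨Sum.inr (l.2.symm ⟨f, hf, hc⟩), by simp [leafOf]⟩
    · rintro ⟨i | j, rfl⟩
      · exact (l.1 i).2.1
      · exact (l.2 j).2.1
  three v f g := by
    by_contra! h
    have h1 := T.three_le v
    change 3 ≤ Nat.card ({f | Quotient.mk T.part f = v} : Set F) at h1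
    rw [Nat.card_coe_set_eq] at h1
    have h2 : {f | Quotient.mk T.part f = v} ⊆ ({f, g} : Set F) := by
      intro x hx
      by_cases hxf : x = f
      · exact Or.inl hxf
      · exact Or.inr (h x hx hxf)
    have := (h1.trans (Set.ncard_le_ncard h2 (Set.toFinite _))).trans (Set.ncard_insert_le f {g})
    rw [Set.ncard_singleton] at this
    omega

/-- The set of labels beyond a flag of a numbered stable tree. -/
def labels (l : T.Numbering m n) (f : F) : Finset (Fin m ⊕ Fin n) :=
  leafSet (Quotient.mk T.part) (flagSide T.part T.inv) (leafOf l) f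

/-- The isomorphism class of a numbered stable tree is determined by this family of sets of
labels. -/
def splits [Fintype F] (l : T.Numbering m n) : Finset (Finset (Fin m ⊕ Fin n)) :=
  Finset.univ.image (labels l)

lemma labels_injective [Finite F] (l : T.Numbering m n) : Function.Injective (labels l) :=
  (leafTree l).leafSet_injective

/-- The colour of a flag is determined by its set of labels, since the flags of edges have the
first colour. -/
lemma colour_eq_colB [Finite F] (l : T.Numbering m n) (f : F) :
    T.colour f = colB (sumCol m n) (labels l f) := by
  by_cases hf : T.inv f = f
  · obtain ⟨x, rfl⟩ := ((leafTree l).loc_iff f).1 hf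
    rw [labels, (leafTree l).leafSet_loc, colB_singleton, colour_leafOf]
  · rw [T.edge_colour f hf, colB_of_not]
    rintro ⟨x, hx⟩
    exact hf ((leafTree l).card_leafSet_eq_one_iff.1 (by rw [labels] at hx; rw [hx]; simp))

end numbering

section iso

variable {F F' : Type} {T : StableTree F} {T' : StableTree F'} {m n : ℕ}

/-- An isomorphism of trees respects the sides of the flags. -/
lemma flagSide_iso [Finite F] (e : StableTree.Iso T T') (f : F) (v : T.Vertex) :
    e.verts v ∈ flagSide T'.part T'.inv (e.flags f) ↔ v ∈ flagSide T.part T.inv f := by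
  have hs' := flagSides_of_stableTree T'
  have h : FlagSides (Quotient.mk T.part) T.inv
      fun f => {v | e.verts v ∈ flagSide T'.part T'.inv (e.flags f)} :=
    { inv_inv := T.inv_inv
      leaf := fun f hf => by
        rw [hs'.leaf _ (by rw [e.inv_comm, hf])]
        rfl
      compl := fun f hf w => by
        have := hs'.compl (e.flags f) (by rwa [e.inv_comm, e.flags.injective.ne_iff]) (e.verts w)
        rwa [e.inv_comm] at this
      vert_not_mem := fun f => hs'.vert_not_mem (e.flags f)
      exists_flag := fun u w huw => by
        obtain ⟨f, hf, hw⟩ := hs'.exists_flag _ _ (e.verts.injective.ne huw)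
        refine ⟨e.flags.symm f, e.verts.injective ?_, ?_⟩
        · rw [← hf]
          change Quotient.mk T'.part (e.flags (e.flags.symm f)) = _
          rw [Equiv.apply_symm_apply]
        · change e.verts w ∈ flagSide T'.part T'.inv (e.flags (e.flags.symm f))
          rwa [Equiv.apply_symm_apply]
      unique := fun f f' w hv hw hw' => e.flags.injective
        (hs'.unique _ _ _ (congrArg e.verts hv) hw hw') }
  exact Set.ext_iff.1 (congrFun (h.eq_of_flagSides (flagSides_of_stableTree T)) f) v

lemma leafOf_iso {e : StableTree.Iso T T'} {l : T.Numbering m n} {l' : T'.Numbering m n}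
    (he : e.Preserves l l') (x : Fin m ⊕ Fin n) : leafOf l' x = e.flags (leafOf l x) := by
  rcases x with i | j
  · exact he.1 i
  · exact he.2 j

lemma labels_iso [Finite F] {e : StableTree.Iso T T'} {l : T.Numbering m n}
    {l' : T'.Numbering m n} (he : e.Preserves l l') (f : F) :
    labels l' (e.flags f) = labels l f := by
  ext x
  rw [labels, labels, mem_leafSet, mem_leafSet, leafOf_iso he, e.flags.injective.eq_iff,
    ← flagSide_iso e f (Quotient.mk T.part (leafOf l x))]
  rfl

lemma splits_iso [Fintype F] [Fintype F'] {e : StableTree.Iso T T'} {l : T.Numbering m n}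
    {l' : T'.Numbering m n} (he : e.Preserves l l') : splits l' = splits l := by
  ext A
  simp only [splits, Finset.mem_image, Finset.mem_univ, true_and, e.flags.surjective.exists,
    labels_iso he]

/-- Isomorphisms of numbered stable trees are unique. -/
lemma iso_unique [Finite F] [Finite F'] {e e' : StableTree.Iso T T'} {l : T.Numbering m n}
    {l' : T'.Numbering m n} (he : e.Preserves l l') (he' : e'.Preserves l l') :
    e.flags = e'.flags :=
  Equiv.ext fun f => labels_injective l' (by rw [labels_iso he, labels_iso he'])

lemma exists_iso [Fintype F] [Fintype F'] {l : T.Numbering m n} {l' : T'.Numbering m n}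
    (h : splits l = splits l') : ∃ e : StableTree.Iso T T', e.Preserves l l' := by
  have hr : Set.range (labels l) = Set.range (labels l') := by
    ext A
    have := Finset.ext_iff.1 h A
    simpa [splits] using this
  obtain ⟨e, he, hv, hi, hl⟩ := exists_iso_of_range_eq (leafTree l) (leafTree l') hr
  refine ⟨⟨e, fun a b => ?_, hi, fun f => ?_⟩, fun i => (hl (Sum.inl i)).symm,
    fun j => (hl (Sum.inr j)).symm⟩
  · have := hv a b
    rwa [Quotient.eq, Quotient.eq] at this
  · rw [colour_eq_colB l, colour_eq_colB l']
    exact congrArg _ (he f)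

end iso

section centre

variable {F F' : Type} {T : StableTree F} {T' : StableTree F'}

lemma isCentre_iso (e : StableTree.Iso T T') {C : Set T.Vertex}
    (hC : IsCentre (Quotient.mk T.part) T.inv C) :
    IsCentre (Quotient.mk T'.part) T'.inv (e.verts '' C) := by
  rcases hC with ⟨v, rfl⟩ | ⟨f, hf, rfl⟩
  · exact Or.inl ⟨e.verts v, Set.image_singleton⟩
  · refine Or.inr ⟨e.flags f, by rwa [e.inv_comm, e.flags.injective.ne_iff], ?_⟩
    rw [Set.image_pair, e.inv_comm]
    rfl

end centre

section centre

variable {F : Type} [Fintype F] {T : StableTree F} {m n : ℕ}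

/-- The hierarchy of a numbered stable tree with a centre. -/
def hierOf (l : T.Numbering m n) (C : Set T.Vertex) : Finset (Finset (Fin m ⊕ Fin n)) :=
  centreHier (Quotient.mk T.part) T.inv (flagSide T.part T.inv) (leafOf l) C

lemma mem_hierOf {l : T.Numbering m n} {C : Set T.Vertex} {A : Finset (Fin m ⊕ Fin n)} :
    A ∈ hierOf l C ↔ A = Finset.univ ∨
      ∃ f, (T.inv f ≠ f ∧ Away (flagSide T.part T.inv) C f) ∧ labels l f = A :=
  mem_centreHier

variable {F' : Type} {T' : StableTree F'}

lemma away_iso (e : StableTree.Iso T T') (C : Set T.Vertex) (f : F) :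
    Away (flagSide T'.part T'.inv) (e.verts '' C) (e.flags f) ↔
      Away (flagSide T.part T.inv) C f := by
  simp only [Away, Set.exists_mem_image, flagSide_iso]

lemma hierOf_iso [Fintype F'] {e : StableTree.Iso T T'} {l : T.Numbering m n}
    {l' : T'.Numbering m n} (he : e.Preserves l l') (C : Set T.Vertex) :
    hierOf l' (e.verts '' C) = hierOf l C := by
  ext A
  simp only [mem_hierOf, e.flags.surjective.exists, away_iso, labels_iso he, e.inv_comm,
    e.flags.injective.ne_iff]

end centre

section model

variable {k m n : ℕ} {H : Finset (Finset (Fin m ⊕ Fin n))} {A : Fin k → Finset (Fin m ⊕ Fin n)}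

namespace IsHierFlags

variable (hA : IsHierFlags H (sumCol m n) A)

include hA

lemma exists_numbering : ∃ l : hA.tree.Numbering m n, ∀ x, A (leafOf l x) = {x} := by
  choose loc hloc using hA.exists_leaf
  have hc : ∀ x, hA.tree.colour (loc x) = sumCol m n x := fun x => by
    change colB _ (A (loc x)) = _
    rw [hloc, colB_singleton]
  have hinj : Function.Injective loc := fun x y h => by
    have := hloc x
    rw [h, hloc] at this
    exact (Finset.singleton_injective this).symm
  have hsurj : ∀ f, hA.tree.inv f = f → ∃ x, loc x = f := fun f hf => by
    obtain ⟨x, hx⟩ := hA.exists_leaf_of_hierInv hf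
    exact ⟨x, hA.injective (by rw [hloc, hx])⟩
  let l0 : Fin m → hA.tree.Leaves 0 := fun i =>
    ⟨loc (Sum.inl i), hA.hierInv_leaf (hloc _), hc _⟩
  let l1 : Fin n → hA.tree.Leaves 1 := fun i =>
    ⟨loc (Sum.inr i), hA.hierInv_leaf (hloc _), hc _⟩
  have h0 : Function.Bijective l0 := by
    refine ⟨fun i j h => Sum.inl_injective (hinj (congrArg Subtype.val h)), ?_⟩
    rintro ⟨f, hf, hcf⟩
    obtain ⟨x | x, rfl⟩ := hsurj f hf
    · exact ⟨x, rfl⟩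
    · rw [hc] at hcf
      exact absurd hcf one_ne_zero
  have h1 : Function.Bijective l1 := by
    refine ⟨fun i j h => Sum.inr_injective (hinj (congrArg Subtype.val h)), ?_⟩
    rintro ⟨f, hf, hcf⟩
    obtain ⟨x | x, rfl⟩ := hsurj f hf
    · rw [hc] at hcf
      exact absurd hcf zero_ne_one
    · exact ⟨x, rfl⟩
  refine ⟨(Equiv.ofBijective l0 h0, Equiv.ofBijective l1 h1), ?_⟩
  rintro (i | i)
  · exact hloc _
  · exact hloc _

lemma flagSide_eq : flagSide hA.tree.part hA.tree.inv = hierSide H A :=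
  (flagSides_of_stableTree hA.tree).eq_of_flagSides hA.flagSides

lemma labels_eq {l : hA.tree.Numbering m n} (hl : ∀ x, A (leafOf l x) = {x}) (f : Fin k) :
    labels l f = A f := by
  ext x
  have h := hA.stable.mem_iff_beyond (hA.isFlagSet f) x
  rw [← hl x] at h
  rw [labels, mem_leafSet, h, hA.flagSide_eq]
  refine or_congr ?_ mk_mem_hierSide
  rw [hA.injective.eq_iff, eq_comm]

/-- The hierarchy is recovered from a centre away from which exactly the flags in `H` point. -/
lemma hierOf_eq {l : hA.tree.Numbering m n} (hl : ∀ x, A (leafOf l x) = {x})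
    {C : Set hA.tree.Vertex}
    (hC : ∀ f, A f ∈ H ∨ (A f)ᶜ ∈ H → (Away (hierSide H A) C f ↔ A f ∈ H)) : hierOf l C = H := by
  ext B
  rw [mem_hierOf, hA.flagSide_eq]
  simp only [hA.labels_eq hl]
  constructor
  · rintro (rfl | ⟨f, ⟨hf, hfa⟩, rfl⟩)
    · exact hA.stable.univ_mem
    · exact (hC f ((hA.hierInv_ne_iff f).1 hf)).1 hfa
  · intro hB
    by_cases hu : B = Finset.univ
    · exact Or.inl hu
    · obtain ⟨f, rfl⟩ := (hA.range B).2 (Or.inr (Or.inl ⟨hB, hu⟩))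
      exact Or.inr ⟨f, ⟨(hA.hierInv_ne_iff f).2 (Or.inl hB), (hC f (Or.inl hB)).2 hB⟩, rfl⟩

/-- The centre is the edge between two complementary members of the hierarchy, if there are such
members, and the root otherwise. -/
lemma exists_centre {l : hA.tree.Numbering m n} (hl : ∀ x, A (leafOf l x) = {x}) :
    ∃ C, IsCentre (Quotient.mk hA.tree.part) hA.tree.inv C ∧ hierOf l C = H := by
  by_cases hedge : ∃ B ∈ H, Bᶜ ∈ H
  · obtain ⟨B, hB, hB'⟩ := hedge
    obtain ⟨f, rfl⟩ := (hA.range B).2 (Or.inr (Or.inl ⟨hB, hA.stable.ne_univ_of_compl hB'⟩))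
    have hf := (hA.hierInv_ne_iff f).2 (Or.inl hB)
    have hAf := apply_hierInv ((hA.exists_compl_iff f).2 (Or.inl hB))
    refine ⟨_, Or.inr ⟨f, hf, rfl⟩, hA.hierOf_eq hl fun g hg => ?_⟩
    have hv1 : hierVert H (A f) = (A f)ᶜ := hierVert_of_compl hB'
    have hv2 : hierVert H (A (hierInv A f)) = A f := by
      rw [hAf, hierVert_of_compl (by rwa [compl_compl]), compl_compl]
    refine away_hierSide_edge.trans ?_
    rw [← not_and_or]
    constructor
    · intro h
      by_contra hgH
      have hg' := hg.resolve_left hgH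
      have hgu : (A g)ᶜ ≠ Finset.univ := fun h =>
        (hA.stable.flag_nonempty (hA.isFlagSet g)).ne_empty (by simpa using h)
      refine h ⟨Or.inr ⟨hg', fun h1 => ?_⟩, Or.inr ⟨hg', fun h1 => ?_⟩⟩
      · rw [hv1] at h1
        rcases hA.stable.subset_or_subset_compl hB hB' hg' hgu with h2 | h2
        · obtain ⟨x, hx⟩ := hA.stable.nonempty hB'
          exact (Finset.mem_compl.1 hx) (h2 (h1 hx))
        · exact hgH (compl_injective (h2.antisymm h1) ▸ hB)
      · change hierVert H (A (hierInv A f)) ⊆ _ at h1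
        rw [hv2] at h1
        rcases hA.stable.subset_or_subset_compl hB hB' hg' hgu with h2 | h2
        · exact hgH ((compl_eq_comm.1 (h2.antisymm h1)) ▸ hB')
        · obtain ⟨x, hx⟩ := hA.stable.nonempty hB
          exact (Finset.mem_compl.1 (h2 (h1 hx))) hx
    · rintro hgH ⟨h1, h2⟩
      rw [hA.stable.beyond_iff_of_mem (hA.isFlagSet _) hgH] at h1 h2
      change hierVert H (A (hierInv A f)) ⊆ _ at h2
      rw [hv1] at h1
      rw [hv2] at h2
      refine hA.stable.flag_ne_univ (hA.isFlagSet g) (Finset.univ_subset_iff.1 ?_)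
      rw [← Finset.union_compl (A f)]
      exact Finset.union_subset h2 h1
  · have hnot : ∀ B ∈ H, Bᶜ ∉ H := fun B hB hB' => hedge ⟨B, hB, hB'⟩
    have h3 := hA.stable.three_le
    obtain ⟨x⟩ : Nonempty (Fin m ⊕ Fin n) := Fintype.card_pos_iff.1 (by omega)
    obtain ⟨B, hB, -⟩ := (hA.stable.isPart_children
      (by rw [Finset.card_univ]; omega)).cover x (Finset.mem_univ x)
    obtain ⟨f, rfl⟩ := (hA.range B).2 (isFlagSet_of_mem_children hB)
    have hv : hierVert H (A f) = Finset.univ := by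
      refine hA.stable.hierVert_eq (fun h => ?_) hA.stable.univ_mem hB
      rcases (mem_children.1 hB).2.1 with h1 | h1
      · exact hnot _ h1 h
      · exact hA.stable.compl_not_mem_of_card h1 h
    refine ⟨_, Or.inl ⟨Quotient.mk _ f, rfl⟩, hA.hierOf_eq hl fun g hg => ?_⟩
    refine away_hierSide_vertex.trans ?_
    rw [hv]
    constructor
    · intro h
      by_contra hgH
      have hg' := hg.resolve_left hgH
      refine h (Or.inr ⟨hg', fun h1 => ?_⟩)
      exact (hA.stable.flag_nonempty (hA.isFlagSet g)).ne_empty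
        (by simpa using Finset.univ_subset_iff.1 h1)
    · rintro hgH (⟨-, h⟩ | ⟨h, -⟩)
      · exact hA.stable.flag_ne_univ (hA.isFlagSet g) (Finset.univ_subset_iff.1 h)
      · exact hnot _ hgH h

end IsHierFlags

/-- Every stable hierarchy belongs to a numbered stable tree with a centre. -/
theorem exists_tree_of_isStableHier (hH : IsStableHier H (sumCol m n)) :
    ∃ (k : ℕ) (T : StableTree (Fin k)) (l : T.Numbering m n) (C : Set T.Vertex),
      IsCentre (Quotient.mk T.part) T.inv C ∧ hierOf l C = H := by
  classical
  let e := (Fintype.equivFin {A // IsFlagSet H A}).symm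
  have hA : IsHierFlags H (sumCol m n) fun i => (e i : Finset (Fin m ⊕ Fin n)) :=
    ⟨hH, Subtype.val_injective.comp e.injective, fun B => ⟨?_, fun hB => ⟨e.symm ⟨B, hB⟩, ?_⟩⟩⟩
  · obtain ⟨l, hl⟩ := hA.exists_numbering
    obtain ⟨C, hC⟩ := hA.exists_centre hl
    exact ⟨_, hA.tree, l, C, hC⟩
  · rintro ⟨f, rfl⟩
    exact (e f).2
  · simp

end model

/-! ### Traces of permuted tensor products -/

section paths

variable {K : Type*} [Fintype K] [DecidableEq K]

/-- The entries of a power of a matrix as sums over paths. -/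
lemma matrix_pow_succ_apply (N : Matrix K K ℂ) (n : ℕ) (x y : K) :
    (N ^ (n + 1)) x y = ∑ c : Fin n → K, ∏ i : Fin (n + 1),
      N (Fin.cons (α := fun _ => K) x c i) (Fin.snoc (α := fun _ => K) c y i) := by
  induction n generalizing x with
  | zero => simp [Fin.snoc]
  | succ n ih =>
    rw [pow_succ', Matrix.mul_apply]
    refine Eq.trans ?_ (Equiv.sum_comp (Fin.consEquiv fun _ : Fin (n + 1) => K) _)
    rw [Fintype.sum_prod_type]
    refine Finset.sum_congr rfl fun z _ => ?_
    rw [ih, Finset.mul_sum]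
    refine Finset.sum_congr rfl fun c _ => ?_
    change _ = ∏ i : Fin (n + 1 + 1), N (Fin.cons (α := fun _ => K) x
      (Fin.cons (α := fun _ => K) z c) i)
        (Fin.snoc (α := fun _ => K) (Fin.cons (α := fun _ => K) z c) y i)
    rw [Fin.prod_univ_succ (n := n + 1)]
    simp only [Fin.cons_succ, ← Fin.cons_snoc_eq_snoc_cons, Fin.cons_zero]

lemma sum_matrix_pow_diag (N : Matrix K K ℂ) (P : K → Prop) [DecidablePred P] (n : ℕ) :
    ∑ x with P x, (N ^ (n + 1)) x x = ∑ c : Fin (n + 1) → K with P (c 0),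
      ∏ i : Fin (n + 1), N (c i) (c (finRotate _ i)) := by
  rw [Finset.sum_filter, Finset.sum_filter]
  refine Eq.trans ?_ (Equiv.sum_comp (Fin.consEquiv fun _ : Fin (n + 1) => K) _)
  rw [Fintype.sum_prod_type]
  refine Finset.sum_congr rfl fun x _ => ?_
  simp only [Fin.consEquiv_apply, Fin.cons_zero]
  split_ifs with h
  · rw [matrix_pow_succ_apply]
    refine Finset.sum_congr rfl fun c _ => Finset.prod_congr rfl fun i _ => ?_
    rw [Fin.snoc_eq_cons_rotate]
  · simp

end paths

section orbits

variable {V : Type*} [Fintype V] (π : Perm V)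

/-- The elements of the orbits, in cyclic order. -/
def orbitEquiv : (Σ r : {r // r ∈ reps π Finset.univ}, Fin (len π r)) ≃ V :=
  Equiv.ofBijective (fun x => (π ^ (x.2 : ℕ)) x.1) (by
    constructor
    · rintro ⟨⟨r, hr⟩, i⟩ ⟨⟨r', hr'⟩, j⟩ h
      have hrr : r = r' := by
        apply eq_of_mem_reps hr hr'
        have h1 : π.SameCycle r ((π ^ (i : ℕ)) r) := ⟨i, by simp⟩
        have h2 : π.SameCycle r' ((π ^ (j : ℕ)) r') := ⟨j, by simp⟩
        have h' : (π ^ (i : ℕ)) r = (π ^ (j : ℕ)) r' := h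
        rw [h'] at h1
        exact h1.trans h2.symm
      subst hrr
      have h' : (π ^ (i : ℕ)) r = (π ^ (j : ℕ)) r := h
      have := Function.iterate_injOn_Iio_minimalPeriod (f := π) (x := r) i.2 j.2
        (by simpa [Perm.iterate_eq_pow] using h')
      rw [Fin.ext this]
    · intro v
      have hr : rep π v ∈ reps π Finset.univ := rep_mem_reps (permInv_univ π) (Finset.mem_univ v)
      obtain ⟨n, hn⟩ := (rep_sameCycle π v).exists_nat_pow_eq
      refine ⟨⟨⟨rep π v, hr⟩, ⟨n % len π (rep π v), Nat.mod_lt _ (len_pos _ _)⟩⟩, ?_⟩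
      change (π ^ (n % len π (rep π v))) (rep π v) = v
      conv_rhs => rw [← hn, ← Nat.mod_add_div n (len π (rep π v)), pow_add, pow_mul]
      rw [Perm.mul_apply, ← pow_mul, (pow_apply_eq_iff π (rep π v) _).2 (dvd_mul_right _ _)])

lemma orbitEquiv_apply (r : {r // r ∈ reps π Finset.univ}) (i : Fin (len π r)) :
    orbitEquiv π ⟨r, i⟩ = (π ^ (i : ℕ)) r := rfl

lemma pow_finRotate (r : V) (i : Fin (len π r)) :
    (π ^ (finRotate (len π r) i : ℕ)) r = π ((π ^ (i : ℕ)) r) := by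
  have hpos := len_pos π r
  have hper := pow_len_apply π r
  generalize len π r = n at i hpos hper
  obtain ⟨n, rfl⟩ : ∃ k, n = k + 1 := ⟨n - 1, by omega⟩
  rw [← Perm.mul_apply, ← pow_succ', coe_finRotate]
  split_ifs with h
  · rw [h, Fin.val_last, hper, pow_zero, Perm.one_apply]
  · rfl

/-- A sum over families indexed by a set with a permutation is a product over the orbits. -/
lemma sum_prod_orbits [DecidableEq V] {K : Type*} [Fintype K] (M : V → K → K → ℂ) :
    ∑ s : V → K, ∏ v, M v (s v) (s (π v)) = ∏ r ∈ reps π Finset.univ,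
      ∑ c : Fin (len π r) → K, ∏ i : Fin (len π r),
        M ((π ^ (i : ℕ)) r) (c i) (c (finRotate _ i)) := by
  rw [← Finset.prod_coe_sort, Finset.prod_univ_sum, Fintype.piFinset_univ]
  refine Fintype.sum_equiv (((orbitEquiv π).symm.arrowCongr (Equiv.refl K)).trans
    (Equiv.piCurry fun _ _ => K)) _ _ fun s => ?_
  rw [← (orbitEquiv π).prod_comp, Fintype.prod_sigma]
  refine Finset.prod_congr rfl fun r _ => Finset.prod_congr rfl fun i _ => ?_
  change M _ _ (s (π (orbitEquiv π ⟨r, i⟩))) =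
    M _ (s (orbitEquiv π ⟨r, i⟩)) (s (orbitEquiv π ⟨r, finRotate _ i⟩))
  rw [orbitEquiv_apply, orbitEquiv_apply, pow_finRotate]

/-- The analogue for the sections of a family of sets, when the matrix `N` is compatible with the
permutation. -/
lemma sum_sections_eq [DecidableEq V] {κ : V → Type*} [∀ v, Fintype (κ v)]
    [∀ v, DecidableEq (κ v)]
    (N : Matrix (Σ v, κ v) (Σ v, κ v) ℂ) (hN : ∀ x y, N x y ≠ 0 → y.1 = π x.1) :
    ∑ s : ∀ v, κ v, ∏ v, N ⟨v, s v⟩ ⟨π v, s (π v)⟩ =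
      ∏ r ∈ reps π Finset.univ, ∑ p : κ r, (N ^ len π r) ⟨r, p⟩ ⟨r, p⟩ := by
  -- Sections are families in the total space which lie over the identity; `M` vanishes on all other
  -- families.
  let M : V → (Σ v, κ v) → (Σ v, κ v) → ℂ := fun v x y => if x.1 = v then N x y else 0
  have h1 : ∑ s : ∀ v, κ v, ∏ v, N ⟨v, s v⟩ ⟨π v, s (π v)⟩ =
      ∑ s : V → (Σ v, κ v), ∏ v, M v (s v) (s (π v)) := by
    refine Finset.sum_of_injOn (fun s v => ⟨v, s v⟩) ?_ (fun _ _ => Finset.mem_coe.2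
      (Finset.mem_univ _)) ?_ ?_
    · intro s _ s' _ h
      funext v
      simpa using congrFun h v
    · intro s _ hs
      by_contra hne
      have h2 : ∀ v, (s v).1 = v := by
        intro v
        have := Finset.prod_ne_zero_iff.1 hne v (Finset.mem_univ v)
        by_contra h
        exact this (if_neg h)
      refine hs ⟨fun v => h2 v ▸ (s v).2, by simp, ?_⟩
      funext v
      have : ∀ (x : Σ v, κ v) (h : x.1 = v), (⟨v, h ▸ x.2⟩ : Σ v, κ v) = x := by
        rintro x rfl
        rfl
      exact this _ (h2 v)
    · intro s _
      exact Finset.prod_congr rfl fun v _ => (if_pos rfl).symm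
  rw [h1, sum_prod_orbits]
  refine Finset.prod_congr rfl fun r _ => ?_
  have h3 : ∑ p : κ r, (N ^ len π r) ⟨r, p⟩ ⟨r, p⟩ = ∑ x with x.1 = r, (N ^ len π r) x x := by
    refine Finset.sum_bij (fun p _ => ⟨r, p⟩) (by simp) ?_ ?_ fun _ _ => rfl
    · intro p _ p' _ h
      simpa using h
    · rintro ⟨v, p⟩ h
      obtain rfl : v = r := by simpa using h
      exact ⟨p, Finset.mem_univ _, rfl⟩
  rw [h3]
  have hpos := len_pos π r
  generalize len π r = n at hpos
  obtain ⟨n, rfl⟩ : ∃ k, n = k + 1 := ⟨n - 1, by omega⟩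
  rw [sum_matrix_pow_diag, Finset.sum_filter]
  refine Finset.sum_congr rfl fun c _ => ?_
  split_ifs with h
  · by_cases hz : ∏ i, N (c i) (c (finRotate (n + 1) i)) = 0
    · rw [hz, Finset.prod_eq_zero_iff]
      obtain ⟨i, -, hi⟩ := Finset.prod_eq_zero_iff.1 hz
      exact ⟨i, Finset.mem_univ i, by simp only [M, hi, ite_self]⟩
    -- A closed path with nonzero weight which starts over `r` runs along the orbit of `r`.
    · have h4 : ∀ i : ℕ, ∀ hi : i < n + 1, (c ⟨i, hi⟩).1 = (π ^ i) r := by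
        intro i
        induction i with
        | zero => exact fun _ => h
        | succ i ih =>
          intro hi
          have h5 := hN _ _ (Finset.prod_ne_zero_iff.1 hz ⟨i, by omega⟩ (Finset.mem_univ _))
          rw [finRotate_of_lt (by omega), ih] at h5
          rw [pow_succ', Perm.mul_apply, ← h5]
      exact Finset.prod_congr rfl fun i _ => if_pos (h4 i i.2)
  · exact Finset.prod_eq_zero (Finset.mem_univ 0) (if_neg h)

end orbits

section trace

variable {V : Type*} [Fintype V] {E : V → Type*} [∀ v, AddCommGroup (E v)] [∀ v, Module ℂ (E v)]

/-- The operator on a product of vector spaces which permutes the factors. -/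
def permutedMap (π : Perm V) (A : ∀ v, E (π.symm v) →ₗ[ℂ] E v) : (∀ v, E v) →ₗ[ℂ] ∀ v, E v :=
  LinearMap.pi fun v => A v ∘ₗ LinearMap.proj (π.symm v)

variable [∀ v, FiniteDimensional ℂ (E v)]

/-- The trace of an operator which permutes the factors of a tensor product is the product over the
orbits of the traces of the returning maps. -/
theorem trace_map_reindex [DecidableEq V] (π : Perm V) (A : ∀ v, E (π.symm v) →ₗ[ℂ] E v) :
    LinearMap.trace ℂ _ ((PiTensorProduct.map A) ∘ₗ
      (PiTensorProduct.reindex ℂ E π).toLinearMap) =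
      ∏ r ∈ reps π Finset.univ, LinearMap.trace ℂ (E r)
        (LinearMap.proj r ∘ₗ (permutedMap π A ^ len π r) ∘ₗ LinearMap.single ℂ E r) := by
  let b : ∀ v, Module.Basis (Fin (Module.finrank ℂ (E v))) ℂ (E v) := fun v =>
    Module.finBasis ℂ (E v)
  let B := Pi.basis b
  let N := (LinearMap.toMatrix B B (permutedMap π A)).transpose
  have hN : ∀ x y, N x y = (b y.1).repr (permutedMap π A (Pi.single x.1 (b x.1 x.2)) y.1) y.2 := by
    intro x y
    simp [N, B, LinearMap.toMatrix_apply]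
  have hN0 : ∀ x y, N x y ≠ 0 → y.1 = π x.1 := by
    intro x y h
    by_contra hne
    apply h
    rw [hN]
    simp only [permutedMap, LinearMap.pi_apply, LinearMap.coe_comp, Function.comp_apply,
      LinearMap.coe_proj, Function.eval]
    rw [Pi.single_eq_of_ne]
    · simp
    · rintro h'
      exact hne (by rw [← h', Equiv.apply_symm_apply])
  rw [LinearMap.trace_eq_matrix_trace ℂ (Basis.piTensorProduct b), Matrix.trace]
  trans ∑ s : ∀ v, Fin (Module.finrank ℂ (E v)), ∏ v, N ⟨v, s v⟩ ⟨π v, s (π v)⟩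
  · refine Finset.sum_congr rfl fun s _ => ?_
    rw [Matrix.diag_apply, LinearMap.toMatrix_apply, Basis.piTensorProduct_apply]
    simp only [LinearMap.coe_comp, Function.comp_apply, LinearEquiv.coe_coe,
      PiTensorProduct.reindex_tprod, PiTensorProduct.map_tprod]
    rw [Basis.piTensorProduct_repr_tprod_apply]
    refine (Equiv.prod_comp π _).symm.trans ?_
    refine Finset.prod_congr rfl fun v _ => ?_
    rw [hN]
    simp only [permutedMap, LinearMap.pi_apply, LinearMap.coe_comp, Function.comp_apply,
      LinearMap.coe_proj, Function.eval]
    have : ∀ w, w = v → b w (s w) = (Pi.single v (b v (s v)) : ∀ v, E v) w := by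
      rintro w rfl
      simp
    rw [this _ (π.symm_apply_apply v)]
  · rw [sum_sections_eq π N hN0]
    refine Finset.prod_congr rfl fun r _ => ?_
    rw [LinearMap.trace_eq_matrix_trace ℂ (b r), Matrix.trace]
    refine Finset.sum_congr rfl fun p _ => ?_
    rw [Matrix.diag_apply, LinearMap.toMatrix_apply, ← Matrix.transpose_pow,
      Matrix.transpose_apply, LinearMap.toMatrix_pow, LinearMap.toMatrix_apply]
    simp [B]

end trace

/-! ### The spaces of decorations of a tree -/

section onSets

variable (W : S2Module.{u}) {A B : Type} {m n : ℕ}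

/-- The evaluation of an element of `W(A, B)` at a pair of numberings. -/
def onSetsEval (a : Fin m ≃ A) (b : Fin n ≃ B) : W.onSets A B →ₗ[ℂ] W.carrier m n where
  toFun φ := φ.1 m n a b
  map_add' _ _ := rfl
  map_smul' _ _ := rfl

lemma onSets_apply (φ : W.onSets A B) (a a' : Fin m ≃ A) (b b' : Fin n ≃ B) :
    φ.1 m n a' b' = W.rho m n ((a'.trans a.symm)⁻¹, (b'.trans b.symm)⁻¹) (φ.1 m n a b) := by
  have ha : (a'.trans a.symm).trans a = a' := by simp [Equiv.trans_assoc]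
  have hb : (b'.trans b.symm).trans b = b' := by simp [Equiv.trans_assoc]
  rw [← φ.2 m n a b, ha, hb]

/-- Evaluation at a pair of numberings identifies `W(A, B)` with `W(m, n)`. -/
def onSetsEquiv (a : Fin m ≃ A) (b : Fin n ≃ B) : W.onSets A B ≃ₗ[ℂ] W.carrier m n :=
  LinearEquiv.ofBijective (onSetsEval W a b) (by
    constructor
    · rw [← LinearMap.ker_eq_bot, LinearMap.ker_eq_bot']
      intro φ hφ
      have hφ' : φ.1 m n a b = 0 := hφ
      apply Subtype.ext
      funext m' n' a' b'
      obtain rfl : m' = m := Fin.equiv_iff_eq.1 ⟨a'.trans a.symm⟩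
      obtain rfl : n' = n := Fin.equiv_iff_eq.1 ⟨b'.trans b.symm⟩
      rw [onSets_apply W φ a a' b b', hφ', map_zero]
      rfl
    · intro w
      let φ : ∀ m' n' : ℕ, (Fin m' ≃ A) → (Fin n' ≃ B) → W.carrier m' n' := fun m' n' a' b' => by
        have hm : m' = m := Fin.equiv_iff_eq.1 ⟨a'.trans a.symm⟩
        have hn : n' = n := Fin.equiv_iff_eq.1 ⟨b'.trans b.symm⟩
        subst hm hn
        exact W.rho m' n' ((a'.trans a.symm)⁻¹, (b'.trans b.symm)⁻¹) w
      have hφ : ∀ a' b', φ m n a' b' =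
          W.rho m n ((a'.trans a.symm)⁻¹, (b'.trans b.symm)⁻¹) w := fun _ _ => rfl
      refine ⟨⟨φ, fun m' n' a' b' σ τ => ?_⟩, ?_⟩
      · obtain rfl : m' = m := Fin.equiv_iff_eq.1 ⟨a'.trans a.symm⟩
        obtain rfl : n' = n := Fin.equiv_iff_eq.1 ⟨b'.trans b.symm⟩
        rw [hφ, hφ, ← Module.End.mul_apply, ← map_mul]
        rfl
      · change φ m n a b = w
        rw [hφ]
        have : ((a.trans a.symm)⁻¹, (b.trans b.symm)⁻¹) =
            (1 : Perm (Fin m) × Perm (Fin n)) := by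
          rw [Equiv.self_trans_symm, Equiv.self_trans_symm]
          rfl
        rw [this, map_one]
        rfl)

lemma onSetsEquiv_apply (a : Fin m ≃ A) (b : Fin n ≃ B) (φ : W.onSets A B) :
    onSetsEquiv W a b φ = φ.1 m n a b := rfl

/-- The trace of an automorphism of a pair of finite sets. -/
lemma trace_onSetsMap (s : Perm A) (t : Perm B) (a : Fin m ≃ A) (b : Fin n ≃ B) :
    LinearMap.trace ℂ _ (W.onSetsMap s t) = LinearMap.trace ℂ _
      (W.rho m n (a.trans (s.trans a.symm), b.trans (t.trans b.symm))) := by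
  rw [← LinearMap.trace_conj' (W.onSetsMap s t) (onSetsEquiv W a b)]
  congr 1
  refine LinearMap.ext fun w => ?_
  obtain ⟨φ, rfl⟩ := (onSetsEquiv W a b).surjective w
  rw [LinearEquiv.conj_apply_apply, LinearEquiv.symm_apply_apply, onSetsEquiv_apply,
    onSetsEquiv_apply]
  exact onSets_apply W φ a (a.trans s.symm) b (b.trans t.symm)

instance [Finite A] [Finite B] [h : ∀ m n, FiniteDimensional ℂ (W.carrier m n)] :
    FiniteDimensional ℂ (W.onSets A B) := by
  obtain ⟨m, ⟨a⟩⟩ := Finite.exists_equiv_fin A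
  obtain ⟨n, ⟨b⟩⟩ := Finite.exists_equiv_fin B
  exact Module.Finite.equiv (onSetsEquiv W a.symm b.symm).symm

end onSets

section tensor

variable (W : S2Module.{u}) {F F' F'' : Type} {T : StableTree F} {T' : StableTree F'}
  {T'' : StableTree F''}

/-- The value of a decoration depends on the numberings of the flags only. -/
lemma decoration_congr (x : ∀ v : T.Vertex, W.onSets (T.FlagsAt v 0) (T.FlagsAt v 1))
    {v w : T.Vertex} (h : v = w) {m n : ℕ} {a : Fin m ≃ T.FlagsAt v 0} {b : Fin n ≃ T.FlagsAt v 1}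
    {a' : Fin m ≃ T.FlagsAt w 0} {b' : Fin n ≃ T.FlagsAt w 1} (ha : ∀ i, (a i : F) = a' i)
    (hb : ∀ i, (b i : F) = b' i) : (x v).1 m n a b = (x w).1 m n a' b' := by
  subst h
  rw [Equiv.ext fun i => Subtype.ext (ha i), Equiv.ext fun i => Subtype.ext (hb i)]

lemma tensorMap_tprod (e : StableTree.Iso T T')
    (x : ∀ v : T.Vertex, W.onSets (T.FlagsAt v 0) (T.FlagsAt v 1)) :
    e.tensorMap W (PiTensorProduct.tprod ℂ x) = PiTensorProduct.tprod ℂ fun v =>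
      W.onSetsMap (e.flagsAt v 0) (e.flagsAt v 1) (x (e.verts.symm v)) := by
  rw [StableTree.Iso.tensorMap, LinearMap.comp_apply, LinearEquiv.coe_coe,
    PiTensorProduct.reindex_tprod, PiTensorProduct.map_tprod]

lemma iso_ext {e e' : StableTree.Iso T T'} (h : e.flags = e'.flags) : e = e' := by
  cases e
  cases e'
  cases h
  rfl

/-- The composition of isomorphisms of trees. -/
def isoTrans (e : StableTree.Iso T T') (e' : StableTree.Iso T' T'') : StableTree.Iso T T'' where
  flags := e.flags.trans e'.flags
  part_iff a b := (e.part_iff a b).trans (e'.part_iff _ _)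
  inv_comm f := by
    rw [Equiv.trans_apply, e'.inv_comm, e.inv_comm, Equiv.trans_apply]
  colour_comm f := by
    rw [Equiv.trans_apply, e'.colour_comm, e.colour_comm]

lemma preserves_isoTrans {e : StableTree.Iso T T'} {e' : StableTree.Iso T' T''} {m n : ℕ}
    {l : T.Numbering m n} {l' : T'.Numbering m n} {l'' : T''.Numbering m n}
    (he : e.Preserves l l') (he' : e'.Preserves l' l'') : (isoTrans e e').Preserves l l'' :=
  ⟨fun i => by rw [he'.1, he.1]; rfl, fun i => by rw [he'.2, he.2]; rfl⟩

lemma tensorMap_isoTrans (e : StableTree.Iso T T') (e' : StableTree.Iso T' T'')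
    (y : StableTree.tensor W T) :
    (isoTrans e e').tensorMap W y = e'.tensorMap W (e.tensorMap W y) := by
  rw [← LinearMap.comp_apply]
  congr 1
  refine PiTensorProduct.ext (MultilinearMap.ext fun x => ?_)
  simp only [LinearMap.compMultilinearMap_apply, LinearMap.comp_apply, tensorMap_tprod]
  congr 1
  funext v
  apply Subtype.ext
  funext m n a b
  refine decoration_congr W x ?_ (fun _ => rfl) (fun _ => rfl)
  obtain ⟨f, rfl⟩ := Quotient.exists_rep v
  rfl

lemma tensorMap_of_flags_eq_refl (e : StableTree.Iso T T) (h : e.flags = Equiv.refl F)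
    (y : StableTree.tensor W T) : e.tensorMap W y = y := by
  rw [← LinearMap.id_apply (R := ℂ) y]
  congr 1
  refine PiTensorProduct.ext (MultilinearMap.ext fun x => ?_)
  simp only [LinearMap.compMultilinearMap_apply, LinearMap.id_apply, tensorMap_tprod]
  congr 1
  funext v
  apply Subtype.ext
  funext m n a b
  have h1 : ∀ f, e.flags.symm f = f := fun f => by rw [h]; rfl
  refine decoration_congr W x ?_ (fun _ => h1 _) (fun _ => h1 _)
  obtain ⟨f, rfl⟩ := Quotient.exists_rep v
  exact congrArg (Quotient.mk _) (h1 f)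

/-- The operator on decorations induced by an automorphism of a tree, and its powers. -/
lemma permutedMap_pow_apply [Fintype T.Vertex] (e : StableTree.Iso T T) (k : ℕ)
    (x : ∀ v : T.Vertex, W.onSets (T.FlagsAt v 0) (T.FlagsAt v 1)) (v w : T.Vertex) {m n : ℕ}
    (a : Fin m ≃ T.FlagsAt v 0) (b : Fin n ≃ T.FlagsAt v 1)
    (a' : Fin m ≃ T.FlagsAt w 0) (b' : Fin n ≃ T.FlagsAt w 1)
    (ha : ∀ i, (a i : F) = (e.flags ^ k) (a' i)) (hb : ∀ i, (b i : F) = (e.flags ^ k) (b' i))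
    (hw : (e.verts ^ k) w = v) :
    (((permutedMap (E := fun v : T.Vertex => W.onSets (T.FlagsAt v 0) (T.FlagsAt v 1)) e.verts
      fun v => W.onSetsMap (e.flagsAt v 0) (e.flagsAt v 1)) ^ k) x v).1 m n a b =
      (x w).1 m n a' b' := by
  induction k generalizing v with
  | zero => exact decoration_congr W x hw.symm ha hb
  | succ k ih =>
    rw [pow_succ', Module.End.mul_apply]
    refine ih (e.verts.symm v) (a.trans (e.flagsAt v 0).symm) (b.trans (e.flagsAt v 1).symm)
      (fun i => ?_) (fun i => ?_) ?_
    · change e.flags.symm (a i) = _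
      rw [ha, pow_succ', Perm.mul_apply, Equiv.symm_apply_apply]
    · change e.flags.symm (b i) = _
      rw [hb, pow_succ', Perm.mul_apply, Equiv.symm_apply_apply]
    · rw [← hw, pow_succ', Perm.mul_apply, Equiv.symm_apply_apply]

variable [Fintype F] [h : ∀ m n, FiniteDimensional ℂ (W.carrier m n)]

open Classical in
/-- The trace of an automorphism of a tree on the decorations is the product over the orbits of
vertices of the values of the class function of `ch W` on the flags at the vertex. -/
theorem trace_tensorMap (e : StableTree.Iso T T) :
    LinearMap.trace ℂ _ (e.tensorMap W) = ∏ v ∈ reps e.verts Finset.univ,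
      val (e.flags ^ len e.verts v) T.colour
        (Finset.univ.filter fun f => Quotient.mk T.part f = v) W.ch := by
  rw [StableTree.Iso.tensorMap]
  refine (trace_map_reindex (E := fun v : T.Vertex => W.onSets (T.FlagsAt v 0) (T.FlagsAt v 1))
    e.verts fun v => W.onSetsMap (e.flagsAt v 0) (e.flagsAt v 1)).trans ?_
  refine Finset.prod_congr rfl fun v _ => ?_
  set k := len e.verts v with hk
  have hv : (e.verts ^ k) v = v := pow_len_apply _ _
  have hmk : ∀ k f,
      Quotient.mk T.part ((e.flags ^ k) f) = (e.verts ^ k) (Quotient.mk T.part f) := by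
    intro k f
    induction k with
    | zero => rfl
    | succ k ih =>
      rw [pow_succ', Perm.mul_apply, pow_succ', Perm.mul_apply, ← ih]
      rfl
  have hmk' : ∀ f, Quotient.mk T.part ((e.flags ^ k) f) = v ↔ Quotient.mk T.part f = v := by
    intro f
    rw [hmk]
    conv_lhs => rw [← hv]
    exact (e.verts ^ k).injective.eq_iff
  have hcol := col_pow (φ := e.flags) e.colour_comm k
  let s : ∀ i, Perm (T.FlagsAt v i) := fun i => Perm.subtypePerm (e.flags ^ k) fun f => by
    rw [hmk', hcol]
  obtain ⟨m, ⟨a⟩⟩ := Finite.exists_equiv_fin (T.FlagsAt v 0)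
  obtain ⟨n, ⟨b⟩⟩ := Finite.exists_equiv_fin (T.FlagsAt v 1)
  have hloop : (LinearMap.proj v ∘ₗ ((permutedMap
      (E := fun v : T.Vertex => W.onSets (T.FlagsAt v 0) (T.FlagsAt v 1)) e.verts
      fun v => W.onSetsMap (e.flagsAt v 0) (e.flagsAt v 1)) ^ k) ∘ₗ LinearMap.single ℂ _ v) =
      W.onSetsMap (s 0) (s 1) := by
    refine LinearMap.ext fun y => Subtype.ext ?_
    funext m n a b
    refine (permutedMap_pow_apply W e k _ v v a b (a.trans (s 0).symm) (b.trans (s 1).symm)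
      (fun i => ?_) (fun i => ?_) hv).trans ?_
    · exact (congrArg Subtype.val ((s 0).apply_symm_apply (a i))).symm
    · exact (congrArg Subtype.val ((s 1).apply_symm_apply (b i))).symm
    · rw [LinearMap.single_apply, Pi.single_eq_same]
      rfl
  rw [hloop, trace_onSetsMap W (s 0) (s 1) a.symm b.symm]
  symm
  refine val_ch W hcol ?_ (fun i => (a.symm i : F)) (fun i => (b.symm i : F))
    (Subtype.val_injective.comp a.symm.injective) (Subtype.val_injective.comp b.symm.injective)
    ?_ ?_ ?_ ?_
  · intro f
    simp [hmk']
  · intro f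
    rw [Finset.mem_filter]
    constructor
    · rintro ⟨⟨-, hf⟩, hc⟩
      exact ⟨a ⟨f, hf, hc⟩, by simp⟩
    · rintro ⟨i, rfl⟩
      exact ⟨⟨Finset.mem_univ _, (a.symm i).2.1⟩, (a.symm i).2.2⟩
  · intro f
    rw [Finset.mem_filter]
    constructor
    · rintro ⟨⟨-, hf⟩, hc⟩
      exact ⟨b ⟨f, hf, hc⟩, by simp⟩
    · rintro ⟨i, rfl⟩
      exact ⟨⟨Finset.mem_univ _, (b.symm i).2.1⟩, (b.symm i).2.2⟩
  · intro i
    simp [s]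
  · intro i
    simp [s]

end tensor

/-! ### The character of the module of trees -/

/-- The trace of an operator on a product of vector spaces. -/
lemma trace_pi {ι : Type*} [Fintype ι] [DecidableEq ι] {E : ι → Type*} [∀ i, AddCommGroup (E i)]
    [∀ i, Module ℂ (E i)] [∀ i, FiniteDimensional ℂ (E i)] (M : (∀ i, E i) →ₗ[ℂ] ∀ i, E i) :
    LinearMap.trace ℂ _ M = ∑ i, LinearMap.trace ℂ (E i)
      (LinearMap.proj i ∘ₗ M ∘ₗ LinearMap.single ℂ E i) := by
  have h : M = ∑ i, (M ∘ₗ LinearMap.single ℂ E i) ∘ₗ LinearMap.proj i := by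
    refine LinearMap.ext fun x => ?_
    simp only [LinearMap.sum_apply, LinearMap.comp_apply, LinearMap.single_apply,
      LinearMap.proj_apply]
    rw [← map_sum, Finset.univ_sum_single]
  conv_lhs => rw [h, map_sum]
  exact Finset.sum_congr rfl fun i _ => LinearMap.trace_comp_comm' _ _

section

variable {m n : ℕ}

/-- A stable tree with numbered leaves. -/
structure NumTree (m n : ℕ) where
  /-- the number of flags -/
  flags : ℕ
  /-- the tree -/
  tree : StableTree (Fin flags)
  /-- the numbering of its leaves -/
  num : tree.Numbering m n

/-- The isomorphism classes of numbered stable trees, encoded by their families of sets of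
labels. -/
def treeClasses (m n : ℕ) : Set (Finset (Finset (Fin m ⊕ Fin n))) :=
  Set.range fun p : NumTree m n => splits p.num

instance : Fintype (treeClasses m n) := Fintype.ofFinite _

/-- A representative of a class. -/
def repTree (c : treeClasses m n) : NumTree m n := c.2.choose

lemma splits_repTree (c : treeClasses m n) : splits (repTree c).num = c := c.2.choose_spec

/-- The class of a numbered stable tree. -/
def classOf {k : ℕ} {T : StableTree (Fin k)} (l : T.Numbering m n) : treeClasses m n :=
  ⟨splits l, ⟨k, T, l⟩, rfl⟩

lemma exists_iso_repTree {k : ℕ} {T : StableTree (Fin k)} (l : T.Numbering m n) :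
    ∃ e : StableTree.Iso (repTree (classOf l)).tree T, e.Preserves (repTree (classOf l)).num l :=
  exists_iso (splits_repTree (classOf l))

variable (W : S2Module.{u})

lemma treeSpace_apply (x : W.treeSpace m n) {k k' : ℕ} {T : StableTree (Fin k)}
    {T' : StableTree (Fin k')} {l : T.Numbering m n} {l' : T'.Numbering m n}
    {e : StableTree.Iso T T'} (he : e.Preserves l l') :
    x.1 k' T' l' = e.tensorMap W (x.1 k T l) := x.2 k k' T T' l l' e he

/-- The restriction of a family to the chosen representatives. -/
def treeRestrict (m n : ℕ) : W.treeSpace m n →ₗ[ℂ]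
    ∀ c : treeClasses m n, StableTree.tensor W (repTree c).tree where
  toFun x c := x.1 _ _ (repTree c).num
  map_add' _ _ := rfl
  map_smul' _ _ := rfl

lemma treeRestrict_injective : Function.Injective (treeRestrict W m n) := by
  intro x x' h
  apply Subtype.ext
  funext k T l
  obtain ⟨e, he⟩ := exists_iso_repTree l
  rw [treeSpace_apply W x he, treeSpace_apply W x' he]
  exact congrArg _ (congrFun h (classOf l))

lemma treeRestrict_surjective : Function.Surjective (treeRestrict W m n) := by
  intro y
  choose e he using fun (k : ℕ) (T : StableTree (Fin k)) (l : T.Numbering m n) =>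
    exists_iso_repTree l
  let x : ∀ (k : ℕ) (T : StableTree (Fin k)), T.Numbering m n → StableTree.tensor W T :=
    fun k T l => (e k T l).tensorMap W (y (classOf l))
  have hx : ∀ (c : treeClasses m n) {k : ℕ} {T : StableTree (Fin k)} {l : T.Numbering m n}
      (e' : StableTree.Iso (repTree c).tree T), e'.Preserves (repTree c).num l →
      x k T l = e'.tensorMap W (y c) := by
    intro c k T l e' he'
    obtain rfl : c = classOf l :=
      Subtype.ext ((splits_repTree c).symm.trans (splits_iso he').symm)
    rw [iso_ext (iso_unique he' (he k T l))]
  refine ⟨⟨x, fun k k' T T' l l' f hf => ?_⟩, ?_⟩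
  · rw [hx (classOf l) _ (preserves_isoTrans (he k T l) hf), tensorMap_isoTrans]
  · funext c
    let e' : StableTree.Iso (repTree c).tree (repTree c).tree :=
      ⟨Equiv.refl _, fun _ _ => Iff.rfl, fun _ => rfl, fun _ => rfl⟩
    exact (hx c e' ⟨fun _ => rfl, fun _ => rfl⟩).trans (tensorMap_of_flags_eq_refl W e' rfl (y c))

/-- The space of trees is the product over the classes of the spaces of decorations. -/
def treeSpaceEquiv (m n : ℕ) : W.treeSpace m n ≃ₗ[ℂ]
    ∀ c : treeClasses m n, StableTree.tensor W (repTree c).tree :=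
  LinearEquiv.ofBijective (treeRestrict W m n)
    ⟨treeRestrict_injective W, treeRestrict_surjective W⟩

lemma treeSpaceEquiv_apply (x : W.treeSpace m n) (c : treeClasses m n) :
    treeSpaceEquiv W m n x c = x.1 _ _ (repTree c).num := rfl

variable [∀ m n, FiniteDimensional ℂ (W.carrier m n)]

instance {k : ℕ} (T : StableTree (Fin k)) : FiniteDimensional ℂ (StableTree.tensor W T) :=
  inferInstanceAs (Module.Finite ℂ (PiTensorProduct ℂ fun v : T.Vertex =>
    W.onSets (T.FlagsAt v 0) (T.FlagsAt v 1)))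

theorem finiteDimensional_trees (m n : ℕ) : FiniteDimensional ℂ (W.trees.carrier m n) :=
  Module.Finite.equiv (treeSpaceEquiv W m n).symm

/-- The renumbering of the leaves. -/
def renumber {k : ℕ} {T : StableTree (Fin k)} (σ : Perm (Fin m)) (τ : Perm (Fin n))
    (l : T.Numbering m n) : T.Numbering m n := (σ.trans l.1, τ.trans l.2)

open Classical in
/-- The character of the module of trees: only the classes fixed by the renumbering contribute. -/
theorem trace_trees (σ : Perm (Fin m)) (τ : Perm (Fin n)) :
    LinearMap.trace ℂ _ (W.trees.rho m n (σ, τ)) = ∑ c : treeClasses m n,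
      if h : ∃ e : StableTree.Iso (repTree c).tree (repTree c).tree,
        e.Preserves (repTree c).num (renumber σ τ (repTree c).num) then
        LinearMap.trace ℂ _ (h.choose.tensorMap W) else 0 := by
  trans LinearMap.trace ℂ (W.treeSpace m n) (W.treeRep m n (σ, τ))
  · rfl
  rw [← LinearMap.trace_conj' (M := W.treeSpace m n)
    (N := ∀ c : treeClasses m n, StableTree.tensor W (repTree c).tree) (W.treeRep m n (σ, τ))
    (treeSpaceEquiv W m n)]
  refine (trace_pi (E := fun c : treeClasses m n => StableTree.tensor W (repTree c).tree)
    _).trans ?_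
  refine Finset.sum_congr rfl fun c _ => ?_
  have key : ∀ y, (LinearMap.proj c ∘ₗ ((treeSpaceEquiv W m n).conj (W.treeRep m n (σ, τ))) ∘ₗ
      LinearMap.single ℂ _ c) y = ((treeSpaceEquiv W m n).symm (Pi.single c y)).1 _ _
        (renumber σ τ (repTree c).num) := fun y => rfl
  have hsymm : ∀ (y : StableTree.tensor W (repTree c).tree) (c' : treeClasses m n),
      ((treeSpaceEquiv W m n).symm (Pi.single c y)).1 _ _ (repTree c').num =
        (Pi.single c y : ∀ c : treeClasses m n, StableTree.tensor W (repTree c).tree) c' := by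
    intro y c'
    rw [← treeSpaceEquiv_apply, LinearEquiv.apply_symm_apply]
  split_ifs with h
  · congr 1
    refine LinearMap.ext fun y => ?_
    rw [key, treeSpace_apply W _ h.choose_spec, hsymm, Pi.single_eq_same]
  -- A class which is moved contributes a block outside of the diagonal.
  · refine (congrArg (LinearMap.trace ℂ _) (LinearMap.ext (g := 0) fun y => ?_)).trans (map_zero _)
    obtain ⟨e, he⟩ := exists_iso_repTree (renumber σ τ (repTree c).num)
    rw [key, treeSpace_apply W _ he, hsymm, Pi.single_eq_of_ne, map_zero, LinearMap.zero_apply]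
    intro hc
    exact h (exists_iso ((splits_repTree c).trans (congrArg Subtype.val hc).symm))

end

/-! ### Fixed trees with a centre and invariant hierarchies -/

section small

variable {X : Type*}

lemma card_colours (col : X → Fin 2) (S : Finset X) : (S.filter fun x => col x = 0).card +
    (S.filter fun x => col x = 1).card = S.card := by
  rw [← Finset.card_filter_add_card_filter_not (s := S) fun x => col x = 0]
  congr 2
  refine Finset.filter_congr fun x _ => ?_
  generalize col x = i
  revert i
  decide

variable [Fintype X] {φ : Perm X} {col : X → Fin 2} {S : Finset X}

lemma val_ch_eq_zero (W : S2Module.{u}) (hcol : ∀ x, col (φ x) = col x) (hS : PermInv φ S)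
    (h : Subsingleton (W.carrier (S.filter fun x => col x = 0).card
      (S.filter fun x => col x = 1).card)) : val φ col S W.ch = 0 := by
  rw [val, sval, coeff_ch_eq_zero, mul_zero]
  rwa [cwt_orbitType hcol hS, cwt_orbitType hcol hS]

open Classical in
lemma sval_e2 (d : Fin 2 × ℕ+ →₀ ℕ) : sval d e2 =
    if d = Finsupp.single (0, 1) 2 then 1 else if d = Finsupp.single (0, 2) 1 then -1 else 0 := by
  rw [sval, e2, psum, psum, X_pow_eq, MvPowerSeries.X, map_smul, map_sub, coeff_monomial,
    coeff_monomial]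
  have hne : (Finsupp.single (0, 1) 2 : Fin 2 × ℕ+ →₀ ℕ) ≠ Finsupp.single (0, 2) 1 := by
    intro h
    simpa using congrArg Finsupp.degree h
  split_ifs with h h' h'
  · exact absurd (h.symm.trans h') hne
  · rw [h]
    simp [zfac]
  · rw [h']
    simp [zfac]
  · simp

lemma val_e2_eq_zero (hS : PermInv φ S) (h : S.card ≠ 2) : val φ col S e2 = 0 := by
  have h1 := wt_orbitType (col := col) hS
  rw [val, sval_e2, if_neg, if_neg]
  · intro h2
    rw [h2] at h1
    simp [wt] at h1
    omega
  · intro h2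
    rw [h2] at h1
    simp [wt] at h1
    omega

variable [DecidableEq X]

lemma val_e2_of_fixed {x y : X} (hxy : x ≠ y) (hx : φ x = x) (hy : φ y = y) (hcx : col x = 0)
    (hcy : col y = 0) : val φ col {x, y} e2 = 1 := by
  have h : orbitType φ col {x, y} = Finsupp.single (0, 1) 2 := by
    rw [Finset.insert_eq, orbitType_union (by simpa using hxy), orbitType_singleton hx,
      orbitType_singleton hy, hcx, hcy, ← Finsupp.single_add]
  rw [val, sval_e2, if_pos h]

lemma val_e2_of_swap {x y : X} (hxy : x ≠ y) (hx : φ x = y) (hy : φ y = x) (hcx : col x = 0)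
    (hcy : col y = 0) : val φ col {x, y} e2 = -1 := by
  have hS : PermInv φ {x, y} := permInv_of_forall (by simp [hx, hy])
  have hcol : ∀ z ∈ ({x, y} : Finset X), col (φ z) = col z := by simp [hx, hy, hcx, hcy]
  have h : orbitType φ col {x, y} = Finsupp.single (0, 2) 1 := by
    rw [orbitType_of_sameCycle hS hcol (Finset.mem_insert_self _ _), hcx]
    · congr 2
      apply PNat.eq
      rw [coe_plen, len]
      have : Function.minimalPeriod φ x = 2 := by
        have := Fact.mk Nat.prime_two
        exact Function.minimalPeriod_eq_prime (by
          change φ (φ x) = x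
          rw [hx, hy]) (by
          change φ x ≠ x
          rw [hx]
          exact hxy.symm)
      exact this
    · intro z hz
      rcases Finset.mem_insert.1 hz with rfl | hz
      · exact Perm.SameCycle.refl _ _
      · rw [Finset.mem_singleton.1 hz, ← hx]
        exact (Perm.sameCycle_apply_right.2 (Perm.SameCycle.refl _ _))
  rw [val, sval_e2, if_pos h, if_neg]
  intro h2
  simpa using congrArg Finsupp.degree (h.symm.trans h2)

end small

section fixed

variable {k m n : ℕ} {T : StableTree (Fin k)} {e : StableTree.Iso T T} {C : Set T.Vertex}
  (hCe : e.verts '' C = C)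

section

include hCe

lemma away_auto (f : Fin k) : Away (flagSide T.part T.inv) C (e.flags f) ↔
    Away (flagSide T.part T.inv) C f := by
  rw [← away_iso e C f, hCe]

lemma permInv_awayFlags : PermInv e.flags (awayFlags T.inv (flagSide T.part T.inv) C) := by
  intro f
  rw [mem_awayFlags, mem_awayFlags, away_auto hCe, e.inv_comm, e.flags.injective.ne_iff]

end

variable {l : T.Numbering m n} {σ : Perm (Fin m)} {τ : Perm (Fin n)}

lemma permB_labels_renumber (f : Fin k) :
    permB (Perm.sumCongr σ τ) (labels (renumber σ τ l) f) = labels l f := by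
  ext x
  obtain ⟨x, rfl⟩ := (Perm.sumCongr σ τ).surjective x
  rw [mem_permB, labels, labels, mem_leafSet, mem_leafSet, renumber, leafOf_sumCongr]

variable (he : e.Preserves l (renumber σ τ l))

include he

local notation "Φ" => Perm.sumCongr σ τ

lemma labels_auto (f : Fin k) : labels l (e.flags f) = permB Φ (labels l f) := by
  rw [← labels_iso he f, permB_labels_renumber]

/-- The value on a set of flags is the value on the sets of labels. -/
lemma val_image_labels {j : ℕ} {Q : Finset (Fin k)} (hQ : PermInv (e.flags ^ j) Q) (f : SymC) :
    val (e.flags ^ j) T.colour Q f =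
      val (permB Φ ^ j) (colB (sumCol m n)) (Q.image (labels l)) f := by
  have hpow : ∀ x, labels l ((e.flags ^ j) x) = (permB Φ ^ j) (labels l x) := fun x =>
    map_pow (S := Finset.univ) (permInv_univ e.flags) (fun x _ => labels_auto he x) j
      (Finset.mem_univ x)
  have hcol : ∀ A, colB (sumCol m n) ((permB Φ ^ j) A) = colB (sumCol m n) A := fun A => by
    rw [permB_pow]
    exact colB_permB (fun x => col_pow (sumCol_sumCongr σ τ) j x) A
  rw [val, val, orbitType_of_bijOn (β := labels l) hQ ?_ (fun x _ => hpow x) ?_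
    (fun A _ => hcol A) (fun x _ => colour_eq_colB l x)]
  · apply permInv_of_forall
    intro A hA
    obtain ⟨x, hx, rfl⟩ := Finset.mem_image.1 hA
    rw [← hpow]
    exact Finset.mem_image_of_mem _ ((hQ x).2 hx)
  · rw [Finset.coe_image]
    exact (labels_injective l).injOn.bijOn_image

include hCe

lemma permInv_hierOf : PermInv (permB Φ) (hierOf l C) := by
  apply permInv_of_forall
  intro A hA
  rw [mem_hierOf] at hA ⊢
  rcases hA with rfl | ⟨f, ⟨hf, ha⟩, rfl⟩
  · left
    ext x
    simp
  · right
    refine ⟨e.flags f, ⟨?_, (away_auto hCe f).2 ha⟩, labels_auto he f⟩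
    rwa [e.inv_comm, e.flags.injective.ne_iff]

open Classical in
/-- The part of the trace which belongs to the vertices beyond the flags pointing away from the
centre. -/
lemma prod_eq_hierWeight [Nonempty (Fin m ⊕ Fin n)] (W : S2Module.{u}) {V' : Finset T.Vertex}
    (hV : Set.BijOn (fun f => Quotient.mk T.part (T.inv f))
      {f | T.inv f ≠ f ∧ Away (flagSide T.part T.inv) C f} V')
    {R : Finset (Finset (Fin m ⊕ Fin n))} (hR : ∀ A, A ∈ R ↔ A ∈ hierOf l C ∧ A ≠ Finset.univ) :
    ∏ v ∈ reps e.verts V', val (e.flags ^ len e.verts v) T.colour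
        (Finset.univ.filter fun f => Quotient.mk T.part f = v) W.ch =
      hierWeight (dP1 W.ch) Φ (sumCol m n) (hierOf l C) R := by
  have ht := leafTree l
  set w : Finset (Fin m ⊕ Fin n) → ℂ := fun A =>
    val (permB Φ ^ len (permB Φ) A) (colB (sumCol m n)) (children (hierOf l C) A) (dP1 W.ch) with hw
  have hwinv : ∀ A, w (permB Φ A) = w A :=
    val_children_permB (sumCol_sumCongr σ τ) (permInv_hierOf hCe he) _
  set Q := awayFlags T.inv (flagSide T.part T.inv) C with hQ
  have hQc : (Q : Set (Fin k)) = {f | T.inv f ≠ f ∧ Away (flagSide T.part T.inv) C f} := by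
    ext f
    simp [hQ, mem_awayFlags]
  rw [← hQc] at hV
  have hQe : PermInv e.flags Q := permInv_awayFlags hCe
  have hβ : ∀ f ∈ Q, Quotient.mk T.part (T.inv (e.flags f)) =
      e.verts (Quotient.mk T.part (T.inv f)) := by
    intro f _
    rw [e.inv_comm]
    rfl
  -- The flag `T.inv f` towards the centre is fixed by the first return map. Taking it off from the
  -- flags at the vertex turns `ch W` into its derivative.
  have hval : ∀ f ∈ Q, val (e.flags ^ len e.verts (Quotient.mk T.part (T.inv f))) T.colour
      (Finset.univ.filter fun g => Quotient.mk T.part g = Quotient.mk T.part (T.inv f)) W.ch =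
      w (labels l f) := by
    intro f hf
    obtain ⟨hfi, hfa⟩ := mem_awayFlags.1 hf
    have hlen : len e.verts (Quotient.mk T.part (T.inv f)) = len (permB Φ) (labels l f) := by
      rw [len_map (β := fun f => Quotient.mk T.part (T.inv f)) hQe hβ hV.injOn hf,
        len_map (β := labels l) hQe (fun x _ => labels_auto he x) (labels_injective l).injOn hf]
    have hlen' : len e.flags f = len (permB Φ) (labels l f) :=
      (len_map (β := labels l) hQe (fun x _ => labels_auto he x) (labels_injective l).injOn hf).symm
    rw [hlen]
    set j := len (permB Φ) (labels l f) with hj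
    have hfj : (e.flags ^ j) f = f := by
      rw [← hlen']
      exact pow_len_apply _ _
    have hinvj : ∀ x, T.inv ((e.flags ^ j) x) = (e.flags ^ j) (T.inv x) := fun x =>
      (map_pow (φ := e.flags) (ψ := e.flags) (β := T.inv) (S := Finset.univ)
        (permInv_univ e.flags) (fun x _ => e.inv_comm x) j (Finset.mem_univ x))
    have hvj : ∀ x, Quotient.mk T.part ((e.flags ^ j) x) =
        (e.verts ^ j) (Quotient.mk T.part x) := fun x =>
      (map_pow (φ := e.flags) (ψ := e.verts) (β := Quotient.mk T.part) (S := Finset.univ)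
        (permInv_univ e.flags) (fun x _ => rfl) j (Finset.mem_univ x))
    have hif : (e.flags ^ j) (T.inv f) = T.inv f := by rw [← hinvj, hfj]
    set P := Finset.univ.filter fun h => Quotient.mk T.part h = Quotient.mk T.part (T.inv f) ∧
      h ≠ T.inv f with hP
    have hPj : PermInv (e.flags ^ j) P := by
      intro h
      have h1 : (e.flags ^ j) h = T.inv f ↔ h = T.inv f := by
        conv_lhs => rw [← hif]
        exact (e.flags ^ j).injective.eq_iff
      have h2 : Quotient.mk T.part ((e.flags ^ j) h) = Quotient.mk T.part (T.inv f) ↔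
          Quotient.mk T.part h = Quotient.mk T.part (T.inv f) := by
        conv_lhs => rw [← hif, hvj, hvj]
        exact (e.verts ^ j).injective.eq_iff
      simp only [hP, Finset.mem_filter, Finset.mem_univ, true_and, ne_eq, h1, h2]
    have hins : (Finset.univ.filter fun g => Quotient.mk T.part g = Quotient.mk T.part (T.inv f)) =
        insert (T.inv f) P := by
      ext h
      simp only [hP, Finset.mem_filter, Finset.mem_univ, true_and, Finset.mem_insert]
      by_cases h1 : h = T.inv f
      · simp [h1]
      · simp [h1]
    rw [hins, ← val_dP1 (by simp [hP]) hif ?_, val_image_labels he hPj, hw]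
    · have hch : children (hierOf l C) (labels l f) = P.image (labels l) := by
        have := ht.children_centreHier_leafSet hfi hfa
        rw [hP]
        convert this <;> rfl
      change _ = val (permB Φ ^ j) _ (children (hierOf l C) (labels l f)) _
      rw [hch]
    · rw [T.colour_inv, T.edge_colour f hfi]
  have hV' : PermInv e.verts V' := by
    apply permInv_of_forall
    intro v hv
    obtain ⟨f, hf, rfl⟩ := hV.surjOn hv
    rw [← hβ f hf]
    exact hV.mapsTo ((hQe f).2 hf)
  have hbR : Set.BijOn (labels l) Q R := by
    refine ⟨fun f hf => (hR _).2 ⟨mem_hierOf.2 (Or.inr ⟨f, mem_awayFlags.1 hf, rfl⟩),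
      ht.leafSet_ne_univ f⟩, (labels_injective l).injOn, fun A hA => ?_⟩
    obtain ⟨hA, hAu⟩ := (hR A).1 hA
    obtain ⟨f, hf, rfl⟩ := (mem_hierOf.1 hA).resolve_left hAu
    exact ⟨f, mem_awayFlags.2 hf, rfl⟩
  have hRinv : PermInv (permB Φ) R := by
    apply permInv_of_forall
    intro A hA
    obtain ⟨f, hf, rfl⟩ := hbR.surjOn hA
    rw [← labels_auto he]
    exact hbR.mapsTo ((hQe f).2 hf)
  rw [hierWeight, ← prod_reps_of_bijOn (f := fun f => w (labels l f)) hQe hV' hβ hV ?_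
    fun f hf => (hval f hf).symm]
  · exact prod_reps_of_bijOn (f := fun f => w (labels l f)) hQe hRinv
      (fun x _ => labels_auto he x) hbR (fun A _ => hwinv A) fun f _ => rfl
  · intro v hv
    obtain ⟨f, hf, rfl⟩ := hV.surjOn hv
    have h1 := hval _ ((hQe f).2 hf)
    rw [hβ f hf, labels_auto he, hwinv] at h1
    exact h1.trans (hval f hf).symm

end fixed

/-! ### Invariant centres -/

section centres

variable {F V : Type*} {vert : F → V} {inv : F → F} {side : F → Set V}

namespace FlagSides

variable (hs : FlagSides vert inv side)

include hs

/-- An edge is determined by its ends. -/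
lemma eq_or_eq_inv_of_pair_eq {f g : F} (hf : inv f ≠ f) (hg : inv g ≠ g)
    (h : ({vert f, vert (inv f)} : Set V) = {vert g, vert (inv g)}) : f = g ∨ f = inv g := by
  rcases Set.pair_eq_pair_iff.1 h with ⟨h1, h2⟩ | ⟨h1, h2⟩
  · exact Or.inl (hs.unique f g _ h1 (hs.vert_inv_mem hf) (h2 ▸ hs.vert_inv_mem hg))
  · right
    refine hs.unique f (inv g) (vert (inv f)) h1 (hs.vert_inv_mem hf) ?_
    rw [h2]
    have hg' : inv (inv g) ≠ inv g := by
      rw [hs.inv_inv]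
      exact hg.symm
    simpa [hs.inv_inv] using hs.vert_inv_mem hg'

end FlagSides

open Classical in
/-- The sign of a centre which is invariant under an automorphism: edges which are fixed with
their orientation count negatively. -/
def centreSign (vert : F → V) (inv : F → F) (eF : Perm F) (C : Set V) : ℤ :=
  if ∃ f, inv f ≠ f ∧ eF f = f ∧ C = {vert f, vert (inv f)} then -1 else 1

namespace FlagSides

variable (hs : FlagSides vert inv side) {eF : Perm F}

include hs

lemma singleton_ne_pair {v : V} {f : F} (hf : inv f ≠ f) :
    ({v} : Set V) ≠ {vert f, vert (inv f)} := by
  intro h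
  have h1 : vert f = v := (h ▸ Set.mem_insert _ _ : vert f ∈ ({v} : Set V))
  have h2 : vert (inv f) = v :=
    (h ▸ Set.mem_insert_of_mem _ rfl : vert (inv f) ∈ ({v} : Set V))
  exact hs.vert_not_mem f (h1.trans h2.symm ▸ hs.vert_inv_mem hf)

lemma centreSign_singleton (v : V) : centreSign vert inv eF {v} = 1 :=
  if_neg fun ⟨_, hf, _, h⟩ => hs.singleton_ne_pair hf h

lemma centreSign_of_swap (hinv : ∀ f, inv (eF f) = eF (inv f)) {f : F} (hf : inv f ≠ f)
    (h : eF f = inv f) : centreSign vert inv eF {vert f, vert (inv f)} = 1 := by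
  refine if_neg fun ⟨g, hg, hge, hgf⟩ => ?_
  rcases hs.eq_or_eq_inv_of_pair_eq hf hg hgf with rfl | rfl
  · exact hf (h.symm.trans hge)
  · rw [← hinv, hge, hs.inv_inv] at h
    exact hg h

lemma pair_invariant_iff {eV : Perm V} (hvert : ∀ f, vert (eF f) = eV (vert f))
    (hinv : ∀ f, inv (eF f) = eF (inv f)) {f : F} (hf : inv f ≠ f) :
    eV '' {vert f, vert (inv f)} = {vert f, vert (inv f)} ↔ eF f = f ∨ eF f = inv f := by
  rw [Set.image_pair, ← hvert, ← hvert, ← hinv]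
  constructor
  · exact hs.eq_or_eq_inv_of_pair_eq (by rwa [hinv, eF.injective.ne_iff]) hf
  · rintro (h | h)
    · rw [h]
    · rw [h, hs.inv_inv, Set.pair_comm]

open Classical in
/-- The invariant centres, counted with sign, add up to one. -/
lemma sum_centreSign [Fintype F] [Fintype V] [Nonempty V] {eV : Perm V}
    (hvert : ∀ f, vert (eF f) = eV (vert f)) (hinv : ∀ f, inv (eF f) = eF (inv f)) :
    ∑ C ∈ Finset.univ.filter (fun C : Set V => IsCentre vert inv C ∧ eV '' C = C),
      centreSign vert inv eF C = 1 := by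
  set s := Finset.univ.filter fun f : F => inv f ≠ f ∧ (eF f = f ∨ eF f = inv f) with hsdef
  set P : F → Set V := fun f => {vert f, vert (inv f)} with hP
  have hsplit : Finset.univ.filter (fun C : Set V => IsCentre vert inv C ∧ eV '' C = C) =
      (Finset.univ.filter fun v => eV v = v).image (fun v => ({v} : Set V)) ∪ s.image P := by
    ext C
    simp only [Finset.mem_filter, Finset.mem_univ, true_and, Finset.mem_union, Finset.mem_image,
      hsdef]
    constructor
    · rintro ⟨⟨v, rfl⟩ | ⟨f, hf, rfl⟩, hC⟩
      · exact Or.inl ⟨v, by simpa using hC, rfl⟩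
      · exact Or.inr ⟨f, ⟨hf, (hs.pair_invariant_iff hvert hinv hf).1 hC⟩, rfl⟩
    · rintro (⟨v, hv, rfl⟩ | ⟨f, ⟨hf, h⟩, rfl⟩)
      · exact ⟨Or.inl ⟨v, rfl⟩, by simp [hv]⟩
      · exact ⟨Or.inr ⟨f, hf, rfl⟩, (hs.pair_invariant_iff hvert hinv hf).2 h⟩
  have hdisj : Disjoint ((Finset.univ.filter fun v => eV v = v).image fun v => ({v} : Set V))
      (s.image P) := by
    rw [Finset.disjoint_left]
    intro C h1 h2
    obtain ⟨v, -, rfl⟩ := Finset.mem_image.1 h1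
    obtain ⟨f, hf, h⟩ := Finset.mem_image.1 h2
    exact hs.singleton_ne_pair (Finset.mem_filter.1 hf).2.1 h.symm
  -- Every invariant edge is counted twice, by its two flags.
  have hedge : ∑ f ∈ s, centreSign vert inv eF (P f) =
      ∑ C ∈ s.image P, 2 * centreSign vert inv eF C := by
    rw [← Finset.sum_fiberwise_of_maps_to fun f hf => Finset.mem_image_of_mem P hf]
    refine Finset.sum_congr rfl fun C hC => ?_
    obtain ⟨g, hg, rfl⟩ := Finset.mem_image.1 hC
    have hgi := (Finset.mem_filter.1 hg).2.1
    have hfib : s.filter (fun f => P f = P g) = {g, inv g} := by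
      ext f
      rw [Finset.mem_filter, Finset.mem_insert, Finset.mem_singleton]
      constructor
      · rintro ⟨hf, h⟩
        exact hs.eq_or_eq_inv_of_pair_eq (Finset.mem_filter.1 hf).2.1 hgi h
      · rintro (rfl | rfl)
        · exact ⟨hg, rfl⟩
        · obtain ⟨-, h1, h2⟩ := Finset.mem_filter.1 hg
          refine ⟨Finset.mem_filter.2 ⟨Finset.mem_univ _, ?_, ?_⟩, ?_⟩
          · rw [hs.inv_inv]
            exact hgi.symm
          · rcases h2 with h2 | h2
            · left
              rw [← hinv, h2]
            · right
              rw [← hinv, h2]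
          · rw [hP]
            simp only [hs.inv_inv]
            exact Set.pair_comm _ _
    rw [Finset.sum_congr rfl (g := fun _ => centreSign vert inv eF (P g))
      fun f hf => by rw [(Finset.mem_filter.1 hf).2], hfib, Finset.sum_const,
      Finset.card_pair (Ne.symm hgi), nsmul_eq_mul, Nat.cast_ofNat]
  have hs2 : s = Finset.univ.filter (fun f => inv f ≠ f ∧ eF f = f) ∪
      Finset.univ.filter (fun f => inv f ≠ f ∧ eF f = inv f) := by
    rw [hsdef, ← Finset.filter_or]
    refine Finset.filter_congr fun f _ => ?_
    tauto
  have hs2d : Disjoint (Finset.univ.filter (fun f => inv f ≠ f ∧ eF f = f))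
      (Finset.univ.filter (fun f => inv f ≠ f ∧ eF f = inv f)) := by
    rw [Finset.disjoint_left]
    intro f h1 h2
    obtain ⟨-, h, h1⟩ := Finset.mem_filter.1 h1
    obtain ⟨-, -, h2⟩ := Finset.mem_filter.1 h2
    exact h (h2.symm.trans h1)
  have hcount : ∑ f ∈ s, centreSign vert inv eF (P f) =
      (Finset.univ.filter fun f => inv f ≠ f ∧ eF f = inv f).card -
        (Finset.univ.filter fun f => inv f ≠ f ∧ eF f = f).card := by
    rw [hs2, Finset.sum_union hs2d,
      Finset.sum_congr rfl (g := fun _ => (-1 : ℤ)) (s₁ := Finset.univ.filter _) fun f hf => ?_,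
      Finset.sum_congr rfl (g := fun _ => (1 : ℤ)) (s₁ := Finset.univ.filter (fun f =>
        inv f ≠ f ∧ eF f = inv f)) fun f hf => ?_, Finset.sum_const, Finset.sum_const]
    · simp only [nsmul_eq_mul]
      ring
    · obtain ⟨-, h, h1⟩ := Finset.mem_filter.1 hf
      exact hs.centreSign_of_swap hinv h h1
    · obtain ⟨-, h, h1⟩ := Finset.mem_filter.1 hf
      exact if_pos ⟨f, h, h1, rfl⟩
  have hl := hs.lefschetz eF eV hvert hinv (Classical.arbitrary V)
  rw [hsplit, Finset.sum_union hdisj, Finset.sum_image fun v _ w _ h => Set.singleton_injective h,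
    Finset.sum_congr rfl fun v _ => hs.centreSign_singleton v, Finset.sum_const, nsmul_eq_mul,
    mul_one]
  rw [← Finset.mul_sum, hcount] at hedge
  convert_to ((Finset.univ.filter fun v => eV v = v).card : ℤ) +
    ∑ C ∈ s.image P, centreSign vert inv eF C = 1
  have hl' : 2 * ((Finset.univ.filter fun v => eV v = v).card : ℤ) =
      2 + (Finset.univ.filter fun f => inv f ≠ f ∧ eF f = f).card -
        (Finset.univ.filter fun f => inv f ≠ f ∧ eF f = inv f).card := by
    convert hl
  linarith

end FlagSides

end centres

section weight

variable {X : Type*} [Fintype X] [DecidableEq X]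

/-- The contribution of a hierarchy on all of `X` to `c ∘ g - e_2 ∘ (g - p_1^{(1)})`. -/
def rootWeight (c : SymC) (φ : Perm X) (col : X → Fin 2) (H : Finset (Finset X)) : ℂ :=
  (val (permB φ) (colB col) (children H Finset.univ) c -
    if ∀ B ∈ children H Finset.univ, 2 ≤ B.card then
      val (permB φ) (colB col) (children H Finset.univ) e2 else 0) *
    hierWeight (dP1 c) φ col H (H.erase Finset.univ)

end weight

section fixed

variable {k m n : ℕ} {T : StableTree (Fin k)} {e : StableTree.Iso T T} {l : T.Numbering m n}
  {σ : Perm (Fin m)} {τ : Perm (Fin n)} (he : e.Preserves l (renumber σ τ l)) (W : S2Module.{u})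
  [h : ∀ m n, FiniteDimensional ℂ (W.carrier m n)] [Nonempty (Fin m ⊕ Fin n)]
  (hW : ∀ m n : ℕ, (m < 2 ∨ m + n < 3) → Subsingleton (W.carrier m n))

include he

local notation "Φ" => Perm.sumCongr σ τ

/-- A fixed vertex contributes the trace: the root is a vertex with at least three flags, so that
`e_2` does not contribute. -/
lemma rootWeight_hierOf_vertex {v : T.Vertex} (hv : e.verts v = v) :
    rootWeight W.ch Φ (sumCol m n) (hierOf l {v}) = LinearMap.trace ℂ _ (e.tensorMap W) := by
  classical
  have hCe : e.verts '' {v} = {v} := by simp [hv]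
  have ht := leafTree l
  have hch : children (hierOf l {v}) Finset.univ =
      (Finset.univ.filter fun f => Quotient.mk T.part f = v).image (labels l) := by
    have := ht.children_centreHier_vertex v
    convert this <;> rfl
  have hreps : reps e.verts Finset.univ = insert v (reps e.verts (Finset.univ.erase v)) := by
    ext x
    rw [Finset.mem_insert, mem_reps, mem_reps, Finset.mem_erase]
    by_cases hx : x = v
    · subst hx
      have : rep e.verts x = x := by
        obtain ⟨i, hi⟩ := (rep_sameCycle e.verts x).symm
        rw [← hi]
        exact Function.IsFixedPt.perm_zpow hv i
      simp [this]
    · simp [hx]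
  have hlen : len e.verts v = 1 := Function.minimalPeriod_eq_one_iff_isFixedPt.2 hv
  have hQ : PermInv (e.flags ^ 1) (Finset.univ.filter fun f => Quotient.mk T.part f = v) := by
    intro f
    rw [Finset.mem_filter, Finset.mem_filter, pow_one]
    have : Quotient.mk T.part (e.flags f) = e.verts (Quotient.mk T.part f) := rfl
    rw [this]
    conv_lhs => rw [← hv]
    simp
  have hcard : 3 ≤ (Finset.univ.filter fun f => Quotient.mk T.part f = v).card := by
    have := T.three_le v
    rwa [Nat.card_eq_fintype_card, Fintype.card_subtype] at this
  have hinv : PermInv (permB Φ) (children (hierOf l {v}) Finset.univ) :=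
    permInv_children (permInv_hierOf hCe he) (permInv_univ _)
  rw [trace_tensorMap, hreps, Finset.prod_insert (by simp [mem_reps]), hlen,
    val_image_labels he hQ, ← hch, pow_one, rootWeight, val_e2_eq_zero hinv, ite_self, sub_zero,
    prod_eq_hierWeight hCe he W (V' := Finset.univ.erase v)]
  · convert ht.bijOn_vert_inv_vertex v
    ext x
    simp
  · intro A
    rw [Finset.mem_erase, and_comm]
  · rw [hch, Finset.card_image_of_injective _ (labels_injective l)]
    omega

include hW

/-- An invariant edge contributes the trace up to sign: the root has two children, so that only
`e_2` contributes, with a sign which depends on whether the two sides are exchanged. -/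
lemma rootWeight_hierOf_edge {g : Fin k} (hg : T.inv g ≠ g)
    (hCe : e.verts '' {Quotient.mk T.part g, Quotient.mk T.part (T.inv g)} =
      {Quotient.mk T.part g, Quotient.mk T.part (T.inv g)}) :
    rootWeight W.ch Φ (sumCol m n)
      (hierOf l {Quotient.mk T.part g, Quotient.mk T.part (T.inv g)}) =
    centreSign (Quotient.mk T.part) T.inv e.flags
      {Quotient.mk T.part g, Quotient.mk T.part (T.inv g)} *
      LinearMap.trace ℂ _ (e.tensorMap W) := by
  classical
  have ht := leafTree l
  have hg' : T.inv (T.inv g) ≠ T.inv g := by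
    rw [T.inv_inv]
    exact hg.symm
  set C : Set T.Vertex := {Quotient.mk T.part g, Quotient.mk T.part (T.inv g)} with hC
  have hch : children (hierOf l C) Finset.univ = {labels l g, labels l (T.inv g)} := by
    have := ht.children_centreHier_edge hg
    convert this <;> rfl
  have hinv : PermInv (permB Φ) (children (hierOf l C) Finset.univ) :=
    permInv_children (permInv_hierOf hCe he) (permInv_univ _)
  have hne : labels l g ≠ labels l (T.inv g) := (labels_injective l).ne hg.symm
  have hcol : ∀ f, T.inv f ≠ f → colB (sumCol m n) (labels l f) = 0 := fun f hf => by
    rw [← colour_eq_colB, T.edge_colour f hf]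
  have h2 : ∀ B ∈ children (hierOf l C) Finset.univ, 2 ≤ B.card := by
    rw [hch]
    intro B hB
    rcases Finset.mem_insert.1 hB with rfl | hB
    · exact ht.two_le_card_leafSet hg
    · rw [Finset.mem_singleton.1 hB]
      exact ht.two_le_card_leafSet hg'
  have hprod : LinearMap.trace ℂ _ (e.tensorMap W) =
      hierWeight (dP1 W.ch) Φ (sumCol m n) (hierOf l C) ((hierOf l C).erase Finset.univ) := by
    rw [trace_tensorMap, prod_eq_hierWeight hCe he W]
    · convert ht.bijOn_vert_inv_edge hg
      simp
    · intro A
      rw [Finset.mem_erase, and_comm]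
  rw [rootWeight, if_pos h2, val_ch_eq_zero W (fun A => colB_permB (sumCol_sumCongr σ τ) A) hinv,
    hprod]
  · rw [zero_sub]
    congr 1
    rw [hch]
    rcases (ht.pair_invariant_iff (fun _ => rfl) e.inv_comm hg).1 hCe with h1 | h1
    · rw [val_e2_of_fixed hne (by rw [← labels_auto he, h1])
        (by rw [← labels_auto he, ← e.inv_comm, h1]) (hcol g hg) (hcol _ hg'),
        centreSign, if_pos ⟨g, hg, h1, rfl⟩]
      norm_num
    · rw [val_e2_of_swap hne (by rw [← labels_auto he, h1])
        (by rw [← labels_auto he, ← e.inv_comm, h1, T.inv_inv]) (hcol g hg) (hcol _ hg'), hC,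
        ht.centreSign_of_swap e.inv_comm hg h1]
      norm_num
  · refine hW _ _ (Or.inr ?_)
    rw [card_colours, hch, Finset.card_pair hne]
    norm_num

/-- The weight of the hierarchy of an invariant centre is the trace, up to the sign of the
centre. -/
lemma rootWeight_hierOf {C : Set T.Vertex} (hC : IsCentre (Quotient.mk T.part) T.inv C)
    (hCe : e.verts '' C = C) : rootWeight W.ch Φ (sumCol m n) (hierOf l C) =
    centreSign (Quotient.mk T.part) T.inv e.flags C * LinearMap.trace ℂ _ (e.tensorMap W) := by
  rcases hC with ⟨v, rfl⟩ | ⟨g, hg, rfl⟩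
  · rw [(leafTree l).centreSign_singleton, Int.cast_one, one_mul,
      rootWeight_hierOf_vertex he W (by simpa using hCe)]
  · exact rootWeight_hierOf_edge he W hW hg hCe

end fixed

/-! ### Trees and hierarchies -/

lemma IsPart.card_le {X : Type*} [DecidableEq X] {P : Finset (Finset X)} {b : Finset X}
    (hP : IsPart P b) : P.card ≤ b.card := by
  by_cases h : P = pointPart b
  · rw [h, pointPart, Finset.card_image_of_injective _ Finset.singleton_injective]
  · exact (hP.card_lt h).le

section stable

variable {X : Type*} [Fintype X] {φ : Perm X} {col : X → Fin 2} (W : S2Module.{u})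
  (hW : ∀ m n : ℕ, (m < 2 ∨ m + n < 3) → Subsingleton (W.carrier m n))

include hW

lemma coeff_ch_of_wt_lt {d : Fin 2 × ℕ+ →₀ ℕ} (h : wt d < 3) : coeff d W.ch = 0 := by
  rw [wt_eq_sum] at h
  exact coeff_ch_eq_zero W (hW _ _ (Or.inr h))

lemma val_dP1_ch_eq_zero (hcol : ∀ x, col (φ x) = col x) {S : Finset X} (hS : PermInv φ S)
    (h : ∀ x ∈ S, col x ≠ 0) : val φ col S (dP1 W.ch) = 0 := by
  have h1 : dP1 W.ch = orbitDeriv (0, 1) W.ch := by simp [dP1, orbitDeriv]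
  rw [val, h1, ← sval_add_single, sval, coeff_ch_eq_zero, mul_zero]
  refine hW _ _ (Or.inl ?_)
  rw [cwt_add, cwt_orbitType hcol hS, Finset.filter_false_of_mem h]
  simp [cwt]

variable [DecidableEq X]

/-- Only stable hierarchies contribute. -/
lemma isStableHier_of_rootWeight_ne_zero (hcol : ∀ x, col (φ x) = col x) {H : Finset (Finset X)}
    (hH : IsHier H Finset.univ) (hHφ : PermInv (permB φ) H) (h2 : 2 ≤ Fintype.card X)
    (h : rootWeight W.ch φ col H ≠ 0) : IsStableHier H col := by
  classical
  have hP : IsPart (children H Finset.univ) Finset.univ :=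
    hH.isPart_children (by rwa [Finset.card_univ])
  have hPinv : PermInv (permB φ) (children H Finset.univ) := permInv_children hHφ (permInv_univ φ)
  obtain ⟨hroot, hw⟩ := mul_ne_zero_iff.1 h
  have hch : val (permB φ) (colB col) (children H Finset.univ) W.ch ≠ 0 →
      3 ≤ (children H Finset.univ).card ∧
        2 ≤ ((children H Finset.univ).filter fun B => colB col B = 0).card := by
    intro h1
    by_contra h3
    refine h1 (val_ch_eq_zero W (fun A => colB_permB hcol A) hPinv (hW _ _ ?_))
    rw [card_colours]
    omega
  have he2 : val (permB φ) (colB col) (children H Finset.univ) e2 ≠ 0 →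
      (children H Finset.univ).card = 2 := fun h1 => by
    by_contra h3
    exact h1 (val_e2_eq_zero hPinv h3)
  -- The term with `e_2` requires children with at least two elements; if there are others, then
  -- `ch W` has to contribute, which requires three children.
  have hsmall : ∀ B ∈ children H Finset.univ, B.card < 2 →
      3 ≤ (children H Finset.univ).card := by
    intro B hB hB2
    rw [if_neg fun h3 => by have := h3 B hB; omega, sub_zero] at hroot
    exact (hch hroot).1
  have hne : (children H Finset.univ).Nonempty := by
    obtain ⟨x⟩ : Nonempty X := Fintype.card_pos_iff.1 (by omega)
    obtain ⟨B, hB, -⟩ := hP.cover x (Finset.mem_univ x)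
    exact ⟨B, hB⟩
  refine ⟨hH, ?_, ?_, ?_, ?_⟩
  · by_contra h3
    obtain ⟨B, hB⟩ := hne
    have h4 := Finset.card_lt_card (mem_children.1 hB).1
    rw [Finset.card_univ] at h4
    have h5 := hsmall B hB (by omega)
    have h6 := hP.card_le
    rw [Finset.card_univ] at h6
    omega
  · intro A hA hA1
    obtain ⟨x, hx⟩ := Finset.card_eq_one.1 hA1
    have hAu : A ≠ Finset.univ := by
      rintro rfl
      simp at hA1
    have hAne : A.Nonempty := Finset.card_pos.1 (by have := hH.two_le A hA; omega)
    -- If the complement of a member `A` were a point, then the root would have just two children,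
    -- one of them a point; neither of the two terms of the weight contributes for such a root.
    have hchild : children H Finset.univ = {A, Aᶜ} := by
      refine children_eq_of_isPart ⟨?_, fun _ _ => Finset.subset_univ _, ?_, ?_⟩ ?_ ?_ ?_
      · intro B hB
        rcases Finset.mem_insert.1 hB with rfl | hB
        · exact hAne
        · rw [Finset.mem_singleton.1 hB, hx]
          exact Finset.singleton_nonempty x
      · intro y _
        by_cases hy : y ∈ A
        · exact ⟨A, by simp, hy⟩
        · exact ⟨Aᶜ, by simp, Finset.mem_compl.2 hy⟩
      · intro B hB D hD y hyB hyD
        simp only [Finset.mem_insert, Finset.mem_singleton] at hB hD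
        rcases hB with rfl | rfl <;> rcases hD with rfl | rfl
        · rfl
        · exact absurd hyB (Finset.mem_compl.1 hyD)
        · exact absurd hyD (Finset.mem_compl.1 hyB)
        · rfl
      · intro B hB
        rcases Finset.mem_insert.1 hB with rfl | hB
        · exact ⟨Finset.ssubset_univ_iff.2 hAu, Or.inl hA⟩
        · rw [Finset.mem_singleton.1 hB]
          refine ⟨Finset.ssubset_univ_iff.2 fun h3 => ?_, Or.inr hA1⟩
          rw [Finset.compl_eq_univ_iff] at h3
          exact hAne.ne_empty h3
      · exact fun U hU => Finset.card_pos.1 (by have := hH.two_le U hU; omega)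
      · intro U hU hUu
        rcases hH.laminar U hU A hA with h3 | h3 | h3
        · exact ⟨A, by simp, h3⟩
        · refine ⟨A, by simp, ?_⟩
          by_contra h4
          obtain ⟨y, hy, hyA⟩ := Finset.not_subset.1 h4
          have hyx : y = x := by
            rw [← Finset.mem_singleton, ← hx]
            exact Finset.mem_compl.2 hyA
          apply hUu.2
          intro z _
          by_cases hz : z ∈ A
          · exact h3 hz
          · have hzx : z = x := by
              rw [← Finset.mem_singleton, ← hx]
              exact Finset.mem_compl.2 hz
            rwa [hzx, ← hyx]
        · exact ⟨Aᶜ, by simp, Finset.subset_compl_iff_disjoint_right.2 h3⟩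
    have h3 := hsmall Aᶜ (by simp [hchild]) (by omega)
    rw [hchild] at h3
    have := Finset.card_le_two (a := A) (b := Aᶜ)
    omega
  · intro S hS hSu
    by_contra! h3
    apply hw
    have hR : PermInv (permB φ) (H.erase Finset.univ) := by
      intro A
      rw [Finset.mem_erase, Finset.mem_erase, hHφ A, ← (permB φ).injective.ne_iff (x := A)]
      simp
    have hSR : S ∈ H.erase Finset.univ := Finset.mem_erase.2 ⟨hSu, hS⟩
    refine Finset.prod_eq_zero (rep_mem_reps hR hSR) ?_
    have h4 := apply_eq_of_sameCycle (f := fun S => val (permB φ ^ len (permB φ) S) (colB col)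
      (children H S) (dP1 W.ch)) (S := Finset.univ) (permInv_univ _)
      (fun S _ => val_children_permB hcol hHφ (dP1 W.ch) S) (rep_sameCycle (permB φ) S).symm
      (Finset.mem_univ S)
    refine h4.trans ?_
    refine val_dP1_ch_eq_zero W hW (fun A => ?_) ?_ h3
    · rw [permB_pow]
      exact colB_permB (fun x => col_pow hcol _ x) A
    · rw [permB_pow]
      apply permInv_children _ (permInv_pow_len φ S)
      rw [← permB_pow]
      exact hHφ.pow _
  · by_contra h3
    rw [not_or] at h3
    obtain ⟨h3, h4⟩ := h3
    have h5 : ¬ 2 ≤ ((children H Finset.univ).filter fun B => colB col B = 0).card := by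
      intro h5
      obtain ⟨B, hB, D, hD, hBD⟩ := Finset.one_lt_card.1 h5
      rw [Finset.mem_filter] at hB hD
      exact h4 ⟨B, hB.1, D, hD.1, hBD, hB.2, hD.2⟩
    have h6 : val (permB φ) (colB col) (children H Finset.univ) W.ch = 0 := by
      by_contra h6
      exact h5 (hch h6).2
    rw [h6, zero_sub] at hroot
    split_ifs at hroot with h7
    · apply h5
      rw [Finset.filter_true_of_mem, he2 (neg_ne_zero.1 hroot)]
      intro B hB
      refine colB_of_not ?_
      rintro ⟨x, rfl⟩
      simpa using h7 _ hB
    · simp at hroot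

end stable

section count

variable {m n : ℕ}

section

variable {k : ℕ} {T : StableTree (Fin k)} {l : T.Numbering m n} {C : Set T.Vertex}

lemma labels_mem_hierOf_iff {f : Fin k} (hf : T.inv f ≠ f) :
    labels l f ∈ hierOf l C ↔ Away (flagSide T.part T.inv) C f := by
  rw [mem_hierOf]
  constructor
  · rintro (h | ⟨g, ⟨-, hg⟩, h⟩)
    · obtain ⟨h1, -, -⟩ := (leafTree l).three (Quotient.mk T.part f) f f
      have : Nonempty (Fin m ⊕ Fin n) := by
        obtain ⟨x, -⟩ := (leafTree l).leafSet_nonempty f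
        exact ⟨x⟩
      exact absurd h ((leafTree l).leafSet_ne_univ f)
    · rwa [← labels_injective l h]
  · exact fun h => Or.inr ⟨f, ⟨hf, h⟩, rfl⟩

lemma mem_splits_iff (hC : IsCentre (Quotient.mk T.part) T.inv C) {A : Finset (Fin m ⊕ Fin n)} :
    A ∈ splits l ↔ A.card = 1 ∨ (A ∈ hierOf l C ∧ A ≠ Finset.univ) ∨
      (Aᶜ ∈ hierOf l C ∧ Aᶜ ≠ Finset.univ) := by
  have := Set.ext_iff.1 ((leafTree l).range_leafSet_eq hC) A
  rw [Set.mem_ofPred_eq] at this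
  rw [splits, Finset.mem_image]
  simp only [Finset.mem_univ, true_and]
  exact this

/-- The centre is determined by the hierarchy. -/
lemma centre_eq_of_hierOf_eq {C' : Set T.Vertex} (hC : IsCentre (Quotient.mk T.part) T.inv C)
    (hC' : IsCentre (Quotient.mk T.part) T.inv C') (h : hierOf l C = hierOf l C') : C = C' := by
  refine (leafTree l).centre_ext hC hC' fun f hf => ?_
  rw [← labels_mem_hierOf_iff (l := l) hf, h, labels_mem_hierOf_iff hf]

variable {σ : Perm (Fin m)} {τ : Perm (Fin n)}

/-- If the hierarchy of a centre is invariant under a renumbering, then so is the tree. -/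
lemma exists_auto_of_permInv (hC : IsCentre (Quotient.mk T.part) T.inv C)
    (h : PermInv (permB (Perm.sumCongr σ τ)) (hierOf l C)) :
    ∃ e : StableTree.Iso T T, e.Preserves l (renumber σ τ l) := by
  apply exists_iso
  have h1 : ∀ A, permB (Perm.sumCongr σ τ) A ∈ splits l ↔ A ∈ splits l := by
    intro A
    have hc : (permB (Perm.sumCongr σ τ) A)ᶜ = permB (Perm.sumCongr σ τ) Aᶜ := by
      ext x
      obtain ⟨x, rfl⟩ := (Perm.sumCongr σ τ).surjective x
      rw [Finset.mem_compl, mem_permB, mem_permB, Finset.mem_compl]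
    have hu : ∀ A, permB (Perm.sumCongr σ τ) A = Finset.univ ↔ A = Finset.univ := by
      intro A
      rw [← (permB (Perm.sumCongr σ τ)).injective.eq_iff (a := A)]
      simp
    rw [mem_splits_iff hC, mem_splits_iff hC, hc, h, h, card_permB, ne_eq, hu, ne_eq, hu]
  ext A
  rw [← h1, splits, splits, Finset.mem_image, Finset.mem_image]
  simp only [Finset.mem_univ, true_and, ← permB_labels_renumber (σ := σ) (τ := τ) (l := l),
    (permB (Perm.sumCongr σ τ)).injective.eq_iff]

lemma image_centre_eq_iff {e : StableTree.Iso T T} (he : e.Preserves l (renumber σ τ l))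
    (hC : IsCentre (Quotient.mk T.part) T.inv C) :
    e.verts '' C = C ↔ PermInv (permB (Perm.sumCongr σ τ)) (hierOf l C) := by
  refine ⟨fun h => permInv_hierOf h he, fun h => ?_⟩
  refine (leafTree l).centre_ext (isCentre_iso e hC) hC fun f hf => ?_
  obtain ⟨f, rfl⟩ := e.flags.surjective f
  rw [e.inv_comm, e.flags.injective.ne_iff] at hf
  rw [away_iso, ← labels_mem_hierOf_iff (l := l) hf, ← h, ← labels_auto he, labels_mem_hierOf_iff]
  rwa [e.inv_comm, e.flags.injective.ne_iff]

end

variable (W : S2Module.{u}) [h : ∀ m n, FiniteDimensional ℂ (W.carrier m n)]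
  (hW : ∀ m n : ℕ, (m < 2 ∨ m + n < 3) → Subsingleton (W.carrier m n))

include hW

open Classical in
/-- The contribution of a class of trees, as a sum over the centres with invariant hierarchy. -/
lemma sum_centres_rootWeight [Nonempty (Fin m ⊕ Fin n)] (σ : Perm (Fin m)) (τ : Perm (Fin n))
    {k : ℕ} {T : StableTree (Fin k)} (l : T.Numbering m n) :
    ∑ C ∈ Finset.univ.filter (fun C : Set T.Vertex => IsCentre (Quotient.mk T.part) T.inv C ∧
        PermInv (permB (Perm.sumCongr σ τ)) (hierOf l C)),
      rootWeight W.ch (Perm.sumCongr σ τ) (sumCol m n) (hierOf l C) =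
    if h : ∃ e : StableTree.Iso T T, e.Preserves l (renumber σ τ l) then
      LinearMap.trace ℂ _ (h.choose.tensorMap W) else 0 := by
  split_ifs with h
  · have he := h.choose_spec
    set e := h.choose
    have hne : Nonempty T.Vertex := ⟨Quotient.mk T.part (leafOf l (Classical.arbitrary _))⟩
    have hs := (leafTree l).sum_centreSign (eF := e.flags) (eV := e.verts) (fun _ => rfl) e.inv_comm
    rw [← one_mul (LinearMap.trace ℂ _ _), ← Int.cast_one, ← hs, Int.cast_sum, Finset.sum_mul]
    refine Finset.sum_congr ?_ fun C hC => ?_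
    · refine Finset.filter_congr fun C _ => and_congr_right fun hC => ?_
      exact (image_centre_eq_iff he hC).symm
    · obtain ⟨hC, hCe⟩ := (Finset.mem_filter.1 hC).2
      exact rootWeight_hierOf he W hW hC hCe
  · refine Finset.sum_eq_zero fun C hC => ?_
    obtain ⟨hC, hCe⟩ := (Finset.mem_filter.1 hC).2
    exact absurd (exists_auto_of_permInv hC hCe) h

/-- The character of the module of trees as a sum over hierarchies. -/
theorem val_trees (hmn : 2 ≤ m + n) (σ : Perm (Fin m)) (τ : Perm (Fin n)) :
    val (Perm.sumCongr σ τ) (sumCol m n) Finset.univ W.trees.ch =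
      ∑ H ∈ hiers (Perm.sumCongr σ τ) Finset.univ,
        rootWeight W.ch (Perm.sumCongr σ τ) (sumCol m n) H := by
  classical
  have hcard : 2 ≤ Fintype.card (Fin m ⊕ Fin n) := by simpa using hmn
  have hne : Nonempty (Fin m ⊕ Fin n) := Fintype.card_pos_iff.1 (by omega)
  rw [val, ← typeOf, sval_ch, trace_trees]
  have h1 := fun c : treeClasses m n => sum_centres_rootWeight W hW σ τ (repTree c).num
  rw [← Finset.sum_congr rfl fun c _ => h1 c, Finset.sum_sigma']
  -- A class of trees is determined by the hierarchy of a centre, since its sets of labels are the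
  -- members, their complements and the points.
  refine Finset.sum_of_injOn (fun p => hierOf (repTree p.1).num p.2) ?_ ?_ ?_ ?_
  · rintro ⟨c, C⟩ hp ⟨c', C'⟩ hp' hH
    simp only [Finset.coe_sigma, Finset.coe_univ, Set.mem_sigma_iff, Set.mem_univ, true_and,
      Finset.coe_filter, Finset.mem_univ, Set.mem_ofPred_eq] at hp hp'
    have hH : hierOf (repTree c).num C = hierOf (repTree c').num C' := hH
    have hc : c = c' := by
      apply Subtype.ext
      rw [← splits_repTree c, ← splits_repTree c']
      ext A
      rw [mem_splits_iff hp.1, mem_splits_iff hp'.1, hH]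
    subst hc
    rw [centre_eq_of_hierOf_eq hp.1 hp'.1 hH]
  · rintro ⟨c, C⟩ hp
    simp only [Finset.coe_sigma, Finset.coe_univ, Set.mem_sigma_iff, Set.mem_univ, true_and,
      Finset.coe_filter, Finset.mem_univ, Set.mem_ofPred_eq] at hp
    exact mem_hiers.2 ⟨(leafTree _).isHier_centreHier hp.1 hcard, hp.2⟩
  · intro H hH hnot
    obtain ⟨hH, hHφ⟩ := mem_hiers.1 hH
    by_contra hw
    apply hnot
    obtain ⟨k, T, l, C, hC, rfl⟩ := exists_tree_of_isStableHier
      (isStableHier_of_rootWeight_ne_zero W hW (sumCol_sumCongr σ τ) hH hHφ hcard hw)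
    obtain ⟨e, he⟩ := exists_iso (l := l) (l' := (repTree (classOf l)).num)
      (splits_repTree (classOf l)).symm
    refine ⟨⟨classOf l, e.verts '' C⟩, ?_, hierOf_iso he C⟩
    simp only [Finset.coe_sigma, Finset.coe_univ, Set.mem_sigma_iff, Set.mem_univ, true_and,
      Finset.coe_filter, Finset.mem_univ, Set.mem_ofPred_eq]
    exact ⟨isCentre_iso e hC, by rwa [hierOf_iso he]⟩
  · rintro ⟨c, C⟩ _
    rfl

end count

/-! ### Leaves of the first colour -/

section leaves

variable {F : Type} [Finite F] {T : StableTree F} {m n : ℕ} (l : T.Numbering m n)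

/-- Beyond a flag of the first colour there is a leaf of the first colour, since every vertex
carries a second flag of this colour. -/
lemma exists_inl_mem_labels {f : F} (hf : T.colour f = 0) : ∃ i, Sum.inl i ∈ labels l f := by
  classical
  have ht := leafTree l
  induction hN : (labels l f).card using Nat.strong_induction_on generalizing f with
  | _ N ih =>
    by_cases hfi : T.inv f = f
    · obtain ⟨x, rfl⟩ := (ht.loc_iff f).1 hfi
      rw [colour_leafOf] at hf
      rcases x with i | j
      · exact ⟨i, by rw [labels, ht.leafSet_loc, Finset.mem_singleton]⟩
      · exact absurd hf one_ne_zero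
    · obtain ⟨h, hv, hc, hne⟩ : ∃ h, Quotient.mk T.part h = Quotient.mk T.part (T.inv f) ∧
          T.colour h = 0 ∧ h ≠ T.inv f := by
        have h2 := T.two_le (Quotient.mk T.part (T.inv f))
        have : Nontrivial {h : F // Quotient.mk T.part h = Quotient.mk T.part (T.inv f) ∧
            T.colour h = 0} := Finite.one_lt_card_iff_nontrivial.1 h2
        obtain ⟨⟨h, h1, h2⟩, h3⟩ := exists_ne (⟨T.inv f, rfl, by
          rw [T.colour_inv, hf]⟩ : {h : F // Quotient.mk T.part h = Quotient.mk T.part (T.inv f) ∧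
            T.colour h = 0})
        exact ⟨h, h1, h2, fun h4 => h3 (Subtype.ext h4)⟩
      have hsub : labels l h ⊆ labels l f := ht.leafSet_subset hfi hv hne
      have hne' : labels l h ≠ labels l f := fun h1 => by
        rw [labels_injective l h1] at hv
        exact ht.vert_ne_vert_inv hfi hv
      obtain ⟨i, hi⟩ := ih _ (hN ▸ Finset.card_lt_card (hsub.ssubset_of_ne hne')) hc rfl
      exact ⟨i, hsub hi⟩

include l

/-- A stable tree has at least two leaves of the first colour and at least three leaves. -/
lemma two_le_of_numbering : 2 ≤ m ∧ 3 ≤ m + n := by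
  have ht := leafTree l
  obtain ⟨v⟩ : Nonempty T.Vertex := by
    obtain ⟨v | f⟩ := T.isTree.connected.nonempty
    · exact ⟨v⟩
    · exact ⟨Quotient.mk T.part f⟩
  constructor
  · have : Nontrivial {h : F // Quotient.mk T.part h = v ∧ T.colour h = 0} :=
      Finite.one_lt_card_iff_nontrivial.1 (T.two_le v)
    obtain ⟨⟨f, hf, hfc⟩, ⟨g, hg, hgc⟩, hfg⟩ := exists_pair_ne
      {h : F // Quotient.mk T.part h = v ∧ T.colour h = 0}
    obtain ⟨i, hi⟩ := exists_inl_mem_labels l hfc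
    obtain ⟨j, hj⟩ := exists_inl_mem_labels l hgc
    have hij : i ≠ j := by
      rintro rfl
      exact hfg (Subtype.ext (ht.eq_of_mem_leafSet (hf.trans hg.symm) hi hj))
    have := Fintype.one_lt_card_iff.2 ⟨i, j, hij⟩
    rwa [Fintype.card_fin] at this
  · obtain ⟨f, hf⟩ := Quotient.exists_rep v
    obtain ⟨g, hg, hgf, -⟩ := ht.three v f f
    obtain ⟨h, hh, hhf, hhg⟩ := ht.three v f g
    obtain ⟨x, hx⟩ := ht.leafSet_nonempty f
    obtain ⟨y, hy⟩ := ht.leafSet_nonempty g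
    obtain ⟨z, hz⟩ := ht.leafSet_nonempty h
    have hf' : Quotient.mk T.part f = v := hf
    have := Fintype.two_lt_card_iff.2 ⟨x, y, z,
      fun e => hgf (ht.eq_of_mem_leafSet (hg.trans hf'.symm) hy (e ▸ hx)),
      fun e => hhf (ht.eq_of_mem_leafSet (hh.trans hf'.symm) hz (e ▸ hx)),
      fun e => hhg (ht.eq_of_mem_leafSet (hh.trans hg.symm) hz (e ▸ hy))⟩
    rwa [Fintype.card_sum, Fintype.card_fin, Fintype.card_fin] at this

end leaves

section trees

variable (W : S2Module.{u})

lemma subsingleton_trees (m n : ℕ) (h : m < 2 ∨ m + n < 3) :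
    Subsingleton (W.trees.carrier m n) := by
  refine ⟨fun x y => Subtype.ext ?_⟩
  funext k T l
  have := two_le_of_numbering l
  omega

/-! ### The equation of the Legendre transform -/

lemma coeff_e2_of_wt_lt {d : Fin 2 × ℕ+ →₀ ℕ} (h : wt d < 2) : coeff d e2 = 0 := by
  classical
  have h1 := sval_e2 d
  rw [sval, if_neg, if_neg] at h1
  · exact (mul_eq_zero.1 h1).resolve_left (zfac_ne_zero d)
  · rintro rfl
    simp [wt] at h
  · rintro rfl
    simp [wt] at h

lemma val_plethysm_eq_zero {X : Type*} [Fintype X] {φ : Perm X} {col : X → Fin 2}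
    (hcol : ∀ x, col (φ x) = col x) {g : SymC} (hg : constantCoeff g = 0)
    (hg1 : coeff (Finsupp.single (1, 1) 1) g = 0) {b : Finset X} (hb : PermInv φ b) {f : SymC}
    (hf : ∀ d, wt d ≤ b.card → coeff d f = 0) : val φ col b (plethysm f g) = 0 := by
  classical
  rw [val_plethysm hcol hg hg1 hb]
  refine Finset.sum_eq_zero fun P hP => ?_
  obtain ⟨hP, hPφ⟩ := mem_parts.1 hP
  rw [val, sval, hf _ (by rw [wt_orbitType hPφ]; exact hP.card_le), mul_zero, zero_mul]

lemma adams_sub (k : ℕ+) (f g : SymC) : adams k (f - g) = adams k f - adams k g := by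
  simp only [adams, ← substAlgHom_apply (hasSubst_adams k), map_sub]

section legendre

variable (hW : ∀ m n : ℕ, (m < 2 ∨ m + n < 3) → Subsingleton (W.carrier m n))

include hW

lemma coeff_dP1_ch {d : Fin 2 × ℕ+ →₀ ℕ} (hd : wt d < 2) : coeff d (dP1 W.ch) = 0 := by
  have h1 : dP1 W.ch = orbitDeriv (0, 1) W.ch := by simp [dP1, orbitDeriv]
  have h2 : sval d (dP1 W.ch) = 0 := by
    rw [h1, ← sval_add_single, sval, coeff_ch_of_wt_lt W hW, mul_zero]
    rw [wt_add]
    simp only [wt, Finsupp.sum_single_index, mul_zero, PNat.one_coe, mul_one] at hd ⊢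
    omega
  exact (mul_eq_zero.1 h2).resolve_left (zfac_ne_zero d)

variable [h : ∀ m n, FiniteDimensional ℂ (W.carrier m n)]

/-- Counting trees by their vertices minus their edges: the first term on the right counts trees
with a marked vertex, the second one trees with a marked edge. -/
theorem ch_trees {g : SymC} (hg : IsUnital g) (hfix : g = psum 0 1 + plethysm (dP1 W.ch) g) :
    W.trees.ch = plethysm W.ch g - plethysm e2 (g - psum 0 1) := by
  classical
  refine eq_of_forall_val_eq fun m n σ τ => ?_
  have hwt : ∀ i : Fin 2, wt (Finsupp.single (i, 1) 1) = 1 := fun i => by simp [wt]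
  have ha : ∀ i, coeff (Finsupp.single (i, 1) 1) (dP1 W.ch) = 0 := fun i =>
    coeff_dP1_ch W hW (by rw [hwt]; norm_num)
  have hc : ∀ i, coeff (Finsupp.single (i, 1) 1) W.ch = 0 := fun i =>
    coeff_ch_of_wt_lt W hW (by rw [hwt]; norm_num)
  have hcol := sumCol_sumCongr σ τ
  have hcard : (Finset.univ : Finset (Fin m ⊕ Fin n)).card = m + n := by simp
  -- The description by hierarchies requires two labels; in degree less than two all terms vanish.
  by_cases hmn : 2 ≤ m + n
  · rw [val_trees W hW hmn]
    trans val (Perm.sumCongr σ τ) (sumCol m n) Finset.univ (plethysm W.ch g) -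
      val (Perm.sumCongr σ τ) (sumCol m n) Finset.univ (plethysm e2 (g - psum 0 1))
    · rw [val_plethysm_eq_rootSum ha hc hg hfix hcol (permInv_univ _) (by rwa [hcard]), rootSum,
        val_plethysm_e2 ha hg hfix hcol (permInv_univ _) (by rwa [hcard]), Finset.sum_filter,
        ← Finset.sum_sub_distrib]
      refine Finset.sum_congr rfl fun H _ => ?_
      rw [rootWeight]
      split_ifs
      · rw [sub_mul]
      · rw [sub_zero, sub_zero]
    · rw [val, val, val, sval_sub]
  · have hg1 : constantCoeff (g - psum 0 1) = 0 := by
      rw [map_sub, hg.const, psum, constantCoeff_X, sub_zero]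
    have hg2 : coeff (Finsupp.single (1, 1) 1) (g - psum 0 1) = 0 := by
      rw [map_sub, hg.coeff_one, psum, coeff_X, if_neg, sub_zero]
      intro h
      have := Finsupp.single_left_injective one_ne_zero h
      simp at this
    have h1 := val_plethysm_eq_zero hcol hg.const hg.coeff_one (permInv_univ _) (f := W.ch)
      fun d hd => coeff_ch_of_wt_lt W hW (by rw [hcard] at hd; omega)
    have h2 := val_plethysm_eq_zero hcol hg1 hg2 (permInv_univ _) (f := e2)
      fun d hd => coeff_e2_of_wt_lt (by rw [hcard] at hd; omega)
    rw [val] at h1 h2 ⊢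
    rw [val, sval_sub, h1, h2, ← typeOf, sval_ch, sub_zero]
    have := subsingleton_trees W m n (by omega)
    rw [Subsingleton.elim (W.trees.rho m n (σ, τ)) 0, map_zero]

/-- The equation of the Legendre transform and the uniqueness of its solution. -/
theorem legendreEq_trees : LegendreEq (e2 - W.ch) (h2 + W.trees.ch) ∧
    ∀ G, LegendreEq (e2 - W.ch) G → G = h2 + W.trees.ch := by
  have hdF : dP1 (e2 - W.ch) = psum 0 1 - dP1 W.ch := by
    rw [← dP1_e2, dP1, dP1, dP1, map_sub]
  have hc : constantCoeff (dP1 W.ch) = 0 := by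
    rw [← coeff_zero_eq_constantCoeff_apply]
    exact coeff_dP1_ch W hW (by simp [wt])
  have ha : ∀ i, coeff (Finsupp.single (i, 1) 1) (dP1 W.ch) = 0 := fun i =>
    coeff_dP1_ch W hW (by simp [wt])
  have hF : IsUnital (dP1 (e2 - W.ch)) := hdF ▸ isUnital_psum_sub hc (ha 0) (ha 1)
  obtain ⟨g, hg, hinv, -, hfix⟩ := exists_inverse hc (ha 0) (ha 1)
  have hg1 : constantCoeff (g - psum 0 1) = 0 := by
    rw [map_sub, hg.const, psum, constantCoeff_X, sub_zero]
  have heq : LegendreEq (e2 - W.ch) (h2 + W.trees.ch) := by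
    refine legendreEq_of_inverse hF hg (by rw [hdF, hinv]) ?_
    rw [ch_trees W hW hg hfix, plethysm_sub _ _ hg.const, plethysm_e2 hg.const, plethysm_e2 hg1,
      adams_sub, adams_psum, h2, mul_one]
    have h2 : (2 : SymC) * MvPowerSeries.C (2⁻¹ : ℂ) = 1 := by
      rw [← map_ofNat (MvPowerSeries.C (σ := Fin 2 × ℕ+) (R := ℂ)) 2, ← map_mul]
      norm_num
    simp only [smul_eq_C_mul]
    linear_combination (psum 0 1 * g) * h2
  exact ⟨heq, fun G hG => legendreEq_unique hF heq hG⟩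

end legendre

/-! ### The rank -/

lemma prod_rkSubst (i j : ℕ) :
    ((Finsupp.single ((0 : Fin 2), (1 : ℕ+)) i + Finsupp.single (1, 1) j).prod
      fun s e => rkSubst s ^ e) =
      monomial (Finsupp.single 0 i + Finsupp.single 1 j) (1 : ℂ) := by
  have h1 : ∀ (a : Fin 2 × ℕ+) (k : ℕ),
      ((Finsupp.single a k).prod fun s e => rkSubst s ^ e) = rkSubst a ^ k :=
    fun a k => Finsupp.prod_single_index (pow_zero _)
  refine (Finsupp.prod_add_index' (h := fun s e => rkSubst s ^ e) (fun _ => pow_zero _)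
    fun _ _ _ => pow_add _ _ _).trans ?_
  rw [h1, h1]
  simp [rkSubst, X_pow_eq, monomial_mul_monomial]

lemma rkCoeff_eq (i j : ℕ) (f : SymC) : rkCoeff i j f =
    coeff (Finsupp.single (0, 1) i + Finsupp.single (1, 1) j) f := by
  classical
  rw [rkCoeff, rk, coeff_subst hasSubst_rkSubst,
    finsum_eq_single _ (Finsupp.single ((0 : Fin 2), (1 : ℕ+)) i + Finsupp.single (1, 1) j)]
  · rw [prod_rkSubst, coeff_monomial_same, smul_eq_mul, mul_one]
  · intro d hd
    by_cases h : ∀ a ∈ d.support, a.2 = 1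
    · have hd' : d = Finsupp.single (0, 1) (d (0, 1)) + Finsupp.single (1, 1) (d (1, 1)) := by
        ext ⟨a, k⟩
        by_cases hk : k = 1
        · subst hk
          have : a = 0 ∨ a = 1 := by revert a; decide
          rcases this with rfl | rfl <;> simp
        · have h1 : d (a, k) = 0 := by
            by_contra h1
            exact hk (h (a, k) (Finsupp.mem_support_iff.2 h1))
          simp [h1, Ne.symm hk]
      rw [hd', prod_rkSubst, coeff_monomial, if_neg, smul_zero]
      intro h1
      apply hd
      rw [hd']
      have h2 := DFunLike.congr_fun h1 0
      have h3 := DFunLike.congr_fun h1 1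
      simp at h2 h3
      rw [h2, h3]
    · push Not at h
      obtain ⟨a, ha, ha1⟩ := h
      rw [Finsupp.prod, Finset.prod_eq_zero ha, map_zero, smul_zero]
      rw [rkSubst, if_neg ha1, zero_pow (Finsupp.mem_support_iff.1 ha)]

lemma rkCoeff_add (i j : ℕ) (f g : SymC) : rkCoeff i j (f + g) = rkCoeff i j f + rkCoeff i j g := by
  rw [rkCoeff_eq, rkCoeff_eq, rkCoeff_eq, map_add]

lemma rkCoeff_sub (i j : ℕ) (f g : SymC) : rkCoeff i j (f - g) = rkCoeff i j f - rkCoeff i j g := by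
  rw [rkCoeff_eq, rkCoeff_eq, rkCoeff_eq, map_sub]

lemma rkCoeff_ch_eq_zero {i j : ℕ} (h : Subsingleton (W.carrier i j)) : rkCoeff i j W.ch = 0 := by
  rw [rkCoeff_eq]
  apply coeff_ch_eq_zero
  rw [cwt_add, cwt_add]
  simpa [cwt] using h

lemma rkCoeff_psum_sq (i j : ℕ) :
    rkCoeff i j (psum 0 1 ^ 2) = if (i, j) = (2, 0) then 1 else 0 := by
  classical
  rw [rkCoeff_eq, psum, X_pow_eq, coeff_monomial]
  refine if_congr ⟨fun h => ?_, fun h => ?_⟩ rfl rfl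
  · have h1 := DFunLike.congr_fun h (0, 1)
    have h2 := DFunLike.congr_fun h (1, 1)
    simp at h1 h2
    rw [h1, h2]
  · obtain ⟨rfl, rfl⟩ := Prod.mk.inj h
    simp

lemma rkCoeff_psum_two (i j : ℕ) : rkCoeff i j (psum 0 2) = 0 := by
  classical
  rw [rkCoeff_eq, psum, coeff_X, if_neg]
  intro h
  have h1 := DFunLike.congr_fun h (0, 2)
  simp at h1

lemma rkCoeff_smul (i j : ℕ) (c : ℂ) (f : SymC) : rkCoeff i j (c • f) = c * rkCoeff i j f := by
  rw [rkCoeff_eq, rkCoeff_eq, map_smul, smul_eq_mul]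

lemma rkStar_of_rkCoeff {f : SymC} (hf : ∀ i j, (i < 2 ∨ i + j < 3) →
    rkCoeff i j f = if (i, j) = (2, 0) then 2⁻¹ else 0) : RkStar f := by
  refine ⟨?_, fun i j h1 h2 => ?_⟩
  · rw [hf 2 0 (Or.inr (by norm_num)), if_pos rfl]
    norm_num
  · rw [hf i j h2, if_neg h1]

lemma rkStar_e2_sub_ch (hW : ∀ m n : ℕ, (m < 2 ∨ m + n < 3) → Subsingleton (W.carrier m n)) :
    RkStar (e2 - W.ch) := by
  refine rkStar_of_rkCoeff fun i j h => ?_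
  rw [rkCoeff_sub, rkCoeff_ch_eq_zero W (hW i j h), e2, rkCoeff_smul, rkCoeff_sub,
    rkCoeff_psum_sq, rkCoeff_psum_two]
  split_ifs <;> simp

lemma rkStar_h2_add_ch (hW : ∀ m n : ℕ, (m < 2 ∨ m + n < 3) → Subsingleton (W.carrier m n)) :
    RkStar (h2 + W.ch) := by
  refine rkStar_of_rkCoeff fun i j h => ?_
  rw [rkCoeff_add, rkCoeff_ch_eq_zero W (hW i j h), h2, rkCoeff_smul, rkCoeff_add,
    rkCoeff_psum_sq, rkCoeff_psum_two]
  split_ifs <;> simp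

end trees

/-! ### Integrality -/

lemma memLambda2_add {f g : SymC} (hf : MemLambda2 f) (hg : MemLambda2 g) :
    MemLambda2 (f + g) := by
  intro d
  obtain ⟨a, ha⟩ := hf d
  obtain ⟨b, hb⟩ := hg d
  refine ⟨a + b, ?_⟩
  rw [← substAlgHom_apply hasSubst_powerSumSeries] at ha hb ⊢
  rw [map_add, map_add, ha, hb, Int.cast_add]

lemma memLambda2_sub {f g : SymC} (hf : MemLambda2 f) (hg : MemLambda2 g) :
    MemLambda2 (f - g) := by
  intro d
  obtain ⟨a, ha⟩ := hf d
  obtain ⟨b, hb⟩ := hg d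
  refine ⟨a - b, ?_⟩
  rw [← substAlgHom_apply hasSubst_powerSumSeries] at ha hb ⊢
  rw [map_sub, map_sub, ha, hb, Int.cast_sub]

lemma memLambda2_psum (i : Fin 2) (k : ℕ+) : MemLambda2 (psum i k) := by
  classical
  intro d
  rw [psum, subst_X hasSubst_powerSumSeries, coeff_powerSumSeries]
  split_ifs
  · exact ⟨1, by simp⟩
  · exact ⟨0, by simp⟩

section colouring

variable {X : Type*} [Fintype X]

/-- The content of an assignment `u` of variables to the points: the exponent of the product of
the variables `x_{col x, u x}`. -/
def content (col : X → Fin 2) (u : X → ℕ) : Fin 2 × ℕ →₀ ℕ :=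
  ∑ x, Finsupp.single (col x, u x) 1

/-- The assignments of variables to the points which have a given content. -/
abbrev Assignment (col : X → Fin 2) (d : Fin 2 × ℕ →₀ ℕ) : Type _ :=
  {u : X → ℕ // content col u = d}

lemma content_apply_ne_zero (col : X → Fin 2) (u : X → ℕ) (x : X) :
    content col u (col x, u x) ≠ 0 := by
  rw [content, Finsupp.finsetSum_apply]
  exact (Finset.sum_pos' (fun _ _ => Nat.zero_le _) ⟨x, Finset.mem_univ x, by simp⟩).ne'

instance (col : X → Fin 2) (d : Fin 2 × ℕ →₀ ℕ) : Finite (Assignment col d) := by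
  have h : ∀ (u : Assignment col d) (x : X), (col x, u.1 x) ∈ d.support := by
    intro u x
    have := content_apply_ne_zero col u.1 x
    rw [u.2] at this
    exact Finsupp.mem_support_iff.2 this
  refine Finite.of_injective (fun u x => (⟨_, h u x⟩ : d.support)) fun u v huv => ?_
  apply Subtype.ext
  funext x
  exact congrArg (fun p : d.support => p.1.2) (congrFun huv x)

instance (col : X → Fin 2) (d : Fin 2 × ℕ →₀ ℕ) : Fintype (Assignment col d) := Fintype.ofFinite _

lemma sum_content (col : X → Fin 2) (u : X → ℕ) (i : Fin 2) :
    ((content col u).sum fun a e => if a.1 = i then e else 0) =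
      (Finset.univ.filter fun x => col x = i).card := by
  rw [content, ← Finsupp.sum_finsetSum_index]
  · rw [Finset.card_filter]
    refine Finset.sum_congr rfl fun x _ => ?_
    rw [Finsupp.sum_single_index (by simp)]
  · simp
  · intro a b c
    split_ifs <;> simp

lemma content_comp {φ : Perm X} {col : X → Fin 2} (hcol : ∀ x, col (φ x) = col x) (u : X → ℕ) :
    content col (u ∘ φ) = content col u := by
  rw [content, content, ← Equiv.sum_comp φ fun x => Finsupp.single (col x, u x) 1]
  refine Finset.sum_congr rfl fun x _ => ?_
  rw [hcol, Function.comp_apply]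

lemma sum_eq_sum_reps {M : Type*} [AddCommMonoid M] {φ : Perm X} {h : X → M}
    (hh : ∀ x, h (φ x) = h x) : ∑ x, h x = ∑ r ∈ reps φ Finset.univ, len φ r • h r := by
  classical
  rw [← Finset.sum_fiberwise_of_maps_to (g := rep φ) (t := reps φ Finset.univ)
    fun x hx => rep_mem_reps (permInv_univ φ) hx]
  refine Finset.sum_congr rfl fun r hr => ?_
  have hr' := (mem_reps.1 hr).2
  rw [← card_orbit, hr', ← Finset.sum_const]
  refine Finset.sum_congr rfl fun x hx => ?_
  rw [Finset.mem_filter] at hx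
  have h1 : φ.SameCycle r x := hx.2 ▸ rep_sameCycle φ x
  exact apply_eq_of_sameCycle (permInv_univ φ) (fun x _ => hh x) h1 (Finset.mem_univ r)

open Classical in
/-- The coefficients of a product of power sums count the invariant assignments. -/
lemma coeff_subst_orbitType {φ : Perm X} {col : X → Fin 2} (hcol : ∀ x, col (φ x) = col x)
    (d : Fin 2 × ℕ →₀ ℕ) :
    coeff d (subst powerSumSeries (monomial (orbitType φ col Finset.univ) (1 : ℂ))) =
      (Finset.univ.filter fun u : Assignment col d => ∀ x, u.1 (φ x) = u.1 x).card := by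
  have hrep : ∀ x, rep φ (φ x) = rep φ x := fun x =>
    rep_congr (Perm.sameCycle_apply_left.2 (Perm.SameCycle.refl _ _))
  have hreps : ∀ x, rep φ x ∈ reps φ Finset.univ := fun x =>
    rep_mem_reps (permInv_univ φ) (Finset.mem_univ x)
  have hu_rep : ∀ u : X → ℕ, (∀ x, u (φ x) = u x) → ∀ x, u (rep φ x) = u x := fun u hu x =>
    apply_eq_of_sameCycle (permInv_univ φ) (fun x _ => hu x) (rep_sameCycle φ x).symm
      (Finset.mem_univ x)
  have hcol_rep : ∀ x, col (rep φ x) = col x := fun x =>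
    apply_eq_of_sameCycle (permInv_univ φ) (fun x _ => hcol x) (rep_sameCycle φ x).symm
      (Finset.mem_univ x)
  have hsum : ∀ u : X → ℕ, (∀ x, u (φ x) = u x) → content col u =
      ∑ r ∈ reps φ Finset.univ, Finsupp.single (col r, u r) (len φ r) := by
    intro u hu
    rw [content, sum_eq_sum_reps (φ := φ) fun x => by rw [hcol, hu]]
    exact Finset.sum_congr rfl fun r _ => by simp
  rw [monomial_orbitType, ← substAlgHom_apply hasSubst_powerSumSeries, map_prod]
  simp only [substAlgHom_apply, psum, subst_X hasSubst_powerSumSeries]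
  rw [coeff_prod]
  simp only [coeff_powerSumSeries, Finset.prod_ite_zero, Finset.prod_const_one, coe_plen]
  rw [Finset.sum_boole]
  congr 1
  symm
  -- An invariant assignment is a choice of a variable for each orbit, which contributes a power of
  -- this variable, with the length of the orbit as exponent, to the content.
  refine Finset.card_nbij (fun u => Finsupp.equivFunOnFinite.symm fun r =>
    if r ∈ reps φ Finset.univ then Finsupp.single (col r, u.1 r) (len φ r) else 0) ?_ ?_ ?_
  · rintro ⟨u, rfl⟩ hu
    have hu := (Finset.mem_filter.1 hu).2
    rw [Finset.coe_filter, Set.mem_ofPred_eq, Finset.mem_finsuppAntidiag]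
    refine ⟨⟨?_, ?_⟩, ?_⟩
    · refine (Finset.sum_congr rfl fun r hr => ?_).trans (hsum u hu).symm
      simp [hr]
    · intro r hr
      by_contra h
      simp [h] at hr
    · intro r hr
      exact ⟨u r, by simp [hr]⟩
  · rintro ⟨u, hud⟩ hu ⟨v, hvd⟩ hv huv
    have hu := (Finset.mem_filter.1 hu).2
    have hv := (Finset.mem_filter.1 hv).2
    apply Subtype.ext
    funext x
    have h1 := DFunLike.congr_fun huv (rep φ x)
    simp only [Finsupp.equivFunOnFinite_symm_apply_apply, if_pos (hreps x)] at h1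
    have h2 := Finsupp.single_left_injective (len_pos φ (rep φ x)).ne' h1
    have h3 := (Prod.mk.inj h2).2
    rwa [hu_rep u hu, hu_rep v hv] at h3
  · intro l hl
    rw [Finset.coe_filter, Set.mem_ofPred_eq, Finset.mem_finsuppAntidiag] at hl
    obtain ⟨⟨hld, hls⟩, hlr⟩ := hl
    have : ∀ r, ∃ j, r ∈ reps φ Finset.univ → l r = Finsupp.single (col r, j) (len φ r) := by
      intro r
      by_cases hr : r ∈ reps φ Finset.univ
      · obtain ⟨j, hj⟩ := hlr r hr
        exact ⟨j, fun _ => hj⟩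
      · exact ⟨0, fun h => absurd h hr⟩
    choose j hj using this
    have hinv : ∀ x, j (rep φ (φ x)) = j (rep φ x) := fun x => by rw [hrep]
    have hl' : ∀ r ∈ reps φ Finset.univ, Finsupp.single (col r, j (rep φ r)) (len φ r) = l r := by
      intro r hr
      rw [hj r hr, (mem_reps.1 hr).2]
    refine ⟨⟨fun x => j (rep φ x), ?_⟩, ?_, ?_⟩
    · rw [hsum _ hinv, ← hld]
      exact Finset.sum_congr rfl hl'
    · exact Finset.mem_filter.2 ⟨Finset.mem_univ _, hinv⟩
    · ext1 r
      simp only [Finsupp.equivFunOnFinite_symm_apply_apply]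
      split_ifs with hr
      · exact hl' r hr
      · exact (Finsupp.notMem_support_iff.1 fun h => hr (hls h)).symm

end colouring

section invariants

variable {m n : ℕ} {V : Type u} [AddCommGroup V] [Module ℂ V]

/-- The representation on the families of vectors indexed by the assignments of a given content;
its invariants have as dimension a coefficient of the characteristic. -/
def assignmentRep (ρ : Representation ℂ (Perm (Fin m) × Perm (Fin n)) V) (d : Fin 2 × ℕ →₀ ℕ) :
    Representation ℂ (Perm (Fin m) × Perm (Fin n)) (Assignment (sumCol m n) d → V) where
  toFun g :=
    { toFun := fun f u => ρ g (f ⟨u.1 ∘ Perm.sumCongr g.1 g.2, by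
        rw [content_comp (sumCol_sumCongr g.1 g.2), u.2]⟩)
      map_add' := fun f f' => by
        funext u
        simp
      map_smul' := fun c f => by
        funext u
        simp }
  map_one' := by
    ext f u
    simp
  map_mul' g g' := by
    refine LinearMap.ext fun f => funext fun u => ?_
    change ρ (g * g') (f _) = ρ g (ρ g' (f _))
    rw [map_mul, Module.End.mul_apply]
    congr 3
    apply Subtype.ext
    funext x
    rcases x with x | x <;> rfl

open Classical in
lemma trace_assignmentRep [FiniteDimensional ℂ V]
    (ρ : Representation ℂ (Perm (Fin m) × Perm (Fin n)) V) (d : Fin 2 × ℕ →₀ ℕ)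
    (g : Perm (Fin m) × Perm (Fin n)) :
    LinearMap.trace ℂ _ (assignmentRep ρ d g) = LinearMap.trace ℂ V (ρ g) *
      (Finset.univ.filter fun u : Assignment (sumCol m n) d =>
        ∀ x, u.1 (Perm.sumCongr g.1 g.2 x) = u.1 x).card := by
  rw [trace_pi (E := fun _ : Assignment (sumCol m n) d => V), ← Finset.sum_boole, Finset.mul_sum]
  refine Finset.sum_congr rfl fun u _ => ?_
  have hg := content_comp (sumCol_sumCongr g.1 g.2) u.1
  have key : ∀ y, (LinearMap.proj u ∘ₗ assignmentRep ρ d g ∘ₗ LinearMap.single ℂ _ u) y =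
      ρ g ((Pi.single u y : Assignment (sumCol m n) d → V)
        ⟨u.1 ∘ Perm.sumCongr g.1 g.2, hg.trans u.2⟩) := fun y => rfl
  split_ifs with h
  · rw [mul_one]
    congr 1
    refine LinearMap.ext fun y => ?_
    have : (⟨u.1 ∘ Perm.sumCongr g.1 g.2, hg.trans u.2⟩ : Assignment (sumCol m n) d) = u :=
      Subtype.ext (funext h)
    rw [key, this, Pi.single_eq_same]
  · rw [mul_zero]
    refine (congrArg (LinearMap.trace ℂ _) (LinearMap.ext (g := 0) fun y => ?_)).trans (map_zero _)
    rw [key, Pi.single_eq_of_ne, map_zero, LinearMap.zero_apply]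
    exact fun h1 => h fun x => congrFun (congrArg Subtype.val h1) x

/-- The characteristic of a representation has nonnegative integers as coefficients: they are
dimensions of spaces of invariants. -/
lemma memLambda2_chMN [FiniteDimensional ℂ V]
    (ρ : Representation ℂ (Perm (Fin m) × Perm (Fin n)) V) : MemLambda2 (chMN m n ρ) := by
  classical
  intro d
  have hinv : Invertible (Nat.card (Perm (Fin m) × Perm (Fin n)) : ℂ) :=
    invertibleOfNonzero (Nat.cast_ne_zero.2 Nat.card_pos.ne')
  refine ⟨Module.finrank ℂ (assignmentRep ρ d).invariants, ?_⟩
  rw [Int.cast_natCast, ← Representation.card_inv_mul_sum_char_eq_finrank, chMN,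
    ← substAlgHom_apply hasSubst_powerSumSeries, map_smul, map_sum, map_smul, map_sum, smul_eq_mul]
  congr 1
  · simp [Nat.card_eq_fintype_card, Fintype.card_perm]
  · refine Finset.sum_congr rfl fun g _ => ?_
    rw [map_smul, map_smul, psumOfPerm_mul_psumOfPerm, typeOf, substAlgHom_apply,
      coeff_subst_orbitType (sumCol_sumCongr g.1 g.2), smul_eq_mul, Representation.character,
      trace_assignmentRep]

/-- A coefficient of the characteristic, in the variables, comes from a single component. -/
lemma memLambda2_ch (W : S2Module.{u}) [h : ∀ m n, FiniteDimensional ℂ (W.carrier m n)] :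
    MemLambda2 W.ch := by
  classical
  intro d
  obtain ⟨z, hz⟩ := memLambda2_chMN (W.rho (d.sum fun a e => if a.1 = 0 then e else 0)
    (d.sum fun a e => if a.1 = 1 then e else 0)) d
  refine ⟨z, hz ▸ ?_⟩
  rw [coeff_subst hasSubst_powerSumSeries, coeff_subst hasSubst_powerSumSeries]
  refine finsum_congr fun e => ?_
  obtain ⟨m, n, σ, τ, rfl⟩ := exists_sum_orbitType_eq e
  have h1 := subst_monomial hasSubst_powerSumSeries
    (orbitType (Perm.sumCongr σ τ) (sumCol m n) Finset.univ) (1 : ℂ)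
  rw [show algebraMap ℂ (MvPowerSeries (Fin 2 × ℕ) ℂ) 1 = 1 from map_one _, one_mul] at h1
  rw [← h1, coeff_subst_orbitType (sumCol_sumCongr σ τ)]
  -- If there is an assignment of content `d`, then the sizes `m` and `n` are determined by `d`.
  rcases isEmpty_or_nonempty (Assignment (sumCol m n) d) with he | ⟨⟨u, rfl⟩⟩
  · simp
  · rw [coeff_ch, sum_content, sum_content, ← typeOf, (cwt_typeOf σ τ).1, (cwt_typeOf σ τ).2,
      ← cwt_orbitType (sumCol_sumCongr σ τ) (permInv_univ _) 0,
      ← cwt_orbitType (sumCol_sumCongr σ τ) (permInv_univ _) 1, ← typeOf, (cwt_typeOf σ τ).1,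
      (cwt_typeOf σ τ).2]

end invariants

/-- The series `h_2` is the characteristic of the trivial representation of `S_2`. -/
lemma chMN_trivial : chMN 2 0 (Representation.trivial ℂ (Perm (Fin 2) × Perm (Fin 0)) ℂ) = h2 := by
  have h1 : psumOfPerm 0 (1 : Perm (Fin 2)) = psum 0 1 ^ 2 := by
    rw [psumOfPerm, Perm.parts_partition]
    simp [pow_two]
    rfl
  have h2 : psumOfPerm 0 (Equiv.swap (0 : Fin 2) 1) = psum 0 2 := by
    have hs : (Equiv.swap (0 : Fin 2) 1).IsSwap := ⟨0, 1, by decide, rfl⟩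
    rw [psumOfPerm, Perm.parts_partition, Perm.isSwap_iff_cycleType.1 hs,
      Perm.card_support_eq_two.2 hs]
    simp
    rfl
  have h3 : ∀ τ : Perm (Fin 0), psumOfPerm 1 τ = 1 := by
    intro τ
    rw [Subsingleton.elim τ 1, psumOfPerm, Perm.parts_partition]
    simp
  have hu : (Finset.univ : Finset (Perm (Fin 2))) = {1, Equiv.swap 0 1} := by decide
  rw [chMN, Fintype.sum_prod_type]
  simp only [h3]
  rw [hu, Finset.sum_pair (by decide), h1, h2, _root_.h2]
  simp

lemma memLambda2_h2 : MemLambda2 h2 := chMN_trivial ▸ memLambda2_chMN _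

lemma memLambda2_e2 : MemLambda2 e2 := by
  have : e2 = h2 - psum 0 2 := by
    rw [e2, h2, smul_sub, smul_add, add_sub_assoc, sub_eq_add_neg]
    congr 1
    rw [eq_sub_iff_add_eq, neg_add_eq_sub, sub_eq_iff_eq_add, ← add_smul]
    norm_num
  exact this ▸ memLambda2_sub memLambda2_h2 (memLambda2_psum 0 2)

end TreeLegendre

end

theorem mainTheorem4 (W : S2Module.{u})
    (hfin : ∀ m n : ℕ, FiniteDimensional ℂ (W.carrier m n))
    (hW : ∀ m n : ℕ, (m < 2 ∨ m + n < 3) → Subsingleton (W.carrier m n)) :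
    (∀ m n : ℕ, FiniteDimensional ℂ (W.trees.carrier m n)) ∧
      MemLambda2Star (e2 - W.ch) ∧
      MemLambda2Star (h2 + W.trees.ch) ∧
      IsPartialLegendre (e2 - W.ch) (h2 + W.trees.ch) := by
  have hT : ∀ m n : ℕ, FiniteDimensional ℂ (W.trees.carrier m n) :=
    TreeLegendre.finiteDimensional_trees W
  have hTW := TreeLegendre.subsingleton_trees W
  have hG : RkStar (h2 + W.trees.ch) := TreeLegendre.rkStar_h2_add_ch W.trees hTW
  obtain ⟨heq, huniq⟩ := TreeLegendre.legendreEq_trees W hW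
  exact ⟨hT,
    ⟨TreeLegendre.memLambda2_sub TreeLegendre.memLambda2_e2 (TreeLegendre.memLambda2_ch W),
      TreeLegendre.rkStar_e2_sub_ch W hW⟩,
    ⟨TreeLegendre.memLambda2_add TreeLegendre.memLambda2_h2 (TreeLegendre.memLambda2_ch W.trees),
      hG⟩, hG, heq, fun G _ hG => huniq G hG⟩
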